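/- **Conventions.** An involution on a central simple algebra $A$ (finite-dimensional over its centre, characteristic $\neq 2$) is of the first kind if it fixes the centre $Z(A)$ pointwise, and unitary (of the second kind) otherwise. For an involution $\sigma$ on $A$ and $\varepsilon=\pm1$, let $u(A,\sigma,\varepsilon)\in\mathbb N\cup\{\infty\}$ be the supremum of the ranks of anisotropic $\varepsilon$-hermitian spaces over $(A,\sigma)$, where the rank of a finitely generated right module $V$ over $A$ is $\dim_{Z(A)}V/(\deg A\cdot\operatorname{ind}A)$. Let $u^+(A)$ be the common value of $u(A,\sigma,\varepsilon)$ for $\sigma$ orthogonal and $\varepsilon=1$, or $\sigma$ symplectic and $\varepsilon=-1$; let $u^-(A)$ be the common value for $\sigma$ orthogonal and $\varepsilon=-1$, or $\sigma$ symplectic and $\varepsilon=1$. For a subfield $F$ of $Z(A)$ with $[Z(A):F]=2$, let $u^0(A/F)$ be the common value of $u(A,\sigma,\varepsilon)$ over $\varepsilon=\pm1$ and all unitary $\sigma$ on $A$ with $Z(A)^\sigma=F$ (the statement includes that the invariants occurring in it are defined, i.e. that such involutions exist and the value is independent of their choice). Let $k$ be a complete discretely valued field whose residue field $\bar k$ has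 characteristic different from $2$, let $K/k$ be a quadratic extension, and let $D$ be a finite-dimensional central division algebra over $k$ that admits an involution of the first kind, such that $D\otimes_kK$ is a division algebra. Extend the valuation of $k$ to $K$, $D$ and $D\otimes_kK$, and denote by $\bar K$, $\bar D$ and $\overline{D\otimes_kK}$ the residue algebras. "Unramified" means that the value group does not grow. **Corollary.** (1) If $K/k$ is unramified and $D\otimes_kK$ is unramified over $K$, then $$u^0\bigl((D\otimes_kK)/k\bigr)=2\,u^0\bigl((\bar D\otimes_{\bar k}\bar K)/\bar k\bigr).$$ (2) If $D\otimes_kK$ is ramified over $K$, then $Z(\bar D)=\bar k(\sqrt{u})$ and $\bar K=\bar k(\sqrt{\lambda})$ for some non-squares $u,\lambda\in\bar k$, and for any such $u,\lambda$ $$u^0\bigl((D\otimes_kK)/k\bigr)=u^0\bigl((\bar D\otimes_{\bar k}\bar K)/\bar k_1\bigr)+u^0\bigl((\bar D\otimes_{\bar k}\bar K)/\bar k_3\bigr),$$ where $\bar k_1=\bar k(\sqrt u\otimes1)$ and $\bar k_3=\bar k(\sqrt u\otimes\sqrt\lambda)$ inside $Z(\bar D)\otimes_{\bar k}\bar K$.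 (3) If $K/k$ is ramified, then $$u^0\bigl((D\otimes_kK)/k\bigr)=u^+\bigl(\overline{D\otimes_kK}\bigr)+u^-\bigl(\overline{D\otimes_kK}\bigr);$$ in particular, if moreover $D$ is unramified over $k$, then $u^0\bigl((D\otimes_kK)/k\bigr)=u^+(\bar D)+u^-(\bar D)$. -/

import Mathlib

open scoped TensorProduct

noncomputable section

/-! ### Involutions

An involution on a ring `A` is Mathlib's `RingInvo A`: an additive bijection `σ` of `A` that reverses
products and satisfies `σ ∘ σ = id`.  Its values are written `(σ x).unop`. -/

section Involutions

variable {A : Type*} [Ring A]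

/-- `σ` is of the first kind: it fixes the centre of `A` pointwise. -/
def IsFirstKind (σ : RingInvo A) : Prop :=
  ∀ z ∈ Subring.center A, (σ z).unop = z

/-- The space `Sym(A, σ)` of symmetric elements of an involution of the first kind, as a vector space
over the centre of `A`. -/
def symElements (σ : RingInvo A) (hσ : IsFirstKind σ) : Submodule (Subring.center A) A where
  carrier := {x | (σ x).unop = x}
  add_mem' {x y} hx hy := by
    have hx' : (σ x).unop = x := hx
    have hy' : (σ y).unop = y := hy
    simp [hx', hy']
  zero_mem' := by simp
  smul_mem' c x hx := by
    have hx' : (σ x).unop = x := hx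
    have hc : (σ (c : A)).unop = c := hσ c c.2
    have hcomm := Subring.mem_center_iff.1 c.2 x
    simpa [Subring.smul_def, hx', hc] using hcomm

/-- `σ` is orthogonal: it is of the first kind and, `d` being the degree of the central simple algebra
`A`, the symmetric elements have dimension `d (d + 1) / 2` over the centre. -/
def IsOrthogonal (σ : RingInvo A) : Prop :=
  ∃ hσ : IsFirstKind σ, ∃ d : ℕ, 0 < d ∧ Module.finrank (Subring.center A) A = d ^ 2 ∧
    2 * Module.finrank (Subring.center A) (symElements σ hσ) = d * (d + 1)

/-- `σ` is symplectic: it is of the first kind and, `d` being the degree of the central simple algebra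
`A`, the symmetric elements have dimension `d (d - 1) / 2` over the centre. -/
def IsSymplectic (σ : RingInvo A) : Prop :=
  ∃ hσ : IsFirstKind σ, ∃ d : ℕ, 0 < d ∧ Module.finrank (Subring.center A) A = d ^ 2 ∧
    2 * Module.finrank (Subring.center A) (symElements σ hσ) = d * (d - 1)

/-- `σ` is unitary (of the second kind), and `F` is the set of central elements fixed by `σ`. -/
def IsUnitaryOver (F : Subring A) (σ : RingInvo A) : Prop :=
  ¬ IsFirstKind σ ∧ ∀ z : A, z ∈ F ↔ z ∈ Subring.center A ∧ (σ z).unop = z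

end Involutions

/-! ### Hermitian spaces and `u`-invariants -/

section Hermitian

universe u

variable {A : Type u} [Ring A]

/-- `h` is an `ε`-hermitian space over `(A, σ)` on the right `A`-module `V` (right `A`-modules are
left modules over `Aᵐᵒᵖ`): a bi-additive, sesquilinear, `ε`-symmetric, nondegenerate form. -/
structure IsHermitianSpace (σ : RingInvo A) (ε : ℤˣ) {V : Type*} [AddCommGroup V] [Module Aᵐᵒᵖ V]
    (h : V → V → A) : Prop where
  add_left : ∀ x y z, h (x + y) z = h x z + h y z
  add_right : ∀ x y z, h x (y + z) = h x y + h x z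
  sesq : ∀ (a b : A) (x y : V),
    h (MulOpposite.op a • x) (MulOpposite.op b • y) = (σ a).unop * h x y * b
  symm : ∀ x y, h y x = (ε : ℤ) • (σ (h x y)).unop
  nondegenerate : ∀ y, (∀ x, h x y = 0) → y = 0

/-- The form `h` has no isotropic vector. -/
def IsAnisotropic {V : Type*} [AddCommGroup V] (h : V → V → A) : Prop :=
  ∀ x, h x x = 0 → x = 0

/-- `u(A, σ, ε)`: the supremum in `ℕ ∪ {∞}` of the ranks of the anisotropic `ε`-hermitian spaces over
`(A, σ)`.  For a central simple algebra `A` over a field `K`, simple right `A`-modules have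
`K`-dimension `deg A * ind A`, so the rank `dim_K V / (deg A * ind A)` is the length of the `A`-module
`V`; if `A` is a division algebra, this is the dimension of `V` over `A`. -/
def uInv (σ : RingInvo A) (ε : ℤˣ) : ℕ∞ :=
  sSup {n : ℕ∞ | ∃ (V : Type u) (_ : AddCommGroup V) (_ : Module Aᵐᵒᵖ V) (h : V → V → A),
    Module.Finite Aᵐᵒᵖ V ∧ IsHermitianSpace σ ε h ∧ IsAnisotropic h ∧ n = Module.length Aᵐᵒᵖ V}

variable (A)

/-- `u⁺(A)` is defined and equal to `n`: there are pairs `(σ, ε)` with `σ` orthogonal and `ε = 1` or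
`σ` symplectic and `ε = -1`, and `n` is the common value of `u(A, σ, ε)` for these pairs. -/
def IsUPlus (n : ℕ∞) : Prop :=
  (∃ σ : RingInvo A, IsOrthogonal σ ∨ IsSymplectic σ) ∧
    ∀ σ : RingInvo A, (IsOrthogonal σ → uInv σ 1 = n) ∧ (IsSymplectic σ → uInv σ (-1) = n)

/-- `u⁻(A)` is defined and equal to `n`: there are pairs `(σ, ε)` with `σ` orthogonal and `ε = -1` or
`σ` symplectic and `ε = 1`, and `n` is the common value of `u(A, σ, ε)` for these pairs. -/
def IsUMinus (n : ℕ∞) : Prop :=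
  (∃ σ : RingInvo A, IsOrthogonal σ ∨ IsSymplectic σ) ∧
    ∀ σ : RingInvo A, (IsOrthogonal σ → uInv σ (-1) = n) ∧ (IsSymplectic σ → uInv σ 1 = n)

variable {A}

/-- `u⁰(A / F)` is defined and equal to `n`: there are unitary involutions on `A` whose field of fixed
central elements is `F`, and `n` is the common value of `u(A, σ, ε)` for all such `σ` and all
`ε = ±1`. -/
def IsUZero (F : Subring A) (n : ℕ∞) : Prop :=
  (∃ σ : RingInvo A, IsUnitaryOver F σ) ∧
    ∀ σ : RingInvo A, IsUnitaryOver F σ → ∀ ε : ℤˣ, uInv σ ε = n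

end Hermitian

/-! ### Valuations and residue algebras

`O` is a complete discrete valuation ring with fraction field `k` and valuation `v`.  If `A` is a
finite-dimensional division algebra over `k`, then `v` has a unique extension `w` to `A`, namely
`w x = v (N x) / [A : k]` with `N` the norm from `A` to `k`.  (If `K` is the centre of `A` and `n` the
degree of `A` over `K`, then `N x = N_{K/k} (Nrd x) ^ n` and `[A : k] = n ^ 2 [K : k]`, so this is the
usual `v' (Nrd x) / n` with `v' y = v (N_{K/k} y) / [K : k]`.)  Thus `w x ≥ 0`, `w x > 0` and
`w x = 0` say that `N x` lies in `O`, in its maximal ideal, or in its group of units. -/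

section Valuation

variable (O k : Type*) [CommRing O] [Field k] [Algebra O k]
variable {A : Type*} [Ring A] [Algebra k A]

/-- `w x ≥ 0`. -/
def IsValInteger (x : A) : Prop :=
  ∃ a : O, Algebra.norm k x = algebraMap O k a

theorem isValInteger_algebraMap (a : O) :
    IsValInteger O k (algebraMap k A (algebraMap O k a)) :=
  ⟨a ^ Module.finrank k A, by rw [Algebra.norm_algebraMap, map_pow]⟩

variable [IsLocalRing O]

/-- `w x > 0`. -/
def IsValPositive (x : A) : Prop :=
  ∃ a ∈ IsLocalRing.maximalIdeal O, Algebra.norm k x = algebraMap O k a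

/-- `w x = 0`. -/
def IsValUnit (x : A) : Prop :=
  ∃ a : O, IsUnit a ∧ Algebra.norm k x = algebraMap O k a

/-- For division algebras `B ⊆ A` over `k`, the inclusion being `f`: the algebra `A` is unramified
over `B`, i.e. `w(A^*) = w(B^*)`. -/
def IsUnramifiedOver {B : Type*} [Ring B] [Algebra k B] (f : B →ₐ[k] A) : Prop :=
  ∀ x : A, x ≠ 0 → ∃ b : B, IsValUnit O k (f b * x)

variable (A)

/-- The valuation ring `R_w = {x | w x ≥ 0}`.  (For a division algebra `A` this set is already a
subring, so that it coincides with the subring it generates.) -/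
def valRing : Subring A :=
  Subring.closure {x | IsValInteger O k x}

/-- The maximal ideal `{x | w x > 0}` of `R_w`.  (For a division algebra `A` this set is already a
two-sided ideal, so that it coincides with the ideal it generates.) -/
def valIdeal : TwoSidedIdeal (valRing O k A) :=
  TwoSidedIdeal.span {x | IsValPositive O k (x : A)}

/-- The residue algebra of `A`, i.e. `R_w` modulo its maximal ideal. -/
def ResidueAlg : Type _ := (valIdeal O k A).ringCon.Quotient

instance : Ring (ResidueAlg O k A) :=
  inferInstanceAs (Ring (valIdeal O k A).ringCon.Quotient)

variable {A} in
theorem isValPositive_algebraMap [FiniteDimensional k A] [Nontrivial A] (a : O)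
    (ha : a ∈ IsLocalRing.maximalIdeal O) :
    IsValPositive O k (algebraMap k A (algebraMap O k a)) :=
  ⟨a ^ Module.finrank k A, Ideal.pow_mem_of_mem _ ha _ Module.finrank_pos,
    by rw [Algebra.norm_algebraMap, map_pow]⟩

/-- The structure map of `R_w` as an algebra over `O`. -/
def toValRing : O →+* valRing O k A :=
  ((algebraMap k A).comp (algebraMap O k)).codRestrict _
    fun a => Subring.subset_closure (isValInteger_algebraMap O k a)

/-- The reduction map from `R_w` to the residue algebra. -/
def toResidueAlg : valRing O k A →+* ResidueAlg O k A :=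
  (valIdeal O k A).ringCon.mk'

theorem toResidueAlg_toValRing [FiniteDimensional k A] (a : O)
    (ha : a ∈ IsLocalRing.maximalIdeal O) :
    ((toResidueAlg O k A).comp (toValRing O k A)) a = 0 := by
  have key : toValRing O k A a ∈ valIdeal O k A := by
    rcases subsingleton_or_nontrivial A with hA | hA
    · have : toValRing O k A a = 0 := Subtype.ext (Subsingleton.elim _ _)
      rw [this]
      exact (valIdeal O k A).zero_mem
    · exact TwoSidedIdeal.subset_span (isValPositive_algebraMap O k a ha)
  exact (RingCon.eq _).2 ((TwoSidedIdeal.mem_iff _ _).1 key)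

/-- The residue algebra of `A` is an algebra over the residue field of `O`. -/
instance [FiniteDimensional k A] : Algebra (IsLocalRing.ResidueField O) (ResidueAlg O k A) :=
  RingHom.toAlgebra'
    (Ideal.Quotient.lift (IsLocalRing.maximalIdeal O)
      ((toResidueAlg O k A).comp (toValRing O k A)) (toResidueAlg_toValRing O k A))
    (by
      intro c x
      obtain ⟨a, rfl⟩ := Ideal.Quotient.mk_surjective c
      obtain ⟨y, rfl⟩ := RingCon.mk'_surjective (c := (valIdeal O k A).ringCon) x
      change toResidueAlg O k A (toValRing O k A a) * toResidueAlg O k A y =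
        toResidueAlg O k A y * toResidueAlg O k A (toValRing O k A a)
      rw [← map_mul, ← map_mul]
      congr 1
      exact Subtype.ext (Algebra.commutes (algebraMap O k a) (y : A)))

end Valuation

/-- For a field `F` of characteristic not two, an `F`-algebra `A` and a commutative subalgebra `S` of
`A` that is a field: `S = F(√c)` with `c ∈ F` not a square and `a ∈ S` a square root of `c`. -/
def IsSqrtGenerator {F A : Type*} [Field F] [Ring A] [Algebra F A] (S : Subalgebra F A) (a : A) :
    Prop :=
  ∃ c : F, ¬ IsSquare c ∧ a * a = algebraMap F A c ∧ Algebra.adjoin F {a} = S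

end

/-! The corollary is Larmour's theorem for E = D ⊗ K with the unitary involution s = σ ⊗ g, where g
generates Gal(K/k) and σ is an involution of the first kind on D. Over a complete discretely valued
division algebra of residue characteristic not 2, every anisotropic ε-hermitian form is diagonal,
and rescaling the basis brings each entry to valuation 0 or 1. The entries of valuation 0 reduce to
a form over the residue involution τ. Those of valuation 1, divided by a uniformizer p with s(p) =
δp, reduce to a δε-hermitian form over the residue τ' of x ↦ p⁻¹ s(x) p. The form is anisotropic
exactly when both residue forms are, so u(s, ε) = u(τ, ε) + u(τ', δε); this is
`ResidueValuation.uInv_eq_add`. It rests on square roots of 1 + t inside k[t] for t of positive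
valuation, and on parity: one part takes values of even valuation, the other of odd valuation.

It remains to choose p and to recognize τ and τ'. If nothing ramifies, p is a uniformizer of k,
central and symmetric, so τ' = τ is unitary over the residue field and the sum is twice one
invariant. If E is ramified over K, p comes from D: conjugation by p negates √u in the centre of the
residue algebra of D, while τ and τ' both negate √λ. Hence one of them fixes √u ⊗ 1 and the other
fixes √u ⊗ √λ. If K/k is ramified, p is the square root of a uniformizer of k, central and skew, so
τ' = τ and δ = -1; the centre of the residue algebra of E is the residue field of k, so τ is of the
first kind and the two terms are u⁺ and u⁻ in some order.

The cases are governed by `ramIndex_eq_one_or_two`: either D is unramified with central residue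
algebra, or its ramification index is 2 and the residue algebra has a quadratic centre on which
uniformizers act nontrivially. The proof uses the signature dim Sym - dim Skew. For an involution of
the first kind it is plus or minus the degree times the dimension of the centre, it is zero as soon
as the centre is moved, and it is additive over the graded pieces of the valuation filtration.
Comparing it with [D : k] = e · [residue algebra : residue field] determines e and the residue
centre.

That u⁺, u⁻ and u⁰ do not depend on the involution follows from Skolem–Noether, with Hilbert 90 in
the unitary case. The valuation is built from the norm; that its ring is closed under addition comes
from Weierstrass preparation, which plays the part of Hensel's lemma. -/

noncomputable section

/-! ### Sandwich maps and the Skolem–Noether theorem for division rings. -/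

section SkolemNoether

variable {A : Type*} [DivisionRing A]

/-- Shortest-relation argument. Once one coefficient is normalized to 1, commuting the relation with
y cancels that coefficient, so by induction all coefficients are central; x = 1 then contradicts
independence over the centre. -/
theorem eq_zero_of_forall_sum_mul_mul_eq_zero {ι : Type*} {b : ι → A}
    (hb : LinearIndependent (Subring.center A) b) (s : Finset ι) :
    ∀ a : ι → A, (∀ x, ∑ i ∈ s, a i * x * b i = 0) → ∀ i ∈ s, a i = 0 := by
  classical
  induction s using Finset.strongInduction with
  | H s ih =>
    intro a ha i₀ hi₀
    by_contra hne
    set c : ι → A := fun i => (a i₀)⁻¹ * a i with hc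
    have hc0 : c i₀ = 1 := inv_mul_cancel₀ hne
    have hcs : ∀ x, ∑ i ∈ s, c i * x * b i = 0 := by
      intro x
      have := congrArg (fun y => (a i₀)⁻¹ * y) (ha x)
      simpa [Finset.mul_sum, hc, mul_assoc] using this
    have hcomm : ∀ y, ∀ i ∈ s, c i * y = y * c i := by
      intro y i hi
      by_cases hii : i = i₀
      · rw [hii, hc0, one_mul, mul_one]
      have key := ih (s.erase i₀) (Finset.erase_ssubset hi₀) (fun i => c i * y - y * c i) (by
        intro x
        have h1 : ∑ i ∈ s, (c i * y - y * c i) * x * b i = 0 := by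
          have e1 := hcs (y * x)
          have e2 := congrArg (fun z => y * z) (hcs x)
          simp only [Finset.mul_sum, mul_zero] at e2
          rw [← sub_zero (0 : A)]
          nth_rewrite 1 [← e1]
          rw [← e2, ← Finset.sum_sub_distrib]
          exact Finset.sum_congr rfl fun i _ => by simp only [sub_mul, mul_assoc]
        rw [← Finset.add_sum_erase s _ hi₀, hc0] at h1
        simpa using h1) i (Finset.mem_erase.2 ⟨hii, hi⟩)
      exact sub_eq_zero.1 key
    have hcen : ∀ i ∈ s, c i ∈ Subring.center A := fun i hi =>
      Subring.mem_center_iff.2 fun y => (hcomm y i hi).symm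
    have hrel : ∑ i ∈ s, (if h : i ∈ s then (⟨c i, hcen i h⟩ : Subring.center A) else 0) • b i = 0 := by
      rw [← hcs 1]
      refine Finset.sum_congr rfl fun i hi => ?_
      rw [dif_pos hi, Subring.smul_def, mul_one, smul_eq_mul]
    have := linearIndependent_iff'.1 hb s _ hrel i₀ hi₀
    rw [dif_pos hi₀, Subtype.ext_iff] at this
    exact one_ne_zero (hc0.symm.trans this)

/-- The sandwich map A ⊗ Aᵒᵖ → End(A) is injective by the previous lemma, and both sides have
dimension n² over the centre. -/
theorem exists_eq_sum_mul_mul {ι : Type*} [Fintype ι] (b : Module.Basis ι (Subring.center A) A)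
    (f : A →ₗ[Subring.center A] A) : ∃ a : ι → A, ∀ x, f x = ∑ i, a i * x * b i := by
  classical
  have : Module.Finite (Subring.center A) A := Module.Finite.of_basis b
  let Φ : (ι → A) →ₗ[Subring.center A] (A →ₗ[Subring.center A] A) :=
    { toFun := fun a => ∑ i, LinearMap.mulLeftRight (Subring.center A) (a i, b i)
      map_add' := fun a a' => by
        ext x
        simp [add_mul, Finset.sum_add_distrib]
      map_smul' := fun c a => by
        ext x
        simp [Finset.smul_sum] }
  have hΦ : ∀ a x, Φ a x = ∑ i, a i * x * b i := fun a x => by simp [Φ]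
  have hinj : Function.Injective Φ := by
    rw [injective_iff_map_eq_zero]
    intro a ha
    funext i
    exact eq_zero_of_forall_sum_mul_mul_eq_zero b.linearIndependent Finset.univ a
      (fun x => by rw [← hΦ, ha]; rfl) i (Finset.mem_univ i)
  have hsurj : Function.Surjective Φ := by
    refine (LinearMap.injective_iff_surjective_of_finrank_eq_finrank ?_).1 hinj
    rw [Module.finrank_pi_fintype, Module.finrank_linearMap, Finset.sum_const, Finset.card_univ,
      ← Module.finrank_eq_card_basis b, smul_eq_mul]
  obtain ⟨a, ha⟩ := hsurj f
  exact ⟨a, fun x => by rw [← hΦ, ha]⟩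

/-- Write φ(x) = Σ aᵢ x bᵢ. Expanding φ(xy) = φ(x)φ(y) gives Σ (aᵢ x - φ(x) aᵢ) y bᵢ = 0 for all y,
hence aᵢ x = φ(x) aᵢ; since φ(1) = 1, some aᵢ is nonzero and conjugates. -/
theorem exists_forall_eq_mul_mul_inv [Module.Finite (Subring.center A) A] (φ : A →+* A)
    (hφ : ∀ z ∈ Subring.center A, φ z = z) : ∃ g : A, g ≠ 0 ∧ ∀ x, φ x = g * x * g⁻¹ := by
  let b := Module.Free.chooseBasis (Subring.center A) A
  let f : A →ₗ[Subring.center A] A :=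
    { toFun := φ
      map_add' := map_add φ
      map_smul' := fun c x => by
        simp [Subring.smul_def, hφ c c.2] }
  obtain ⟨a, ha⟩ := exists_eq_sum_mul_mul b f
  have ha' : ∀ x, φ x = ∑ i, a i * x * b i := ha
  have hrel : ∀ x, ∀ i, a i * x - φ x * a i = 0 := by
    intro x i
    refine eq_zero_of_forall_sum_mul_mul_eq_zero b.linearIndependent Finset.univ
      (fun i => a i * x - φ x * a i) (fun y => ?_) i (Finset.mem_univ i)
    have h1 := ha' (x * y)
    rw [map_mul, ha' y, Finset.mul_sum] at h1
    rw [← sub_eq_zero.2 h1.symm, ← Finset.sum_sub_distrib]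
    exact Finset.sum_congr rfl fun i _ => by simp only [sub_mul, mul_assoc]
  have hex : ∃ i, a i ≠ 0 := by
    by_contra! hall
    have h1 := ha' 1
    simp [hall] at h1
  obtain ⟨i, hi⟩ := hex
  refine ⟨a i, hi, fun x => ?_⟩
  rw [sub_eq_zero.1 (hrel x i), mul_assoc, mul_inv_cancel₀ hi, mul_one]

end SkolemNoether

/-! ### Involutions up to conjugation, and independence of the `u`-invariants of the involution. -/

section Invo

variable {A : Type*}

theorem RingInvo.unop_add [Ring A] (σ : RingInvo A) (x y : A) :
    (σ (x + y)).unop = (σ x).unop + (σ y).unop := by simp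

theorem RingInvo.unop_mul [Ring A] (σ : RingInvo A) (x y : A) :
    (σ (x * y)).unop = (σ y).unop * (σ x).unop := by simp

theorem RingInvo.unop_sub [Ring A] (σ : RingInvo A) (x y : A) :
    (σ (x - y)).unop = (σ x).unop - (σ y).unop := by simp

theorem RingInvo.unop_sum [Ring A] (σ : RingInvo A) {ι : Type*} (s : Finset ι) (f : ι → A) :
    (σ (∑ i ∈ s, f i)).unop = ∑ i ∈ s, (σ (f i)).unop := by
  rw [map_sum]
  exact map_sum (MulOpposite.opAddEquiv (α := A)).symm _ _

theorem RingInvo.unop_pow [Ring A] (σ : RingInvo A) (x : A) (n : ℕ) :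
    (σ (x ^ n)).unop = (σ x).unop ^ n := by simp

theorem RingInvo.unop_inv [DivisionRing A] (σ : RingInvo A) (x : A) :
    (σ x⁻¹).unop = (σ x).unop⁻¹ := by
  rcases eq_or_ne x 0 with rfl | hx
  · simp
  · refine eq_inv_of_mul_eq_one_left ?_
    rw [← RingInvo.unop_mul, mul_inv_cancel₀ hx]
    simp

theorem RingInvo.unop_ne_zero [Ring A] (σ : RingInvo A) {x : A} (hx : x ≠ 0) :
    (σ x).unop ≠ 0 := by
  simpa using hx

theorem RingInvo.unop_mem_center [Ring A] (σ : RingInvo A) {z : A} (hz : z ∈ Subring.center A) :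
    (σ z).unop ∈ Subring.center A := by
  rw [Subring.mem_center_iff] at hz ⊢
  intro y
  have h := congrArg (fun x => (σ x).unop) (hz ((σ y).unop))
  simpa [RingInvo.unop_mul, RingInvo.involution] using h.symm

/-- A map satisfying the axioms of an involution, as an element of `RingInvo A`. -/
def RingInvo.ofFun [Ring A] (f : A → A) (hadd : ∀ x y, f (x + y) = f x + f y)
    (hmul : ∀ x y, f (x * y) = f y * f x) (hf : ∀ x, f (f x) = x) : RingInvo A where
  toFun x := MulOpposite.op (f x)
  invFun x := f x.unop
  left_inv x := hf x
  right_inv x := by simp [hf]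
  map_add' x y := by simp [hadd]
  map_mul' x y := by simp [hmul]
  involution' x := hf x

theorem units_smul_smul [Ring A] (δ : ℤˣ) (x : A) : (δ : ℤ) • (δ : ℤ) • x = x := by
  rcases Int.units_eq_one_or δ with rfl | rfl <;> simp

/-- The involution `x ↦ g σ(x) g⁻¹`, where `σ(g) = δ g` with `δ = ±1`. -/
def RingInvo.conj [DivisionRing A] (σ : RingInvo A) (g : A) (hg : g ≠ 0) (δ : ℤˣ)
    (hδ : (σ g).unop = (δ : ℤ) • g) : RingInvo A :=
  RingInvo.ofFun (fun x => g * (σ x).unop * g⁻¹)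
    (fun x y => by rw [RingInvo.unop_add, mul_add, add_mul])
    (fun x y => by
      rw [RingInvo.unop_mul]
      simp only [mul_assoc, inv_mul_cancel_left₀ hg])
    (fun x => by
      rw [RingInvo.unop_mul, RingInvo.unop_mul, RingInvo.unop_inv, hδ, RingInvo.involution]
      rcases Int.units_eq_one_or δ with rfl | rfl
      · simp [hg]
      · simp [hg, inv_neg])

@[simp]
theorem RingInvo.conj_apply [DivisionRing A] (σ : RingInvo A) (g : A) (hg : g ≠ 0) (δ : ℤˣ)
    (hδ : (σ g).unop = (δ : ℤ) • g) (x : A) :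
    (σ.conj g hg δ hδ x).unop = g * (σ x).unop * g⁻¹ := rfl

theorem RingInvo.ext_unop [Ring A] {σ τ : RingInvo A} (h : ∀ x, (σ x).unop = (τ x).unop) :
    σ = τ := by
  have : ∀ x, σ x = τ x := fun x => MulOpposite.unop_injective (h x)
  exact DFunLike.ext _ _ this

/-- The composite of τ and σ is an endomorphism fixing the centre, hence inner; τ² = 1 then forces
σ(g)g⁻¹ to be central. -/
theorem exists_conj_of_eq_on_center [DivisionRing A] [Module.Finite (Subring.center A) A]
    (σ τ : RingInvo A) (h : ∀ z ∈ Subring.center A, (σ z).unop = (τ z).unop) :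
    ∃ g : A, g ≠ 0 ∧ (∀ x, (τ x).unop = g * (σ x).unop * g⁻¹) ∧
      (σ g).unop * g⁻¹ ∈ Subring.center A := by
  let φ : A →+* A :=
    { toFun := fun x => (τ (σ x).unop).unop
      map_one' := by simp
      map_zero' := by simp
      map_add' := fun x y => by simp
      map_mul' := fun x y => by simp }
  obtain ⟨g, hg, hφ⟩ := exists_forall_eq_mul_mul_inv φ (fun z hz => by
    change (τ (σ z).unop).unop = z
    rw [h z hz, RingInvo.involution])
  have hτ : ∀ x, (τ x).unop = g * (σ x).unop * g⁻¹ := by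
    intro x
    have := hφ (σ x).unop
    change (τ (σ (σ x).unop).unop).unop = _ at this
    rwa [RingInvo.involution] at this
  refine ⟨g, hg, hτ, Subring.mem_center_iff.2 fun x => ?_⟩
  have h2 := RingInvo.involution τ x
  have hg' := RingInvo.unop_ne_zero σ hg
  rw [hτ, hτ, RingInvo.unop_mul, RingInvo.unop_mul, RingInvo.unop_inv, RingInvo.involution] at h2
  have h3 : (σ g).unop * g⁻¹ * (g * ((σ g).unop⁻¹ * (x * (σ g).unop)) * g⁻¹) =
      x * ((σ g).unop * g⁻¹) := by
    simp only [mul_assoc, inv_mul_cancel_left₀ hg, mul_inv_cancel_left₀ hg']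
  rw [← h3, h2]

/-- The central element c = σ(g)g⁻¹ is fixed by σ, so σ²(g) = g reads c² = 1. -/
theorem exists_unop_eq_smul_of_isFirstKind [DivisionRing A] [Module.Finite (Subring.center A) A]
    {σ τ : RingInvo A} (hσ : IsFirstKind σ) (hτ : IsFirstKind τ) :
    ∃ (g : A) (hg : g ≠ 0) (δ : ℤˣ) (hδ : (σ g).unop = (δ : ℤ) • g), τ = σ.conj g hg δ hδ := by
  obtain ⟨g, hg, h, hc⟩ := exists_conj_of_eq_on_center σ τ fun z hz => by rw [hσ z hz, hτ z hz]
  set c := (σ g).unop * g⁻¹ with hcdef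
  have hσg : (σ g).unop = c * g := by rw [hcdef, inv_mul_cancel_right₀ hg]
  have hcc : c * c = 1 := by
    have h1 := RingInvo.involution σ g
    rw [hσg, RingInvo.unop_mul, hσ c hc, hσg, Subring.mem_center_iff.1 hc, ← mul_assoc] at h1
    exact mul_right_cancel₀ hg (h1.trans (one_mul g).symm)
  rcases mul_self_eq_one_iff.1 hcc with h1 | h1
  · refine ⟨g, hg, 1, by rw [hσg, h1]; simp, RingInvo.ext_unop fun x => ?_⟩
    rw [h, RingInvo.conj_apply]
  · refine ⟨g, hg, -1, by rw [hσg, h1]; simp, RingInvo.ext_unop fun x => ?_⟩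
    rw [h, RingInvo.conj_apply]

theorem IsUnitaryOver.exists_ne [Ring A] {F : Subring A} {σ : RingInvo A} (hσ : IsUnitaryOver F σ) :
    ∃ s ∈ Subring.center A, s ≠ 0 ∧ (σ s).unop = -s := by
  have h := hσ.1
  unfold IsFirstKind at h
  push Not at h
  obtain ⟨z, hz, hne⟩ := h
  refine ⟨z - (σ z).unop, sub_mem hz (σ.unop_mem_center hz), sub_ne_zero.2 (Ne.symm hne), ?_⟩
  rw [RingInvo.unop_sub, RingInvo.involution, neg_sub]

/-- The trace z + σ(z) and the norm z σ(z) lie in F, so τ fixes them and τ(z) is a root of (X - z)(X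
- σ(z)). If τ(z) = z, then z lies in F and σ fixes it too. -/
theorem IsUnitaryOver.eq_on_center [DivisionRing A] {F : Subring A} {σ τ : RingInvo A}
    (hσ : IsUnitaryOver F σ) (hτ : IsUnitaryOver F τ) (z : A) (hz : z ∈ Subring.center A) :
    (σ z).unop = (τ z).unop := by
  have hz' := σ.unop_mem_center hz
  have hcomm : z * (σ z).unop = (σ z).unop * z := (Subring.mem_center_iff.1 hz _).symm
  have h1 : z + (σ z).unop ∈ F := (hσ.2 _).2 ⟨add_mem hz hz', by
    rw [RingInvo.unop_add, RingInvo.involution, add_comm]⟩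
  have h2 : z * (σ z).unop ∈ F := (hσ.2 _).2 ⟨mul_mem hz hz', by
    rw [RingInvo.unop_mul, RingInvo.involution]⟩
  have h3 := ((hτ.2 _).1 h1).2
  have h4 := ((hτ.2 _).1 h2).2
  rw [RingInvo.unop_add] at h3
  rw [RingInvo.unop_mul] at h4
  have h5 : (τ (σ z).unop).unop = z + (σ z).unop - (τ z).unop := by rw [← h3]; abel
  have h6 : ((σ z).unop - (τ z).unop) * ((τ z).unop - z) = 0 := by
    have hc2 : (τ z).unop * z = z * (τ z).unop := (Subring.mem_center_iff.1 hz _)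
    rw [h5, sub_mul, add_mul, sub_eq_iff_eq_add] at h4
    rw [sub_mul, mul_sub, mul_sub, ← hcomm, ← hc2.symm]
    have h7 : z * (τ z).unop + (σ z).unop * (τ z).unop = z * (σ z).unop +
      (τ z).unop * (τ z).unop := h4
    rw [← sub_eq_zero.2 h7]
    abel
  rcases mul_eq_zero.1 h6 with h | h
  · exact sub_eq_zero.1 h
  · have h8 : (τ z).unop = z := sub_eq_zero.1 h
    rw [h8]
    exact ((hσ.2 z).1 ((hτ.2 z).2 ⟨hz, h8⟩)).2

/-- Here c = σ(g)g⁻¹ satisfies c σ(c) = 1. Hilbert 90 gives a central m with σ(m)c = m, namely 1 +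
c, or a skew central element when c = -1; then mg is symmetric and induces the same conjugation as
g. -/
theorem IsUnitaryOver.exists_eq_conj [DivisionRing A] [Module.Finite (Subring.center A) A]
    {F : Subring A} {σ τ : RingInvo A} (hσ : IsUnitaryOver F σ) (hτ : IsUnitaryOver F τ) :
    ∃ (g : A) (hg : g ≠ 0) (hδ : (σ g).unop = ((1 : ℤˣ) : ℤ) • g), τ = σ.conj g hg 1 hδ := by
  obtain ⟨g, hg, h, hc⟩ := exists_conj_of_eq_on_center σ τ (hσ.eq_on_center hτ)
  set c := (σ g).unop * g⁻¹ with hcdef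
  have hσg : (σ g).unop = c * g := by rw [hcdef, inv_mul_cancel_right₀ hg]
  have hcc : c * (σ c).unop = 1 := by
    have h1 := RingInvo.involution σ g
    rw [hσg, RingInvo.unop_mul, hσg, mul_assoc, Subring.mem_center_iff.1 (σ.unop_mem_center hc),
      ← mul_assoc] at h1
    exact mul_right_cancel₀ hg (h1.trans (one_mul g).symm)
  obtain ⟨m, hm, hm0, hmg⟩ : ∃ m ∈ Subring.center A, m ≠ 0 ∧ (σ m).unop * c = m := by
    by_cases h1 : c = -1
    · obtain ⟨s, hs, hs0, hss⟩ := hσ.exists_ne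
      exact ⟨s, hs, hs0, by rw [hss, h1]; simp⟩
    · refine ⟨1 + c, add_mem (one_mem _) hc, fun h0 => h1 (eq_neg_of_add_eq_zero_right h0), ?_⟩
      rw [RingInvo.unop_add, add_mul, Subring.mem_center_iff.1 hc (σ c).unop, hcc, add_comm]
      simp
  have hmm := Subring.mem_center_iff.1 hm
  refine ⟨m * g, mul_ne_zero hm0 hg, ?_, RingInvo.ext_unop fun x => ?_⟩
  · rw [RingInvo.unop_mul, hσg, mul_assoc,
      Subring.mem_center_iff.1 (σ.unop_mem_center hm), ← mul_assoc,
      Subring.mem_center_iff.1 (σ.unop_mem_center hm), hmg]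
    simp
  · rw [h, RingInvo.conj_apply, mul_inv_rev, ← hmm g]
    have := hmm (σ x).unop
    rw [mul_assoc g m, ← this]
    simp only [mul_assoc]
    rw [← mul_assoc m, ← hmm g⁻¹, mul_inv_cancel_right₀ hm0]

/-- Scaling a form h to gh changes the involution by conjugation and the sign by δ, and preserves
anisotropy and the underlying module. -/
theorem uInv_le_uInv_conj [DivisionRing A] (σ : RingInvo A) (g : A) (hg : g ≠ 0) (δ : ℤˣ)
    (hδ : (σ g).unop = (δ : ℤ) • g) (ε : ℤˣ) :
    uInv σ ε ≤ uInv (σ.conj g hg δ hδ) (δ * ε) := by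
  refine sSup_le_sSup ?_
  rintro n ⟨V, _, _, h, hfin, hh, han, rfl⟩
  refine ⟨V, inferInstance, inferInstance, fun x y => g * h x y, hfin, ⟨?_, ?_, ?_, ?_, ?_⟩, ?_, rfl⟩
  · intro x y z
    rw [hh.add_left, mul_add]
  · intro x y z
    rw [hh.add_right, mul_add]
  · intro a b x y
    rw [hh.sesq, RingInvo.conj_apply]
    simp only [mul_assoc, inv_mul_cancel_left₀ hg]
  · intro x y
    rw [hh.symm, RingInvo.conj_apply, RingInvo.unop_mul, hδ]
    rcases Int.units_eq_one_or δ with rfl | rfl <;> rcases Int.units_eq_one_or ε with rfl | rfl <;>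
    simp [hg, mul_assoc]
  · intro y hy
    exact hh.nondegenerate y fun x => (mul_eq_zero.1 (hy x)).resolve_left hg
  · intro x hx
    exact han x ((mul_eq_zero.1 hx).resolve_left hg)

theorem uInv_conj [DivisionRing A] (σ : RingInvo A) (g : A) (hg : g ≠ 0) (δ : ℤˣ)
    (hδ : (σ g).unop = (δ : ℤ) • g) (ε : ℤˣ) :
    uInv (σ.conj g hg δ hδ) ε = uInv σ (δ * ε) := by
  refine le_antisymm ?_ ?_
  · have h1 : ((σ.conj g hg δ hδ) g⁻¹).unop = (δ : ℤ) • g⁻¹ := by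
      rw [RingInvo.conj_apply, RingInvo.unop_inv, hδ]
      rcases Int.units_eq_one_or δ with rfl | rfl <;> simp [hg, inv_neg]
    have h2 := uInv_le_uInv_conj (σ.conj g hg δ hδ) g⁻¹ (inv_ne_zero hg) δ h1 ε
    have h3 : (σ.conj g hg δ hδ).conj g⁻¹ (inv_ne_zero hg) δ h1 = σ :=
      RingInvo.ext_unop fun x => by
        simp only [RingInvo.conj_apply, inv_inv, mul_assoc, inv_mul_cancel_left₀ hg,
          inv_mul_cancel₀ hg, mul_one]
    rwa [h3] at h2
  · have := uInv_le_uInv_conj σ g hg δ hδ (δ * ε)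
    rwa [← mul_assoc, Int.units_mul_self, one_mul] at this

/-- Conjugation by a skew central element leaves σ unchanged but flips the sign. -/
theorem IsUnitaryOver.uInv_neg [DivisionRing A] {F : Subring A} {σ : RingInvo A}
    (hσ : IsUnitaryOver F σ) (ε : ℤˣ) : uInv σ (-ε) = uInv σ ε := by
  obtain ⟨s, hs, hs0, hss⟩ := hσ.exists_ne
  have h := uInv_conj σ s hs0 (-1) (by rw [hss]; simp) ε
  have h3 : σ.conj s hs0 (-1) (by rw [hss]; simp) = σ := RingInvo.ext_unop fun x => by
    rw [RingInvo.conj_apply, ← Subring.mem_center_iff.1 hs, mul_inv_cancel_right₀ hs0]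
  rw [h3] at h
  rw [h, neg_one_mul]

theorem IsUnitaryOver.isUZero [DivisionRing A] [Module.Finite (Subring.center A) A]
    {F : Subring A} {σ : RingInvo A} (hσ : IsUnitaryOver F σ) : IsUZero F (uInv σ 1) := by
  refine ⟨⟨σ, hσ⟩, fun τ hτ ε => ?_⟩
  obtain ⟨g, hg, hδ, rfl⟩ := hσ.exists_eq_conj hτ
  rw [uInv_conj, one_mul]
  rcases Int.units_eq_one_or ε with rfl | rfl
  · rfl
  · exact hσ.uInv_neg 1

end Invo

/-! ### Diagonalization of anisotropic hermitian forms. -/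

section Diagonal

/-- The diagonal form `⟨a₁, …, aₙ⟩` is an anisotropic `ε`-hermitian form over `(A, σ)`. -/
structure IsAnisotropicDiag {A : Type*} [Ring A] (σ : RingInvo A) (ε : ℤˣ) {ι : Type*} [Fintype ι]
    (a : ι → A) : Prop where
  symm : ∀ i, (ε : ℤ) • (σ (a i)).unop = a i
  anisotropic : ∀ x : ι → A, ∑ i, (σ (x i)).unop * a i * x i = 0 → x = 0

theorem length_fin_fun (A : Type*) [DivisionRing A] (n : ℕ) :
    Module.length Aᵐᵒᵖ (Fin n → A) = n := by
  have h1 : Module.length Aᵐᵒᵖ A = 1 := by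
    rw [← Module.length_eq_one Aᵐᵒᵖ Aᵐᵒᵖ]
    exact (MulOpposite.opLinearEquiv Aᵐᵒᵖ).length_eq
  rw [Module.length_pi]
  simp [h1]

/-- Gram–Schmidt: anisotropy makes every h(vᵢ, vᵢ) invertible, so any vector outside the span can be
corrected to be orthogonal to the family. -/
theorem exists_orthogonal_family {A : Type*} [DivisionRing A] {σ : RingInvo A} {ε : ℤˣ} {V : Type*}
    [AddCommGroup V] [Module Aᵐᵒᵖ V] [Module.Finite Aᵐᵒᵖ V] {h : V → V → A}
    (hh : IsHermitianSpace σ ε h) (han : IsAnisotropic h) (m : ℕ)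
    (hm : m ≤ Module.finrank Aᵐᵒᵖ V) :
    ∃ v : Fin m → V, (∀ i, v i ≠ 0) ∧ ∀ i j, i ≠ j → h (v i) (v j) = 0 := by
  have hzero : ∀ x, h x 0 = 0 := fun x => by simpa using hh.add_right x 0 0
  have hsum : ∀ {k : ℕ} (x : V) (f : Fin k → V), h x (∑ i, f i) = ∑ i, h x (f i) := fun x f =>
    map_sum (AddMonoidHom.mk' (h x) (hh.add_right x)) f Finset.univ
  have hsub : ∀ x y z, h x (y - z) = h x y - h x z := fun x y z =>
    map_sub (AddMonoidHom.mk' (h x) (hh.add_right x)) y z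
  have hsmul : ∀ x y b, h x (MulOpposite.op b • y) = h x y * b := fun x y b => by
    simpa using hh.sesq 1 b x y
  have hswap : ∀ x y, h x y = 0 → h y x = 0 := fun x y hxy => by
    rw [hh.symm x y, hxy]; simp
  induction m with
  | zero => exact ⟨Fin.elim0, fun i => i.elim0, fun i => i.elim0⟩
  | succ m ih =>
    obtain ⟨v, hv0, hv⟩ := ih (by omega)
    obtain ⟨u, hu⟩ : ∃ u, u ∉ Submodule.span Aᵐᵒᵖ (Set.range v) := by
      by_contra! hall
      have h1 : Submodule.span Aᵐᵒᵖ (Set.range v) = ⊤ := eq_top_iff.2 fun x _ => hall x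
      have h2 := finrank_range_le_card (R := Aᵐᵒᵖ) v
      rw [Set.finrank, h1, finrank_top, Fintype.card_fin] at h2
      omega
    set w := u - ∑ i, MulOpposite.op ((h (v i) (v i))⁻¹ * h (v i) u) • v i with hw
    have hw0 : w ≠ 0 := fun h0 => hu (by
      rw [sub_eq_zero.1 h0]
      exact Submodule.sum_mem _ fun i _ => Submodule.smul_mem _ _
        (Submodule.subset_span (Set.mem_range_self i)))
    have hvw : ∀ j, h (v j) w = 0 := fun j => by
      have hj : h (v j) (v j) ≠ 0 := fun h0 => hv0 j (han _ h0)
      rw [hw, hsub, hsum, Finset.sum_eq_single j, hsmul, mul_inv_cancel_left₀ hj, sub_self]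
      · intro i _ hij
        rw [hsmul, hv j i hij.symm, zero_mul]
      · simp
    refine ⟨Fin.cons w v, fun i => ?_, fun i j hij => ?_⟩
    · induction i using Fin.cases with
      | zero => simpa using hw0
      | succ i => simpa using hv0 i
    · induction i using Fin.cases with
      | zero =>
        induction j using Fin.cases with
        | zero => exact absurd rfl hij
        | succ j => simpa using hswap _ _ (hvw j)
      | succ i =>
        induction j using Fin.cases with
        | zero => simpa using hvw i
        | succ j => simpa using hv i j fun e => hij (by rw [e])

/-- An orthogonal family of full length replaces the space by a tuple of scalars, so no module
remains in the definition and algebras in different universes can be compared. Conversely an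
anisotropic diagonal form is nondegenerate: test a radical vector against itself. -/
theorem uInv_eq_sSup_diag {A : Type*} [DivisionRing A] (σ : RingInvo A) (ε : ℤˣ) :
    uInv σ ε = sSup {n : ℕ∞ | ∃ m : ℕ, n = m ∧ ∃ a : Fin m → A, IsAnisotropicDiag σ ε a} := by
  refine congrArg sSup (Set.ext fun n => ⟨?_, ?_⟩)
  · rintro ⟨V, _, _, h, hfin, hh, han, rfl⟩
    obtain ⟨v, hv0, hv⟩ := exists_orthogonal_family hh han _ le_rfl
    refine ⟨Module.finrank Aᵐᵒᵖ V, Module.length_eq_finrank _ _, fun i => h (v i) (v i),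
      fun i => (hh.symm _ _).symm, fun x hx => ?_⟩
    have hsumr : ∀ (x : V) (f : Fin (Module.finrank Aᵐᵒᵖ V) → V),
        h x (∑ i, f i) = ∑ i, h x (f i) := fun x f =>
      map_sum (AddMonoidHom.mk' (h x) (hh.add_right x)) f Finset.univ
    have hsuml : ∀ (x : V) (f : Fin (Module.finrank Aᵐᵒᵖ V) → V),
        h (∑ i, f i) x = ∑ i, h (f i) x := fun x f =>
      map_sum (AddMonoidHom.mk' (fun y => h y x) fun y z => hh.add_left y z x) f Finset.univ
    have h0 : h (∑ i, MulOpposite.op (x i) • v i) (∑ i, MulOpposite.op (x i) • v i) = 0 := by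
      rw [hsuml, ← hx]
      refine Finset.sum_congr rfl fun i _ => ?_
      rw [hsumr, Finset.sum_eq_single i, hh.sesq]
      · intro j _ hji
        rw [hh.sesq, hv i j hji.symm, mul_zero, zero_mul]
      · simp
    have h1 := han _ h0
    funext j
    have hz : h (v j) (∑ i, MulOpposite.op (x i) • v i) = 0 := by
      rw [h1]; simpa using hh.add_right (v j) 0 0
    rw [hsumr, Finset.sum_eq_single j] at hz
    · have h2 := hh.sesq 1 (x j) (v j) (v j)
      simp only [MulOpposite.op_one, one_smul, map_one, MulOpposite.unop_one, one_mul] at h2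
      rw [h2] at hz
      exact (mul_eq_zero.1 hz).resolve_left fun h3 => hv0 j (han _ h3)
    · intro i _ hij
      have h2 := hh.sesq 1 (x i) (v j) (v i)
      simp only [MulOpposite.op_one, one_smul, map_one, MulOpposite.unop_one, one_mul] at h2
      rw [h2, hv j i hij.symm, zero_mul]
    · simp
  · rintro ⟨m, rfl, a, ha⟩
    have han : IsAnisotropic fun x y : Fin m → A => ∑ i, (σ (x i)).unop * a i * y i := ha.anisotropic
    refine ⟨Fin m → A, inferInstance, inferInstance,
      fun x y => ∑ i, (σ (x i)).unop * a i * y i, ?_, ⟨?_, ?_, ?_, ?_, ?_⟩, han,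
      (length_fin_fun A m).symm⟩
    · have : Module.Finite Aᵐᵒᵖ A := Module.Finite.equiv (MulOpposite.opLinearEquiv Aᵐᵒᵖ).symm
      infer_instance
    · intro x y z
      simp [add_mul, Finset.sum_add_distrib]
    · intro x y z
      simp [mul_add, Finset.sum_add_distrib]
    · intro b c x y
      simp [Finset.mul_sum, Finset.sum_mul, mul_assoc]
    · intro x y
      rw [RingInvo.unop_sum, Finset.smul_sum]
      refine Finset.sum_congr rfl fun i _ => ?_
      rw [RingInvo.unop_mul, RingInvo.unop_mul, RingInvo.involution]
      conv_lhs => rw [← ha.symm i]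
      simp only [mul_smul_comm, smul_mul_assoc, mul_assoc]
    · intro y hy
      exact han y (hy y)

theorem le_uInv {A : Type*} [DivisionRing A] {σ : RingInvo A} {ε : ℤˣ} {ι : Type*} [Fintype ι]
    {a : ι → A} (ha : IsAnisotropicDiag σ ε a) : (Fintype.card ι : ℕ∞) ≤ uInv σ ε := by
  rw [uInv_eq_sSup_diag]
  let e := Fintype.equivFin ι
  refine le_sSup ⟨Fintype.card ι, rfl, a ∘ e.symm, fun i => ha.symm _, fun x hx => ?_⟩
  have h := ha.anisotropic (x ∘ e) (by
    rw [← hx, ← Equiv.sum_comp e]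
    simp)
  funext i
  simpa using congrFun h (e.symm i)

theorem uInv_le {A : Type*} [DivisionRing A] {σ : RingInvo A} {ε : ℤˣ} {N : ℕ∞}
    (h : ∀ (m : ℕ) (a : Fin m → A), IsAnisotropicDiag σ ε a → (m : ℕ∞) ≤ N) : uInv σ ε ≤ N := by
  rw [uInv_eq_sSup_diag]
  refine sSup_le ?_
  rintro _ ⟨m, rfl, a, ha⟩
  exact h m a ha

theorem uInv_le_uInv_of_ringEquiv {A B : Type*} [DivisionRing A] [DivisionRing B] (e : A ≃+* B)
    {σ : RingInvo A} {τ : RingInvo B} (h : ∀ x, (τ (e x)).unop = e (σ x).unop) (ε : ℤˣ) :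
    uInv σ ε ≤ uInv τ ε := by
  refine uInv_le fun m a ha => ?_
  have h1 : IsAnisotropicDiag τ ε (e ∘ a) := by
    refine ⟨fun i => ?_, fun x hx => ?_⟩
    · simp only [Function.comp_apply]
      rw [h, ← map_zsmul, ha.symm]
    · have h2 := ha.anisotropic (e.symm ∘ x) (e.injective (by
        rw [map_zero, ← hx, map_sum]
        refine Finset.sum_congr rfl fun i _ => ?_
        simp [← h]))
      funext i
      simpa using congrFun h2 i
  simpa using le_uInv h1

theorem uInv_eq_uInv_of_ringEquiv {A B : Type*} [DivisionRing A] [DivisionRing B] (e : A ≃+* B)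
    {σ : RingInvo A} {τ : RingInvo B} (h : ∀ x, (τ (e x)).unop = e (σ x).unop) (ε : ℤˣ) :
    uInv σ ε = uInv τ ε :=
  le_antisymm (uInv_le_uInv_of_ringEquiv e h ε)
    (uInv_le_uInv_of_ringEquiv e.symm (fun x => by
      rw [e.eq_symm_apply, ← h, e.apply_symm_apply]) ε)

end Diagonal

/-! ### Eigenspaces of linear involutions under scalar extension. -/

section EigenspaceDim

variable {F V : Type*} [Field F] [AddCommGroup V] [Module F V] [FiniteDimensional F V]

theorem finrank_ker_sub_add_finrank_ker_add (h2 : (2 : F) ≠ 0) (s : V →ₗ[F] V)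
    (hs : ∀ x, s (s x) = x) :
    Module.finrank F (LinearMap.ker (s - LinearMap.id)) +
      Module.finrank F (LinearMap.ker (s + LinearMap.id)) = Module.finrank F V := by
  refine Submodule.finrank_add_eq_of_isCompl ⟨?_, ?_⟩
  · rw [Submodule.disjoint_def]
    intro x hx hy
    rw [LinearMap.mem_ker, LinearMap.sub_apply, LinearMap.id_apply, sub_eq_zero] at hx
    rw [LinearMap.mem_ker, LinearMap.add_apply, LinearMap.id_apply, hx, ← two_smul F] at hy
    exact (smul_eq_zero.1 hy).resolve_left h2
  · rw [codisjoint_iff, eq_top_iff]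
    intro x _
    have hx : x = (2 : F)⁻¹ • (x + s x) + (2 : F)⁻¹ • (x - s x) := by
      rw [← smul_add, add_add_sub_cancel, ← two_smul F, smul_smul, inv_mul_cancel₀ h2, one_smul]
    rw [hx]
    refine Submodule.add_mem_sup (Submodule.smul_mem _ _ ?_) (Submodule.smul_mem _ _ ?_)
    · rw [LinearMap.mem_ker, LinearMap.sub_apply, LinearMap.id_apply, map_add, hs]
      abel
    · rw [LinearMap.mem_ker, LinearMap.add_apply, LinearMap.id_apply, map_sub, hs]
      abel

/-- The inequality is enough: the kernels of s - 1 and s + 1 have dimensions adding up to dim V over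
either field, so applying it to both makes both equalities. -/
theorem finrank_ker_le_finrank_ker_baseChange (L : Type*) [Field L] [Algebra F L] (s : V →ₗ[F] V) :
    Module.finrank F (LinearMap.ker s) ≤ Module.finrank L (LinearMap.ker (s.baseChange L)) := by
  rw [← Module.finrank_baseChange (R := L) (M' := LinearMap.ker s)]
  let f : L ⊗[F] LinearMap.ker s →ₗ[L] L ⊗[F] V := (LinearMap.ker s).subtype.baseChange L
  have hf : Function.Injective f :=
    Module.Flat.lTensor_preserves_injective_linearMap (M := L) _ (LinearMap.ker s).injective_subtype
  refine LinearMap.finrank_le_finrank_of_injective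
    (f := f.codRestrict (LinearMap.ker (s.baseChange L)) fun x => ?_)
    (fun x y h => hf (congrArg Subtype.val h))
  induction x using TensorProduct.induction_on with
  | zero => simp
  | tmul c x => simp [f]
  | add x y hx hy => rw [map_add]; exact add_mem hx hy

end EigenspaceDim

/-! ### Symmetric elements of involutions on matrix algebras. -/

section MatrixInvolutions

variable {L : Type*} [Field L] (n : ℕ)

/-- Symmetric matrices are functions on unordered pairs of indices. -/
theorem two_mul_finrank_ker_transpose_sub :
    2 * Module.finrank L (LinearMap.ker
      ((Matrix.transposeLinearEquiv (Fin n) (Fin n) L L).toLinearMap - LinearMap.id)) =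
      n * (n + 1) := by
  let Φ : (Sym2 (Fin n) → L) →ₗ[L] Matrix (Fin n) (Fin n) L :=
    { toFun := fun f => Matrix.of fun i j => f s(i, j)
      map_add' := fun f g => rfl
      map_smul' := fun c f => rfl }
  have hinj : Function.Injective Φ := by
    intro f g h
    funext x
    induction x using Sym2.ind with
    | _ i j => exact congrFun (congrFun h i) j
  have hrange : LinearMap.range Φ = LinearMap.ker
      ((Matrix.transposeLinearEquiv (Fin n) (Fin n) L L).toLinearMap - LinearMap.id) := by
    ext y
    rw [LinearMap.mem_ker, LinearMap.sub_apply, sub_eq_zero]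
    constructor
    · rintro ⟨f, rfl⟩
      ext i j
      change f s(j, i) = f s(i, j)
      rw [Sym2.eq_swap]
    · intro h
      refine ⟨fun x => Sym2.lift ⟨fun i j => y i j, fun i j => ?_⟩ x, ?_⟩
      · exact (congrFun (congrFun h j) i)
      · ext i j
        rfl
  rw [← hrange, LinearMap.finrank_range_of_inj hinj, Module.finrank_pi, Sym2.card,
    Fintype.card_fin, Nat.choose_two_right, Nat.add_sub_cancel, mul_comm (n + 1) n,
    Nat.mul_div_cancel' (Nat.even_mul_succ_self n).two_dvd]

theorem two_mul_finrank_ker_transpose_add (h2 : (2 : L) ≠ 0) :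
    2 * Module.finrank L (LinearMap.ker
      ((Matrix.transposeLinearEquiv (Fin n) (Fin n) L L).toLinearMap + LinearMap.id)) =
      n * (n - 1) := by
  have h := finrank_ker_sub_add_finrank_ker_add h2
    (Matrix.transposeLinearEquiv (Fin n) (Fin n) L L).toLinearMap (fun x => rfl)
  have h1 := two_mul_finrank_ker_transpose_sub (L := L) n
  rw [Module.finrank_matrix, Module.finrank_self, Fintype.card_fin, mul_one] at h
  rcases n with _ | n
  · simp at h1 h ⊢
  · rw [Nat.add_sub_cancel]
    nlinarith

theorem exists_forall_eq_mul_mul_inv_matrix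
    (φ : Matrix (Fin n) (Fin n) L ≃ₐ[L] Matrix (Fin n) (Fin n) L) :
    ∃ g g' : Matrix (Fin n) (Fin n) L, g * g' = 1 ∧ g' * g = 1 ∧ ∀ x, φ x = g * x * g' := by
  let e : Matrix (Fin n) (Fin n) L ≃ₐ[L] Module.End L (Fin n → L) := Matrix.toLinAlgEquiv'
  obtain ⟨T, hT⟩ := ((e.symm.trans φ).trans e).eq_linearEquivConjAlgEquiv
  refine ⟨e.symm T.toLinearMap, e.symm T.symm.toLinearMap, ?_, ?_, fun x => ?_⟩
  · rw [← map_mul, ← map_one e.symm]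
    congr 1
    exact LinearMap.ext fun x => by simp
  · rw [← map_mul, ← map_one e.symm]
    congr 1
    exact LinearMap.ext fun x => by simp
  · have h := DFunLike.congr_fun hT (e x)
    simp only [AlgEquiv.trans_apply, AlgEquiv.symm_apply_apply] at h
    rw [← e.symm_apply_apply (φ x), h]
    nth_rewrite 2 [← e.symm_apply_apply x]
    rw [← map_mul, ← map_mul]
    rfl

/-- By Skolem–Noether τ(x) = g xᵗ g⁻¹, and τ² = 1 forces gᵗ = cg with c = ±1. Then x ↦ xg carries
the fixed space of τ onto the symmetric matrices if c = 1 and onto the skew-symmetric ones if c =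
-1. -/
theorem two_mul_finrank_ker_of_matrix_antiautomorphism (h2 : (2 : L) ≠ 0) (hn : n ≠ 0)
    (τ : Matrix (Fin n) (Fin n) L →ₗ[L] Matrix (Fin n) (Fin n) L) (hτ1 : τ 1 = 1)
    (hmul : ∀ x y, τ (x * y) = τ y * τ x) (hinv : ∀ x, τ (τ x) = x) :
    2 * Module.finrank L (LinearMap.ker (τ - LinearMap.id)) = n * (n + 1) ∨
      2 * Module.finrank L (LinearMap.ker (τ - LinearMap.id)) = n * (n - 1) := by
  have : NeZero n := ⟨hn⟩
  let φ : Matrix (Fin n) (Fin n) L ≃ₐ[L] Matrix (Fin n) (Fin n) L :=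
    AlgEquiv.ofLinearEquiv
      ((Matrix.transposeLinearEquiv (Fin n) (Fin n) L L).trans
        (LinearEquiv.ofInvolutive τ hinv))
      (by change τ (Matrix.transpose 1) = 1; rw [Matrix.transpose_one, hτ1])
      (fun x y => by
        change τ (x * y).transpose = τ x.transpose * τ y.transpose
        rw [Matrix.transpose_mul, hmul])
  obtain ⟨g, g', hgg', hg'g, hφ⟩ := exists_forall_eq_mul_mul_inv_matrix n φ
  have hτ : ∀ x, τ x = g * x.transpose * g' := fun x => hφ x.transpose
  have hcen : ∀ x, x * (g.transpose * g') = (g.transpose * g') * x := by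
    intro x
    have h1 := hinv x
    rw [hτ, hτ, Matrix.transpose_mul, Matrix.transpose_mul, Matrix.transpose_transpose] at h1
    have h3 : g.transpose * g'.transpose = 1 := by
      rw [← Matrix.transpose_mul, hg'g, Matrix.transpose_one]
    have h4 : g.transpose * g' * (g * (g'.transpose * (x * g.transpose)) * g') =
        x * (g.transpose * g') := by
      calc _ = g.transpose * (g' * g) * (g'.transpose * (x * g.transpose)) * g' := by
            simp only [mul_assoc]
        _ = (g.transpose * g'.transpose) * (x * g.transpose) * g' := by
            rw [hg'g]; simp only [mul_assoc, one_mul]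
        _ = _ := by rw [h3]; simp only [mul_assoc, one_mul]
    rw [← h4, h1]
  obtain ⟨c, hc⟩ : ∃ c : L, g.transpose * g' = Matrix.scalar (Fin n) c := by
    have h : g.transpose * g' ∈ Set.range (Matrix.scalar (Fin n)) :=
      Matrix.mem_range_scalar_of_commute_single fun i j _ => (hcen _)
    obtain ⟨c, hc⟩ := h
    exact ⟨c, hc.symm⟩
  have hgt : g.transpose = c • g := by
    have h1 : g.transpose * g' * g = Matrix.scalar (Fin n) c * g := by rw [hc]
    rw [mul_assoc, hg'g, mul_one] at h1
    rw [h1, Matrix.scalar_apply, Matrix.smul_eq_diagonal_mul]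
  have hg0 : g ≠ 0 := fun h0 => by
    rw [h0, zero_mul] at hgg'
    exact zero_ne_one hgg'
  have hcc : c * c = 1 := by
    have h1 := congrArg Matrix.transpose hgt
    rw [Matrix.transpose_transpose, Matrix.transpose_smul, hgt, smul_smul] at h1
    have h3 : (c * c - 1) • g = 0 := by rw [sub_smul, one_smul, ← h1, sub_self]
    exact sub_eq_zero.1 ((smul_eq_zero.1 h3).resolve_right hg0)
  let R : Matrix (Fin n) (Fin n) L ≃ₗ[L] Matrix (Fin n) (Fin n) L :=
    { toFun := fun x => x * g
      invFun := fun x => x * g'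
      left_inv := fun x => by simp only [mul_assoc, hgg', mul_one]
      right_inv := fun x => by simp only [mul_assoc, hg'g, mul_one]
      map_add' := fun x y => add_mul _ _ _
      map_smul' := fun c x => by simp }
  have hker : ∀ x, τ x = x ↔ (x * g).transpose = c • (x * g) := by
    intro x
    rw [Matrix.transpose_mul, hgt, hτ, smul_mul_assoc]
    have hc0 : c ≠ 0 := fun h0 => by simp [h0] at hcc
    rw [smul_right_inj hc0]
    refine ⟨fun h => ?_, fun h => by rw [h, mul_assoc, hgg', mul_one]⟩
    have h5 := congrArg (fun y => y * g) h
    simpa only [mul_assoc, hg'g, mul_one] using h5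
  rcases mul_self_eq_one_iff.1 hcc with rfl | rfl
  · left
    have h5 : (LinearMap.ker (τ - LinearMap.id)).map R.toLinearMap = LinearMap.ker
        ((Matrix.transposeLinearEquiv (Fin n) (Fin n) L L).toLinearMap - LinearMap.id) := by
      ext y
      rw [Submodule.mem_map_equiv, LinearMap.mem_ker, LinearMap.sub_apply, sub_eq_zero,
        LinearMap.mem_ker, LinearMap.sub_apply, sub_eq_zero, LinearMap.id_apply, hker, one_smul]
      change (R (R.symm y)).transpose = R (R.symm y) ↔ y.transpose = y
      rw [R.apply_symm_apply]
    rw [← two_mul_finrank_ker_transpose_sub (L := L) n, ← h5]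
    exact congrArg _ (LinearEquiv.finrank_map_eq R _).symm
  · right
    have h5 : (LinearMap.ker (τ - LinearMap.id)).map R.toLinearMap = LinearMap.ker
        ((Matrix.transposeLinearEquiv (Fin n) (Fin n) L L).toLinearMap + LinearMap.id) := by
      ext y
      rw [Submodule.mem_map_equiv, LinearMap.mem_ker, LinearMap.sub_apply, sub_eq_zero,
        LinearMap.mem_ker, LinearMap.add_apply, ← eq_neg_iff_add_eq_zero, LinearMap.id_apply, hker,
        neg_one_smul]
      change (R (R.symm y)).transpose = -(R (R.symm y)) ↔ y.transpose = -y
      rw [R.apply_symm_apply]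
    rw [← two_mul_finrank_ker_transpose_add n h2, ← h5]
    exact congrArg _ (LinearEquiv.finrank_map_eq R _).symm

end MatrixInvolutions

/-! ### Involutions of the first kind are orthogonal or symplectic. -/

section Types

variable {A : Type*} [DivisionRing A] [Module.Finite (Subring.center A) A]

/-- A two-sided ideal of L ⊗ A is stable under id ⊗ f for every linear f, since f is a sum of
sandwich maps. Taking for f a coordinate functional times 1 turns a nonzero element of the ideal
into a nonzero scalar. -/
theorem isSimpleRing_baseChange (L : Type*) [Field L] [Algebra (Subring.center A) L] :
    IsSimpleRing (L ⊗[Subring.center A] A) := by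
  let F := Subring.center A
  let b := Module.Free.chooseBasis F A
  have hnt : Nontrivial (L ⊗[F] A) := by
    rw [← rank_pos_iff_nontrivial (R := L), Module.rank_baseChange]
    simpa using rank_pos
  have htop : ∀ I : TwoSidedIdeal (L ⊗[F] A), I ≠ ⊥ → I = ⊤ := by
    intro I hI
    obtain ⟨x, hx, hx0⟩ : ∃ x ∈ I, x ≠ 0 := by
      by_contra! hall
      exact hI (eq_bot_iff.2 fun x hx => (TwoSidedIdeal.mem_bot _).2 (hall x hx))
    have hstable : ∀ f : A →ₗ[F] A, f.lTensor L x ∈ I := by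
      intro f
      obtain ⟨a, ha⟩ := exists_eq_sum_mul_mul b f
      have h : ∀ y, f.lTensor L y = ∑ i, (1 ⊗ₜ[F] a i) * y * (1 ⊗ₜ[F] b i) := by
        intro y
        induction y using TensorProduct.induction_on with
        | zero => simp
        | tmul c z =>
          rw [LinearMap.lTensor_tmul, ha, TensorProduct.tmul_sum]
          simp
        | add y z hy hz =>
          rw [map_add, hy, hz, ← Finset.sum_add_distrib]
          simp only [mul_add, add_mul]
      rw [h]
      exact sum_mem fun i _ => I.mul_mem_right _ _ (I.mul_mem_left _ _ hx)
    let B := Algebra.TensorProduct.basis L b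
    obtain ⟨i, hi⟩ : ∃ i, B.repr x i ≠ 0 := by
      by_contra! hall
      exact hx0 (B.repr.injective (Finsupp.ext fun i => by rw [hall i]; simp))
    have hcoord : ∀ y, ((b.coord i).smulRight (1 : A)).lTensor L y = (B.repr y i) ⊗ₜ[F] (1 : A) := by
      intro y
      induction y using TensorProduct.induction_on with
      | zero => simp
      | tmul c z =>
        rw [LinearMap.lTensor_tmul, Algebra.TensorProduct.basis_repr_tmul]
        simp only [LinearMap.smulRight_apply, Module.Basis.coord_apply, TensorProduct.tmul_smul,
          Finsupp.smul_apply, Finsupp.mapRange_apply, smul_eq_mul]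
        rw [mul_comm, ← Algebra.smul_def, ← TensorProduct.smul_tmul']
      | add y z hy hz =>
        rw [map_add, hy, hz, map_add, Finsupp.add_apply, TensorProduct.add_tmul]
    have h1 := hstable ((b.coord i).smulRight (1 : A))
    rw [hcoord] at h1
    have h2 := I.mul_mem_left ((B.repr x i)⁻¹ ⊗ₜ[F] (1 : A)) _ h1
    rw [Algebra.TensorProduct.tmul_mul_tmul, inv_mul_cancel₀ hi, one_mul] at h2
    exact (TwoSidedIdeal.one_mem_iff I).1 h2
  exact IsSimpleRing.of_eq_bot_or_eq_top fun I => (em (I = ⊥)).imp_right (htop I)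

/-- An involution of the first kind as a linear map over the centre. -/
def IsFirstKind.toLinearMap {A : Type*} [Ring A] {σ : RingInvo A} (hσ : IsFirstKind σ) :
    A →ₗ[Subring.center A] A where
  toFun x := (σ x).unop
  map_add' := σ.unop_add
  map_smul' c x := by
    simp only [Subring.smul_def, smul_eq_mul, RingInvo.unop_mul, hσ c c.2, RingHom.id_apply]
    exact Subring.mem_center_iff.1 c.2 _

theorem IsFirstKind.symElements_eq_ker {A : Type*} [Ring A] {σ : RingInvo A} (hσ : IsFirstKind σ) :
    symElements σ hσ = LinearMap.ker (hσ.toLinearMap - LinearMap.id) := by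
  ext x
  rw [LinearMap.mem_ker, LinearMap.sub_apply, sub_eq_zero]
  rfl

/-- Over an algebraic closure of the centre the algebra becomes a matrix algebra of size d, where
the count is known, and the dimension of the fixed space does not change under this extension. -/
theorem two_mul_finrank_symElements (h2 : (2 : A) ≠ 0) {σ : RingInvo A} (hσ : IsFirstKind σ) :
    ∃ d : ℕ, 0 < d ∧ Module.finrank (Subring.center A) A = d ^ 2 ∧
      (2 * Module.finrank (Subring.center A) (symElements σ hσ) = d * (d + 1) ∨
        2 * Module.finrank (Subring.center A) (symElements σ hσ) = d * (d - 1)) := by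
  let F := Subring.center A
  let L := AlgebraicClosure F
  have h2F : (2 : F) ≠ 0 := fun h => h2 (by
    have h' := congrArg (Subring.subtype F) h
    rwa [map_ofNat, map_zero] at h')
  have h2L : (2 : L) ≠ 0 := fun h => h2F ((algebraMap F L).injective (by
    rw [map_ofNat, map_zero]; exact h))
  have : IsSimpleRing (L ⊗[F] A) := isSimpleRing_baseChange L
  obtain ⟨n, hn, ⟨e⟩⟩ := IsSimpleRing.exists_algEquiv_matrix_of_isAlgClosed L (L ⊗[F] A)
  have hdim : Module.finrank F A = n ^ 2 := by
    rw [← Module.finrank_baseChange (R := L), e.toLinearEquiv.finrank_eq, Module.finrank_matrix,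
      Module.finrank_self, Fintype.card_fin, mul_one, sq]
  let s : A →ₗ[F] A := hσ.toLinearMap
  have hs : ∀ x, s (s x) = x := σ.involution
  let S : L ⊗[F] A →ₗ[L] L ⊗[F] A := s.baseChange L
  have hS : ∀ x, S (S x) = x := fun x => by
    induction x using TensorProduct.induction_on with
    | zero => simp
    | tmul c x => simp [S, hs]
    | add x y hx hy => rw [map_add, map_add, hx, hy]
  have hSmul : ∀ x y, S (x * y) = S y * S x := fun x y => by
    induction x using TensorProduct.induction_on with
    | zero => simp
    | add x x' hx hx' => rw [add_mul, map_add, map_add, mul_add, hx, hx']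
    | tmul c x =>
      induction y using TensorProduct.induction_on with
      | zero => simp
      | add y y' hy hy' => rw [mul_add, map_add, map_add, add_mul, hy, hy']
      | tmul d y =>
        have hxy : s (x * y) = s y * s x := σ.unop_mul x y
        simp [S, hxy, mul_comm]
  have hS1 : S 1 = 1 := by
    have h1 : s 1 = 1 := by change (σ 1).unop = 1; simp
    rw [Algebra.TensorProduct.one_def, LinearMap.baseChange_tmul, h1]
  let τ : Matrix (Fin n) (Fin n) L →ₗ[L] Matrix (Fin n) (Fin n) L :=
    e.toLinearMap ∘ₗ S ∘ₗ e.symm.toLinearMap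
  have hτapp : ∀ x, τ x = e (S (e.symm x)) := fun x => rfl
  have hτ := two_mul_finrank_ker_of_matrix_antiautomorphism n h2L hn.out τ
    (by rw [hτapp, map_one, hS1, map_one]) (fun x y => by simp only [hτapp, map_mul, hSmul])
    (fun x => by simp only [hτapp, e.symm_apply_apply, hS, e.apply_symm_apply])
  have hkerτ : (LinearMap.ker (S - LinearMap.id)).map e.toLinearEquiv.toLinearMap =
      LinearMap.ker (τ - LinearMap.id) := by
    ext y
    rw [Submodule.mem_map_equiv, LinearMap.mem_ker, LinearMap.sub_apply, sub_eq_zero,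
      LinearMap.mem_ker, LinearMap.sub_apply, sub_eq_zero, hτapp]
    change S (e.symm y) = e.symm y ↔ e (S (e.symm y)) = y
    rw [← e.injective.eq_iff, e.apply_symm_apply]
  have hfin : Module.finrank L (LinearMap.ker (τ - LinearMap.id)) =
      Module.finrank L (LinearMap.ker (S - LinearMap.id)) := by
    rw [← hkerτ]
    exact LinearEquiv.finrank_map_eq e.toLinearEquiv _
  have hle1 := finrank_ker_le_finrank_ker_baseChange L (s - LinearMap.id)
  have hle2 := finrank_ker_le_finrank_ker_baseChange L (s + LinearMap.id)
  rw [LinearMap.baseChange_sub, LinearMap.baseChange_id] at hle1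
  rw [LinearMap.baseChange_add, LinearMap.baseChange_id] at hle2
  have hsum1 := finrank_ker_sub_add_finrank_ker_add h2F s hs
  have hsum2 := finrank_ker_sub_add_finrank_ker_add h2L S hS
  rw [Module.finrank_baseChange] at hsum2
  have heq : Module.finrank F (LinearMap.ker (s - LinearMap.id)) =
      Module.finrank L (LinearMap.ker (S - LinearMap.id)) := by
    change Module.finrank F _ ≤ Module.finrank L (LinearMap.ker (S - _)) at hle1
    change Module.finrank F _ ≤ Module.finrank L (LinearMap.ker (S + _)) at hle2
    omega
  refine ⟨n, Nat.pos_of_ne_zero hn.out, hdim, ?_⟩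
  rw [hσ.symElements_eq_ker]
  change 2 * Module.finrank F (LinearMap.ker (s - LinearMap.id)) = _ ∨
    2 * Module.finrank F (LinearMap.ker (s - LinearMap.id)) = _
  rwa [heq, ← hfin]

theorem IsFirstKind.isOrthogonal_or_isSymplectic (h2 : (2 : A) ≠ 0) {σ : RingInvo A}
    (hσ : IsFirstKind σ) : IsOrthogonal σ ∨ IsSymplectic σ := by
  obtain ⟨d, hd, hdim, h | h⟩ := two_mul_finrank_symElements h2 hσ
  · exact Or.inl ⟨hσ, d, hd, hdim, h⟩
  · exact Or.inr ⟨hσ, d, hd, hdim, h⟩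

theorem not_isOrthogonal_and_isSymplectic {A : Type*} [Ring A] {σ : RingInvo A}
    (ho : IsOrthogonal σ) (hs : IsSymplectic σ) : False := by
  obtain ⟨hσ, d, hd, hdim, h⟩ := ho
  obtain ⟨_, d', hd', hdim', h'⟩ := hs
  have hdd : d = d' := Nat.pow_left_injective (n := 2) (by norm_num) (hdim.symm.trans hdim')
  subst hdd
  have h3 := h.symm.trans h'
  have h4 := Nat.eq_of_mul_eq_mul_left hd h3
  omega

end Types

/-! ### The invariants `u⁺` and `u⁻` are well defined. -/

section TypeChange

variable {A : Type*} [DivisionRing A]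

/-- Left multiplication by a nonzero element as a linear automorphism over the centre. -/
def mulLeftEquiv (g : A) (hg : g ≠ 0) : A ≃ₗ[Subring.center A] A where
  toFun x := g * x
  invFun x := g⁻¹ * x
  left_inv x := inv_mul_cancel_left₀ hg x
  right_inv x := mul_inv_cancel_left₀ hg x
  map_add' := mul_add g
  map_smul' c x := by simp

theorem IsFirstKind.conj {σ : RingInvo A} (hσ : IsFirstKind σ) {g : A} {hg : g ≠ 0} {δ : ℤˣ}
    {hδ : (σ g).unop = (δ : ℤ) • g} : IsFirstKind (σ.conj g hg δ hδ) := fun z hz => by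
  rw [RingInvo.conj_apply, hσ z hz, Subring.mem_center_iff.1 hz, mul_inv_cancel_right₀ hg]

/-- Left multiplication by g identifies the δ-eigenspace of σ with the symmetric elements of the
conjugate. So the type is kept for δ = 1, while for δ = -1 the dimensions are complementary and the
type changes. -/
theorem mem_symElements_conj {σ : RingInvo A} (hσ : IsFirstKind σ) {g : A} {hg : g ≠ 0} {δ : ℤˣ}
    {hδ : (σ g).unop = (δ : ℤ) • g} (x : A) :
    g * x ∈ symElements (σ.conj g hg δ hδ) hσ.conj ↔ (δ : ℤ) • (σ x).unop = x := by
  change (σ.conj g hg δ hδ (g * x)).unop = g * x ↔ _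
  rw [RingInvo.conj_apply, RingInvo.unop_mul, hδ, mul_assoc, mul_smul_comm, smul_mul_assoc,
    mul_assoc, mul_inv_cancel₀ hg, mul_one]
  exact (mul_right_injective₀ hg).eq_iff

variable [Module.Finite (Subring.center A) A]

theorem finrank_symElements_conj {σ : RingInvo A} (hσ : IsFirstKind σ) {g : A} {hg : g ≠ 0}
    {hδ : (σ g).unop = ((1 : ℤˣ) : ℤ) • g} :
    Module.finrank (Subring.center A) (symElements (σ.conj g hg 1 hδ) hσ.conj) =
      Module.finrank (Subring.center A) (symElements σ hσ) := by
  rw [← LinearEquiv.finrank_map_eq (mulLeftEquiv g hg) (symElements σ hσ)]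
  suffices h : symElements (σ.conj g hg 1 hδ) hσ.conj =
      (symElements σ hσ).map (mulLeftEquiv g hg).toLinearMap by rw [h]
  ext y
  rw [Submodule.mem_map_equiv]
  have h := mem_symElements_conj hσ (hg := hg) (hδ := hδ) (g⁻¹ * y)
  rw [mul_inv_cancel_left₀ hg] at h
  rw [h]
  simp only [Units.val_one, one_smul]
  rfl

theorem finrank_symElements_conj_neg (h2 : (2 : A) ≠ 0) {σ : RingInvo A} (hσ : IsFirstKind σ) {g : A}
    {hg : g ≠ 0} {hδ : (σ g).unop = ((-1 : ℤˣ) : ℤ) • g} :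
    Module.finrank (Subring.center A) (symElements (σ.conj g hg (-1) hδ) hσ.conj) +
      Module.finrank (Subring.center A) (symElements σ hσ) =
      Module.finrank (Subring.center A) A := by
  have h2F : (2 : Subring.center A) ≠ 0 := fun h => h2 (by
    have h' := congrArg (Subring.subtype (Subring.center A)) h
    rwa [map_ofNat, map_zero] at h')
  rw [hσ.symElements_eq_ker, ← finrank_ker_sub_add_finrank_ker_add h2F hσ.toLinearMap σ.involution,
    add_comm, ← LinearEquiv.finrank_map_eq (mulLeftEquiv g hg)
      (LinearMap.ker (hσ.toLinearMap + LinearMap.id))]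
  suffices h : symElements (σ.conj g hg (-1) hδ) hσ.conj =
      (LinearMap.ker (hσ.toLinearMap + LinearMap.id)).map (mulLeftEquiv g hg).toLinearMap by rw [h]
  ext y
  rw [Submodule.mem_map_equiv]
  have h := mem_symElements_conj hσ (hg := hg) (hδ := hδ) (g⁻¹ * y)
  rw [mul_inv_cancel_left₀ hg] at h
  rw [h, LinearMap.mem_ker, LinearMap.add_apply, ← eq_neg_iff_add_eq_zero]
  simp only [Units.val_neg, Units.val_one, neg_smul, one_smul]
  exact neg_eq_iff_eq_neg

theorem IsOrthogonal.conj {σ : RingInvo A} (hσ : IsOrthogonal σ) {g : A} {hg : g ≠ 0}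
    {hδ : (σ g).unop = ((1 : ℤˣ) : ℤ) • g} : IsOrthogonal (σ.conj g hg 1 hδ) := by
  obtain ⟨h1, d, hd, hdim, h⟩ := hσ
  exact ⟨h1.conj, d, hd, hdim, by rw [finrank_symElements_conj h1, h]⟩

theorem IsSymplectic.conj {σ : RingInvo A} (hσ : IsSymplectic σ) {g : A} {hg : g ≠ 0}
    {hδ : (σ g).unop = ((1 : ℤˣ) : ℤ) • g} : IsSymplectic (σ.conj g hg 1 hδ) := by
  obtain ⟨h1, d, hd, hdim, h⟩ := hσ
  exact ⟨h1.conj, d, hd, hdim, by rw [finrank_symElements_conj h1, h]⟩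

theorem IsOrthogonal.conj_neg (h2 : (2 : A) ≠ 0) {σ : RingInvo A} (hσ : IsOrthogonal σ) {g : A}
    {hg : g ≠ 0} {hδ : (σ g).unop = ((-1 : ℤˣ) : ℤ) • g} :
    IsSymplectic (σ.conj g hg (-1) hδ) := by
  obtain ⟨h1, d, hd, hdim, h⟩ := hσ
  refine ⟨h1.conj, d, hd, hdim, ?_⟩
  have h3 := finrank_symElements_conj_neg h2 h1 (hg := hg) (hδ := hδ)
  obtain ⟨d, rfl⟩ := Nat.exists_eq_add_of_lt hd
  rw [hdim] at h3
  rw [Nat.add_sub_cancel]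
  nlinarith

theorem IsSymplectic.conj_neg (h2 : (2 : A) ≠ 0) {σ : RingInvo A} (hσ : IsSymplectic σ) {g : A}
    {hg : g ≠ 0} {hδ : (σ g).unop = ((-1 : ℤˣ) : ℤ) • g} :
    IsOrthogonal (σ.conj g hg (-1) hδ) := by
  obtain ⟨h1, d, hd, hdim, h⟩ := hσ
  refine ⟨h1.conj, d, hd, hdim, ?_⟩
  have h3 := finrank_symElements_conj_neg h2 h1 (hg := hg) (hδ := hδ)
  obtain ⟨d, rfl⟩ := Nat.exists_eq_add_of_lt hd
  rw [hdim] at h3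
  rw [Nat.add_sub_cancel] at h
  nlinarith

/-- Any other involution of the first kind is a conjugate of σ with some sign δ. That sign
multiplies ε and changes the type exactly when it is -1, so only the combination of type and ε
matters. -/
theorem IsOrthogonal.isUPlus (h2 : (2 : A) ≠ 0) {σ : RingInvo A} (hσ : IsOrthogonal σ) :
    IsUPlus A (uInv σ 1) ∧ IsUMinus A (uInv σ (-1)) := by
  have key : ∀ τ : RingInvo A, (IsOrthogonal τ → ∀ ε, uInv τ ε = uInv σ ε) ∧
      (IsSymplectic τ → ∀ ε, uInv τ ε = uInv σ (-ε)) := by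
    intro τ
    refine ⟨fun hτ ε => ?_, fun hτ ε => ?_⟩
    · obtain ⟨g, hg, δ, hδ, rfl⟩ := exists_unop_eq_smul_of_isFirstKind hσ.1 hτ.1
      rcases Int.units_eq_one_or δ with rfl | rfl
      · rw [uInv_conj, one_mul]
      · exact absurd (hσ.conj_neg h2) fun h => not_isOrthogonal_and_isSymplectic hτ h
    · obtain ⟨g, hg, δ, hδ, rfl⟩ := exists_unop_eq_smul_of_isFirstKind hσ.1 hτ.1
      rcases Int.units_eq_one_or δ with rfl | rfl
      · exact absurd hσ.conj fun h => not_isOrthogonal_and_isSymplectic h hτ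
      · rw [uInv_conj, neg_one_mul]
  refine ⟨⟨⟨σ, Or.inl hσ⟩, fun τ => ⟨fun h => (key τ).1 h 1, fun h => ?_⟩⟩,
    ⟨⟨σ, Or.inl hσ⟩, fun τ => ⟨fun h => (key τ).1 h (-1), fun h => (key τ).2 h 1⟩⟩⟩
  rw [(key τ).2 h (-1), neg_neg]

theorem IsSymplectic.isUPlus (h2 : (2 : A) ≠ 0) {σ : RingInvo A} (hσ : IsSymplectic σ) :
    IsUPlus A (uInv σ (-1)) ∧ IsUMinus A (uInv σ 1) := by
  have key : ∀ τ : RingInvo A, (IsSymplectic τ → ∀ ε, uInv τ ε = uInv σ ε) ∧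
      (IsOrthogonal τ → ∀ ε, uInv τ ε = uInv σ (-ε)) := by
    intro τ
    refine ⟨fun hτ ε => ?_, fun hτ ε => ?_⟩
    · obtain ⟨g, hg, δ, hδ, rfl⟩ := exists_unop_eq_smul_of_isFirstKind hσ.1 hτ.1
      rcases Int.units_eq_one_or δ with rfl | rfl
      · rw [uInv_conj, one_mul]
      · exact absurd (hσ.conj_neg h2) fun h => not_isOrthogonal_and_isSymplectic h hτ
    · obtain ⟨g, hg, δ, hδ, rfl⟩ := exists_unop_eq_smul_of_isFirstKind hσ.1 hτ.1
      rcases Int.units_eq_one_or δ with rfl | rfl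
      · exact absurd hσ.conj fun h => not_isOrthogonal_and_isSymplectic hτ h
      · rw [uInv_conj, neg_one_mul]
  refine ⟨⟨⟨σ, Or.inr hσ⟩, fun τ => ⟨fun h => (key τ).2 h 1, fun h => (key τ).1 h (-1)⟩⟩,
    ⟨⟨σ, Or.inr hσ⟩, fun τ => ⟨fun h => ?_, fun h => (key τ).1 h 1⟩⟩⟩
  rw [(key τ).2 h (-1), neg_neg]

/-- Since only the sum is recorded, the type of σ need not be known: in the symplectic case the two
summands are exchanged. -/
theorem IsFirstKind.exists_isUPlus_isUMinus (h2 : (2 : A) ≠ 0) {σ : RingInvo A}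
    (hσ : IsFirstKind σ) :
    ∃ p m : ℕ∞, IsUPlus A p ∧ IsUMinus A m ∧ p + m = uInv σ 1 + uInv σ (-1) := by
  rcases hσ.isOrthogonal_or_isSymplectic h2 with h | h
  · exact ⟨_, _, (h.isUPlus h2).1, (h.isUPlus h2).2, rfl⟩
  · exact ⟨_, _, (h.isUPlus h2).1, (h.isUPlus h2).2, add_comm _ _⟩

end TypeChange

/-! ### Discrete valuations on division rings with a reduction map. -/

/-- A normalized discrete valuation on a division ring, together with a reduction map onto its
residue ring. The reduction map is only meaningful on elements of nonnegative valuation. -/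
structure ResidueValuation (A B : Type*) [DivisionRing A] [DivisionRing B] where
  -- The value at 0 is arbitrary, which is why the later fields allow `x = 0` separately.
  ord : A → ℤ
  ord_mul : ∀ x y, x ≠ 0 → y ≠ 0 → ord (x * y) = ord x + ord y
  ord_add : ∀ x y, x ≠ 0 → y ≠ 0 → x + y ≠ 0 → min (ord x) (ord y) ≤ ord (x + y)
  exists_ord_eq_one : ∃ p, p ≠ 0 ∧ ord p = 1
  res : A → B
  res_one : res 1 = 1
  res_add : ∀ x y, (x = 0 ∨ 0 ≤ ord x) → (y = 0 ∨ 0 ≤ ord y) → res (x + y) = res x + res y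
  res_mul : ∀ x y, (x = 0 ∨ 0 ≤ ord x) → (y = 0 ∨ 0 ≤ ord y) → res (x * y) = res x * res y
  res_eq_zero_iff : ∀ x, (x = 0 ∨ 0 ≤ ord x) → (res x = 0 ↔ x = 0 ∨ 1 ≤ ord x)
  res_surj : ∀ b, ∃ x, (x = 0 ∨ 0 ≤ ord x) ∧ res x = b

namespace ResidueValuation

variable {A B : Type*} [DivisionRing A] [DivisionRing B] (W : ResidueValuation A B)

/-- `x` has valuation at least `n`. -/
def ge (n : ℤ) (x : A) : Prop := x = 0 ∨ n ≤ W.ord x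

variable {W}

theorem ge.mono {m n : ℤ} {x : A} (h : W.ge n x) (hmn : m ≤ n) : W.ge m x :=
  h.imp_right hmn.trans

theorem ge.le {n : ℤ} {x : A} (h : W.ge n x) (hx : x ≠ 0) : n ≤ W.ord x := h.resolve_left hx

theorem ge.mul {m n : ℤ} {x y : A} (hx : W.ge m x) (hy : W.ge n y) : W.ge (m + n) (x * y) := by
  by_cases hx0 : x = 0
  · exact Or.inl (by rw [hx0, zero_mul])
  by_cases hy0 : y = 0
  · exact Or.inl (by rw [hy0, mul_zero])
  exact Or.inr (by rw [W.ord_mul x y hx0 hy0]; exact add_le_add (hx.le hx0) (hy.le hy0))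

theorem ge.mul_zero_zero {x y : A} (hx : W.ge 0 x) (hy : W.ge 0 y) : W.ge 0 (x * y) :=
  (add_zero (0 : ℤ)) ▸ hx.mul hy

theorem ge.add {n : ℤ} {x y : A} (hx : W.ge n x) (hy : W.ge n y) : W.ge n (x + y) := by
  by_cases hx0 : x = 0
  · rwa [hx0, zero_add]
  by_cases hy0 : y = 0
  · rwa [hy0, add_zero]
  by_cases hxy : x + y = 0
  · exact Or.inl hxy
  exact Or.inr ((le_min (hx.le hx0) (hy.le hy0)).trans (W.ord_add x y hx0 hy0 hxy))

variable (W)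

@[simp]
theorem ord_one : W.ord 1 = 0 := by
  have h := W.ord_mul 1 1 one_ne_zero one_ne_zero
  rw [mul_one] at h
  omega

theorem ord_neg (x : A) : W.ord (-x) = W.ord x := by
  have h1 : W.ord (-1) = 0 := by
    have h := W.ord_mul (-1) (-1) (neg_ne_zero.2 one_ne_zero) (neg_ne_zero.2 one_ne_zero)
    rw [neg_mul_neg, one_mul, ord_one] at h
    omega
  by_cases hx : x = 0
  · rw [hx, neg_zero]
  rw [← neg_one_mul, W.ord_mul _ _ (neg_ne_zero.2 one_ne_zero) hx, h1, zero_add]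

theorem ord_inv {x : A} (hx : x ≠ 0) : W.ord x⁻¹ = -W.ord x := by
  have h := W.ord_mul x x⁻¹ hx (inv_ne_zero hx)
  rw [mul_inv_cancel₀ hx, ord_one] at h
  omega

theorem ord_zpow {x : A} (hx : x ≠ 0) (n : ℤ) : W.ord (x ^ n) = n * W.ord x := by
  induction n using Int.induction_on with
  | zero => simp
  | succ n ih => rw [zpow_add_one₀ hx, W.ord_mul _ _ (zpow_ne_zero _ hx) hx, ih]; ring
  | pred n ih =>
    rw [zpow_sub_one₀ hx, W.ord_mul _ _ (zpow_ne_zero _ hx) (inv_ne_zero hx), ih, W.ord_inv hx]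
    ring

theorem ord_pow {x : A} (hx : x ≠ 0) (n : ℕ) : W.ord (x ^ n) = n * W.ord x := by
  rw [← zpow_natCast, W.ord_zpow hx]

variable {W}

theorem ge.neg {n : ℤ} {x : A} (hx : W.ge n x) : W.ge n (-x) := by
  rcases hx with h | h
  · exact Or.inl (by rw [h, neg_zero])
  · exact Or.inr (by rwa [W.ord_neg])

theorem ge.sub {n : ℤ} {x y : A} (hx : W.ge n x) (hy : W.ge n y) : W.ge n (x - y) := by
  rw [sub_eq_add_neg]
  exact hx.add hy.neg

theorem ge.sum {n : ℤ} {ι : Type*} (s : Finset ι) {f : ι → A} (h : ∀ i ∈ s, W.ge n (f i)) :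
    W.ge n (∑ i ∈ s, f i) := by
  classical
  induction s using Finset.induction_on with
  | empty => exact Or.inl Finset.sum_empty
  | insert i s hi ih =>
    rw [Finset.sum_insert hi]
    exact (h i (Finset.mem_insert_self i s)).add (ih fun j hj => h j (Finset.mem_insert_of_mem hj))

theorem ge_ord (x : A) : W.ge (W.ord x) x := Or.inr le_rfl

theorem ge_one_right : W.ge 0 (1 : A) := Or.inr W.ord_one.ge

theorem ge.units_smul {n : ℤ} {x : A} (hx : W.ge n x) (δ : ℤˣ) : W.ge n ((δ : ℤ) • x) := by
  rcases Int.units_eq_one_or δ with rfl | rfl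
  · simpa using hx
  · simpa using hx.neg

theorem not_ge_of_lt {n : ℤ} {x : A} (hx : x ≠ 0) (h : W.ord x < n) : ¬ W.ge n x := fun h' =>
  absurd (h'.le hx) (not_le.2 h)

/-- If `x - y` has larger valuation than `x`, then `x` and `y` have the same valuation. -/
theorem ne_zero_and_ord_eq {x y : A} (hx : x ≠ 0) (h : W.ge (W.ord x + 1) (y - x)) :
    y ≠ 0 ∧ W.ord y = W.ord x := by
  have hy : y ≠ 0 := fun hy => by
    rw [hy, zero_sub] at h
    exact not_ge_of_lt hx (by omega) (neg_neg x ▸ h.neg)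
  refine ⟨hy, le_antisymm ?_ ?_⟩
  · by_contra! hlt
    have h1 : W.ge (W.ord x + 1) x := by
      have h2 : W.ge (W.ord x + 1) y := Or.inr (by omega)
      have := h2.sub h
      rwa [sub_sub_cancel] at this
    exact not_ge_of_lt hx (by omega) h1
  · have h1 := (h.mono (by omega)).add (ge_ord (W := W) x)
    rw [sub_add_cancel] at h1
    exact h1.le hy

@[simp]
theorem res_zero : W.res 0 = 0 := (W.res_eq_zero_iff 0 (Or.inl rfl)).2 (Or.inl rfl)

theorem res_neg {x : A} (hx : W.ge 0 x) : W.res (-x) = -W.res x := by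
  rw [eq_neg_iff_add_eq_zero, ← W.res_add _ _ hx.neg hx, neg_add_cancel, res_zero]

theorem res_sub {x y : A} (hx : W.ge 0 x) (hy : W.ge 0 y) : W.res (x - y) = W.res x - W.res y := by
  rw [sub_eq_add_neg, W.res_add _ _ hx hy.neg, res_neg hy, ← sub_eq_add_neg]

theorem res_units_smul {x : A} (hx : W.ge 0 x) (δ : ℤˣ) :
    W.res ((δ : ℤ) • x) = (δ : ℤ) • W.res x := by
  rcases Int.units_eq_one_or δ with rfl | rfl
  · simp
  · simpa using res_neg hx

theorem res_sum {ι : Type*} (s : Finset ι) {f : ι → A} (h : ∀ i ∈ s, W.ge 0 (f i)) :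
    W.res (∑ i ∈ s, f i) = ∑ i ∈ s, W.res (f i) := by
  classical
  induction s using Finset.induction_on with
  | empty => simp
  | insert i s hi ih =>
    rw [Finset.sum_insert hi, Finset.sum_insert hi, W.res_add _ _ (h i (Finset.mem_insert_self i s))
      (ge.sum s fun j hj => h j (Finset.mem_insert_of_mem hj)),
      ih fun j hj => h j (Finset.mem_insert_of_mem hj)]

theorem res_eq_iff {x y : A} (hx : W.ge 0 x) (hy : W.ge 0 y) :
    W.res x = W.res y ↔ W.ge 1 (x - y) := by
  rw [← sub_eq_zero, ← res_sub hx hy]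
  exact W.res_eq_zero_iff _ (hx.sub hy)

theorem res_ne_zero_iff {x : A} (hx : W.ge 0 x) : W.res x ≠ 0 ↔ x ≠ 0 ∧ W.ord x = 0 := by
  rw [Ne, W.res_eq_zero_iff x hx, not_or]
  refine and_congr_right fun hx0 => ?_
  have := hx.le hx0
  omega

theorem ge_of_ord_eq_zero {x : A} (hx : W.ord x = 0) : W.ge 0 x := Or.inr hx.ge

theorem exists_ord_zero_res {b : B} (hb : b ≠ 0) : ∃ x : A, x ≠ 0 ∧ W.ord x = 0 ∧ W.res x = b := by
  obtain ⟨x, hx, rfl⟩ := W.res_surj b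
  have h := (res_ne_zero_iff hx).1 hb
  exact ⟨x, h.1, h.2, rfl⟩

theorem ge.two_inv {n : ℤ} {x : A} (h2 : (2 : B) ≠ 0) (hx : W.ge n x) :
    W.ge n ((2 : A)⁻¹ * x) := by
  have hr : W.res (2 : A) = 2 := by
    rw [← one_add_one_eq_two, W.res_add _ _ ge_one_right ge_one_right, W.res_one, one_add_one_eq_two]
  have hg : W.ge 0 (2 : A) := by
    rw [← one_add_one_eq_two]
    exact ge_one_right.add ge_one_right
  have h := (res_ne_zero_iff hg).1 (by rw [hr]; exact h2)
  have h' : W.ge 0 (2 : A)⁻¹ := ge_of_ord_eq_zero (by rw [W.ord_inv h.1, h.2, neg_zero])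
  simpa using h'.mul hx

theorem two_ne_zero_of_res (W : ResidueValuation A B) (h2 : (2 : B) ≠ 0) : (2 : A) ≠ 0 := fun h => by
  have hr : W.res (2 : A) = 2 := by
    rw [← one_add_one_eq_two, W.res_add _ _ ge_one_right ge_one_right, W.res_one, one_add_one_eq_two]
  rw [h, res_zero] at hr
  exact h2 hr.symm

section Involution

variable (W)

theorem exists_residue_invo (σ : RingInvo A) (hσ : ∀ x, W.ord (σ x).unop = W.ord x) :
    ∃ τ : RingInvo B, ∀ x, W.ge 0 x → (τ (W.res x)).unop = W.res (σ x).unop := by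
  have hsurj : ∀ b, ∃ x, W.ge 0 x ∧ W.res x = b := W.res_surj
  choose l hl hl' using hsurj
  have hge : ∀ n x, W.ge n x → W.ge n (σ x).unop := fun n x hx => by
    rcases hx with rfl | h
    · exact Or.inl (by simp)
    · exact Or.inr (by rwa [hσ])
  have key : ∀ x, W.ge 0 x → W.res (σ (l (W.res x))).unop = W.res (σ x).unop := fun x hx => by
    rw [res_eq_iff (hge _ _ (hl _)) (hge _ _ hx), ← RingInvo.unop_sub]
    exact hge _ _ ((res_eq_iff (hl _) hx).1 (hl' _))
  refine ⟨RingInvo.ofFun (fun b => W.res (σ (l b)).unop) (fun x y => ?_) (fun x y => ?_)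
    (fun x => ?_), fun x hx => ?_⟩
  · rw [← W.res_add _ _ (hge _ _ (hl _)) (hge _ _ (hl _)), ← RingInvo.unop_add,
      ← key _ ((hl x).add (hl y)), W.res_add _ _ (hl x) (hl y), hl', hl']
  · rw [← W.res_mul _ _ (hge _ _ (hl _)) (hge _ _ (hl _)), ← RingInvo.unop_mul,
      ← key _ ((hl x).mul_zero_zero (hl y)), W.res_mul _ _ (hl x) (hl y), hl', hl']
  · rw [key _ (hge _ _ (hl _)), RingInvo.involution, hl']
  · exact key x hx

/-- Any lift x can be replaced by the average of x and εσ(x), because 2 is a unit. -/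
theorem exists_symm_lift {σ : RingInvo A} {τ : RingInvo B} (h2 : (2 : B) ≠ 0)
    (hσ : ∀ x, W.ord (σ x).unop = W.ord x)
    (hτ : ∀ x, W.ge 0 x → (τ (W.res x)).unop = W.res (σ x).unop) (ε : ℤˣ) (b : B)
    (hb : (ε : ℤ) • (τ b).unop = b) :
    ∃ a, W.ge 0 a ∧ (ε : ℤ) • (σ a).unop = a ∧ W.res a = b := by
  obtain ⟨x, hx', rfl⟩ := W.res_surj b
  have hx : W.ge 0 x := hx'
  clear hx'
  have h2A := W.two_ne_zero_of_res h2
  have hx' : W.ge 0 (σ x).unop := hx.imp (fun h => by rw [h]; simp) fun h => by rwa [hσ]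
  have hσ2 : (σ (2 : A)⁻¹).unop = (2 : A)⁻¹ := by
    rw [RingInvo.unop_inv, ← one_add_one_eq_two, RingInvo.unop_add]
    simp
  have hc : ∀ y : A, y * (2 : A)⁻¹ = (2 : A)⁻¹ * y := fun y =>
    ((Commute.ofNat_right y 2).inv_right₀).eq
  have hsymm : (ε : ℤ) • (σ (x + (ε : ℤ) • (σ x).unop)).unop = x + (ε : ℤ) • (σ x).unop := by
    rcases Int.units_eq_one_or ε with rfl | rfl <;> simp [RingInvo.involution, add_comm]
  have hadd : W.ge 0 (x + (ε : ℤ) • (σ x).unop) := hx.add (hx'.units_smul ε)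
  refine ⟨(2 : A)⁻¹ * (x + (ε : ℤ) • (σ x).unop), hadd.two_inv h2, ?_, ?_⟩
  · rw [RingInvo.unop_mul, hσ2, hc, ← mul_smul_comm, hsymm]
  · have h3 : W.res (2 * ((2 : A)⁻¹ * (x + (ε : ℤ) • (σ x).unop))) = 2 * W.res x := by
      rw [mul_inv_cancel_left₀ h2A, W.res_add _ _ hx (hx'.units_smul ε), res_units_smul hx', ← hτ x hx,
        hb, two_mul]
    rw [two_mul, W.res_add _ _ (hadd.two_inv h2) (hadd.two_inv h2), ← two_mul] at h3
    exact mul_left_cancel₀ h2 h3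

end Involution

/-! ### Larmour's theorem. -/

section Larmour

/-- Divide the vector by pʳ, where r is the least valuation of its coordinates. The reduced vector
is nonzero, so the anisotropic residue form does not vanish on it, and the original value has
valuation exactly 2r. -/
theorem sum_ne_zero_and_even {σ : RingInvo A} {τ : RingInvo B}
    (hσ : ∀ x, W.ord (σ x).unop = W.ord x)
    (hτ : ∀ x, W.ge 0 x → (τ (W.res x)).unop = W.res (σ x).unop) {ι : Type*} [Fintype ι]
    {ε : ℤˣ} {a : ι → A} (ha : ∀ i, W.ge 0 (a i)) (hres : IsAnisotropicDiag τ ε fun i => W.res (a i))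
    {x : ι → A} (hx : x ≠ 0) :
    ∑ i, (σ (x i)).unop * a i * x i ≠ 0 ∧ Even (W.ord (∑ i, (σ (x i)).unop * a i * x i)) := by
  classical
  obtain ⟨p, hp0, hp⟩ := W.exists_ord_eq_one
  have hge : ∀ n x, W.ge n x → W.ge n (σ x).unop := fun n x hx => by
    rcases hx with rfl | h
    · exact Or.inl (by simp)
    · exact Or.inr (by rwa [hσ])
  obtain ⟨j, hj⟩ := Function.ne_iff.1 hx
  obtain ⟨i₀, hi₀, hmin⟩ := Finset.exists_min_image (Finset.univ.filter fun i => x i ≠ 0)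
    (fun i => W.ord (x i)) ⟨j, by simpa using hj⟩
  have hx0 : x i₀ ≠ 0 := by simpa using hi₀
  set r := W.ord (x i₀) with hr
  have hpr : p ^ r ≠ 0 := zpow_ne_zero _ hp0
  have hpinv : W.ge (-r) (p ^ r)⁻¹ := Or.inr (by rw [W.ord_inv hpr, W.ord_zpow hp0, hp, mul_one])
  let z : ι → A := fun i => x i * (p ^ r)⁻¹
  have hz : ∀ i, W.ge 0 (z i) := fun i => by
    by_cases h : x i = 0
    · exact Or.inl (by simp [z, h])
    · have h1 : W.ge r (x i) := Or.inr (hmin i (by simpa using h))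
      simpa using h1.mul hpinv
  have hxz : ∀ i, x i = z i * p ^ r := fun i => (inv_mul_cancel_right₀ hpr (x i)).symm
  have hS : ∑ i, (σ (x i)).unop * a i * x i =
      (σ (p ^ r)).unop * (∑ i, (σ (z i)).unop * a i * z i) * p ^ r := by
    rw [Finset.mul_sum, Finset.sum_mul]
    refine Finset.sum_congr rfl fun i _ => ?_
    rw [hxz i, RingInvo.unop_mul]
    simp only [mul_assoc]
  have hterm : ∀ i, W.ge 0 ((σ (z i)).unop * a i * z i) := fun i => by
    simpa using ((hge _ _ (hz i)).mul (ha i)).mul (hz i)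
  have hres0 : W.res (∑ i, (σ (z i)).unop * a i * z i) ≠ 0 := by
    rw [res_sum _ fun i _ => hterm i]
    intro h0
    have h1 := hres.anisotropic (fun i => W.res (z i)) (by
      rw [← h0]
      refine Finset.sum_congr rfl fun i _ => ?_
      rw [W.res_mul _ _ ((hge _ _ (hz i)).mul_zero_zero (ha i)) (hz i),
        W.res_mul _ _ (hge _ _ (hz i)) (ha i), hτ _ (hz i)])
    have h2 : W.res (z i₀) = 0 := congrFun h1 i₀
    refine (res_ne_zero_iff (hz i₀)).2 ⟨mul_ne_zero hx0 (inv_ne_zero hpr), ?_⟩ h2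
    rw [W.ord_mul _ _ hx0 (inv_ne_zero hpr), W.ord_inv hpr, W.ord_zpow hp0, hp]
    omega
  obtain ⟨hS0, hSord⟩ := (res_ne_zero_iff (ge.sum _ fun i _ => hterm i)).1 hres0
  rw [hS]
  refine ⟨mul_ne_zero (mul_ne_zero (RingInvo.unop_ne_zero σ hpr) hS0) hpr, ?_⟩
  rw [W.ord_mul _ _ (mul_ne_zero (RingInvo.unop_ne_zero σ hpr) hS0) hpr,
    W.ord_mul _ _ (RingInvo.unop_ne_zero σ hpr) hS0, hσ, hSord, add_zero]
  exact ⟨_, rfl⟩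

theorem unop_eq_of_eq_smul_unop {σ : RingInvo A} {ε : ℤˣ} {a : A} (ha : (ε : ℤ) • (σ a).unop = a) :
    (σ a).unop = (ε : ℤ) • a := by
  nth_rewrite 2 [← ha]
  rw [units_smul_smul]

variable {k : Type*} [Field k] [Algebra k A]

theorem unop_eq_of_mem_adjoin {σ : RingInvo A}
    (hσk : ∀ c, (σ (algebraMap k A c)).unop = algebraMap k A c) {t y : A} (ht : (σ t).unop = t)
    (hy : y ∈ Algebra.adjoin k {t}) : (σ y).unop = y := by
  rw [Algebra.adjoin_singleton_eq_range_aeval] at hy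
  obtain ⟨p, rfl⟩ := hy
  change (σ (Polynomial.aeval t p)).unop = Polynomial.aeval t p
  induction p using Polynomial.induction_on' with
  | add p q hp hq => rw [map_add, RingInvo.unop_add, hp, hq]
  | monomial n c =>
    rw [Polynomial.aeval_monomial, RingInvo.unop_mul, hσk, RingInvo.unop_pow, ht]
    exact (Algebra.commutes c (t ^ n)).symm

/-- Put a' = a(1 + t). Then t is symmetric for the adjoint involution x ↦ a⁻¹σ(x)a, and so is a
square root y of 1 + t lying in k[t]. This means σ(y)a = ay, whence σ(y)ay = ay² = a'. Having the
root in k[t] is essential. -/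
theorem exists_unop_mul_mul_eq (hsqrt : ∀ t, W.ge 1 t → ∃ y ∈ Algebra.adjoin k {t}, y * y = 1 + t)
    {σ : RingInvo A} (hσk : ∀ c, (σ (algebraMap k A c)).unop = algebraMap k A c) {ε : ℤˣ} {a a' : A}
    (ha0 : a ≠ 0) (ha : (ε : ℤ) • (σ a).unop = a) (ha' : (ε : ℤ) • (σ a').unop = a')
    (h : W.ge (W.ord a + 1) (a' - a)) : ∃ y, (σ y).unop * a * y = a' := by
  have hσa := unop_eq_of_eq_smul_unop ha
  have hσa' := unop_eq_of_eq_smul_unop ha'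
  have hinv : (σ a⁻¹).unop = (ε : ℤ) • a⁻¹ := by
    rw [RingInvo.unop_inv, hσa]
    rcases Int.units_eq_one_or ε with rfl | rfl <;> simp [inv_neg]
  let τ := σ.conj a⁻¹ (inv_ne_zero ha0) ε hinv
  have hτ : ∀ x, (τ x).unop = a⁻¹ * (σ x).unop * a := fun x => by
    rw [RingInvo.conj_apply, inv_inv]
  have hτk : ∀ c, (τ (algebraMap k A c)).unop = algebraMap k A c := fun c => by
    rw [hτ, hσk, mul_assoc, Algebra.commutes, inv_mul_cancel_left₀ ha0]
  have hge : W.ge 1 (a⁻¹ * (a' - a)) := by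
    have h1 : W.ge (-W.ord a) a⁻¹ := Or.inr (by rw [W.ord_inv ha0])
    have h2 := h1.mul h
    rwa [neg_add_cancel_left] at h2
  obtain ⟨y, hy, hyy⟩ := hsqrt _ hge
  have ht : (τ (a⁻¹ * (a' - a))).unop = a⁻¹ * (a' - a) := by
    rw [hτ, RingInvo.unop_mul, RingInvo.unop_sub, hσa, hσa', hinv, ← smul_sub, smul_mul_smul_comm]
    have h3 : (ε : ℤ) * ε = 1 := by rw [← Units.val_mul, Int.units_mul_self]; rfl
    rw [h3, one_smul]
    simp only [mul_assoc, inv_mul_cancel₀ ha0, mul_one]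
  have hτy := unop_eq_of_mem_adjoin hτk ht hy
  refine ⟨y, ?_⟩
  rw [hτ] at hτy
  have h4 : (σ y).unop * a = a * y := by
    have h5 := congrArg (fun z => a * z) hτy
    simpa only [mul_assoc, mul_inv_cancel_left₀ ha0] using h5
  rw [h4, mul_assoc, hyy, mul_add, mul_inv_cancel_left₀ ha0]
  simp

/-- Lift an isotropic residue vector to z, with value S of positive valuation. If u is the
contribution of a coordinate that is a unit, then u - S is a small perturbation of u, hence equals
σ(y)uy for some y. Multiplying that coordinate by y makes the total value 0. -/
theorem isAnisotropicDiag_res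
    (hsqrt : ∀ t, W.ge 1 t → ∃ y ∈ Algebra.adjoin k {t}, y * y = 1 + t)
    {σ : RingInvo A} (hσk : ∀ c, (σ (algebraMap k A c)).unop = algebraMap k A c) {τ : RingInvo B}
    (hσ : ∀ x, W.ord (σ x).unop = W.ord x)
    (hτ : ∀ x, W.ge 0 x → (τ (W.res x)).unop = W.res (σ x).unop) {ι : Type*} [Fintype ι]
    {ε : ℤˣ} {a : ι → A} (ha : IsAnisotropicDiag σ ε a) (ha0 : ∀ i, a i ≠ 0)
    (hord : ∀ i, W.ord (a i) = 0) : IsAnisotropicDiag τ ε fun i => W.res (a i) := by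
  classical
  have hge : ∀ n x, W.ge n x → W.ge n (σ x).unop := fun n x hx => by
    rcases hx with rfl | h
    · exact Or.inl (by simp)
    · exact Or.inr (by rwa [hσ])
  have hage : ∀ i, W.ge 0 (a i) := fun i => ge_of_ord_eq_zero (hord i)
  refine ⟨fun i => ?_, fun x hx => ?_⟩
  · rw [hτ _ (hage i), ← res_units_smul (hge _ _ (hage i)), ha.symm]
  by_contra hne
  obtain ⟨i₀, hi₀⟩ := Function.ne_iff.1 hne
  have hsurj : ∀ b, ∃ x, W.ge 0 x ∧ W.res x = b := W.res_surj
  choose l hl hl' using hsurj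
  let z : ι → A := fun i => l (x i)
  have hz : ∀ i, W.ge 0 (z i) := fun i => hl _
  obtain ⟨hz0, hzord⟩ := (res_ne_zero_iff (hz i₀)).1 (by rw [hl']; exact hi₀)
  have hterm : ∀ i, W.ge 0 ((σ (z i)).unop * a i * z i) := fun i =>
    ((hge _ _ (hz i)).mul_zero_zero (hage i)).mul_zero_zero (hz i)
  set S := ∑ i, (σ (z i)).unop * a i * z i with hS
  have hS1 : W.ge 1 S := by
    refine (W.res_eq_zero_iff _ (ge.sum _ fun i _ => hterm i)).1 ?_
    rw [res_sum _ fun i _ => hterm i, ← hx]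
    refine Finset.sum_congr rfl fun i _ => ?_
    rw [W.res_mul _ _ ((hge _ _ (hz i)).mul_zero_zero (hage i)) (hz i),
      W.res_mul _ _ (hge _ _ (hz i)) (hage i), ← hτ _ (hz i), hl']
  have hsymm : ∀ i, (ε : ℤ) • (σ ((σ (z i)).unop * a i * z i)).unop =
      (σ (z i)).unop * a i * z i := fun i => by
    rw [RingInvo.unop_mul, RingInvo.unop_mul, RingInvo.involution,
      unop_eq_of_eq_smul_unop (ha.symm i), smul_mul_assoc, mul_smul_comm, units_smul_smul, mul_assoc]
  set u := (σ (z i₀)).unop * a i₀ * z i₀ with hu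
  have hσz0 : (σ (z i₀)).unop ≠ 0 := RingInvo.unop_ne_zero σ hz0
  have hu0 : u ≠ 0 := mul_ne_zero (mul_ne_zero hσz0 (ha0 i₀)) hz0
  have huord : W.ord u = 0 := by
    rw [hu, W.ord_mul _ _ (mul_ne_zero hσz0 (ha0 i₀)) hz0, W.ord_mul _ _ hσz0 (ha0 i₀), hσ, hzord,
      hord]
    rfl
  have hSsymm : (ε : ℤ) • (σ S).unop = S := by
    rw [hS, RingInvo.unop_sum, Finset.smul_sum]
    exact Finset.sum_congr rfl fun i _ => hsymm i
  have hdiff : W.ge (W.ord u + 1) (u - S - u) := by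
    rw [huord, sub_sub_cancel_left, zero_add]
    exact hS1.neg
  obtain ⟨y, hy⟩ := exists_unop_mul_mul_eq hsqrt hσk hu0 (hsymm i₀)
    (by rw [RingInvo.unop_sub, smul_sub, hSsymm, hsymm i₀]) hdiff
  have huS := (ne_zero_and_ord_eq hu0 hdiff).1
  have hy0 : y ≠ 0 := fun h => by
    rw [h, mul_zero] at hy
    exact huS hy.symm
  have hzero := ha.anisotropic (Function.update z i₀ (z i₀ * y)) (by
    rw [← Finset.add_sum_erase _ _ (Finset.mem_univ i₀)]
    have h1 : ∑ i ∈ Finset.univ.erase i₀, (σ (Function.update z i₀ (z i₀ * y) i)).unop * a i *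
        Function.update z i₀ (z i₀ * y) i = S - u := by
      rw [hS, ← Finset.add_sum_erase _ _ (Finset.mem_univ i₀), add_sub_cancel_left]
      refine Finset.sum_congr rfl fun i hi => ?_
      rw [Function.update_of_ne (Finset.ne_of_mem_erase hi)]
    rw [h1, Function.update_self, RingInvo.unop_mul]
    have h2 : (σ y).unop * (σ (z i₀)).unop * a i₀ * (z i₀ * y) = u - S := by
      rw [← hy, hu]
      simp only [mul_assoc]
    rw [h2]
    abel)
  have h3 := congrFun hzero i₀
  rw [Function.update_self] at h3
  exact mul_ne_zero hz0 hy0 h3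

/-- **Larmour's theorem**: over a complete discretely valued division ring the `u`-invariant is the
sum of two residual `u`-invariants. -/
theorem uInv_eq_add (h2 : (2 : B) ≠ 0)
    (hsqrt : ∀ t, W.ge 1 t → ∃ y ∈ Algebra.adjoin k {t}, y * y = 1 + t)
    {σ : RingInvo A} (hσk : ∀ c, (σ (algebraMap k A c)).unop = algebraMap k A c)
    (hσ : ∀ x, W.ord (σ x).unop = W.ord x) {p : A} (hp0 : p ≠ 0) (hp : W.ord p = 1) (δ : ℤˣ)
    (hδ : (σ p⁻¹).unop = (δ : ℤ) • p⁻¹) {τ τ' : RingInvo B}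
    (hτ : ∀ x, W.ge 0 x → (τ (W.res x)).unop = W.res (σ x).unop)
    (hτ' : ∀ x, W.ge 0 x → (τ' (W.res x)).unop =
      W.res ((σ.conj p⁻¹ (inv_ne_zero hp0) δ hδ) x).unop) (ε : ℤˣ) :
    uInv σ ε = uInv τ ε + uInv τ' (δ * ε) := by
  classical
  set σ' := σ.conj p⁻¹ (inv_ne_zero hp0) δ hδ with hσ'def
  have hσ'app : ∀ x, (σ' x).unop = p⁻¹ * (σ x).unop * p := fun x => by
    rw [hσ'def, RingInvo.conj_apply, inv_inv]
  have hσ'k : ∀ c, (σ' (algebraMap k A c)).unop = algebraMap k A c := fun c => by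
    rw [hσ'app, hσk, mul_assoc, Algebra.commutes, inv_mul_cancel_left₀ hp0]
  have hσ' : ∀ x, W.ord (σ' x).unop = W.ord x := fun x => by
    by_cases hx : x = 0
    · simp [hx]
    have h1 := RingInvo.unop_ne_zero σ hx
    rw [hσ'app, W.ord_mul _ _ (mul_ne_zero (inv_ne_zero hp0) h1) hp0,
      W.ord_mul _ _ (inv_ne_zero hp0) h1, W.ord_inv hp0, hσ]
    omega
  have hpδ : (σ p).unop = (δ : ℤ) • p := by
    have h1 := RingInvo.unop_inv σ p⁻¹
    rw [inv_inv, hδ] at h1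
    rw [h1]
    rcases Int.units_eq_one_or δ with rfl | rfl <;> simp [inv_neg]
  refine le_antisymm (uInv_le fun m c hc => ?_) ?_
  · -- the residue forms of an anisotropic form are anisotropic
    have hc0 : ∀ i, c i ≠ 0 := fun i h0 => by
      have h1 := hc.anisotropic (Pi.single i 1) (by
        refine Finset.sum_eq_zero fun j _ => ?_
        by_cases hj : j = i
        · rw [hj, h0]; simp
        · simp [hj])
      simpa using congrFun h1 i
    -- Rescaling by p^(-r) subtracts 2r from the valuation of the entry; the floor division leaves 0
    -- or 1.
    let r : Fin m → ℤ := fun i => W.ord (c i) / 2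
    let q : Fin m → A := fun i => p ^ (-r i)
    have hq0 : ∀ i, q i ≠ 0 := fun i => zpow_ne_zero _ hp0
    let c' : Fin m → A := fun i => (σ (q i)).unop * c i * q i
    have hc'0 : ∀ i, c' i ≠ 0 := fun i =>
      mul_ne_zero (mul_ne_zero (RingInvo.unop_ne_zero σ (hq0 i)) (hc0 i)) (hq0 i)
    have hc'ord : ∀ i, W.ord (c' i) = W.ord (c i) % 2 := fun i => by
      have h1 := RingInvo.unop_ne_zero σ (hq0 i)
      have h3 : W.ord (q i) = -r i := by rw [W.ord_zpow hp0, hp, mul_one]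
      rw [W.ord_mul _ _ (mul_ne_zero h1 (hc0 i)) (hq0 i), W.ord_mul _ _ h1 (hc0 i), hσ, h3]
      have : r i = W.ord (c i) / 2 := rfl
      omega
    have hc' : IsAnisotropicDiag σ ε c' := by
      refine ⟨fun i => ?_, fun x hx => ?_⟩
      · rw [RingInvo.unop_mul, RingInvo.unop_mul, RingInvo.involution,
          unop_eq_of_eq_smul_unop (hc.symm i), smul_mul_assoc, mul_smul_comm, units_smul_smul]
        exact (mul_assoc _ _ _).symm
      · have h1 := hc.anisotropic (fun i => q i * x i) (by
          rw [← hx]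
          refine Finset.sum_congr rfl fun i _ => ?_
          rw [RingInvo.unop_mul]
          simp only [c', mul_assoc])
        funext i
        exact (mul_eq_zero.1 (congrFun h1 i)).resolve_left (hq0 i)
    -- Extension by zero: every subform of an anisotropic diagonal form is anisotropic.
    have hext : ∀ (P : Fin m → Prop) [DecidablePred P] (x : {i // P i} → A),
        ∑ i, (σ (x i)).unop * c' i * x i = 0 → x = 0 := by
      intro P _ x hx
      let z : Fin m → A := fun i => if h : P i then x ⟨i, h⟩ else 0
      have hz1 : ∀ i : {i // P i}, z i = x i := fun i => by simp [z, i.2]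
      have hz2 : ∀ i : {i // ¬ P i}, z i = 0 := fun i => by simp [z, i.2]
      have h1 := hc'.anisotropic z (by
        rw [← Fintype.sum_subtype_add_sum_subtype P]
        simp only [hz1, hz2, mul_zero, Finset.sum_const_zero, add_zero, hx])
      funext i
      rw [← hz1, h1]
      rfl
    have hu : IsAnisotropicDiag τ ε fun i : {i // W.ord (c' i) = 0} => W.res (c' i) :=
      isAnisotropicDiag_res hsqrt hσk hσ hτ ⟨fun i => hc'.symm i, hext _⟩ (fun i => hc'0 i)
        fun i => i.2
    have hodd : IsAnisotropicDiag τ' (δ * ε)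
        fun i : {i // ¬ W.ord (c' i) = 0} => W.res (p⁻¹ * c' i) := by
      refine isAnisotropicDiag_res hsqrt hσ'k hσ' hτ' ⟨fun i => ?_, fun x hx => ?_⟩
        (fun i => mul_ne_zero (inv_ne_zero hp0) (hc'0 i)) fun i => ?_
      · rw [hσ'app, RingInvo.unop_mul, hδ, unop_eq_of_eq_smul_unop (hc'.symm i)]
        rcases Int.units_eq_one_or δ with rfl | rfl <;>
          rcases Int.units_eq_one_or ε with rfl | rfl <;> simp [mul_assoc, hp0]
      · refine hext _ x ?_
        have h3 : p⁻¹ * ∑ i, (σ (x i)).unop * c' i * x i = 0 := by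
          rw [← hx, Finset.mul_sum]
          refine Finset.sum_congr rfl fun i _ => ?_
          rw [hσ'app]
          simp only [mul_assoc, mul_inv_cancel_left₀ hp0]
        exact (mul_eq_zero.1 h3).resolve_left (inv_ne_zero hp0)
      · rw [W.ord_mul _ _ (inv_ne_zero hp0) (hc'0 i), W.ord_inv hp0, hp]
        have h3 := i.2
        rw [hc'ord] at h3 ⊢
        omega
    have hcard := Fintype.card_subtype_compl fun i : Fin m => W.ord (c' i) = 0
    have hle := Fintype.card_subtype_le fun i : Fin m => W.ord (c' i) = 0
    rw [Fintype.card_fin] at hcard hle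
    have hsum : (m : ℕ∞) = (Fintype.card {i // W.ord (c' i) = 0} : ℕ∞) +
        (Fintype.card {i // ¬ W.ord (c' i) = 0} : ℕ∞) := by
      rw [hcard]
      exact_mod_cast (Nat.add_sub_cancel' hle).symm
    rw [hsum]
    exact add_le_add (le_uInv hu) (le_uInv hodd)
  · -- lifts of anisotropic residue forms are anisotropic
    have hnonempty : ∀ (ρ : RingInvo B) (ε : ℤˣ),
        {n : ℕ∞ | ∃ m : ℕ, n = m ∧ ∃ a : Fin m → B, IsAnisotropicDiag ρ ε a}.Nonempty :=
      fun ρ ε => ⟨0, 0, rfl, Fin.elim0, fun i => i.elim0, fun x _ => funext fun i => i.elim0⟩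
    rw [uInv_eq_sSup_diag τ, uInv_eq_sSup_diag τ', ENat.sSup_add (hnonempty _ _)]
    refine iSup₂_le ?_
    rintro _ ⟨m, rfl, a, ha⟩
    rw [ENat.add_sSup (hnonempty _ _)]
    refine iSup₂_le ?_
    rintro _ ⟨n, rfl, b, hb⟩
    choose la hla hla' hla'' using fun i => exists_symm_lift W h2 hσ hτ ε (a i) (ha.symm i)
    choose lb hlb hlb' hlb'' using fun i => exists_symm_lift W h2 hσ' hτ' (δ * ε) (b i) (hb.symm i)
    have hA : IsAnisotropicDiag τ ε fun i => W.res (la i) := by simpa only [hla''] using ha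
    have hB : IsAnisotropicDiag τ' (δ * ε) fun i => W.res (lb i) := by simpa only [hlb''] using hb
    have hc : IsAnisotropicDiag σ ε (Sum.elim la fun j => p * lb j) := by
      refine ⟨fun i => ?_, fun x hx => ?_⟩
      · rcases i with i | j
        · exact hla' i
        · have h3 := hlb' j
          rw [hσ'app] at h3
          simp only [Sum.elim_inr]
          rw [RingInvo.unop_mul, hpδ, mul_smul_comm, smul_smul]
          have h4 : p * (((δ * ε : ℤˣ) : ℤ) • (p⁻¹ * (σ (lb j)).unop * p)) = p * lb j := by rw [h3]
          rw [mul_smul_comm, mul_assoc, mul_inv_cancel_left₀ hp0] at h4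
          rw [← h4]
          push_cast
          rw [mul_comm (ε : ℤ)]
      · have h3 : ∀ j, (σ (x (Sum.inr j))).unop * (p * lb j) * x (Sum.inr j) =
            p * ((σ' (x (Sum.inr j))).unop * lb j * x (Sum.inr j)) := fun j => by
          rw [hσ'app]
          simp only [mul_assoc, mul_inv_cancel_left₀ hp0]
        simp only [Fintype.sum_sum_type, Sum.elim_inl, Sum.elim_inr, h3] at hx
        rw [← Finset.mul_sum] at hx
        have hX : (fun i => x (Sum.inl i)) ≠ 0 → _ := sum_ne_zero_and_even hσ hτ hla hA
        have hY : (fun j => x (Sum.inr j)) ≠ 0 → _ := sum_ne_zero_and_even hσ' hτ' hlb hB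
        set S := ∑ i, (σ (x (Sum.inl i))).unop * la i * x (Sum.inl i) with hS
        set T := ∑ j, (σ' (x (Sum.inr j))).unop * lb j * x (Sum.inr j) with hT
        by_cases hx1 : (fun i => x (Sum.inl i)) = 0
        · by_cases hx2 : (fun j => x (Sum.inr j)) = 0
          · funext i
            rcases i with i | j
            · exact congrFun hx1 i
            · exact congrFun hx2 j
          · exfalso
            have hS0 : S = 0 := Finset.sum_eq_zero fun i _ => by
              rw [show x (Sum.inl i) = 0 from congrFun hx1 i, mul_zero]
            rw [hS0, zero_add] at hx
            exact mul_ne_zero hp0 (hY hx2).1 hx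
        · exfalso
          obtain ⟨hS0, hSe⟩ := hX hx1
          by_cases hx2 : (fun j => x (Sum.inr j)) = 0
          · have hT0 : T = 0 := Finset.sum_eq_zero fun i _ => by
              rw [show x (Sum.inr i) = 0 from congrFun hx2 i, mul_zero]
            rw [hT0, mul_zero, add_zero] at hx
            exact hS0 hx
          · obtain ⟨hT0, hTe⟩ := hY hx2
            -- S and T both have even valuation, so S and pT have valuations of different parity and
            -- cannot cancel.
            have h5 : W.ord S = 1 + W.ord T := by
              rw [eq_neg_of_add_eq_zero_left hx, W.ord_neg, W.ord_mul _ _ hp0 hT0, hp]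
            rw [Int.even_iff] at hSe hTe
            change W.ord S % 2 = 0 at hSe
            change W.ord T % 2 = 0 at hTe
            omega
    have h6 := le_uInv hc
    simpa using h6

end Larmour
end ResidueValuation

/-! ### Weierstrass preparation for irreducible polynomials. -/

section WeierstrassIrreducible

open Polynomial

variable {O k : Type*} [CommRing O] [IsLocalRing O] [IsAdicComplete (IsLocalRing.maximalIdeal O) O]
  [Field k] [Algebra O k]

/-- Over a complete local ring, a polynomial with some unit coefficient and with nonunit constant
term that is irreducible over a field has all its nonleading coefficients in the maximal ideal. -/
theorem coeff_mem_maximalIdeal_of_irreducible (hinj : Function.Injective (algebraMap O k)) (g : O[X])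
    (hirr : Irreducible (g.map (algebraMap O k)))
    (h0 : g.coeff 0 ∈ IsLocalRing.maximalIdeal O) (hunit : ∃ i, IsUnit (g.coeff i)) :
    ∀ i < g.natDegree, g.coeff i ∈ IsLocalRing.maximalIdeal O := by
  have hne : (g : PowerSeries O).map (IsLocalRing.residue O) ≠ 0 := fun h => by
    obtain ⟨i, hi⟩ := hunit
    have h1 := congrArg (PowerSeries.coeff i) h
    rw [PowerSeries.coeff_map, Polynomial.coeff_coe, map_zero, IsLocalRing.residue_eq_zero_iff] at h1
    exact (IsLocalRing.mem_maximalIdeal _).1 h1 hi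
  obtain ⟨P, h, hP⟩ := PowerSeries.exists_isWeierstrassFactorization hne
  have hd := hP.isDistinguishedAt
  have hmonic := hd.monic
  have hI : IsLocalRing.maximalIdeal O ≠ ⊤ := Ideal.IsPrime.ne_top'
  -- Division by the monic P is also a Weierstrass division, so by uniqueness its remainder
  -- vanishes.
  have hdiv : g = P * (g /ₘ P) := by
    have h1 := Polynomial.modByMonic_add_div g P
    have h2 : (P : PowerSeries O) * (h - (g /ₘ P : O[X])) = ((g %ₘ P : O[X]) : PowerSeries O) := by
      rw [mul_sub, ← hP.eq_mul, ← Polynomial.coe_mul, sub_eq_iff_eq_add, ← Polynomial.coe_add, h1]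
    have hdeg : (g %ₘ P).degree < ((P : PowerSeries O).map
        (Ideal.Quotient.mk (IsLocalRing.maximalIdeal O))).order.toNat := by
      have h3 := congrArg ENat.toNat (hd.coe_natDegree_eq_order_map (P : PowerSeries O) 1
        (by rwa [map_one, ← Ideal.ne_top_iff_one]) (by simp))
      rw [ENat.toNat_natCast] at h3
      rw [← h3, ← Polynomial.degree_eq_natDegree hmonic.ne_zero]
      exact Polynomial.degree_modByMonic_lt g hmonic
    have h4 := (PowerSeries.IsWeierstrassDivisorAt.eq_zero_of_mul_eq
      (hd.isWeierstrassDivisorAt hI) hdeg h2).2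
    rw [h4, zero_add] at h1
    exact h1.symm
  -- Either P = 1, and then the constant term of g would be a unit, or g is a constant multiple of
  -- the distinguished polynomial P.
  rcases hirr.isUnit_or_isUnit (a := P.map (algebraMap O k)) (b := (g /ₘ P).map (algebraMap O k))
    (by rw [← Polynomial.map_mul, ← hdiv]) with hu | hu
  · exfalso
    have hP1 : P = 1 := by
      have h1 := (hmonic.map _).eq_one_of_isUnit hu
      exact Polynomial.map_injective _ hinj (by rw [h1, Polynomial.map_one])
    have h2 := hP.eq_mul
    rw [hP1, Polynomial.coe_one, one_mul] at h2
    have h3 := PowerSeries.isUnit_constantCoeff _ hP.isUnit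
    rw [← h2, ← PowerSeries.coeff_zero_eq_constantCoeff_apply, Polynomial.coeff_coe] at h3
    exact (IsLocalRing.mem_maximalIdeal _).1 h0 h3
  · have hq : (g /ₘ P) = C ((g /ₘ P).coeff 0) := by
      refine Polynomial.eq_C_of_natDegree_eq_zero ?_
      rw [← Polynomial.natDegree_map_eq_of_injective hinj]
      exact Polynomial.natDegree_eq_zero_of_isUnit hu
    have hgc : g = P * C ((g /ₘ P).coeff 0) := by rw [← hq]; exact hdiv
    intro i hi
    rw [hgc, Polynomial.coeff_mul_C]
    refine Ideal.mul_mem_right _ _ (hd.mem ?_)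
    refine hi.trans_le ?_
    rw [hgc]
    exact Polynomial.natDegree_mul_C_le _ _

end WeierstrassIrreducible

/-! ### Integrality of minimal polynomials and norms. -/

section MinpolyIntegral

open Polynomial

variable {O k : Type*} [CommRing O] [IsDomain O] [ValuationRing O]
  [IsAdicComplete (IsLocalRing.maximalIdeal O) O] [Field k] [Algebra O k] [IsFractionRing O k]

/-- Divide f by a coefficient of largest absolute value to get g over O with a coefficient equal to
1. If g(0) is not a unit, Weierstrass preparation shows that the dominant coefficient is the leading
one, so g = f. If g(0) is a unit, the dominant coefficient is f(0)/g(0), which lies in O. -/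
theorem mem_lifts_of_irreducible {f : k[X]} (hf : f.Monic) (hirr : Irreducible f) {c : O}
    (h0 : f.coeff 0 = algebraMap O k c) : f ∈ Polynomial.lifts (algebraMap O k) := by
  let v := ValuationRing.valuation O k
  have hv : ∀ x, v x ≤ 1 ↔ ∃ a, algebraMap O k a = x := ValuationRing.mem_integer_iff O k
  obtain ⟨i, hi, hmax⟩ := Finset.exists_max_image f.support (fun j => v (f.coeff j))
    (Polynomial.support_nonempty.2 hf.ne_zero)
  have hi0 : f.coeff i ≠ 0 := Polynomial.mem_support_iff.1 hi
  have hvi : v (f.coeff i) ≠ 0 := (v.ne_zero_iff).2 hi0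
  have hmax' : ∀ j, v (f.coeff j) ≤ v (f.coeff i) := fun j => by
    by_cases hj : f.coeff j = 0
    · rw [hj, map_zero]; exact zero_le
    · exact hmax j (Polynomial.mem_support_iff.2 hj)
  have hgl : C (f.coeff i)⁻¹ * f ∈ Polynomial.lifts (algebraMap O k) := by
    rw [Polynomial.lifts_iff_coeff_lifts]
    intro j
    rw [Polynomial.coeff_C_mul]
    refine (hv _).1 ?_
    rw [map_mul, map_inv₀]
    exact (mul_le_mul_right (hmax' j) _).trans (inv_mul_cancel₀ hvi).le
  obtain ⟨g, hg⟩ := hgl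
  have hg' : g.map (algebraMap O k) = C (f.coeff i)⁻¹ * f := hg
  have hgc : ∀ j, algebraMap O k (g.coeff j) = (f.coeff i)⁻¹ * f.coeff j := fun j => by
    rw [← Polynomial.coeff_map, hg', Polynomial.coeff_C_mul]
  have hinj := IsFractionRing.injective O k
  have hgi : g.coeff i = 1 := hinj (by rw [hgc, inv_mul_cancel₀ hi0, map_one])
  rw [Polynomial.lifts_iff_coeff_lifts]
  by_cases hm : g.coeff 0 ∈ IsLocalRing.maximalIdeal O
  · have hCunit : IsUnit (C (f.coeff i)⁻¹) := Polynomial.isUnit_C.2 (inv_ne_zero hi0).isUnit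
    have hirr' : Irreducible (g.map (algebraMap O k)) := by
      rw [hg']
      exact (irreducible_isUnit_mul hCunit).2 hirr
    have h1 := coeff_mem_maximalIdeal_of_irreducible hinj g hirr' hm ⟨i, hgi ▸ isUnit_one⟩
    have hdeg : g.natDegree = f.natDegree := by
      rw [← Polynomial.natDegree_map_eq_of_injective hinj, hg',
        Polynomial.natDegree_C_mul (inv_ne_zero hi0)]
    have hid : i = f.natDegree := by
      refine le_antisymm (Polynomial.le_natDegree_of_mem_supp i hi) ?_
      by_contra! hlt
      have h2 := h1 i (hdeg ▸ hlt)
      rw [hgi] at h2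
      exact (IsLocalRing.mem_maximalIdeal _).1 h2 isUnit_one
    have hlead : f.coeff i = 1 := by rw [hid]; exact hf
    intro j
    have h3 := hgc j
    rw [hlead, inv_one, one_mul] at h3
    exact ⟨_, h3⟩
  · have hu : IsUnit (g.coeff 0) := by
      by_contra h
      exact hm ((IsLocalRing.mem_maximalIdeal _).2 h)
    obtain ⟨u, hu⟩ := hu
    intro j
    refine ⟨g.coeff j * ↑u⁻¹ * c, ?_⟩
    have h1 := hgc 0
    rw [h0, ← hu] at h1
    have h2 : algebraMap O k ↑u⁻¹ * algebraMap O k ↑u = 1 := by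
      rw [← map_mul, Units.inv_mul, map_one]
    rw [map_mul, map_mul, hgc]
    have h3 : algebraMap O k c = f.coeff i * algebraMap O k ↑u := by
      rw [h1, mul_inv_cancel_left₀ hi0]
    rw [h3]
    calc _ = ((f.coeff i)⁻¹ * f.coeff i) * (algebraMap O k ↑u⁻¹ * algebraMap O k ↑u) *
          f.coeff j := by ring
      _ = _ := by rw [h2, inv_mul_cancel₀ hi0, one_mul, one_mul]

end MinpolyIntegral

section DetIntegral

/-- The norm is the product of the eigenvalues of left multiplication by x over an algebraic
closure, and each of them satisfies the integral equation of x. -/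
theorem isIntegral_norm_of_isIntegral {O k A : Type*} [CommRing O] [IsDomain O] [IsIntegrallyClosed O]
    [Field k] [Algebra O k] [IsFractionRing O k] [Ring A] [Algebra k A] [Algebra O A]
    [IsScalarTower O k A] [FiniteDimensional k A] {x : A} (hx : IsIntegral O x) :
    ∃ a : O, Algebra.norm k x = algebraMap O k a := by
  classical
  suffices h : IsIntegral O (Algebra.norm k x) by
    obtain ⟨a, ha⟩ := IsIntegrallyClosed.isIntegral_iff.1 h
    exact ⟨a, ha.symm⟩
  let L := AlgebraicClosure k
  let b := Module.finBasis k A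
  let M := Algebra.leftMulMatrix b x
  rw [← isIntegral_algebraMap_iff (algebraMap k L).injective, Algebra.norm_eq_matrix_det b]
  change IsIntegral O (algebraMap k L M.det)
  rw [RingHom.map_det, Matrix.det_eq_prod_roots_charpoly]
  refine IsIntegral.multiset_prod fun y hy => ⟨minpoly O x, minpoly.monic hx, ?_⟩
  set N := (algebraMap k L).mapMatrix M
  have hy' : (N.charpoly).IsRoot y := Polynomial.isRoot_of_mem_roots hy
  have h1 : Polynomial.aeval M (minpoly O x) = 0 := by
    have h2 : Polynomial.aeval ((Algebra.leftMulMatrix b).restrictScalars O x) (minpoly O x) = 0 := by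
      rw [Polynomial.aeval_algHom_apply, minpoly.aeval, map_zero]
    exact h2
  have h3 : Polynomial.aeval N (minpoly O x) = 0 := by
    have h4 : N = (Algebra.ofId k L).mapMatrix.restrictScalars O M := rfl
    rw [h4, Polynomial.aeval_algHom_apply, h1, map_zero]
  have h5 : Polynomial.aeval N ((minpoly O x).map (algebraMap O L)) = 0 := by
    rwa [Polynomial.aeval_map_algebraMap]
  have h6 : Module.End.HasEigenvalue (Matrix.toLin' N) y := by
    rw [Module.End.hasEigenvalue_iff_isRoot_charpoly, Matrix.charpoly_toLin']
    exact hy'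
  have h7 := Module.End.isRoot_of_hasEigenvalue h6
  have h8 : minpoly L (Matrix.toLin' N) ∣ (minpoly O x).map (algebraMap O L) := by
    refine minpoly.dvd _ _ ?_
    have h9 : Polynomial.aeval (Matrix.toLinAlgEquiv' N) ((minpoly O x).map (algebraMap O L)) = 0 := by
      rw [← AlgEquiv.coe_toAlgHom, Polynomial.aeval_algHom_apply, h5, map_zero]
    exact h9
  have h10 := h7.dvd h8
  rwa [Polynomial.IsRoot, Polynomial.eval_map] at h10

end DetIntegral

section MinpolyInv

open Polynomial

variable {k A : Type*} [Field k] [DivisionRing A] [Algebra k A]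

theorem aeval_inv_reflect_mul_pow {x : A} (hx : x ≠ 0) (N : ℕ) (p : k[X]) (hp : p.natDegree ≤ N) :
    aeval x⁻¹ (reflect N p) * x ^ N = aeval x p := by
  refine Polynomial.induction_with_natDegree_le
    (fun p => aeval x⁻¹ (reflect N p) * x ^ N = aeval x p) N (by simp) (fun n r _ hn => ?_)
    (fun f g hfg hg hf' hg' => ?_) p hp
  · rw [reflect_C_mul_X_pow, revAt_le hn, map_mul, map_mul, aeval_C, map_pow, map_pow, aeval_X,
      aeval_X, mul_assoc]
    congr 1
    · rw [aeval_C]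
    rw [inv_pow, inv_mul_eq_iff_eq_mul₀ (pow_ne_zero _ hx), ← pow_add, Nat.sub_add_cancel hn]
  · rw [reflect_add, map_add, map_add, add_mul, hf', hg']

theorem natDegree_minpoly_inv_le [FiniteDimensional k A] {x : A} (hx : x ≠ 0) :
    minpoly k x⁻¹ ∣ C ((minpoly k x).coeff 0)⁻¹ * reflect (minpoly k x).natDegree (minpoly k x) := by
  refine minpoly.dvd _ _ ?_
  have h := aeval_inv_reflect_mul_pow hx _ (minpoly k x) le_rfl
  rw [minpoly.aeval, mul_eq_zero, or_iff_left (pow_ne_zero _ hx)] at h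
  rw [map_mul, h, mul_zero]

/-- The minimal polynomial of x⁻¹ is the reversed minimal polynomial of x made monic: divisibility
holds one way, and exchanging x and x⁻¹ shows that the degrees agree. -/
theorem coeff_zero_minpoly_inv [FiniteDimensional k A] {x : A} (hx : x ≠ 0) :
    (minpoly k x⁻¹).coeff 0 = ((minpoly k x).coeff 0)⁻¹ := by
  have key : ∀ {y : A}, y ≠ 0 →
      (C ((minpoly k y).coeff 0)⁻¹ * reflect (minpoly k y).natDegree (minpoly k y)).Monic ∧
      (C ((minpoly k y).coeff 0)⁻¹ * reflect (minpoly k y).natDegree (minpoly k y)).natDegree =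
        (minpoly k y).natDegree := by
    intro y hy
    have h0 := minpoly.coeff_zero_ne_zero (Algebra.IsIntegral.isIntegral (R := k) y) hy
    set f := minpoly k y
    have hle : (C (f.coeff 0)⁻¹ * reflect f.natDegree f).natDegree ≤ f.natDegree :=
      (natDegree_C_mul_le _ _).trans ((natDegree_reflect_le).trans (max_self _).le)
    have hc : (C (f.coeff 0)⁻¹ * reflect f.natDegree f).coeff f.natDegree = 1 := by
      rw [coeff_C_mul, coeff_reflect, revAt_le le_rfl, Nat.sub_self, inv_mul_cancel₀ h0]
    exact ⟨monic_of_natDegree_le_of_coeff_eq_one _ hle hc,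
      natDegree_eq_of_le_of_coeff_ne_zero hle (hc ▸ one_ne_zero)⟩
  have hle : ∀ {y : A}, y ≠ 0 → (minpoly k y⁻¹).natDegree ≤ (minpoly k y).natDegree := fun {y} hy =>
    (natDegree_le_of_dvd (natDegree_minpoly_inv_le hy) (key hy).1.ne_zero).trans (key hy).2.le
  have hge := hle (inv_ne_zero hx)
  rw [inv_inv] at hge
  have h1 := eq_of_monic_of_dvd_of_natDegree_le
    (minpoly.monic (Algebra.IsIntegral.isIntegral (R := k) x⁻¹)) (key hx).1
    (natDegree_minpoly_inv_le hx) ((key hx).2.le.trans hge)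
  have hm := minpoly.monic (Algebra.IsIntegral.isIntegral (R := k) x)
  rw [← h1, coeff_C_mul, coeff_reflect, revAt_le (Nat.zero_le _), Nat.sub_zero, hm.coeff_natDegree,
    mul_one]

end MinpolyInv

/-! ### The valuation ring of a division algebra consists of its integral elements. -/

section Integers

open Polynomial

variable {O k : Type*} [CommRing O] [IsDomain O] [IsDiscreteValuationRing O]
  [IsAdicComplete (IsLocalRing.maximalIdeal O) O] [Field k] [Algebra O k] [IsFractionRing O k]
  {A : Type*} [DivisionRing A] [Algebra k A] [FiniteDimensional k A]

theorem exists_monic_map_eq_minpoly {x : A} {c : O}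
    (h : (minpoly k x).coeff 0 = algebraMap O k c) :
    ∃ p : O[X], p.Monic ∧ p.map (algebraMap O k) = minpoly k x ∧
      p.natDegree = (minpoly k x).natDegree ∧ p.coeff 0 = c := by
  have hx := Algebra.IsIntegral.isIntegral (R := k) x
  obtain ⟨p, hp, hd, hm⟩ := Polynomial.lifts_and_natDegree_eq_and_monic
    (mem_lifts_of_irreducible (minpoly.monic hx) (minpoly.irreducible hx) h) (minpoly.monic hx)
  refine ⟨p, hm, hp, hd, IsFractionRing.injective O k ?_⟩
  rw [← h, ← hp, coeff_map]

theorem isIntegral_of_coeff_zero_minpoly [Algebra O A] [IsScalarTower O k A] {x : A} {c : O}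
    (h : (minpoly k x).coeff 0 = algebraMap O k c) : IsIntegral O x := by
  obtain ⟨p, hm, hp, -⟩ := exists_monic_map_eq_minpoly h
  refine ⟨p, hm, ?_⟩
  rw [← aeval_def, ← aeval_map_algebraMap k, hp, minpoly.aeval]

theorem IsIntegral.aeval_of_isIntegral {R B : Type*} [CommRing R] [Ring B] [Algebra R B] {x : B}
    (hx : IsIntegral R x) (q : R[X]) : IsIntegral R (aeval x q) :=
  IsIntegral.of_mem_of_fg (Algebra.adjoin R {x}) hx.fg_adjoin_singleton _ (aeval_mem_adjoin_singleton R x)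

variable (O k A) in
theorem isValInteger_zero : IsValInteger O k (0 : A) :=
  ⟨0, by rw [Algebra.norm_zero, map_zero]⟩

variable (O k A) in
theorem isValInteger_one : IsValInteger O k (1 : A) := ⟨1, by rw [map_one, map_one]⟩

theorem IsValInteger.mul {x y : A} (hx : IsValInteger O k x) (hy : IsValInteger O k y) :
    IsValInteger O k (x * y) := by
  obtain ⟨a, ha⟩ := hx
  obtain ⟨b, hb⟩ := hy
  exact ⟨a * b, by rw [map_mul, map_mul, ha, hb]⟩

/-- All nonleading coefficients of the minimal polynomial are divisible by ϖ, so xⁿ = -ϖz with z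
integral. Taking norms, a power of N(x) lies in the maximal ideal. -/
theorem isValPositive_of_coeff_zero_minpoly {x : A} {c : O} (hc : c ∈ IsLocalRing.maximalIdeal O)
    (h : (minpoly k x).coeff 0 = algebraMap O k c) : IsValPositive O k x := by
  letI := Algebra.compHom A (algebraMap O k)
  haveI : IsScalarTower O k A := IsScalarTower.of_algebraMap_eq' rfl
  have hx := isIntegral_of_coeff_zero_minpoly (O := O) h
  obtain ⟨p, hm, hp, hd, h0⟩ := exists_monic_map_eq_minpoly h
  have hirr : Irreducible (p.map (algebraMap O k)) :=
    hp ▸ minpoly.irreducible (Algebra.IsIntegral.isIntegral (R := k) x)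
  have hcoef := coeff_mem_maximalIdeal_of_irreducible (IsFractionRing.injective O k) p hirr
    (h0 ▸ hc) ⟨p.natDegree, by rw [hm.coeff_natDegree]; exact isUnit_one⟩
  obtain ⟨ϖ, hϖ⟩ := IsDiscreteValuationRing.exists_irreducible O
  have hmem : ∀ i, ∃ b, i < p.natDegree → p.coeff i = ϖ * b := fun i => by
    by_cases hi : i < p.natDegree
    · have h1 := hcoef i hi
      rw [hϖ.maximalIdeal_eq, Ideal.mem_span_singleton'] at h1
      obtain ⟨b, hb⟩ := h1
      exact ⟨b, fun _ => by rw [← hb, mul_comm]⟩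
    · exact ⟨0, fun h => absurd h hi⟩
  choose b hb using hmem
  have hz := hx.aeval_of_isIntegral (∑ i ∈ Finset.range p.natDegree, C (b i) * X ^ i)
  set z := aeval x (∑ i ∈ Finset.range p.natDegree, C (b i) * X ^ i) with hzdef
  have hxn : x ^ p.natDegree + algebraMap k A (algebraMap O k ϖ) * z = 0 := by
    have h1 : aeval x p = 0 := by rw [← aeval_map_algebraMap k, hp, minpoly.aeval]
    rw [hm.as_sum] at h1
    rw [← h1, hzdef, map_add, map_pow, aeval_X, map_sum, map_sum, Finset.mul_sum]
    congr 1
    refine Finset.sum_congr rfl fun i hi => ?_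
    rw [hb i (Finset.mem_range.1 hi), map_mul, map_mul, aeval_C, aeval_C, map_mul, mul_assoc]
    rfl
  obtain ⟨a, ha⟩ := isIntegral_norm_of_isIntegral (k := k) hx
  obtain ⟨a', ha'⟩ := isIntegral_norm_of_isIntegral (k := k) hz.neg
  refine ⟨a, ?_, ha⟩
  have hn : 0 < Module.finrank k A := Module.finrank_pos
  have h2 : a ^ p.natDegree = ϖ ^ Module.finrank k A * a' := by
    apply IsFractionRing.injective O k
    rw [map_pow, ← ha, ← map_pow, eq_neg_of_add_eq_zero_left hxn, ← mul_neg, map_mul, ha',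
      Algebra.norm_algebraMap, map_mul, map_pow]
  have hϖm : ϖ ∈ IsLocalRing.maximalIdeal O := by
    rw [hϖ.maximalIdeal_eq]; exact Ideal.mem_span_singleton_self ϖ
  refine Ideal.IsPrime.mem_of_pow_mem inferInstance p.natDegree ?_
  rw [h2]
  exact Ideal.mul_mem_right _ _ (Ideal.pow_mem_of_mem _ hϖm _ hn)

theorem IsValPositive.isValInteger {x : A} (hx : IsValPositive O k x) : IsValInteger O k x := by
  obtain ⟨a, -, h⟩ := hx
  exact ⟨a, h⟩

theorem norm_ne_zero_of_ne_zero {x : A} (hx : x ≠ 0) : Algebra.norm k x ≠ 0 := fun h => by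
  have h1 : Algebra.norm k (x * x⁻¹) = 1 := by rw [mul_inv_cancel₀ hx, map_one]
  rw [map_mul, h, zero_mul] at h1
  exact zero_ne_one h1

theorem IsValPositive.not_isValInteger_inv {x : A} (hx0 : x ≠ 0) (hx : IsValPositive O k x) :
    ¬ IsValInteger O k x⁻¹ := fun h => by
  obtain ⟨a, ha, hxa⟩ := hx
  obtain ⟨b, hb⟩ := h
  have h1 : a * b = 1 := by
    apply IsFractionRing.injective O k
    rw [map_mul, ← hxa, ← hb, ← map_mul, mul_inv_cancel₀ hx0, map_one, map_one]
  have h2 : a * b ∈ IsLocalRing.maximalIdeal O := Ideal.mul_mem_right _ _ ha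
  rw [h1, IsLocalRing.mem_maximalIdeal] at h2
  exact h2 isUnit_one

/-- Each element of `k` lies in `O`, or its inverse lies in the maximal ideal. -/
theorem exists_algebraMap_eq_or (c : k) :
    (∃ a : O, c = algebraMap O k a) ∨ ∃ a ∈ IsLocalRing.maximalIdeal O, c⁻¹ = algebraMap O k a := by
  rcases ValuationRing.isInteger_or_isInteger O c with ⟨a, ha⟩ | ⟨a, ha⟩
  · exact Or.inl ⟨a, ha.symm⟩
  · by_cases hu : IsUnit a
    · obtain ⟨u, rfl⟩ := hu
      refine Or.inl ⟨↑u⁻¹, ?_⟩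
      rw [← inv_inv c, ← ha]
      refine inv_eq_of_mul_eq_one_left ?_
      rw [← map_mul, Units.inv_mul, map_one]
    · exact Or.inr ⟨a, (IsLocalRing.mem_maximalIdeal _).2 hu, ha.symm⟩

/-- If the constant coefficient of the minimal polynomial of x is not in O, that of x⁻¹ is in the
maximal ideal. Then N(x⁻¹) is in the maximal ideal, which excludes N(x) in O. -/
theorem isValInteger_iff_isIntegral [Algebra O A] [IsScalarTower O k A] {x : A} :
    IsValInteger O k x ↔ IsIntegral O x := by
  refine ⟨fun h => ?_, fun h => isIntegral_norm_of_isIntegral h⟩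
  by_cases hx : x = 0
  · rw [hx]; exact isIntegral_zero
  rcases exists_algebraMap_eq_or (O := O) ((minpoly k x).coeff 0) with ⟨a, ha⟩ | ⟨a, ha, hc⟩
  · exact isIntegral_of_coeff_zero_minpoly ha
  · rw [← coeff_zero_minpoly_inv hx] at hc
    exact absurd ((inv_inv x).symm ▸ h)
      ((isValPositive_of_coeff_zero_minpoly ha hc).not_isValInteger_inv (inv_ne_zero hx))

theorem IsValPositive.exists_coeff_zero_minpoly {x : A} (hx : IsValPositive O k x) :
    ∃ c ∈ IsLocalRing.maximalIdeal O, (minpoly k x).coeff 0 = algebraMap O k c := by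
  by_cases hx0 : x = 0
  · exact ⟨0, Ideal.zero_mem _, by rw [hx0, minpoly.zero, coeff_X_zero, map_zero]⟩
  rcases exists_algebraMap_eq_or (O := O) ((minpoly k x).coeff 0)⁻¹ with ⟨a, ha⟩ | ⟨a, ha, hc⟩
  · rw [← coeff_zero_minpoly_inv hx0] at ha
    letI := Algebra.compHom A (algebraMap O k)
    haveI : IsScalarTower O k A := IsScalarTower.of_algebraMap_eq' rfl
    exact absurd (isValInteger_iff_isIntegral.2 (isIntegral_of_coeff_zero_minpoly ha))
      (hx.not_isValInteger_inv hx0)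
  · exact ⟨a, ha, (inv_inv ((minpoly k x).coeff 0)) ▸ hc⟩

theorem isValInteger_or_inv (x : A) :
    IsValInteger O k x ∨ IsValPositive O k x⁻¹ := by
  by_cases hx : x = 0
  · exact Or.inl (hx ▸ isValInteger_zero O k A)
  have h1 : Algebra.norm k x⁻¹ = (Algebra.norm k x)⁻¹ :=
    eq_inv_of_mul_eq_one_left (by rw [← map_mul, inv_mul_cancel₀ hx, map_one])
  rcases exists_algebraMap_eq_or (O := O) (Algebra.norm k x) with ⟨a, ha⟩ | ⟨a, ha, hc⟩
  · exact Or.inl ⟨a, ha⟩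
  · exact Or.inr ⟨a, ha, h1.trans hc⟩

theorem IsValInteger.aeval {x : A} (hx : IsValInteger O k x) (q : O[X]) :
    IsValInteger O k (Polynomial.eval₂ ((algebraMap k A).comp (algebraMap O k)) x q) := by
  letI := Algebra.compHom A (algebraMap O k)
  haveI : IsScalarTower O k A := IsScalarTower.of_algebraMap_eq' rfl
  exact isValInteger_iff_isIntegral.2 ((isValInteger_iff_isIntegral.1 hx).aeval_of_isIntegral q)

theorem IsValInteger.one_add {x : A} (hx : IsValInteger O k x) : IsValInteger O k (1 + x) := by
  have h := hx.aeval (1 + X)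
  rwa [eval₂_add, eval₂_one, eval₂_X] at h

/-- Since x⁻¹y or its inverse is integral, writing x + y = x(1 + x⁻¹y) or y(1 + y⁻¹x) reduces the
claim to sums 1 + z, which live in the commutative ring O[z]. -/
theorem IsValInteger.add {x y : A} (hx : IsValInteger O k x) (hy : IsValInteger O k y) :
    IsValInteger O k (x + y) := by
  by_cases hx0 : x = 0
  · rwa [hx0, zero_add]
  by_cases hy0 : y = 0
  · rwa [hy0, add_zero]
  rcases isValInteger_or_inv (O := O) (k := k) (x⁻¹ * y) with h | h
  · have h1 := hx.mul h.one_add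
    rwa [mul_add, mul_one, mul_inv_cancel_left₀ hx0] at h1
  · have h1 := hy.mul h.isValInteger.one_add
    rwa [mul_inv_rev, inv_inv, mul_add, mul_one, mul_inv_cancel_left₀ hy0, add_comm] at h1

/-- Integrality is preserved and reflected by homomorphisms of division algebras. -/
theorem isValInteger_map_iff {B : Type*} [DivisionRing B] [Algebra k B] [FiniteDimensional k B]
    (f : B →ₐ[k] A) {x : B} : IsValInteger O k (f x) ↔ IsValInteger O k x := by
  letI := Algebra.compHom A (algebraMap O k)
  haveI : IsScalarTower O k A := IsScalarTower.of_algebraMap_eq' rfl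
  letI := Algebra.compHom B (algebraMap O k)
  haveI : IsScalarTower O k B := IsScalarTower.of_algebraMap_eq' rfl
  rw [isValInteger_iff_isIntegral, isValInteger_iff_isIntegral]
  exact isIntegral_algHom_iff (f.restrictScalars O) f.injective

end Integers

/-! ### The normalized valuation of the base field. -/

section FractionOrder

open IsDedekindDomain

variable (O : Type*) {k : Type*} [CommRing O] [IsDomain O] [IsDiscreteValuationRing O] [Field k]
  [Algebra O k] [IsFractionRing O k]

/-- The normalized valuation of a discretely valued field. -/
def fracOrd (c : k) : ℤ :=
  -WithZero.log ((IsDiscreteValuationRing.maximalIdeal O).valuation k c)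

theorem fracOrd_mul {c d : k} (hc : c ≠ 0) (hd : d ≠ 0) :
    fracOrd O (c * d) = fracOrd O c + fracOrd O d := by
  rw [fracOrd, map_mul, WithZero.log_mul ((Valuation.ne_zero_iff _).2 hc)
    ((Valuation.ne_zero_iff _).2 hd), neg_add, fracOrd, fracOrd]

theorem fracOrd_one : fracOrd O (1 : k) = 0 := by
  rw [fracOrd, map_one, WithZero.log_one, neg_zero]

theorem fracOrd_nonneg_iff {c : k} (hc : c ≠ 0) :
    0 ≤ fracOrd O c ↔ ∃ a : O, c = algebraMap O k a := by
  have h : 0 ≤ fracOrd O c ↔ (IsDiscreteValuationRing.maximalIdeal O).valuation k c ≤ 1 := by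
    rw [fracOrd, neg_nonneg, ← WithZero.log_one,
      WithZero.log_le_log ((Valuation.ne_zero_iff _).2 hc) one_ne_zero]
  rw [h]
  refine ⟨fun h => ?_, ?_⟩
  · obtain ⟨a, ha⟩ := IsDiscreteValuationRing.exists_lift_of_le_one h
    exact ⟨a, ha.symm⟩
  · rintro ⟨a, rfl⟩
    exact HeightOneSpectrum.valuation_le_one _ a

theorem fracOrd_pos_iff {c : k} (hc : c ≠ 0) :
    0 < fracOrd O c ↔ ∃ a ∈ IsLocalRing.maximalIdeal O, c = algebraMap O k a := by
  have h : 0 < fracOrd O c ↔ (IsDiscreteValuationRing.maximalIdeal O).valuation k c < 1 := by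
    rw [fracOrd, neg_pos, ← WithZero.log_one,
      WithZero.log_lt_log ((Valuation.ne_zero_iff _).2 hc) one_ne_zero]
  rw [h]
  refine ⟨fun h => ?_, ?_⟩
  · obtain ⟨a, rfl⟩ := IsDiscreteValuationRing.exists_lift_of_le_one h.le
    exact ⟨a, (HeightOneSpectrum.valuation_lt_one_iff_mem _ a).1 h, rfl⟩
  · rintro ⟨a, ha, rfl⟩
    exact (HeightOneSpectrum.valuation_lt_one_iff_mem _ a).2 ha

theorem exists_fracOrd_eq_one : ∃ c : k, c ≠ 0 ∧ fracOrd O c = 1 := by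
  obtain ⟨c, hc⟩ :=
    HeightOneSpectrum.valuation_exists_uniformizer k (IsDiscreteValuationRing.maximalIdeal O)
  refine ⟨c, (Valuation.ne_zero_iff ((IsDiscreteValuationRing.maximalIdeal O).valuation k)).1
    (hc ▸ WithZero.exp_ne_zero), ?_⟩
  rw [fracOrd, hc, WithZero.log_exp, neg_neg]

end FractionOrder

/-! ### The residue division ring and the normalized valuation of a division algebra. -/

section ResidueDivisionRing

variable {O k : Type*} [CommRing O] [IsDomain O] [IsDiscreteValuationRing O]
  [IsAdicComplete (IsLocalRing.maximalIdeal O) O] [Field k] [Algebra O k] [IsFractionRing O k]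
  {A : Type*} [DivisionRing A] [Algebra k A] [FiniteDimensional k A]

theorem IsValInteger.neg {x : A} (hx : IsValInteger O k x) : IsValInteger O k (-x) := by
  have h := hx.aeval (-Polynomial.X)
  rwa [Polynomial.eval₂_neg, Polynomial.eval₂_X] at h

theorem IsValPositive.mul_right {x y : A} (hx : IsValPositive O k x) (hy : IsValInteger O k y) :
    IsValPositive O k (x * y) := by
  obtain ⟨a, ha, hxa⟩ := hx
  obtain ⟨b, hb⟩ := hy
  exact ⟨a * b, Ideal.mul_mem_right _ _ ha, by rw [map_mul, map_mul, hxa, hb]⟩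

theorem IsValPositive.mul_left {x y : A} (hx : IsValPositive O k x) (hy : IsValInteger O k y) :
    IsValPositive O k (y * x) := by
  obtain ⟨a, ha, hxa⟩ := hx
  obtain ⟨b, hb⟩ := hy
  exact ⟨b * a, Ideal.mul_mem_left _ _ ha, by rw [map_mul, map_mul, hxa, hb]⟩

variable (O k A) in
theorem isValPositive_zero : IsValPositive O k (0 : A) :=
  ⟨0, Ideal.zero_mem _, by rw [Algebra.norm_zero, map_zero]⟩

theorem IsValPositive.add {x y : A} (hx : IsValPositive O k x) (hy : IsValPositive O k y) :
    IsValPositive O k (x + y) := by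
  by_cases hx0 : x = 0
  · rwa [hx0, zero_add]
  by_cases hy0 : y = 0
  · rwa [hy0, add_zero]
  rcases isValInteger_or_inv (O := O) (k := k) (x⁻¹ * y) with h | h
  · have h1 := hx.mul_right h.one_add
    rwa [mul_add, mul_one, mul_inv_cancel_left₀ hx0] at h1
  · have h1 := hy.mul_right h.isValInteger.one_add
    rwa [mul_inv_rev, inv_inv, mul_add, mul_one, mul_inv_cancel_left₀ hy0, add_comm] at h1

theorem IsValPositive.neg {x : A} (hx : IsValPositive O k x) : IsValPositive O k (-x) := by
  have h := hx.mul_right (isValInteger_one O k A).neg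
  rwa [mul_neg, mul_one] at h

theorem mem_valRing_iff {x : A} : x ∈ valRing O k A ↔ IsValInteger O k x := by
  refine ⟨fun h => ?_, fun h => Subring.subset_closure h⟩
  refine Subring.closure_induction (fun _ h => h) (isValInteger_zero O k A)
    (isValInteger_one O k A) (fun _ _ _ _ hx hy => hx.add hy) (fun _ _ hx => hx.neg)
    (fun _ _ _ _ hx hy => hx.mul hy) h

theorem mem_valIdeal_iff {x : valRing O k A} :
    x ∈ valIdeal O k A ↔ IsValPositive O k (x : A) := by
  refine ⟨fun h => ?_, fun h => TwoSidedIdeal.subset_span h⟩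
  refine (TwoSidedIdeal.mem_mk' {x : valRing O k A | IsValPositive O k (x : A)}
    (isValPositive_zero O k A) (fun hx hy => IsValPositive.add hx hy)
    (fun hx => IsValPositive.neg hx)
    (fun {x y} hy => IsValPositive.mul_left hy (mem_valRing_iff.1 x.2))
    (fun {x y} hx => IsValPositive.mul_right hx (mem_valRing_iff.1 y.2)) x).1
    (TwoSidedIdeal.mem_span_iff.1 h _ fun y hy => ?_)
  exact (TwoSidedIdeal.mem_mk' _ _ _ _ _ _ _).2 hy

theorem toResidueAlg_eq_zero_iff {x : valRing O k A} :
    toResidueAlg O k A x = 0 ↔ IsValPositive O k (x : A) := by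
  rw [← mem_valIdeal_iff, TwoSidedIdeal.mem_iff]
  exact RingCon.eq _

variable (O k A) in
theorem toResidueAlg_surjective : Function.Surjective (toResidueAlg O k A) :=
  RingCon.mk'_surjective _

instance : Nontrivial (ResidueAlg O k A) := by
  refine ⟨⟨toResidueAlg O k A 1, 0, fun h => ?_⟩⟩
  refine (toResidueAlg_eq_zero_iff.1 h).not_isValInteger_inv one_ne_zero ?_
  rw [inv_one]
  exact isValInteger_one O k A

theorem isUnit_or_eq_zero_residueAlg (b : ResidueAlg O k A) : IsUnit b ∨ b = 0 := by
  obtain ⟨⟨x, hx⟩, rfl⟩ := toResidueAlg_surjective O k A b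
  rcases isValInteger_or_inv (O := O) (k := k) x⁻¹ with h | h
  · by_cases hx0 : x = 0
    · right
      rw [toResidueAlg_eq_zero_iff]
      exact hx0 ▸ isValPositive_zero O k A
    · left
      have h1 : (⟨x, hx⟩ : valRing O k A) * ⟨x⁻¹, mem_valRing_iff.2 h⟩ = 1 :=
        Subtype.ext (mul_inv_cancel₀ hx0)
      have h2 : ⟨x⁻¹, mem_valRing_iff.2 h⟩ * (⟨x, hx⟩ : valRing O k A) = 1 :=
        Subtype.ext (inv_mul_cancel₀ hx0)
      exact ⟨⟨toResidueAlg O k A ⟨x, hx⟩, toResidueAlg O k A ⟨x⁻¹, mem_valRing_iff.2 h⟩,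
        by rw [← map_mul, h1, map_one], by rw [← map_mul, h2, map_one]⟩, rfl⟩
  · rw [inv_inv] at h
    exact Or.inr (toResidueAlg_eq_zero_iff.2 h)

/-- The residue algebra of a division algebra is a division algebra. -/
@[reducible]
def residueDivisionRing : DivisionRing (ResidueAlg O k A) :=
  DivisionRing.ofIsUnitOrEqZero isUnit_or_eq_zero_residueAlg

attribute [local instance] residueDivisionRing

variable (O k) in
/-- The reduction map, extended by zero to the whole algebra. -/
def residueMap (x : A) : ResidueAlg O k A := by
  classical exact if h : x ∈ valRing O k A then toResidueAlg O k A ⟨x, h⟩ else 0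

theorem residueMap_of_isValInteger {x : A} (h : IsValInteger O k x) :
    residueMap O k x = toResidueAlg O k A ⟨x, mem_valRing_iff.2 h⟩ :=
  dif_pos _

variable (O k) in
/-- The valuation of the norm. -/
def normOrd (x : A) : ℤ := fracOrd O (Algebra.norm k x)

theorem normOrd_mul {x y : A} (hx : x ≠ 0) (hy : y ≠ 0) :
    normOrd O k (x * y) = normOrd O k x + normOrd O k y := by
  rw [normOrd, map_mul, fracOrd_mul O (norm_ne_zero_of_ne_zero hx)
    (norm_ne_zero_of_ne_zero hy)]
  rfl

theorem isValInteger_iff_normOrd {x : A} : IsValInteger O k x ↔ x = 0 ∨ 0 ≤ normOrd O k x := by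
  by_cases hx : x = 0
  · exact ⟨fun _ => Or.inl hx, fun _ => hx ▸ isValInteger_zero O k A⟩
  · rw [or_iff_right hx, normOrd, fracOrd_nonneg_iff O (norm_ne_zero_of_ne_zero hx)]
    rfl

theorem isValPositive_iff_normOrd {x : A} : IsValPositive O k x ↔ x = 0 ∨ 0 < normOrd O k x := by
  by_cases hx : x = 0
  · exact ⟨fun _ => Or.inl hx, fun _ => hx ▸ isValPositive_zero O k A⟩
  · rw [or_iff_right hx, normOrd, fracOrd_pos_iff O (norm_ne_zero_of_ne_zero hx)]
    rfl

variable (O k A) in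
-- The valuations of norms form a subgroup of ℤ, nonzero because the base field already has elements
-- of positive valuation. Dividing by its positive generator normalizes the valuation.
theorem exists_normOrd_generator : ∃ g : ℤ, 0 < g ∧ (∃ p : A, p ≠ 0 ∧ normOrd O k p = g) ∧
    ∀ x : A, x ≠ 0 → ∃ m, normOrd O k x = m * g := by
  let H : AddSubgroup ℤ :=
    { carrier := {n | ∃ x : A, x ≠ 0 ∧ normOrd O k x = n}
      zero_mem' := ⟨1, one_ne_zero, by rw [normOrd, map_one, fracOrd_one]⟩
      add_mem' := by
        rintro _ _ ⟨x, hx, rfl⟩ ⟨y, hy, rfl⟩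
        exact ⟨x * y, mul_ne_zero hx hy, normOrd_mul hx hy⟩
      neg_mem' := by
        rintro _ ⟨x, hx, rfl⟩
        refine ⟨x⁻¹, inv_ne_zero hx, eq_neg_of_add_eq_zero_left ?_⟩
        rw [← normOrd_mul (inv_ne_zero hx) hx, inv_mul_cancel₀ hx, normOrd, map_one, fracOrd_one] }
  obtain ⟨a, ha⟩ := Int.subgroup_cyclic H
  have hmem : ∀ n, n ∈ H ↔ ∃ m, n = m * a := fun n => by
    rw [ha, AddSubgroup.mem_closure_singleton]
    exact ⟨fun ⟨m, hm⟩ => ⟨m, by rw [← hm, smul_eq_mul]⟩, fun ⟨m, hm⟩ => ⟨m, by rw [hm, smul_eq_mul]⟩⟩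
  have ha0 : a ≠ 0 := by
    rintro rfl
    obtain ⟨c, hc, hc1⟩ := exists_fracOrd_eq_one O (k := k)
    obtain ⟨c', hc', rfl⟩ := (fracOrd_pos_iff O hc).1 (hc1 ▸ one_pos)
    have h1 := isValPositive_iff_normOrd.1 (isValPositive_algebraMap (A := A) O k c' hc')
    have h0 : algebraMap k A (algebraMap O k c') ≠ 0 := (map_ne_zero _).2 hc
    obtain ⟨m, hm⟩ := (hmem _).1 ⟨_, h0, rfl⟩
    have h2 := h1.resolve_left h0
    omega
  have habs : ∀ n, n ∈ H ↔ ∃ m, n = m * |a| := fun n => by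
    rw [hmem]
    rcases abs_choice a with h | h <;> rw [h]
    exact ⟨fun ⟨m, hm⟩ => ⟨-m, by rw [hm]; ring⟩, fun ⟨m, hm⟩ => ⟨-m, by rw [hm]; ring⟩⟩
  exact ⟨|a|, abs_pos.2 ha0, (habs _).2 ⟨1, (one_mul _).symm⟩, fun x hx => (habs _).1 ⟨x, hx, rfl⟩⟩

variable (O k A) in
/-- The extension of the valuation of a complete discretely valued field to a finite-dimensional
division algebra, normalized to have value group `ℤ`. -/
def residueValuation : ResidueValuation A (ResidueAlg O k A) :=
  let g := (exists_normOrd_generator O k A).choose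
  have hg : 0 < g := (exists_normOrd_generator O k A).choose_spec.1
  have hg1 := (exists_normOrd_generator O k A).choose_spec.2.1
  have hg2 := (exists_normOrd_generator O k A).choose_spec.2.2
  have hord : ∀ x : A, x ≠ 0 → normOrd O k x = normOrd O k x / g * g := fun x hx => by
    obtain ⟨m, hm⟩ := hg2 x hx
    exact (Int.ediv_mul_cancel ⟨m, by rw [hm, mul_comm]⟩).symm
  have hint : ∀ x : A, (x = 0 ∨ 0 ≤ normOrd O k x / g) ↔ IsValInteger O k x := fun x => by
    rw [isValInteger_iff_normOrd, Int.ediv_nonneg_iff_of_pos hg]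
  have hpos : ∀ x : A, (x = 0 ∨ 1 ≤ normOrd O k x / g) ↔ IsValPositive O k x := fun x => by
    rw [isValPositive_iff_normOrd]
    by_cases hx : x = 0
    · simp [hx]
    · rw [or_iff_right hx, or_iff_right hx]
      have := hord x hx
      constructor
      · intro h
        rw [this]
        exact mul_pos (by omega) hg
      · intro h
        rw [this] at h
        have := pos_of_mul_pos_left h hg.le
        omega
  have hmul : ∀ x y : A, x ≠ 0 → y ≠ 0 →
      normOrd O k (x * y) / g = normOrd O k x / g + normOrd O k y / g := fun x y hx hy => by
    obtain ⟨m, hm⟩ := hg2 x hx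
    rw [normOrd_mul hx hy, Int.add_ediv_of_dvd_left ⟨m, by rw [hm, mul_comm]⟩]
  { ord := fun x => normOrd O k x / g
    ord_mul := hmul
    ord_add := fun x y hx hy hxy => by
      have key : ∀ x y : A, x ≠ 0 → y ≠ 0 → x + y ≠ 0 → normOrd O k x / g ≤ normOrd O k y / g →
          normOrd O k x / g ≤ normOrd O k (x + y) / g := by
        intro x y hx hy hxy hle
        have h1 : IsValInteger O k (x⁻¹ * y) := by
          rw [← hint]
          right
          have h2 := hmul x (x⁻¹ * y) hx (mul_ne_zero (inv_ne_zero hx) hy)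
          rw [mul_inv_cancel_left₀ hx] at h2
          omega
        have h3 : x + y = x * (1 + x⁻¹ * y) := by rw [mul_add, mul_one, mul_inv_cancel_left₀ hx]
        have h4 : 1 + x⁻¹ * y ≠ 0 := fun h => hxy (by rw [h3, h, mul_zero])
        have h5 := ((hint _).2 h1.one_add).resolve_left h4
        rw [h3, hmul _ _ hx h4]
        omega
      rcases le_total (normOrd O k x / g) (normOrd O k y / g) with h | h
      · rw [min_eq_left h]
        exact key x y hx hy hxy h
      · rw [min_eq_right h, add_comm]
        exact key y x hy hx (by rwa [add_comm]) h
    exists_ord_eq_one := by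
      obtain ⟨p, hp, h⟩ := hg1
      exact ⟨p, hp, by rw [h]; exact Int.ediv_self hg.ne'⟩
    res := residueMap O k
    res_one := by
      rw [residueMap_of_isValInteger (isValInteger_one O k A)]
      exact map_one _
    res_add := fun x y hx hy => by
      rw [hint] at hx hy
      rw [residueMap_of_isValInteger hx, residueMap_of_isValInteger hy,
        residueMap_of_isValInteger (hx.add hy), ← map_add]
      rfl
    res_mul := fun x y hx hy => by
      rw [hint] at hx hy
      rw [residueMap_of_isValInteger hx, residueMap_of_isValInteger hy,
        residueMap_of_isValInteger (hx.mul hy), ← map_mul]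
      rfl
    res_eq_zero_iff := fun x hx => by
      rw [hint] at hx
      rw [residueMap_of_isValInteger hx, toResidueAlg_eq_zero_iff, hpos]
    res_surj := fun b => by
      obtain ⟨⟨x, hx⟩, rfl⟩ := toResidueAlg_surjective O k A b
      have hx' := mem_valRing_iff.1 hx
      exact ⟨x, (hint x).2 hx', residueMap_of_isValInteger hx'⟩ }

theorem residueValuation_ge_zero_iff {x : A} :
    (residueValuation O k A).ge 0 x ↔ IsValInteger O k x := by
  rw [isValInteger_iff_normOrd]
  exact or_congr_right
    (Int.ediv_nonneg_iff_of_pos (exists_normOrd_generator O k A).choose_spec.1)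

theorem residueValuation_ge_one_iff {x : A} :
    (residueValuation O k A).ge 1 x ↔ IsValPositive O k x := by
  refine ⟨fun h => ?_, fun h => ?_⟩
  · by_cases hx : x = 0
    · exact hx ▸ isValPositive_zero O k A
    rcases isValInteger_or_inv (O := O) (k := k) x⁻¹ with h1 | h1
    · have h2 := (residueValuation_ge_zero_iff.2 h1).le (inv_ne_zero hx)
      have h3 := h.le hx
      rw [(residueValuation O k A).ord_inv hx] at h2
      omega
    · rwa [inv_inv] at h1
  · by_cases hx : x = 0
    · exact Or.inl hx
    have h1 : ¬ (residueValuation O k A).ge 0 x⁻¹ := fun h1 =>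
      h.not_isValInteger_inv hx (residueValuation_ge_zero_iff.1 h1)
    right
    by_contra! h2
    refine h1 (Or.inr ?_)
    rw [(residueValuation O k A).ord_inv hx]
    omega

theorem isValUnit_iff {x : A} :
    IsValUnit O k x ↔ x ≠ 0 ∧ (residueValuation O k A).ord x = 0 := by
  have h : IsValUnit O k x ↔ IsValInteger O k x ∧ ¬ IsValPositive O k x := by
    constructor
    · rintro ⟨a, ha, h⟩
      refine ⟨⟨a, h⟩, ?_⟩
      rintro ⟨b, hb, h'⟩
      rw [h] at h'
      rw [IsFractionRing.injective O k h'] at ha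
      exact (IsLocalRing.mem_maximalIdeal _).1 hb ha
    · rintro ⟨⟨a, h⟩, h'⟩
      refine ⟨a, ?_, h⟩
      by_contra ha
      exact h' ⟨a, (IsLocalRing.mem_maximalIdeal _).2 ha, h⟩
  rw [h, ← residueValuation_ge_zero_iff, ← residueValuation_ge_one_iff]
  constructor
  · rintro ⟨h0, h1⟩
    have hx : x ≠ 0 := fun hx => h1 (Or.inl hx)
    refine ⟨hx, le_antisymm ?_ (h0.le hx)⟩
    by_contra! h2
    exact h1 (Or.inr (by omega))
  · rintro ⟨hx, h0⟩
    exact ⟨Or.inr h0.ge, fun h1 => by have := h1.le hx; omega⟩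

end ResidueDivisionRing

attribute [local instance] residueDivisionRing

/-! ### Comparison of valuations along homomorphisms and involutions. -/

section Comparison

/-- An element of valuation 0 is integral together with its inverse, hence maps to valuation 0; so
the valuation of f(x) is a fixed multiple of that of x. Multiplicativity is required only at the
level of valuations, so that f may also reverse products. -/
theorem ResidueValuation.exists_ord_eq_mul {A A' B B' : Type*} [DivisionRing A] [DivisionRing A']
    [DivisionRing B] [DivisionRing B'] (W : ResidueValuation A A') (V : ResidueValuation B B')
    (f : B → A) (hmul : ∀ x y, x ≠ 0 → y ≠ 0 → W.ord (f (x * y)) = W.ord (f x) + W.ord (f y))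
    (hne : ∀ x, x ≠ 0 → f x ≠ 0) (hge : ∀ x, W.ge 0 (f x) ↔ V.ge 0 x) :
    ∃ e : ℤ, 0 < e ∧ ∀ x, x ≠ 0 → W.ord (f x) = e * V.ord x := by
  obtain ⟨p, hp, hp1⟩ := V.exists_ord_eq_one
  have h1 : W.ord (f 1) = 0 := by
    have h := hmul 1 1 one_ne_zero one_ne_zero
    rw [mul_one] at h
    omega
  have hinv : ∀ x, x ≠ 0 → W.ord (f x⁻¹) = -W.ord (f x) := fun x hx => by
    have h := hmul x x⁻¹ hx (inv_ne_zero hx)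
    rw [mul_inv_cancel₀ hx, h1] at h
    omega
  have hle : ∀ x, x ≠ 0 → 0 ≤ V.ord x → 0 ≤ W.ord (f x) := fun x hx h =>
    ((hge x).2 (Or.inr h)).le (hne x hx)
  have hzero : ∀ x, x ≠ 0 → V.ord x = 0 → W.ord (f x) = 0 := fun x hx h => by
    have h2 := hle x hx h.ge
    have h3 := hle x⁻¹ (inv_ne_zero hx) (by rw [V.ord_inv hx]; omega)
    rw [hinv x hx] at h3
    omega
  have hpow : ∀ n : ℤ, W.ord (f (p ^ n)) = W.ord (f p) * n := fun n => by
    induction n using Int.induction_on with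
    | zero => rw [zpow_zero, h1, mul_zero]
    | succ n ih => rw [zpow_add_one₀ hp, hmul _ _ (zpow_ne_zero _ hp) hp, ih]; ring
    | pred n ih =>
      rw [zpow_sub_one₀ hp, hmul _ _ (zpow_ne_zero _ hp) (inv_ne_zero hp), ih, hinv p hp]
      ring
  refine ⟨W.ord (f p), lt_of_le_of_ne (hle p hp (by omega)) fun h => ?_, fun x hx => ?_⟩
  · have h2 : W.ge 0 (f p⁻¹) := Or.inr (by rw [hinv p hp]; omega)
    have h3 := ((hge _).1 h2).le (inv_ne_zero hp)
    rw [V.ord_inv hp] at h3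
    omega
  · have h2 : x = x * p ^ (-V.ord x) * p ^ V.ord x := by
      rw [mul_assoc, ← zpow_add₀ hp, neg_add_cancel, zpow_zero, mul_one]
    have h3 : x * p ^ (-V.ord x) ≠ 0 := mul_ne_zero hx (zpow_ne_zero _ hp)
    rw [h2, hmul _ _ h3 (zpow_ne_zero _ hp), hpow, hzero _ h3, zero_add, ← h2]
    rw [V.ord_mul _ _ hx (zpow_ne_zero _ hp), V.ord_zpow hp, hp1]
    ring

variable {O k : Type*} [CommRing O] [IsDomain O] [IsDiscreteValuationRing O]
  [IsAdicComplete (IsLocalRing.maximalIdeal O) O] [Field k] [Algebra O k] [IsFractionRing O k]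
  {A : Type*} [DivisionRing A] [Algebra k A] [FiniteDimensional k A]

theorem unop_aeval {R B : Type*} [CommRing R] [Ring B] [Algebra R B] (σ : RingInvo B)
    (hσ : ∀ c, (σ (algebraMap R B c)).unop = algebraMap R B c) (x : B) (p : Polynomial R) :
    (σ (Polynomial.aeval x p)).unop = Polynomial.aeval (σ x).unop p := by
  induction p using Polynomial.induction_on' with
  | add p q hp hq => rw [map_add, RingInvo.unop_add, hp, hq, map_add]
  | monomial n a =>
    rw [Polynomial.aeval_monomial, Polynomial.aeval_monomial, RingInvo.unop_mul, hσ,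
      RingInvo.unop_pow, Algebra.commutes]

theorem isValInteger_unop_iff {σ : RingInvo A}
    (hσ : ∀ c, (σ (algebraMap k A c)).unop = algebraMap k A c) {x : A} :
    IsValInteger O k (σ x).unop ↔ IsValInteger O k x := by
  have key : ∀ {x : A}, IsValInteger O k x → IsValInteger O k (σ x).unop := by
    intro x hx
    let _ := Algebra.compHom A (algebraMap O k)
    have : IsScalarTower O k A := IsScalarTower.of_algebraMap_eq' rfl
    rw [isValInteger_iff_isIntegral] at hx ⊢
    obtain ⟨p, hp, h⟩ := hx
    refine ⟨p, hp, ?_⟩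
    rw [← Polynomial.aeval_def] at h ⊢
    have h1 := unop_aeval (R := O) σ (fun c => hσ _) x p
    rw [← h1, h, map_zero]
    rfl
  refine ⟨fun h => ?_, key⟩
  have h1 := key h
  rwa [σ.involution] at h1

theorem residueValuation_ord_unop {σ : RingInvo A}
    (hσ : ∀ c, (σ (algebraMap k A c)).unop = algebraMap k A c) (x : A) :
    (residueValuation O k A).ord (σ x).unop = (residueValuation O k A).ord x := by
  by_cases hx : x = 0
  · rw [hx, map_zero]
    rfl
  set W := residueValuation O k A
  obtain ⟨e, he, h⟩ := W.exists_ord_eq_mul W (fun x => (σ x).unop)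
    (fun x y hx hy => by
      rw [RingInvo.unop_mul, W.ord_mul _ _ (RingInvo.unop_ne_zero σ hy) (RingInvo.unop_ne_zero σ hx),
        add_comm])
    (fun x hx => RingInvo.unop_ne_zero σ hx)
    (fun x => by
      rw [residueValuation_ge_zero_iff, residueValuation_ge_zero_iff]
      exact isValInteger_unop_iff hσ)
  obtain ⟨p, hp, hp1⟩ := W.exists_ord_eq_one
  have h1 := h _ (RingInvo.unop_ne_zero σ hp)
  rw [h p hp, hp1] at h1
  have h2 : (σ (σ p).unop).unop = p := σ.involution p
  rw [h2, hp1] at h1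
  have he1 : e = 1 := by nlinarith
  rw [h x hx, he1, one_mul]

theorem exists_ord_map_eq_mul {B : Type*} [DivisionRing B] [Algebra k B] [FiniteDimensional k B]
    (f : B →ₐ[k] A) : ∃ e : ℤ, 0 < e ∧ ∀ x, x ≠ 0 →
      (residueValuation O k A).ord (f x) = e * (residueValuation O k B).ord x :=
  (residueValuation O k A).exists_ord_eq_mul (residueValuation O k B) f
    (fun x y hx hy => by
      rw [map_mul, (residueValuation O k A).ord_mul _ _ ((map_ne_zero f).2 hx)
        ((map_ne_zero f).2 hy)])
    (fun x hx => (map_ne_zero f).2 hx)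
    (fun x => by
      rw [residueValuation_ge_zero_iff, residueValuation_ge_zero_iff]
      exact isValInteger_map_iff f)

/-- The homomorphism of residue algebras induced by a homomorphism of division algebras. -/
theorem exists_residue_algHom {B : Type*} [DivisionRing B] [Algebra k B] [FiniteDimensional k B]
    (f : B →ₐ[k] A) : ∃ φ : ResidueAlg O k B →+* ResidueAlg O k A,
      ∀ x, (residueValuation O k B).ge 0 x →
        φ ((residueValuation O k B).res x) = (residueValuation O k A).res (f x) := by
  set V := residueValuation O k B
  set W := residueValuation O k A
  have hge : ∀ {x}, V.ge 0 x → W.ge 0 (f x) := fun {x} h => by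
    rw [residueValuation_ge_zero_iff] at h ⊢
    exact (isValInteger_map_iff f).2 h
  obtain ⟨e, he, hord⟩ := exists_ord_map_eq_mul (O := O) f
  choose g hg hg' using V.res_surj
  have key : ∀ x y, V.ge 0 x → V.ge 0 y → V.res x = V.res y → W.res (f x) = W.res (f y) := by
    intro x y hx hy h
    have h1 : V.ge 1 (x - y) := by
      rw [← sub_eq_zero, ← ResidueValuation.res_sub hx hy] at h
      exact (V.res_eq_zero_iff _ (hx.sub hy)).1 h
    rw [← sub_eq_zero, ← ResidueValuation.res_sub (hge hx) (hge hy), ← map_sub]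
    refine (W.res_eq_zero_iff _ (hge (hx.sub hy))).2 ?_
    by_cases h0 : x - y = 0
    · exact Or.inl ((map_eq_zero f).2 h0)
    · refine Or.inr ?_
      rw [hord _ h0]
      have := h1.le h0
      nlinarith
  refine ⟨⟨⟨⟨fun b => W.res (f (g b)), ?_⟩, ?_⟩, ?_, ?_⟩, ?_⟩
  · rw [key (g 1) 1 (hg 1) ResidueValuation.ge_one_right ((hg' 1).trans V.res_one.symm), map_one,
      W.res_one]
  · intro x y
    change W.res (f (g (x * y))) = W.res (f (g x)) * W.res (f (g y))
    rw [← W.res_mul _ _ (hge (hg x)) (hge (hg y)), ← map_mul]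
    refine key _ _ (hg _) (ResidueValuation.ge.mul_zero_zero (hg x) (hg y)) ?_
    rw [hg', V.res_mul _ _ (hg x) (hg y), hg', hg']
  · change W.res (f (g 0)) = 0
    rw [key (g 0) 0 (hg 0) (Or.inl rfl) ((hg' 0).trans V.res_zero.symm), map_zero, W.res_zero]
  · intro x y
    change W.res (f (g (x + y))) = W.res (f (g x)) + W.res (f (g y))
    rw [← W.res_add _ _ (hge (hg x)) (hge (hg y)), ← map_add]
    refine key _ _ (hg _) (ResidueValuation.ge.add (hg x) (hg y)) ?_
    rw [hg', V.res_add _ _ (hg x) (hg y), hg', hg']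
  · intro x hx
    exact key _ _ (hg _) hx (hg' _)

/-- The residue algebra structure in terms of the reduction map. -/
theorem algebraMap_residue (a : O) :
    algebraMap (IsLocalRing.ResidueField O) (ResidueAlg O k A) (IsLocalRing.residue O a) =
      (residueValuation O k A).res (algebraMap k A (algebraMap O k a)) := by
  refine Eq.trans ?_ (residueMap_of_isValInteger (isValInteger_algebraMap O k a)).symm
  rfl

end Comparison

/-! ### Square roots of elements close to 1. -/

section SquareRoots

open Polynomial

/-- The Catalan series satisfies C = 1 + XC². With a = -1/4 and T = C(aX), the square of 1 - 2aXT is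
1 - 4aX(T - aXT²) = 1 - 4aX = 1 + X. -/
theorem PowerSeries.exists_mul_self_eq_one_add_X {R : Type*} [CommRing R] (h2 : IsUnit (2 : R)) :
    ∃ s : PowerSeries R, s * s = 1 + PowerSeries.X := by
  obtain ⟨u, hu⟩ := h2
  have h4 : (4 : R) * (↑u⁻¹ * ↑u⁻¹) = 1 := by
    calc (4 : R) * (↑u⁻¹ * ↑u⁻¹) = (2 * ↑u⁻¹) * (2 * ↑u⁻¹) := by ring
      _ = 1 := by rw [← hu, Units.mul_inv, one_mul]
  set a : R := -(↑u⁻¹ * ↑u⁻¹) with ha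
  set T : PowerSeries R := PowerSeries.rescale a
    (PowerSeries.map (Nat.castRingHom R) PowerSeries.catalanSeries)
  have hT : T ^ 2 * (PowerSeries.C a * PowerSeries.X) + 1 = T := by
    have h := congrArg (fun f => PowerSeries.rescale a (PowerSeries.map (Nat.castRingHom R) f))
      PowerSeries.catalanSeries_sq_mul_X_add_one
    simpa only [map_add, map_mul, map_pow, map_one, PowerSeries.map_X, PowerSeries.rescale_X] using h
  have ha4 : (PowerSeries.C a : PowerSeries R) * 4 = -1 := by
    have h : a * 4 = -1 := by rw [ha, neg_mul, mul_comm, h4]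
    have h' := congrArg (PowerSeries.C (R := R)) h
    rwa [map_mul, map_neg (PowerSeries.C (R := R)) 1, map_one, map_ofNat] at h'
  refine ⟨1 - 2 * (PowerSeries.C a * PowerSeries.X) * T, ?_⟩
  linear_combination (PowerSeries.C a * PowerSeries.X) * 4 * hT - PowerSeries.X * ha4

variable {O k : Type*} [CommRing O] [IsDomain O] [IsDiscreteValuationRing O]
  [IsAdicComplete (IsLocalRing.maximalIdeal O) O] [Field k] [Algebra O k] [IsFractionRing O k]
  {A : Type*} [DivisionRing A] [Algebra k A] [FiniteDimensional k A]

/-- The minimal polynomial p of t is distinguished, so O[X]/p = O[[X]]/p. The power series square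
root of 1 + X is therefore represented by a polynomial q, and y = q(t); no convergence in A is
needed. -/
theorem exists_mul_self_eq_one_add (h2 : IsUnit (2 : O)) {t : A}
    (ht : IsValPositive O k t) : ∃ y ∈ Algebra.adjoin k {t}, y * y = 1 + t := by
  obtain ⟨c, hc, h0⟩ := ht.exists_coeff_zero_minpoly
  obtain ⟨p, hm, hp, hd, hp0⟩ := exists_monic_map_eq_minpoly h0
  have hirr : Irreducible (p.map (algebraMap O k)) :=
    hp ▸ minpoly.irreducible (Algebra.IsIntegral.isIntegral (R := k) t)
  have hcoef := coeff_mem_maximalIdeal_of_irreducible (IsFractionRing.injective O k) p hirr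
    (hp0 ▸ hc) ⟨p.natDegree, by rw [hm.coeff_natDegree]; exact isUnit_one⟩
  have hdist : p.IsDistinguishedAt (IsLocalRing.maximalIdeal O) := ⟨⟨hcoef _⟩, hm⟩
  obtain ⟨s, hs⟩ := PowerSeries.exists_mul_self_eq_one_add_X h2
  let e := hdist.algEquivQuotient
  obtain ⟨q, hq⟩ := Ideal.Quotient.mk_surjective (e.symm (Ideal.Quotient.mk _ s))
  have h1 : e (Ideal.Quotient.mk _ (q * q)) = e (Ideal.Quotient.mk _ (1 + X)) := by
    have h5 : e (Ideal.Quotient.mk _ (1 + X)) = Ideal.Quotient.mk _ (1 + PowerSeries.X) := by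
      have h6 : e (Ideal.Quotient.mk _ (1 + X)) =
        Ideal.Quotient.mk _ ((1 + X : O[X]) : PowerSeries O) := rfl
      rw [h6, Polynomial.coe_add, Polynomial.coe_one, Polynomial.coe_X]
    rw [map_mul, hq, map_mul, e.apply_symm_apply, ← map_mul, hs, h5]
  have h3 := Ideal.Quotient.eq.1 (e.injective h1)
  obtain ⟨r, hr⟩ := Ideal.mem_span_singleton'.1 h3
  letI := Algebra.compHom A (algebraMap O k)
  haveI : IsScalarTower O k A := IsScalarTower.of_algebraMap_eq' rfl
  have hpt : aeval t p = 0 := by rw [← aeval_map_algebraMap k, hp, minpoly.aeval]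
  have h4 := congrArg (aeval t) hr
  rw [map_mul, hpt, mul_zero, map_sub, map_mul, map_add, map_one, aeval_X] at h4
  refine ⟨aeval t q, ?_, sub_eq_zero.1 h4.symm⟩
  rw [← aeval_map_algebraMap k]
  exact aeval_mem_adjoin_singleton k t

end SquareRoots

/-! ### Graded pieces of subspaces and the fundamental equality. -/

section FundamentalEquality

variable {O k : Type*} [CommRing O] [IsDomain O] [IsDiscreteValuationRing O]
  [IsAdicComplete (IsLocalRing.maximalIdeal O) O] [Field k] [Algebra O k] [IsFractionRing O k]
  {A : Type*} [DivisionRing A] [Algebra k A] [FiniteDimensional k A]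

variable (O k A) in
/-- The ramification index of a division algebra over the base field. -/
def ramIndex : ℕ := (exists_ord_map_eq_mul (O := O) (Algebra.ofId k A)).choose.toNat


theorem ord_algebraMap {c : k} (hc : c ≠ 0) :
    (residueValuation O k A).ord (algebraMap k A c) = ramIndex O k A * (residueValuation O k k).ord c := by
  have h := (exists_ord_map_eq_mul (O := O) (Algebra.ofId k A)).choose_spec
  rw [ramIndex, Int.toNat_of_nonneg h.1.le]
  exact h.2 c hc

variable (O k A) in
theorem ramIndex_pos : 0 < ramIndex O k A := by
  have h := (exists_ord_map_eq_mul (O := O) (Algebra.ofId k A)).choose_spec.1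
  rw [ramIndex]
  omega

theorem ge_zero_base_iff {c : k} : (residueValuation O k k).ge 0 c ↔ ∃ a : O, c = algebraMap O k a := by
  rw [residueValuation_ge_zero_iff, IsValInteger, Algebra.norm_self, MonoidHom.id_apply]

theorem ge_algebraMap_integer (a : O) : (residueValuation O k A).ge 0 (algebraMap k A (algebraMap O k a)) :=
  residueValuation_ge_zero_iff.2 (isValInteger_algebraMap O k a)

theorem residue_smul_res (a : O) {x : A} (hx : (residueValuation O k A).ge 0 x) :
    IsLocalRing.residue O a • (residueValuation O k A).res x =
      (residueValuation O k A).res (algebraMap k A (algebraMap O k a) * x) := by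
  rw [Algebra.smul_def, algebraMap_residue, (residueValuation O k A).res_mul _ _ (ge_algebraMap_integer a) hx]

variable (O) in
/-- The graded piece of a subspace, normalized by an element `Q`. -/
def gradedPiece (Q : A) (S : Submodule k A) : Submodule (IsLocalRing.ResidueField O) (ResidueAlg O k A) where
  carrier := {b | ∃ x ∈ S, (residueValuation O k A).ge 0 (Q⁻¹ * x) ∧ (residueValuation O k A).res (Q⁻¹ * x) = b}
  add_mem' := by
    rintro _ _ ⟨x, hx, hx0, rfl⟩ ⟨y, hy, hy0, rfl⟩
    exact ⟨x + y, S.add_mem hx hy, mul_add Q⁻¹ x y ▸ hx0.add hy0,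
      by rw [mul_add, (residueValuation O k A).res_add _ _ hx0 hy0]⟩
  zero_mem' := ⟨0, S.zero_mem, Or.inl (mul_zero _), by rw [mul_zero, (residueValuation O k A).res_zero]⟩
  smul_mem' := by
    rintro r _ ⟨x, hx, hx0, rfl⟩
    obtain ⟨a, rfl⟩ := IsLocalRing.residue_surjective r
    refine ⟨algebraMap O k a • x, S.smul_mem _ hx, ?_, ?_⟩
    · rw [Algebra.smul_def, ← mul_assoc, ← Algebra.commutes, mul_assoc]
      exact (ge_algebraMap_integer a).mul_zero_zero hx0
    · rw [residue_smul_res a hx0, Algebra.smul_def, ← mul_assoc, ← Algebra.commutes, mul_assoc]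

theorem mem_gradedPiece {Q : A} {S : Submodule k A} {b : ResidueAlg O k A} :
    b ∈ gradedPiece O Q S ↔ ∃ x ∈ S, (residueValuation O k A).ge 0 (Q⁻¹ * x) ∧ (residueValuation O k A).res (Q⁻¹ * x) = b := Iff.rfl

/-- The reduction map is additive over finite sums with integral coefficients. -/
theorem res_sum_smul {ι : Type*} (s : Finset ι) (a : ι → O) {x : ι → A} (hx : ∀ i ∈ s, (residueValuation O k A).ge 0 (x i)) :
    (residueValuation O k A).res (∑ i ∈ s, algebraMap k A (algebraMap O k (a i)) * x i) =
      ∑ i ∈ s, IsLocalRing.residue O (a i) • (residueValuation O k A).res (x i) := by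
  rw [ResidueValuation.res_sum _ fun i hi => (ge_algebraMap_integer (a i)).mul_zero_zero (hx i hi)]
  exact Finset.sum_congr rfl fun i hi => (residue_smul_res _ (hx i hi)).symm

/-- In a nontrivial relation choose a term minimizing e·ord(cⱼ) + dⱼ, and let i be its degree. After
division by its coefficient and by Q i, the terms of other degrees have positive valuation, because
degrees below e are distinct modulo e. What remains reduces to a nontrivial relation in degree i. -/
theorem linearIndependent_of_res {Q : ℕ → A} (hQ0 : ∀ i, Q i ≠ 0) (hQ : ∀ i, (residueValuation O k A).ord (Q i) = i)
    {ι : Type*} {d : ι → ℕ} (hd : ∀ j, d j < ramIndex O k A) {s : ι → A}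
    (hs : ∀ j, (residueValuation O k A).ge (d j) (s j))
    (hli : ∀ i, LinearIndependent (IsLocalRing.ResidueField O) fun j : {j // d j = i} => (residueValuation O k A).res ((Q i)⁻¹ * s j)) :
    LinearIndependent k s := by
  classical
  set e := ramIndex O k A
  rw [linearIndependent_iff']
  intro t c hsum
  by_contra! hne
  obtain ⟨j₀, hj₀, hc₀⟩ := Finset.exists_min_image (t.filter fun j => c j ≠ 0)
    (fun j => (e : ℤ) * (residueValuation O k k).ord (c j) + d j)
    (hne.imp fun j hj => Finset.mem_filter.2 hj)
  rw [Finset.mem_filter] at hj₀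
  set m := (residueValuation O k k).ord (c j₀)
  set i := d j₀
  have hcge : ∀ j ∈ t, c j ≠ 0 → (e : ℤ) * m + i ≤ e * (residueValuation O k k).ord (c j) + d j := fun j hj hj0 =>
    hc₀ j (Finset.mem_filter.2 ⟨hj, hj0⟩)
  have hQge : ∀ j, (residueValuation O k A).ge (d j - i) ((Q i)⁻¹ * s j) := fun j => by
    have h : (residueValuation O k A).ge (-i) (Q i)⁻¹ := Or.inr (by rw [(residueValuation O k A).ord_inv (hQ0 i), hQ])
    exact (h.mul (hs j)).mono (by omega)
  have h1 : (residueValuation O k A).res (∑ j ∈ t, algebraMap k A (c j / c j₀) * ((Q i)⁻¹ * s j)) = 0 := by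
    have h2 : ∑ j ∈ t, algebraMap k A (c j / c j₀) * ((Q i)⁻¹ * s j) =
        algebraMap k A (c j₀)⁻¹ * ((Q i)⁻¹ * ∑ j ∈ t, c j • s j) := by
      rw [Finset.mul_sum, Finset.mul_sum]
      refine Finset.sum_congr rfl fun j _ => ?_
      rw [Algebra.smul_def, ← mul_assoc (Q i)⁻¹, ← Algebra.commutes, div_eq_inv_mul,
        map_mul]
      simp only [mul_assoc]
    rw [h2, hsum, mul_zero, mul_zero, (residueValuation O k A).res_zero]
  have hterm : ∀ j ∈ t, d j ≠ i →
      (residueValuation O k A).ge 1 (algebraMap k A (c j / c j₀) * ((Q i)⁻¹ * s j)) := fun j hj hji => by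
    by_cases hj0 : c j = 0
    · rw [hj0, zero_div, map_zero, zero_mul]
      exact Or.inl rfl
    have h3 : (residueValuation O k A).ge ((e : ℤ) * ((residueValuation O k k).ord (c j) - m)) (algebraMap k A (c j / c j₀)) := by
      right
      rw [ord_algebraMap (div_ne_zero hj0 hj₀.2), div_eq_mul_inv,
        (residueValuation O k k).ord_mul _ _ hj0 (inv_ne_zero hj₀.2), (residueValuation O k k).ord_inv hj₀.2]
      rfl
    refine (h3.mul (hQge j)).mono ?_
    have h4 := hcge j hj hj0
    have h5 : (e : ℤ) * ((residueValuation O k k).ord (c j) - m) + (d j - i) ≠ 0 := by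
      intro h6
      have h7 : ((d j : ℤ) - i) % e = 0 :=
        Int.emod_eq_zero_of_dvd ⟨-((residueValuation O k k).ord (c j) - m), by linear_combination h6⟩
      have h8 := hd j
      have h9 := hd j₀
      have h10 := Int.emod_emod_of_dvd
      have : (d j : ℤ) = i := by
        have h11 : (e : ℤ) ∣ (d j : ℤ) - i := Int.dvd_of_emod_eq_zero h7
        have h12 := Int.eq_zero_of_abs_lt_dvd h11 (by rw [abs_lt]; constructor <;> omega)
        omega
      exact hji (by exact_mod_cast this)
    have h13 : (e : ℤ) * ((residueValuation O k k).ord (c j) - m) = e * (residueValuation O k k).ord (c j) - e * m := by ring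
    omega
  have hint : ∀ j, ∃ a : O, j ∈ t → d j = i → c j / c j₀ = algebraMap O k a := fun j => by
    by_cases hj : j ∈ t ∧ d j = i
    · suffices h : (residueValuation O k k).ge 0 (c j / c j₀) by
        obtain ⟨a, ha⟩ := ge_zero_base_iff.1 h
        exact ⟨a, fun _ _ => ha⟩
      by_cases hj0 : c j = 0
      · exact Or.inl (by rw [hj0, zero_div])
      right
      rw [div_eq_mul_inv, (residueValuation O k k).ord_mul _ _ hj0 (inv_ne_zero hj₀.2), (residueValuation O k k).ord_inv hj₀.2]
      have h4 := hcge j hj.1 hj0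
      have h14 : (0 : ℤ) < e := by exact_mod_cast ramIndex_pos O k A
      have h15 : (e : ℤ) * m ≤ e * (residueValuation O k k).ord (c j) := by
        have := hj.2
        omega
      have h16 := le_of_mul_le_mul_left h15 h14
      change 0 ≤ (residueValuation O k k).ord (c j) + -m
      omega
    · exact ⟨0, fun h h' => absurd ⟨h, h'⟩ hj⟩
  choose a ha using hint
  rw [← Finset.sum_filter_add_sum_filter_not t (fun j => d j = i)] at h1
  have hge0 : ∀ j ∈ t.filter (fun j => d j = i), (residueValuation O k A).ge 0 ((Q i)⁻¹ * s j) := fun j hj => by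
    have h := hQge j
    rwa [(Finset.mem_filter.1 hj).2, sub_self] at h
  have h17 : ∑ j ∈ t.filter (fun j => d j = i), algebraMap k A (c j / c j₀) * ((Q i)⁻¹ * s j) =
      ∑ j ∈ t.filter (fun j => d j = i),
        algebraMap k A (algebraMap O k (a j)) * ((Q i)⁻¹ * s j) :=
    Finset.sum_congr rfl fun j hj => by
      rw [ha j (Finset.mem_filter.1 hj).1 (Finset.mem_filter.1 hj).2]
  have h18 : (residueValuation O k A).ge 1 (∑ j ∈ t.filter (fun j => ¬ d j = i),
      algebraMap k A (c j / c j₀) * ((Q i)⁻¹ * s j)) :=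
    ResidueValuation.ge.sum _ fun j hj =>
      hterm j (Finset.mem_filter.1 hj).1 (Finset.mem_filter.1 hj).2
  rw [(residueValuation O k A).res_add _ _ (h17 ▸ ResidueValuation.ge.sum _ fun j hj =>
    (ge_algebraMap_integer (a j)).mul_zero_zero (hge0 j hj)) (h18.mono zero_le_one),
    ((residueValuation O k A).res_eq_zero_iff _ (h18.mono zero_le_one)).2 h18, add_zero, h17,
    res_sum_smul _ _ hge0] at h1
  have h19 := linearIndependent_iff'.1 (hli i) (t.subtype (fun j => d j = i))
    (fun j => IsLocalRing.residue O (a j)) (by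
      rw [← h1]
      rw [← Finset.sum_subtype_eq_sum_filter]) ⟨j₀, rfl⟩ (Finset.mem_subtype.2 hj₀.1)
  have h20 := ha j₀ hj₀.1 rfl
  rw [div_self hj₀.2, ← map_one (algebraMap O k)] at h20
  rw [← IsFractionRing.injective O k h20, map_one] at h19
  exact one_ne_zero h19

variable (O k A) in
theorem exists_elements_of_ord : ∃ Q : ℕ → A, (∀ i, Q i ≠ 0) ∧ ∀ i : ℕ, (residueValuation O k A).ord (Q i) = i := by
  obtain ⟨p, hp, hp1⟩ := (residueValuation O k A).exists_ord_eq_one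
  exact ⟨fun i => p ^ i, fun i => pow_ne_zero _ hp, fun i => by rw [(residueValuation O k A).ord_pow hp, hp1, mul_one]⟩

/-- Lifts of residually independent elements are independent over k. -/
instance : Module.Finite (IsLocalRing.ResidueField O) (ResidueAlg O k A) := by
  let b := Module.Basis.ofVectorSpace (IsLocalRing.ResidueField O) (ResidueAlg O k A)
  choose l hl hl' using fun j => (residueValuation O k A).res_surj (b j)
  obtain ⟨Q, hQ0, hQ⟩ := exists_elements_of_ord O k A
  -- Everything is in degree 0, and taking 1 there makes the normalized residue the residue itself.
  have h := linearIndependent_of_res (O := O) (Q := fun i => if i = 0 then 1 else Q i)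
    (fun i => by split_ifs; exacts [one_ne_zero, hQ0 i])
    (fun i => by
      split_ifs with h
      · rw [(residueValuation O k A).ord_one, h]; rfl
      · exact hQ i) (d := fun _ => 0) (fun _ => ramIndex_pos O k A) (s := l)
    (fun j => by simpa [ResidueValuation.ge] using hl j) (fun i => by
      by_cases hi : i = 0
      · subst hi
        simp only [if_true, inv_one, one_mul, hl']
        exact b.linearIndependent.comp _ Subtype.val_injective
      · have : IsEmpty {j // (fun _ : Module.Basis.ofVectorSpaceIndex (IsLocalRing.ResidueField O) (ResidueAlg O k A) => 0) j = i} :=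
          ⟨fun j => hi j.2.symm⟩
        exact linearIndependent_empty_type)
  have := h.finite
  exact Module.Finite.of_basis b

end FundamentalEquality

section FundamentalEquality

variable {O k : Type*} [CommRing O] [IsDomain O] [IsDiscreteValuationRing O]
  [IsAdicComplete (IsLocalRing.maximalIdeal O) O] [Field k] [Algebra O k] [IsFractionRing O k]
  {A : Type*} [DivisionRing A] [Algebra k A] [FiniteDimensional k A]

/-- One step of successive approximation: the leading part of x in degree i is a residual
combination of the sⱼ of that degree, and lifting its coefficients cancels it. -/
theorem exists_ge_succ_sub_sum {Q : ℕ → A} (hQ0 : ∀ i, Q i ≠ 0)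
    (hQ : ∀ i, (residueValuation O k A).ord (Q i) = i) {S : Submodule k A}
    {ι : Type*} [Fintype ι] {d : ι → ℕ} {s : ι → A}
    (hs : ∀ j, (residueValuation O k A).ge (d j) (s j)) {i : ℕ}
    (hspan : gradedPiece O (Q i) S ≤ Submodule.span (IsLocalRing.ResidueField O)
      (Set.range fun j : {j // d j = i} => (residueValuation O k A).res ((Q i)⁻¹ * s j)))
    {x : A} (hx : x ∈ S) (hxi : (residueValuation O k A).ge i x) :
    ∃ c : ι → O, (residueValuation O k A).ge (i + 1)
      (x - ∑ j, algebraMap k A (algebraMap O k (c j)) * s j) := by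
  classical
  set W := residueValuation O k A
  have hQi : W.ge (-i) (Q i)⁻¹ := Or.inr (by rw [W.ord_inv (hQ0 i), hQ])
  have h0 : W.ge 0 ((Q i)⁻¹ * x) := (hQi.mul hxi).mono (by omega)
  have h1 := hspan (mem_gradedPiece.2 ⟨x, hx, h0, rfl⟩)
  obtain ⟨r, hr⟩ := (Submodule.mem_span_range_iff_exists_fun _).1 h1
  choose a ha using fun j => IsLocalRing.residue_surjective (r j)
  have hsj : ∀ j : {j // d j = i}, W.ge 0 ((Q i)⁻¹ * s j) := fun j =>
    (hQi.mul (hs j)).mono (by have := j.2; omega)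
  refine ⟨fun j => if h : d j = i then a ⟨j, h⟩ else 0, ?_⟩
  have h2 : ∑ j, algebraMap k A (algebraMap O k (if h : d j = i then a ⟨j, h⟩ else 0)) * s j =
      ∑ j : {j // d j = i}, algebraMap k A (algebraMap O k (a j)) * s j := by
    rw [← Finset.sum_filter_of_ne (p := fun j => d j = i), Finset.sum_subtype (p := fun j => d j = i)]
    · exact Finset.sum_congr rfl fun j _ => by rw [dif_pos j.2]
    · simp
    · intro j _ h
      by_contra hj
      rw [dif_neg hj, map_zero, map_zero, zero_mul] at h
      exact h rfl
  rw [h2]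
  have h3 : (Q i)⁻¹ * ∑ j : {j // d j = i}, algebraMap k A (algebraMap O k (a j)) * s j =
      ∑ j : {j // d j = i}, algebraMap k A (algebraMap O k (a j)) * ((Q i)⁻¹ * s j) := by
    rw [Finset.mul_sum]
    refine Finset.sum_congr rfl fun j _ => ?_
    rw [← mul_assoc, ← Algebra.commutes, mul_assoc]
  have h4 : W.ge 0 ((Q i)⁻¹ * ∑ j : {j // d j = i}, algebraMap k A (algebraMap O k (a j)) * s j) :=
    h3 ▸ ResidueValuation.ge.sum _ fun j _ => (ge_algebraMap_integer (a j)).mul_zero_zero (hsj j)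
  have h5 : W.ge 1 ((Q i)⁻¹ * x -
      (Q i)⁻¹ * ∑ j : {j // d j = i}, algebraMap k A (algebraMap O k (a j)) * s j) := by
    rw [← ResidueValuation.res_eq_iff h0 h4, h3, res_sum_smul _ _ fun j _ => hsj j, ← hr]
    simp only [ha]
    rfl
  have h6 := (ResidueValuation.ge_ord (W := W) (Q i)).mul h5
  rw [← mul_sub, mul_inv_cancel_left₀ (hQ0 i), hQ] at h6
  exact h6

theorem exists_ge_sub_sum {Q : ℕ → A} (hQ0 : ∀ i, Q i ≠ 0)
    (hQ : ∀ i, (residueValuation O k A).ord (Q i) = i) {S : Submodule k A}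
    {ι : Type*} [Fintype ι] {d : ι → ℕ} {s : ι → A} (hsS : ∀ j, s j ∈ S)
    (hs : ∀ j, (residueValuation O k A).ge (d j) (s j))
    (hspan : ∀ i < ramIndex O k A, gradedPiece O (Q i) S ≤ Submodule.span (IsLocalRing.ResidueField O)
      (Set.range fun j : {j // d j = i} => (residueValuation O k A).res ((Q i)⁻¹ * s j)))
    {x : A} (hx : x ∈ S) (hx0 : (residueValuation O k A).ge 0 x) (n : ℕ) (hn : n ≤ ramIndex O k A) :
    ∃ c : ι → O, (residueValuation O k A).ge n
      (x - ∑ j, algebraMap k A (algebraMap O k (c j)) * s j) := by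
  induction n with
  | zero => exact ⟨0, by simpa using hx0⟩
  | succ n ih =>
    obtain ⟨c, hc⟩ := ih (by omega)
    obtain ⟨c', hc'⟩ := exists_ge_succ_sub_sum hQ0 hQ hs (hspan n (by omega))
      (S.sub_mem hx (S.sum_mem fun j _ => by
        rw [← Algebra.smul_def]; exact S.smul_mem _ (hsS j))) hc
    refine ⟨c + c', ?_⟩
    convert hc' using 1
    · push_cast; rfl
    · simp only [Pi.add_apply, map_add, add_mul, Finset.sum_add_distrib]
      abel

/-- Convergence of series with coefficients in a complete discrete valuation ring. -/
theorem exists_sub_sum_eq_pow_mul {ϖ : O} (hϖ : ϖ ∈ IsLocalRing.maximalIdeal O)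
    (hϖ' : IsLocalRing.maximalIdeal O = Ideal.span {ϖ}) (a : ℕ → O) :
    ∃ b : O, ∀ n, ∃ r, b - ∑ m ∈ Finset.range n, ϖ ^ m * a m = ϖ ^ n * r := by
  obtain ⟨L, hL⟩ := IsPrecomplete.prec' (I := IsLocalRing.maximalIdeal O) (M := O)
    (fun n => ∑ m ∈ Finset.range n, ϖ ^ m * a m) (fun {m n} hmn => by
      rw [SModEq.sub_mem, smul_eq_mul, Ideal.mul_top, ← neg_sub, neg_mem_iff,
        ← Finset.sum_range_add_sum_Ico _ hmn, add_sub_cancel_left]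
      refine Ideal.sum_mem _ fun j hj => Ideal.mul_mem_right _ _ ?_
      exact Ideal.pow_le_pow_right (Finset.mem_Ico.1 hj).1 (Ideal.pow_mem_pow hϖ j))
  refine ⟨L, fun n => ?_⟩
  have h := (hL n).symm
  rw [SModEq.sub_mem, smul_eq_mul, Ideal.mul_top, hϖ', Ideal.span_singleton_pow,
    Ideal.mem_span_singleton'] at h
  obtain ⟨r, hr⟩ := h
  exact ⟨r, by rw [← hr, mul_comm]⟩

variable (O k) in
theorem exists_uniformizer : ∃ ϖ : O, IsLocalRing.maximalIdeal O = Ideal.span {ϖ} ∧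
    algebraMap O k ϖ ≠ 0 ∧ (residueValuation O k k).ord (algebraMap O k ϖ) = 1 := by
  obtain ⟨ϖ, hϖ⟩ := IsDiscreteValuationRing.exists_irreducible O
  have h0 : algebraMap O k ϖ ≠ 0 := fun h => hϖ.ne_zero (IsFractionRing.injective O k (by simpa using h))
  refine ⟨ϖ, hϖ.maximalIdeal_eq, h0, ?_⟩
  set V := residueValuation O k k
  have hpos : ∀ {a : O}, a ∈ IsLocalRing.maximalIdeal O → V.ge 1 (algebraMap O k a) := fun {a} ha =>
    residueValuation_ge_one_iff.2 ⟨a, ha, by rw [Algebra.norm_self, MonoidHom.id_apply]⟩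
  have h1 := (hpos (hϖ.maximalIdeal_eq ▸ Ideal.mem_span_singleton_self ϖ)).le h0
  obtain ⟨p, hp, hp1⟩ := V.exists_ord_eq_one
  obtain ⟨a, ha, hpa⟩ := residueValuation_ge_one_iff.1 (Or.inr hp1.ge : V.ge 1 p)
  rw [Algebra.norm_self, MonoidHom.id_apply] at hpa
  rw [hϖ.maximalIdeal_eq, Ideal.mem_span_singleton'] at ha
  obtain ⟨b, rfl⟩ := ha
  rw [map_mul] at hpa
  have hb : algebraMap O k b ≠ 0 := fun h => hp (by rw [hpa, h, zero_mul])
  have h2 : V.ge 0 (algebraMap O k b) := ge_zero_base_iff.2 ⟨b, rfl⟩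
  have h3 := h2.le hb
  rw [hpa, V.ord_mul _ _ hb h0] at hp1
  omega

/-- After scaling x to be integral, e approximation steps leave a remainder divisible by the
uniformizer π of k. Iterating gives coefficients that are power series in π, which converge in the
complete ring O; the final error has arbitrarily large valuation, hence is 0. -/
theorem mem_span_of_gradedPiece_le {Q : ℕ → A} (hQ0 : ∀ i, Q i ≠ 0)
    (hQ : ∀ i, (residueValuation O k A).ord (Q i) = i) {S : Submodule k A}
    {ι : Type*} [Fintype ι] {d : ι → ℕ} {s : ι → A} (hsS : ∀ j, s j ∈ S)
    (hs : ∀ j, (residueValuation O k A).ge (d j) (s j))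
    (hspan : ∀ i < ramIndex O k A, gradedPiece O (Q i) S ≤ Submodule.span (IsLocalRing.ResidueField O)
      (Set.range fun j : {j // d j = i} => (residueValuation O k A).res ((Q i)⁻¹ * s j)))
    {x : A} (hx : x ∈ S) : x ∈ Submodule.span k (Set.range s) := by
  set W := residueValuation O k A with hW
  set e := ramIndex O k A
  obtain ⟨ϖ, hm, hϖ0, hϖ1⟩ := exists_uniformizer O k
  set π := algebraMap k A (algebraMap O k ϖ) with hπ
  have hπ0 : π ≠ 0 := (map_ne_zero _).2 hϖ0
  have hπe : W.ord π = e := by rw [hπ, ord_algebraMap hϖ0, hϖ1, mul_one]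
  have he : 0 < e := ramIndex_pos O k A
  suffices key : ∀ x ∈ S, W.ge 0 x → x ∈ Submodule.span k (Set.range s) by
    have h1 : π ^ (W.ord x).natAbs * x = (algebraMap O k ϖ) ^ (W.ord x).natAbs • x := by
      rw [Algebra.smul_def, map_pow]
    have h2 := key (π ^ (W.ord x).natAbs * x) (h1 ▸ S.smul_mem _ hx) (by
      by_cases hx0 : x = 0
      · exact Or.inl (by rw [hx0, mul_zero])
      right
      rw [W.ord_mul _ _ (pow_ne_zero _ hπ0) hx0, W.ord_pow hπ0, hπe]
      have : (1 : ℤ) ≤ e := by exact_mod_cast he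
      have h3 : ((W.ord x).natAbs : ℤ) ≤ (W.ord x).natAbs * e :=
        le_mul_of_one_le_right (by positivity) this
      omega)
    rw [h1] at h2
    exact (Submodule.smul_mem_iff _ (pow_ne_zero _ hϖ0)).1 h2
  intro x hx hx0
  have hstep : ∀ y : {y : A // y ∈ S ∧ W.ge 0 y}, ∃ c : ι → O, ∃ z : {y : A // y ∈ S ∧ W.ge 0 y},
      (y : A) = ∑ j, algebraMap k A (algebraMap O k (c j)) * s j + π * z := fun y => by
    obtain ⟨c, hc⟩ := exists_ge_sub_sum hQ0 hQ hsS hs hspan y.2.1 y.2.2 e le_rfl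
    have hmem : (y : A) - ∑ j, algebraMap k A (algebraMap O k (c j)) * s j ∈ S :=
      S.sub_mem y.2.1 (S.sum_mem fun j _ => by
        rw [← Algebra.smul_def]; exact S.smul_mem _ (hsS j))
    refine ⟨c, ⟨π⁻¹ * (y - ∑ j, algebraMap k A (algebraMap O k (c j)) * s j), ?_, ?_⟩, ?_⟩
    · rw [hπ, ← map_inv₀, ← Algebra.smul_def]
      exact S.smul_mem _ hmem
    · have h1 : W.ge (-e) π⁻¹ := Or.inr (by rw [W.ord_inv hπ0, hπe])
      exact (h1.mul hc).mono (by omega)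
    · rw [mul_inv_cancel_left₀ hπ0, add_sub_cancel]
  choose c z hcz using hstep
  let y : ℕ → {y : A // y ∈ S ∧ W.ge 0 y} := fun n => z^[n] ⟨x, hx, hx0⟩
  have hy : ∀ n, x = ∑ j, algebraMap k A (algebraMap O k
      (∑ m ∈ Finset.range n, ϖ ^ m * c (y m) j)) * s j + π ^ n * y n := by
    intro n
    induction n with
    | zero => simp [y]
    | succ n ih =>
      have h1 : y (n + 1) = z (y n) := Function.iterate_succ_apply' z n _
      rw [ih, h1]
      rw [hcz (y n)]
      simp only [Finset.sum_range_succ, map_add, add_mul, Finset.sum_add_distrib, mul_add, add_assoc,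
        pow_succ, map_mul, map_pow, mul_assoc, Finset.mul_sum]
      rfl
  choose b r hr using fun j => exists_sub_sum_eq_pow_mul (ϖ := ϖ)
    (hm ▸ Ideal.mem_span_singleton_self ϖ) hm (fun m => c (y m) j)
  have hlim : x = ∑ j, algebraMap k A (algebraMap O k (b j)) * s j := by
    rw [← sub_eq_zero]
    by_contra hne
    obtain ⟨n, hn⟩ : ∃ n : ℕ, W.ord (x - ∑ j, algebraMap k A (algebraMap O k (b j)) * s j) < n :=
      ⟨(W.ord (x - ∑ j, algebraMap k A (algebraMap O k (b j)) * s j) + 1).toNat, by omega⟩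
    have hπn : W.ge n (π ^ n) := Or.inr (by
      rw [W.ord_pow hπ0, hπe]
      have : (1 : ℤ) ≤ e := by exact_mod_cast he
      exact le_mul_of_one_le_right (by positivity) this)
    refine ResidueValuation.not_ge_of_lt hne hn ?_
    have h1 : x - ∑ j, algebraMap k A (algebraMap O k (b j)) * s j = π ^ n * y n -
        ∑ j, π ^ n * (algebraMap k A (algebraMap O k (r j n)) * s j) := by
      nth_rewrite 1 [hy n]
      rw [add_sub_right_comm, ← Finset.sum_sub_distrib, add_comm, sub_eq_add_neg (π ^ n * _),
        ← Finset.sum_neg_distrib]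
      congr 1
      refine Finset.sum_congr rfl fun j _ => ?_
      have h2 := hr j n
      rw [← sub_mul, ← map_sub, ← map_sub, ← neg_sub, h2, ← mul_assoc, hπ, ← map_pow, ← map_pow,
        ← map_mul, ← map_mul, map_neg, map_neg, neg_mul]
    rw [h1]
    have hyn : W.ge n (π ^ n * (y n : A)) := by simpa using hπn.mul (y n).2.2
    refine hyn.sub (ResidueValuation.ge.sum _ fun j _ => ?_)
    have h3 : W.ge 0 (algebraMap k A (algebraMap O k (r j n)) * s j) :=
      (ge_algebraMap_integer _).mul_zero_zero ((hs j).mono (by omega))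
    simpa using hπn.mul h3
  rw [hlim]
  refine Submodule.sum_mem _ fun j _ => ?_
  rw [← Algebra.smul_def]
  exact Submodule.smul_mem _ _ (Submodule.subset_span ⟨j, rfl⟩)

/-- The fundamental equality, for a subspace: its dimension is the sum of the dimensions of its
graded pieces. -/
theorem finrank_eq_sum_finrank_gradedPiece {Q : ℕ → A} (hQ0 : ∀ i, Q i ≠ 0)
    (hQ : ∀ i, (residueValuation O k A).ord (Q i) = i) (S : Submodule k A) :
    Module.finrank k S = ∑ i ∈ Finset.range (ramIndex O k A),
      Module.finrank (IsLocalRing.ResidueField O) (gradedPiece O (Q i) S) := by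
  set W := residueValuation O k A with hW
  set e := ramIndex O k A
  let b := fun i => Module.finBasis (IsLocalRing.ResidueField O) (gradedPiece O (Q i) S)
  choose l hlS hl hl' using fun i j => mem_gradedPiece.1 (b i j).2
  let ι := Σ i : Fin e, Fin (Module.finrank (IsLocalRing.ResidueField O) (gradedPiece O (Q i) S))
  let d : ι → ℕ := fun j => j.1
  let s : ι → A := fun j => l j.1 j.2
  have hs : ∀ j, W.ge (d j) (s j) := fun j => by
    have h1 := (ResidueValuation.ge_ord (W := W) (Q j.1)).mul (hl j.1 j.2)
    rwa [mul_inv_cancel_left₀ (hQ0 _), hQ, add_zero] at h1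
  have hres : ∀ j, W.res ((Q (d j))⁻¹ * s j) = b (d j) j.2 := fun j => hl' j.1 j.2
  have hli : LinearIndependent k s := by
    refine linearIndependent_of_res hQ0 hQ (d := d) (fun j => j.1.2) hs fun i => ?_
    let f : {j : ι // d j = i} →
        Fin (Module.finrank (IsLocalRing.ResidueField O) (gradedPiece O (Q i) S)) :=
      fun j => Fin.cast (congrArg (fun i => Module.finrank (IsLocalRing.ResidueField O)
        (gradedPiece O (Q i) S)) j.2) j.1.2
    have hf : Function.Injective f := by
      rintro ⟨⟨i₁, j₁⟩, h₁⟩ ⟨⟨i₂, j₂⟩, h₂⟩ h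
      obtain rfl : i₁ = i₂ := Fin.ext (h₁.trans h₂.symm)
      have h3 := congrArg Fin.val h
      have h4 : (j₁ : ℕ) = j₂ := h3
      obtain rfl := Fin.ext h4
      rfl
    have h1 : LinearIndependent (IsLocalRing.ResidueField O)
        fun j => ((b i (f j) : gradedPiece O (Q i) S) : ResidueAlg O k A) :=
      ((b i).linearIndependent.map' (Submodule.subtype _) (Submodule.ker_subtype _)).comp f hf
    have h2 : (fun j : {j // d j = i} => W.res ((Q i)⁻¹ * s j)) =
        fun j => ((b i (f j) : gradedPiece O (Q i) S) : ResidueAlg O k A) := by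
      ext j
      obtain ⟨j, rfl⟩ := j
      exact hres j
    rw [h2]
    exact h1
  have hspan : Submodule.span k (Set.range s) = S := by
    refine le_antisymm (Submodule.span_le.2 ?_) fun x hx => ?_
    · rintro _ ⟨j, rfl⟩
      exact hlS _ _
    · refine mem_span_of_gradedPiece_le hQ0 hQ (d := d) (fun j => hlS _ _) hs (fun i hi => ?_) hx
      intro y hy
      have h1 := (b i).sum_repr ⟨y, hy⟩
      have h2 := congrArg Subtype.val h1
      rw [← show _ = y from h2, Submodule.coe_sum]
      refine Submodule.sum_mem _ fun j _ => Submodule.smul_mem _ _ (Submodule.subset_span ?_)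
      exact ⟨⟨⟨⟨i, hi⟩, j⟩, rfl⟩, hl' i j⟩
  conv_lhs => rw [← hspan, finrank_span_eq_card hli, Fintype.card_sigma]
  rw [Finset.sum_range]
  simp

end FundamentalEquality

/-! ### The signature dim Sym - dim Skew of an involution. -/

section Signature

variable (F : Type*) {A : Type*} [Field F] [DivisionRing A] [Algebra F A] [FiniteDimensional F A]

/-- The `ε`-eigenspace of an involution that is linear over a field `F`. -/
def eigenSubmodule (σ : RingInvo A) (hF : ∀ c, (σ (algebraMap F A c)).unop = algebraMap F A c)
    (ε : ℤˣ) : Submodule F A where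
  carrier := {x | (σ x).unop = (ε : ℤ) • x}
  add_mem' {x y} hx hy := by
    change (σ (x + y)).unop = (ε : ℤ) • (x + y)
    rw [RingInvo.unop_add, hx, hy, smul_add]
  zero_mem' := by simp
  smul_mem' c x hx := by
    change (σ (c • x)).unop = (ε : ℤ) • c • x
    rw [Algebra.smul_def, RingInvo.unop_mul, hF, hx, ← Algebra.commutes, mul_smul_comm]

variable {F}

theorem mem_eigenSubmodule {σ : RingInvo A}
    {hF : ∀ c, (σ (algebraMap F A c)).unop = algebraMap F A c} {ε : ℤˣ} {x : A} :
    x ∈ eigenSubmodule F σ hF ε ↔ (σ x).unop = (ε : ℤ) • x := Iff.rfl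

/-- The difference of the dimensions of the spaces of symmetric and skew-symmetric elements. -/
def signature (σ : RingInvo A) (hF : ∀ c, (σ (algebraMap F A c)).unop = algebraMap F A c) : ℤ :=
  Module.finrank F (eigenSubmodule F σ hF 1) - Module.finrank F (eigenSubmodule F σ hF (-1))

theorem finrank_eigenSubmodule_add (h2 : (2 : F) ≠ 0) (σ : RingInvo A)
    (hF : ∀ c, (σ (algebraMap F A c)).unop = algebraMap F A c) :
    Module.finrank F (eigenSubmodule F σ hF 1) + Module.finrank F (eigenSubmodule F σ hF (-1)) =
      Module.finrank F A := by
  let s : A →ₗ[F] A :=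
    { toFun := fun x => (σ x).unop
      map_add' := σ.unop_add
      map_smul' := fun c x => by
        simp only [Algebra.smul_def, RingInvo.unop_mul, hF, RingHom.id_apply]
        exact (Algebra.commutes _ _).symm }
  have h := finrank_ker_sub_add_finrank_ker_add h2 s σ.involution
  have h1 : eigenSubmodule F σ hF 1 = LinearMap.ker (s - LinearMap.id) := by
    ext x
    rw [mem_eigenSubmodule, LinearMap.mem_ker, LinearMap.sub_apply, sub_eq_zero]
    simp [s]
  have h3 : eigenSubmodule F σ hF (-1) = LinearMap.ker (s + LinearMap.id) := by
    ext x
    rw [mem_eigenSubmodule, LinearMap.mem_ker, LinearMap.add_apply, add_eq_zero_iff_eq_neg]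
    simp [s]
  rw [h1, h3, h]

/-- Multiplication by the skew central element σ(z) - z exchanges symmetric and skew-symmetric
elements. -/
theorem signature_eq_zero {σ : RingInvo A}
    {hF : ∀ c, (σ (algebraMap F A c)).unop = algebraMap F A c} {z : A}
    (hz : z ∈ Subring.center A) (hσz : (σ z).unop ≠ z) : signature σ hF = 0 := by
  set w := (σ z).unop - z
  have hw0 : w ≠ 0 := sub_ne_zero.2 hσz
  have hw : w ∈ Subring.center A := Subring.sub_mem _ (RingInvo.unop_mem_center σ hz) hz
  have hσw : (σ w).unop = -w := by
    have h : (σ (σ z).unop).unop = z := σ.involution z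
    rw [RingInvo.unop_sub, h, neg_sub]
  have hwx : ∀ x, x * w = w * x := Subring.mem_center_iff.1 hw
  have key : ∀ ε : ℤˣ, Module.finrank F (eigenSubmodule F σ hF ε) ≤
      Module.finrank F (eigenSubmodule F σ hF (-ε)) := fun ε => by
    let f : eigenSubmodule F σ hF ε →ₗ[F] eigenSubmodule F σ hF (-ε) :=
      { toFun := fun x => ⟨w * x, by
          have hx := mem_eigenSubmodule.1 x.2
          rw [mem_eigenSubmodule, RingInvo.unop_mul, hσw, hx, mul_neg, smul_mul_assoc, hwx,
            Units.val_neg, neg_smul]⟩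
        map_add' := fun x y => Subtype.ext (mul_add _ _ _)
        map_smul' := fun c x => Subtype.ext (mul_smul_comm _ _ _) }
    refine LinearMap.finrank_le_finrank_of_injective (f := f) fun x y h => Subtype.ext ?_
    exact mul_left_cancel₀ hw0 (congrArg Subtype.val h)
  have h1 := key 1
  have h2 := key (-1)
  rw [neg_neg] at h2
  rw [signature]
  omega

/-- Over the centre the two eigenspaces have dimensions m(m ± 1)/2, so they differ by m; the
dimension of the centre over F is a common factor. -/
theorem abs_signature (h2 : (2 : F) ≠ 0) {σ : RingInvo A} (hσ : IsFirstKind σ)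
    (hF : ∀ c, (σ (algebraMap F A c)).unop = algebraMap F A c) :
    ∃ m : ℕ, 0 < m ∧ Module.finrank F A = Module.finrank F (Subalgebra.center F A) * m ^ 2 ∧
      |signature σ hF| = Module.finrank F (Subalgebra.center F A) * m := by
  have h2A : (2 : A) ≠ 0 := fun h => h2 (by
    rw [← map_ofNat (algebraMap F A), map_eq_zero] at h
    exact h)
  let Z := Subring.center A
  let _ : Algebra F Z := ((algebraMap F A).codRestrict Z fun c => Subring.mem_center_iff.2 fun x =>
    (Algebra.commutes c x).symm).toAlgebra
  have hsmul : ∀ (c : F) (z : Z), ((c • z : Z) : A) = c • (z : A) := fun c z => by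
    rw [Algebra.smul_def, Algebra.smul_def]
    rfl
  have : IsScalarTower F Z A := ⟨fun c z x => by
    rw [Subring.smul_def, hsmul, Subring.smul_def, smul_eq_mul, smul_eq_mul, smul_mul_assoc]⟩
  have : Module.Finite Z A := Module.Finite.of_restrictScalars_finite F Z A
  have hz : Module.finrank F Z = Module.finrank F (Subalgebra.center F A) :=
    LinearEquiv.finrank_eq
      { toFun := fun z => ⟨z, z.2⟩
        invFun := fun z => ⟨z, z.2⟩
        map_add' := fun _ _ => rfl
        map_smul' := fun c z => Subtype.ext (hsmul c z)
        left_inv := fun _ => rfl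
        right_inv := fun _ => rfl }
  obtain ⟨m, hm, hdim, hsym⟩ := two_mul_finrank_symElements h2A hσ
  have h3 : Module.finrank F (symElements σ hσ) = Module.finrank F (eigenSubmodule F σ hF 1) :=
    LinearEquiv.finrank_eq
      { toFun := fun x => ⟨x, by
          rw [mem_eigenSubmodule, Units.val_one, one_smul]; exact x.2⟩
        invFun := fun x => ⟨x, by
          have h := mem_eigenSubmodule.1 x.2
          rwa [Units.val_one, one_smul] at h⟩
        map_add' := fun _ _ => rfl
        map_smul' := fun c x => Subtype.ext rfl
        left_inv := fun _ => rfl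
        right_inv := fun _ => rfl }
  have h4 := Module.finrank_mul_finrank F Z (symElements σ hσ)
  have h5 := Module.finrank_mul_finrank F Z A
  have h6 := finrank_eigenSubmodule_add h2 σ hF
  rw [← h3, ← h4, ← h5] at h6
  rw [hz] at h4 h5 h6
  set z := Module.finrank F (Subalgebra.center F A)
  set s := Module.finrank Z (symElements σ hσ)
  set t := Module.finrank F (eigenSubmodule F σ hF (-1))
  refine ⟨m, hm, by rw [← h5, hdim], ?_⟩
  rw [signature, ← h3, ← h4]
  rw [hdim] at h6
  obtain ⟨m, rfl⟩ := Nat.exists_eq_succ_of_ne_zero hm.ne'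
  have h7 : (z : ℤ) * s + t = z * (m + 1) ^ 2 := by exact_mod_cast h6
  rcases hsym with h | h
  · have h8 : 2 * (s : ℤ) = (m + 1) * (m + 2) := by exact_mod_cast h
    have h9 : (z : ℤ) * s - t = z * (m + 1) := by linear_combination z * h8 - h7
    push_cast
    rw [h9, abs_of_nonneg (by positivity)]
  · rw [Nat.succ_sub_one] at h
    have h8 : 2 * (s : ℤ) = (m + 1) * m := by exact_mod_cast h
    have h9 : (z : ℤ) * s - t = -(z * (m + 1)) := by linear_combination z * h8 - h7
    push_cast
    rw [h9, abs_neg, abs_of_nonneg (by positivity)]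

end Signature

/-! ### Conjugation on the residue ring. -/

namespace ResidueValuation

variable {A B : Type*} [DivisionRing A] [DivisionRing B] {W : ResidueValuation A B}

theorem ord_conj (W : ResidueValuation A B) {Q : A} (hQ : Q ≠ 0) (x : A) :
    W.ord (Q * x * Q⁻¹) = W.ord x := by
  by_cases hx : x = 0
  · simp [hx]
  rw [W.ord_mul _ _ (mul_ne_zero hQ hx) (inv_ne_zero hQ), W.ord_mul _ _ hQ hx, W.ord_inv hQ]
  omega

theorem ge.conj {n : ℤ} {x : A} (hx : W.ge n x) {Q : A} (hQ : Q ≠ 0) : W.ge n (Q * x * Q⁻¹) := by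
  rcases hx with rfl | h
  · exact Or.inl (by simp)
  · exact Or.inr (by rwa [W.ord_conj hQ])

/-- Conjugation by a nonzero element induces an endomorphism of the residue ring. -/
theorem exists_residue_conj (W : ResidueValuation A B) {Q : A} (hQ : Q ≠ 0) :
    ∃ φ : B →+* B, ∀ x, W.ge 0 x → φ (W.res x) = W.res (Q * x * Q⁻¹) := by
  have hsurj : ∀ b, ∃ x, W.ge 0 x ∧ W.res x = b := W.res_surj
  choose l hl hl' using hsurj
  have key : ∀ x, W.ge 0 x → W.res (Q * l (W.res x) * Q⁻¹) = W.res (Q * x * Q⁻¹) := fun x hx => by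
    rw [res_eq_iff ((hl _).conj hQ) (hx.conj hQ), ← sub_mul, ← mul_sub]
    exact ((res_eq_iff (hl _) hx).1 (hl' _)).conj hQ
  refine ⟨⟨⟨⟨fun b => W.res (Q * l b * Q⁻¹), ?_⟩, ?_⟩, ?_, ?_⟩, key⟩
  · rw [← W.res_one, key 1 ge_one_right, mul_one, mul_inv_cancel₀ hQ]
  · intro x y
    change W.res (Q * l (x * y) * Q⁻¹) = W.res (Q * l x * Q⁻¹) * W.res (Q * l y * Q⁻¹)
    rw [← W.res_mul _ _ ((hl x).conj hQ) ((hl y).conj hQ)]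
    nth_rewrite 1 [← hl' x, ← hl' y]
    rw [← W.res_mul _ _ (hl x) (hl y), key _ ((hl x).mul_zero_zero (hl y))]
    congr 1
    simp only [mul_assoc, inv_mul_cancel_left₀ hQ]
  · change W.res (Q * l 0 * Q⁻¹) = 0
    rw [← W.res_zero, key 0 (Or.inl rfl), mul_zero, zero_mul]
  · intro x y
    change W.res (Q * l (x + y) * Q⁻¹) = W.res (Q * l x * Q⁻¹) + W.res (Q * l y * Q⁻¹)
    rw [← W.res_add _ _ ((hl x).conj hQ) ((hl y).conj hQ)]
    nth_rewrite 1 [← hl' x, ← hl' y]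
    rw [← W.res_add _ _ (hl x) (hl y), key _ ((hl x).add (hl y)), mul_add, add_mul]

/-- The action of conjugation on the centre of the residue ring depends only on the valuation. -/
theorem res_conj_eq_of_ord_eq {Q Q' : A} (hQ : Q ≠ 0) (hQ' : Q' ≠ 0) (h : W.ord Q = W.ord Q')
    {x : A} (hx : W.ge 0 x) (hz : W.res (Q' * x * Q'⁻¹) ∈ Subring.center B) :
    W.res (Q * x * Q⁻¹) = W.res (Q' * x * Q'⁻¹) := by
  set u := Q * Q'⁻¹
  have hu : u ≠ 0 := mul_ne_zero hQ (inv_ne_zero hQ')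
  have hu0 : W.ord u = 0 := by
    rw [W.ord_mul _ _ hQ (inv_ne_zero hQ'), W.ord_inv hQ']
    omega
  have hui : W.ord u⁻¹ = 0 := by rw [W.ord_inv hu, hu0, neg_zero]
  have h1 : Q * x * Q⁻¹ = u * (Q' * x * Q'⁻¹) * u⁻¹ := by
    simp only [u, mul_inv_rev, inv_inv, mul_assoc, inv_mul_cancel_left₀ hQ']
  have hx' : W.ge 0 (Q' * x * Q'⁻¹) := hx.conj hQ'
  have hu' : W.ge 0 u := Or.inr hu0.ge
  have hui' : W.ge 0 u⁻¹ := Or.inr hui.ge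
  rw [h1, W.res_mul _ _ (hu'.mul_zero_zero hx') hui', W.res_mul _ _ hu' hx',
    Subring.mem_center_iff.1 hz, mul_assoc, ← W.res_mul _ _ hu' hui', mul_inv_cancel₀ hu, W.res_one,
    mul_one]

end ResidueValuation

namespace ResidueValuation

variable {A B : Type*} [DivisionRing A] [DivisionRing B] {W : ResidueValuation A B}

/-- Every valuation is the valuation of a symmetric or skew-symmetric element. -/
theorem exists_unop_eq_smul_of_ord (W : ResidueValuation A B) (h2 : (2 : B) ≠ 0) {σ : RingInvo A}
    (hσ : ∀ x, W.ord (σ x).unop = W.ord x) (n : ℤ) :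
    ∃ Q, Q ≠ 0 ∧ W.ord Q = n ∧ ∃ δ : ℤˣ, (σ Q).unop = (δ : ℤ) • Q := by
  obtain ⟨p, hp, hp1⟩ := W.exists_ord_eq_one
  set x := p ^ n
  have hx : x ≠ 0 := zpow_ne_zero _ hp
  have hxn : W.ord x = n := by rw [W.ord_zpow hp, hp1, mul_one]
  have h2A := W.two_ne_zero_of_res h2
  have hσσ : (σ (σ x).unop).unop = x := σ.involution x
  have hσx : W.ge n (σ x).unop := Or.inr (by rw [hσ, hxn])
  have hxx : W.ge n x := Or.inr hxn.ge
  have key : ∀ δ : ℤˣ, ¬ W.ge (n + 1) (x + (δ : ℤ) • (σ x).unop) →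
      ∃ Q, Q ≠ 0 ∧ W.ord Q = n ∧ ∃ δ : ℤˣ, (σ Q).unop = (δ : ℤ) • Q := fun δ h => by
    have h0 : x + (δ : ℤ) • (σ x).unop ≠ 0 := fun h0 => h (Or.inl h0)
    refine ⟨_, h0, le_antisymm ?_ ((hxx.add (hσx.units_smul δ)).le h0), δ, ?_⟩
    · by_contra! hlt
      exact h (Or.inr hlt)
    · rw [RingInvo.unop_add, map_zsmul, MulOpposite.unop_smul, hσσ, smul_add, units_smul_smul,
        add_comm]
  -- If x + σ(x) and x - σ(x) both had valuation above n, so would their sum 2x, and hence x.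
  by_cases h1 : W.ge (n + 1) (x + ((1 : ℤˣ) : ℤ) • (σ x).unop)
  · by_cases h3 : W.ge (n + 1) (x + ((-1 : ℤˣ) : ℤ) • (σ x).unop)
    · exfalso
      have h4 := (h1.add h3).two_inv h2
      have h5 : (2 : A)⁻¹ * (x + ((1 : ℤˣ) : ℤ) • (σ x).unop +
          (x + ((-1 : ℤˣ) : ℤ) • (σ x).unop)) = x := by
        rw [Units.val_one, one_smul, Units.val_neg, neg_smul, Units.val_one, one_smul,
          add_add_add_comm, add_neg_cancel, add_zero, ← two_mul, inv_mul_cancel_left₀ h2A]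
      rw [h5] at h4
      exact not_ge_of_lt hx (by omega) h4
    · exact key _ h3
  · exact key _ h1

/-- If the residue of an involution is trivial on the centre and conjugation by `P₀` is residually
trivial on the centre, there is a symmetric or skew-symmetric element of the same valuation as `P₀`
that acts trivially on the whole residue ring. -/
theorem exists_residually_central [Module.Finite (Subring.center B) B] (h2 : (2 : B) ≠ 0)
    {σ : RingInvo A} {τ : RingInvo B} (hσ : ∀ x, W.ord (σ x).unop = W.ord x)
    (hτ : ∀ x, W.ge 0 x → (τ (W.res x)).unop = W.res (σ x).unop) {P₀ : A} (hP₀ : P₀ ≠ 0)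
    (htriv : ∀ x, W.ge 0 x → W.res x ∈ Subring.center B → W.res (P₀ * x * P₀⁻¹) = W.res x) :
    ∃ P, P ≠ 0 ∧ W.ord P = W.ord P₀ ∧ (∃ δ : ℤˣ, (σ P).unop = (δ : ℤ) • P) ∧
      ∀ x, W.ge 0 x → W.res (P * x * P⁻¹) = W.res x := by
  have hσge : ∀ {x}, W.ge 0 x → W.ge 0 (σ x).unop := fun {x} h =>
    h.imp (fun h => by rw [h]; simp) fun h => by rwa [hσ]
  -- By Skolem–Noether the conjugation by P₀ is residually inner; a lift C of the conjugating
  -- element corrects P₀ to P₁, which acts trivially.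
  obtain ⟨φ, hφ⟩ := W.exists_residue_conj hP₀
  obtain ⟨c, hc, hφc⟩ := exists_forall_eq_mul_mul_inv φ fun z hz => by
    obtain ⟨x, hx, rfl⟩ := W.res_surj z
    rw [hφ x hx, htriv x hx hz]
  obtain ⟨C, hC0, hCo, rfl⟩ := W.exists_ord_zero_res hc
  have hCi : W.ge 0 C⁻¹ := Or.inr (by rw [W.ord_inv hC0, hCo, neg_zero])
  have hCg : W.ge 0 C := Or.inr hCo.ge
  have hCr : W.res C⁻¹ * W.res C = 1 := by
    rw [← W.res_mul _ _ hCi hCg, inv_mul_cancel₀ hC0, W.res_one]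
  set P₁ := C⁻¹ * P₀ with hP₁
  have hP₁0 : P₁ ≠ 0 := mul_ne_zero (inv_ne_zero hC0) hP₀
  have hP₁o : W.ord P₁ = W.ord P₀ := by
    rw [W.ord_mul _ _ (inv_ne_zero hC0) hP₀, W.ord_inv hC0, hCo]
    omega
  have hP₁t : ∀ x, W.ge 0 x → W.res (P₁ * x * P₁⁻¹) = W.res x := fun x hx => by
    have h1 : P₁ * x * P₁⁻¹ = C⁻¹ * (P₀ * x * P₀⁻¹) * C := by
      simp only [hP₁, mul_inv_rev, inv_inv, mul_assoc]
    have h3 := hx.conj hP₀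
    rw [h1, W.res_mul _ _ (hCi.mul_zero_zero h3) hCg, W.res_mul _ _ hCi h3, ← hφ x hx, hφc]
    have h4 : (W.res C)⁻¹ = W.res C⁻¹ := (eq_inv_of_mul_eq_one_left hCr).symm
    rw [h4]
    calc _ = (W.res C⁻¹ * W.res C) * W.res x * (W.res C⁻¹ * W.res C) := by simp only [mul_assoc]
      _ = _ := by rw [hCr, one_mul, mul_one]
  have hP₁t' : ∀ x, W.ge 0 x → W.res (P₁⁻¹ * x * P₁) = W.res x := fun x hx => by
    have h1 := hx.conj (inv_ne_zero hP₁0)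
    rw [inv_inv] at h1
    rw [← hP₁t _ h1]
    congr 1
    simp only [mul_assoc, mul_inv_cancel₀ hP₁0, mul_one, mul_inv_cancel_left₀ hP₁0]
  set P₂ := (σ P₁).unop with hP₂
  have hP₂0 : P₂ ≠ 0 := RingInvo.unop_ne_zero σ hP₁0
  have hP₂t : ∀ x, W.ge 0 x → W.res (P₂ * x * P₂⁻¹) = W.res x := fun x hx => by
    have hσσ : (σ (σ x).unop).unop = x := σ.involution x
    have h1 : P₂ * x * P₂⁻¹ = (σ (P₁⁻¹ * (σ x).unop * P₁)).unop := by
      rw [σ.unop_mul (P₁⁻¹ * (σ x).unop) P₁, σ.unop_mul P₁⁻¹, hσσ, RingInvo.unop_inv, mul_assoc]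
    have h3 := (hσge hx).conj (inv_ne_zero hP₁0)
    rw [inv_inv] at h3
    rw [h1, ← hτ _ h3, hP₁t' _ (hσge hx), hτ _ (hσge hx), hσσ]
  -- P₁ and σ(P₁) act alike on the residue ring, so u has central residue. The element wanted is P₁
  -- ± σ(P₁) = P₁(1 ± u), with a sign for which 1 ± u is a unit.
  set u := P₁⁻¹ * P₂ with hu
  have hu0 : u ≠ 0 := mul_ne_zero (inv_ne_zero hP₁0) hP₂0
  have huo : W.ord u = 0 := by
    rw [hu, W.ord_mul _ _ (inv_ne_zero hP₁0) hP₂0, W.ord_inv hP₁0, hP₂, hσ]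
    omega
  have hug : W.ge 0 u := Or.inr huo.ge
  have hP₂u : P₂ = P₁ * u := by rw [hu, mul_inv_cancel_left₀ hP₁0]
  have huc : W.res u ∈ Subring.center B := by
    rw [Subring.mem_center_iff]
    intro b
    obtain ⟨x, hx, rfl⟩ := W.res_surj b
    have h1 : W.res (u * x * u⁻¹) = W.res x := by
      have h3 : u * x * u⁻¹ = P₁⁻¹ * (P₂ * x * P₂⁻¹) * P₁ := by
        simp only [hu, mul_inv_rev, inv_inv, mul_assoc]
      rw [h3, hP₁t' _ (ge.conj hx hP₂0), hP₂t x hx]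
    have hx' : W.ge 0 x := hx
    rw [← h1, ← W.res_mul _ _ (hx'.conj hu0) hug, inv_mul_cancel_right₀ hu0, W.res_mul _ _ hug hx,
      h1]
  obtain ⟨δ, hδ⟩ : ∃ δ : ℤˣ, 1 + (δ : ℤ) • W.res u ≠ 0 := by
    by_contra! h
    have h1 := h 1
    have h3 := h (-1)
    apply h2
    simp only [Units.val_one, one_smul, Units.val_neg, neg_smul] at h1 h3
    calc (2 : B) = (1 + W.res u) + (1 + -W.res u) := by rw [← one_add_one_eq_two]; abel
      _ = 0 := by rw [h1, h3, add_zero]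
  set v := 1 + (δ : ℤ) • u with hv
  have hvg : W.ge 0 v := ge_one_right.add (hug.units_smul δ)
  have hvr : W.res v = 1 + (δ : ℤ) • W.res u := by
    rw [hv, W.res_add _ _ ge_one_right (hug.units_smul δ), W.res_one, res_units_smul hug]
  rw [← hvr] at hδ
  have hv0 : v ≠ 0 := fun h => hδ (by rw [h, W.res_zero])
  have hvo : W.ord v = 0 := by
    refine le_antisymm ?_ (hvg.le hv0)
    by_contra! hlt
    exact hδ ((W.res_eq_zero_iff v hvg).2 (Or.inr (by omega)))
  have hvi : W.ge 0 v⁻¹ := Or.inr (by rw [W.ord_inv hv0, hvo, neg_zero])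
  have hvc : W.res v ∈ Subring.center B := by
    rw [hvr]
    exact Subring.add_mem _ (Subring.one_mem _) (Subring.zsmul_mem _ huc _)
  have hσσ : (σ P₂).unop = P₁ := σ.involution P₁
  refine ⟨P₁ * v, mul_ne_zero hP₁0 hv0, ?_, ⟨δ, ?_⟩, fun x hx => ?_⟩
  · rw [W.ord_mul _ _ hP₁0 hv0, hvo, add_zero, hP₁o]
  · have h1 : P₁ * v = P₁ + (δ : ℤ) • P₂ := by
      rw [hv, mul_add, mul_one, mul_smul_comm, ← hP₂u]
    rw [h1, RingInvo.unop_add, map_zsmul, MulOpposite.unop_smul, hσσ, smul_add, units_smul_smul,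
      add_comm]
  · have h1 : P₁ * v * x * (P₁ * v)⁻¹ = P₁ * (v * x * v⁻¹) * P₁⁻¹ := by
      simp only [mul_inv_rev, mul_assoc]
    rw [h1, hP₁t _ (hx.conj hv0), W.res_mul _ _ (hvg.mul_zero_zero hx) hvi, W.res_mul _ _ hvg hx,
      ← Subring.mem_center_iff.1 hvc, mul_assoc, ← W.res_mul _ _ hvg hvi, mul_inv_cancel₀ hv0,
      W.res_one, mul_one]

/-- On the centre of the residue ring, if the square of conjugation by an element is trivial, then
so is conjugation by its even powers. -/
theorem res_conj_pow_two_mul {q : A} (hq : q ≠ 0)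
    (h : ∀ x, W.ge 0 x → W.res x ∈ Subring.center B → W.res (q * (q * x * q⁻¹) * q⁻¹) = W.res x)
    (n : ℕ) {x : A} (hx : W.ge 0 x) (hz : W.res x ∈ Subring.center B) :
    W.res (q ^ (2 * n) * x * (q ^ (2 * n))⁻¹) = W.res x := by
  induction n generalizing x with
  | zero => simp
  | succ n ih =>
    have h1 := (hx.conj hq).conj hq
    have h2 := ih h1 (by rwa [h x hx hz])
    rw [h x hx hz] at h2
    rw [← h2]
    congr 1
    rw [mul_add, mul_one, pow_add, pow_two, mul_inv_rev, mul_inv_rev]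
    simp only [mul_assoc]

end ResidueValuation

/-! ### Ramification of division algebras with an involution of the first kind. -/

section Dichotomy

variable {O k : Type*} [CommRing O] [IsDomain O] [IsDiscreteValuationRing O]
  [IsAdicComplete (IsLocalRing.maximalIdeal O) O] [Field k] [Algebra O k] [IsFractionRing O k]
  {A : Type*} [DivisionRing A] [Algebra k A] [FiniteDimensional k A]

variable (k A) in
theorem two_ne_zero_residueAlg (h2 : (2 : IsLocalRing.ResidueField O) ≠ 0) :
    (2 : ResidueAlg O k A) ≠ 0 := fun h => h2 (by
  rw [← map_ofNat (algebraMap (IsLocalRing.ResidueField O) (ResidueAlg O k A)), map_eq_zero] at h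
  exact h)

theorem two_ne_zero_of_residueField {O : Type*} (k A : Type*) [CommRing O] [IsDomain O]
    [IsDiscreteValuationRing O] [IsAdicComplete (IsLocalRing.maximalIdeal O) O] [Field k]
    [Algebra O k] [IsFractionRing O k] [DivisionRing A] [Algebra k A] [FiniteDimensional k A]
    (h2 : (2 : IsLocalRing.ResidueField O) ≠ 0) : (2 : A) ≠ 0 :=
  (residueValuation O k A).two_ne_zero_of_res (two_ne_zero_residueAlg k A h2)

theorem residue_invo_algebraMap {σ : RingInvo A}
    (hσ : ∀ c, (σ (algebraMap k A c)).unop = algebraMap k A c) {Q : A} (hQ : Q ≠ 0)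
    {τ : RingInvo (ResidueAlg O k A)}
    (hτ : ∀ x, (residueValuation O k A).ge 0 x → (τ ((residueValuation O k A).res x)).unop =
      (residueValuation O k A).res (Q⁻¹ * (σ x).unop * Q)) (c : IsLocalRing.ResidueField O) :
    (τ (algebraMap _ (ResidueAlg O k A) c)).unop = algebraMap _ (ResidueAlg O k A) c := by
  obtain ⟨a, rfl⟩ := IsLocalRing.residue_surjective c
  rw [algebraMap_residue, hτ _ (ge_algebraMap_integer a), hσ, ← Algebra.commutes, mul_assoc,
    inv_mul_cancel₀ hQ, mul_one]

variable (O k) in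
theorem exists_residue_invo_conj {σ : RingInvo A}
    (hσ : ∀ c, (σ (algebraMap k A c)).unop = algebraMap k A c) {Q : A} (hQ : Q ≠ 0) {δ : ℤˣ}
    (hδ : (σ Q).unop = (δ : ℤ) • Q) :
    ∃ τ : RingInvo (ResidueAlg O k A), ∀ x, (residueValuation O k A).ge 0 x →
      (τ ((residueValuation O k A).res x)).unop =
        (residueValuation O k A).res (Q⁻¹ * (σ x).unop * Q) := by
  have hδ' : (σ Q⁻¹).unop = (δ : ℤ) • Q⁻¹ := by
    rw [RingInvo.unop_inv, hδ]
    rcases Int.units_eq_one_or δ with rfl | rfl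
    · simp
    · simp [inv_neg]
  have happ : ∀ x, (σ.conj Q⁻¹ (inv_ne_zero hQ) δ hδ' x).unop = Q⁻¹ * (σ x).unop * Q := fun x => by
    rw [RingInvo.conj_apply, inv_inv]
  obtain ⟨τ, hτ⟩ := (residueValuation O k A).exists_residue_invo
    (σ.conj Q⁻¹ (inv_ne_zero hQ) δ hδ') fun x => by
      have h := (residueValuation O k A).ord_conj (inv_ne_zero hQ) (σ x).unop
      rw [inv_inv] at h
      rw [happ, h, residueValuation_ord_unop hσ]
  exact ⟨τ, fun x hx => by rw [hτ x hx, happ]⟩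

/-- Dividing by Q turns the ε-eigenspace of σ into the εδ-eigenspace of the involution conjugated by
Q. Eigenvectors of the residue involution lift to eigenvectors by averaging, so the graded piece is
the whole residual eigenspace. -/
theorem gradedPiece_eigenSubmodule (h2 : (2 : IsLocalRing.ResidueField O) ≠ 0) {σ : RingInvo A}
    (hσ : ∀ c, (σ (algebraMap k A c)).unop = algebraMap k A c) {Q : A} (hQ : Q ≠ 0) {δ : ℤˣ}
    (hδ : (σ Q).unop = (δ : ℤ) • Q) {τ : RingInvo (ResidueAlg O k A)}
    (hτ : ∀ x, (residueValuation O k A).ge 0 x → (τ ((residueValuation O k A).res x)).unop =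
      (residueValuation O k A).res (Q⁻¹ * (σ x).unop * Q)) (ε : ℤˣ) :
    gradedPiece O Q (eigenSubmodule k σ hσ ε) =
      eigenSubmodule _ τ (residue_invo_algebraMap hσ hQ hτ) (ε * δ) := by
  set W := residueValuation O k A
  have hδ' : (σ Q⁻¹).unop = (δ : ℤ) • Q⁻¹ := by
    rw [RingInvo.unop_inv, hδ]
    rcases Int.units_eq_one_or δ with rfl | rfl
    · simp
    · simp [inv_neg]
  set σ' := σ.conj Q⁻¹ (inv_ne_zero hQ) δ hδ'
  have happ : ∀ x, (σ' x).unop = Q⁻¹ * (σ x).unop * Q := fun x => by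
    rw [RingInvo.conj_apply, inv_inv]
  have hord : ∀ x, W.ord (σ' x).unop = W.ord x := fun x => by
    have h := W.ord_conj (inv_ne_zero hQ) (σ x).unop
    rw [inv_inv] at h
    rw [happ, h, residueValuation_ord_unop hσ]
  have hτ' : ∀ x, W.ge 0 x → (τ (W.res x)).unop = W.res (σ' x).unop := fun x hx => by
    rw [happ]; exact hτ x hx
  have key : ∀ y, (σ (Q * y)).unop = (ε : ℤ) • (Q * y) ↔
      (σ' y).unop = ((ε * δ : ℤˣ) : ℤ) • y := fun y => by
    have h1 : (σ (Q * y)).unop = (δ : ℤ) • (Q * (σ' y).unop) := by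
      rw [RingInvo.unop_mul, hδ, happ, mul_smul_comm, mul_assoc, mul_inv_cancel_left₀ hQ]
    rw [h1]
    constructor
    · intro h
      have h3 := congrArg (fun z => Q⁻¹ * ((δ : ℤ) • z)) h
      simp only [units_smul_smul, inv_mul_cancel_left₀ hQ] at h3
      rw [h3, Units.val_mul, mul_comm, mul_smul, mul_smul_comm, mul_smul_comm,
        inv_mul_cancel_left₀ hQ]
    · intro h
      rw [h, Units.val_mul, mul_comm (ε : ℤ), mul_smul, mul_smul_comm, units_smul_smul,
        mul_smul_comm]
  ext b
  rw [mem_gradedPiece, mem_eigenSubmodule]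
  constructor
  · rintro ⟨x, hx, hx0, rfl⟩
    have hxQ : x = Q * (Q⁻¹ * x) := (mul_inv_cancel_left₀ hQ x).symm
    rw [mem_eigenSubmodule, hxQ, key] at hx
    rw [hτ' _ hx0, hx, ResidueValuation.res_units_smul hx0]
  · intro hb
    obtain ⟨y, hy, hσy, rfl⟩ := W.exists_symm_lift (σ := σ')
      (two_ne_zero_residueAlg k A h2) hord hτ' (ε * δ) b (by rw [hb, units_smul_smul])
    refine ⟨Q * y, ?_, ?_, ?_⟩
    · rw [mem_eigenSubmodule, key]
      exact ResidueValuation.unop_eq_of_eq_smul_unop hσy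
    · rwa [inv_mul_cancel_left₀ hQ]
    · rw [inv_mul_cancel_left₀ hQ]

theorem signature_eq_sum (h2 : (2 : IsLocalRing.ResidueField O) ≠ 0) {σ : RingInvo A}
    (hσ : ∀ c, (σ (algebraMap k A c)).unop = algebraMap k A c) {Q : ℕ → A} (hQ : ∀ i, Q i ≠ 0)
    (hQo : ∀ i, (residueValuation O k A).ord (Q i) = i) {δ : ℕ → ℤˣ}
    (hδ : ∀ i, (σ (Q i)).unop = (δ i : ℤ) • Q i) {τ : ℕ → RingInvo (ResidueAlg O k A)}
    (hτ : ∀ i, ∀ x, (residueValuation O k A).ge 0 x → (τ i ((residueValuation O k A).res x)).unop =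
      (residueValuation O k A).res ((Q i)⁻¹ * (σ x).unop * Q i)) :
    signature σ hσ = ∑ i ∈ Finset.range (ramIndex O k A),
      (δ i : ℤ) * signature (τ i) (residue_invo_algebraMap hσ (hQ i) (hτ i)) := by
  rw [signature, finrank_eq_sum_finrank_gradedPiece hQ hQo,
    finrank_eq_sum_finrank_gradedPiece hQ hQo]
  push_cast
  rw [← Finset.sum_sub_distrib]
  refine Finset.sum_congr rfl fun i _ => ?_
  rw [gradedPiece_eigenSubmodule h2 hσ (hQ i) (hδ i) (hτ i),
    gradedPiece_eigenSubmodule h2 hσ (hQ i) (hδ i) (hτ i), signature]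
  rcases Int.units_eq_one_or (δ i) with h | h <;> rw [h]
  · rw [mul_one, mul_one, Units.val_one, one_mul]
  · rw [one_mul, neg_one_mul, neg_neg, Units.val_neg, Units.val_one, neg_one_mul, neg_sub]

variable (O k A) in
theorem finrank_eq_ramIndex_mul : Module.finrank k A =
    ramIndex O k A * Module.finrank (IsLocalRing.ResidueField O) (ResidueAlg O k A) := by
  obtain ⟨Q, hQ, hQo⟩ := exists_elements_of_ord O k A
  have h := finrank_eq_sum_finrank_gradedPiece hQ hQo (⊤ : Submodule k A)
  have htop : ∀ i, gradedPiece O (Q i) (⊤ : Submodule k A) = ⊤ := fun i => by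
    rw [eq_top_iff]
    rintro b -
    obtain ⟨x, hx, rfl⟩ := (residueValuation O k A).res_surj b
    exact mem_gradedPiece.2 ⟨Q i * x, Submodule.mem_top, by rwa [inv_mul_cancel_left₀ (hQ i)],
      by rw [inv_mul_cancel_left₀ (hQ i)]⟩
  have h1 : ∀ i, Module.finrank (IsLocalRing.ResidueField O) (gradedPiece O (Q i) (⊤ : Submodule k A)) =
      Module.finrank (IsLocalRing.ResidueField O) (ResidueAlg O k A) := fun i => by
    rw [htop i]
    exact finrank_top _ _
  rw [finrank_top, Finset.sum_congr rfl fun i _ => h1 i, Finset.sum_const, Finset.card_range,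
    smul_eq_mul] at h
  exact h

end Dichotomy

section Dichotomy

variable {O k : Type*} [CommRing O] [IsDomain O] [IsDiscreteValuationRing O]
  [IsAdicComplete (IsLocalRing.maximalIdeal O) O] [Field k] [Algebra O k] [IsFractionRing O k]
  {A : Type*} [DivisionRing A] [Algebra k A] [FiniteDimensional k A]

instance : Module.Finite (Subring.center (ResidueAlg O k A)) (ResidueAlg O k A) := by
  let Z := Subring.center (ResidueAlg O k A)
  let _ : Algebra (IsLocalRing.ResidueField O) Z :=
    ((algebraMap (IsLocalRing.ResidueField O) (ResidueAlg O k A)).codRestrict Z fun c =>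
      Subring.mem_center_iff.2 fun x => (Algebra.commutes c x).symm).toAlgebra
  have : IsScalarTower (IsLocalRing.ResidueField O) Z (ResidueAlg O k A) := ⟨fun c z x => by
    rw [Subring.smul_def, Subring.smul_def, smul_eq_mul, smul_eq_mul, Algebra.smul_def,
      Algebra.smul_def, ← mul_assoc]
    rfl⟩
  exact Module.Finite.of_restrictScalars_finite (IsLocalRing.ResidueField O) Z (ResidueAlg O k A)

/-- The case of a valuation-theoretic period `o`: the graded pieces whose degree is not a multiple of
`o` have no signature, the other ones all have the same. -/
theorem finrank_center_mul_ramIndex_div (h2 : (2 : IsLocalRing.ResidueField O) ≠ 0)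
    (hcen : Module.finrank k (Subalgebra.center k A) = 1) {σ : RingInvo A} (hσ1 : IsFirstKind σ)
    (hσ : ∀ c, (σ (algebraMap k A c)).unop = algebraMap k A c) {τ : RingInvo (ResidueAlg O k A)}
    (hτ : ∀ x, (residueValuation O k A).ge 0 x → (τ ((residueValuation O k A).res x)).unop =
      (residueValuation O k A).res (σ x).unop) (hτ1 : IsFirstKind τ) {o f : ℕ} (ho : 0 < o)
    (hof : ramIndex O k A = o * f) {P₀ : A} (hP₀ : P₀ ≠ 0)
    (hP₀o : (residueValuation O k A).ord P₀ = o)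
    (htriv : ∀ x, (residueValuation O k A).ge 0 x →
      (residueValuation O k A).res x ∈ Subring.center (ResidueAlg O k A) →
      (residueValuation O k A).res (P₀ * x * P₀⁻¹) = (residueValuation O k A).res x)
    (hnontriv : ∀ Q : A, Q ≠ 0 → ∀ i : ℕ, (residueValuation O k A).ord Q = i → ¬ o ∣ i →
      ∃ x, (residueValuation O k A).ge 0 x ∧
        (residueValuation O k A).res x ∈ Subring.center (ResidueAlg O k A) ∧
        (residueValuation O k A).res (Q⁻¹ * x * Q) ≠ (residueValuation O k A).res x) :
    f * Module.finrank (IsLocalRing.ResidueField O)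
      (Subalgebra.center (IsLocalRing.ResidueField O) (ResidueAlg O k A)) = o := by
  classical
  set W := residueValuation O k A with hW
  have h2B := two_ne_zero_residueAlg k A h2
  have h2A := two_ne_zero_of_residueField k A h2
  have h2k := two_ne_zero_of_residueField k k h2
  have hord : ∀ x, W.ord (σ x).unop = W.ord x := residueValuation_ord_unop hσ
  obtain ⟨P, hP, hPo, ⟨δ, hδ⟩, hPt⟩ :=
    ResidueValuation.exists_residually_central h2B hord hτ hP₀ htriv
  rw [hP₀o] at hPo
  have hPt' : ∀ n : ℕ, ∀ x, W.ge 0 x → W.res (P ^ n * x * (P ^ n)⁻¹) = W.res x := by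
    intro n
    induction n with
    | zero => intro x _; simp
    | succ n ih =>
      intro x hx
      have h1 : P ^ (n + 1) * x * (P ^ (n + 1))⁻¹ = P ^ n * (P * x * P⁻¹) * (P ^ n)⁻¹ := by
        rw [pow_succ, mul_inv_rev]
        simp only [mul_assoc]
      rw [h1, ih _ (hx.conj hP), hPt x hx]
  have hPt'' : ∀ n : ℕ, ∀ x, W.ge 0 x → W.res ((P ^ n)⁻¹ * x * P ^ n) = W.res x := fun n x hx => by
    have hn : P ^ n ≠ 0 := pow_ne_zero _ hP
    have h1 := hx.conj (inv_ne_zero hn)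
    rw [inv_inv] at h1
    rw [← hPt' n _ h1]
    congr 1
    simp only [mul_assoc, mul_inv_cancel₀ hn, mul_one, mul_inv_cancel_left₀ hn]
  have hδn : ∀ n : ℕ, (σ (P ^ n)).unop = ((δ ^ n : ℤˣ) : ℤ) • P ^ n := fun n => by
    rw [RingInvo.unop_pow, hδ]
    rcases Int.units_eq_one_or δ with rfl | rfl
    · simp
    · rcases Nat.even_or_odd n with h | h
      · simp [h.neg_pow, h.neg_one_pow]
      · simp [h.neg_pow, h.neg_one_pow]
  choose Q₁ hQ₁ hQ₁o δ₁ hδ₁ using fun i : ℕ => W.exists_unop_eq_smul_of_ord h2B hord i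
  -- In degrees divisible by o, powers of P act trivially on the residue ring, so the residue
  -- involution there is τ itself. In the other degrees any symmetric or skew element will do.
  let Q : ℕ → A := fun i => if o ∣ i then P ^ (i / o) else Q₁ i
  let δ' : ℕ → ℤˣ := fun i => if o ∣ i then δ ^ (i / o) else δ₁ i
  have hQ : ∀ i, Q i ≠ 0 := fun i => by
    by_cases h : o ∣ i
    · simp only [Q, if_pos h]; exact pow_ne_zero _ hP
    · simp only [Q, if_neg h]; exact hQ₁ i
  have hQo : ∀ i, W.ord (Q i) = i := fun i => by
    by_cases h : o ∣ i
    · simp only [Q, if_pos h]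
      rw [W.ord_pow hP, hPo]
      exact_mod_cast Nat.div_mul_cancel h
    · simp only [Q, if_neg h]; exact hQ₁o i
  have hδ' : ∀ i, (σ (Q i)).unop = (δ' i : ℤ) • Q i := fun i => by
    by_cases h : o ∣ i
    · simp only [Q, δ', if_pos h]; exact hδn _
    · simp only [Q, δ', if_neg h]; exact hδ₁ i
  choose τ₁ hτ₁ using fun i => exists_residue_invo_conj O k hσ (hQ i) (hδ' i)
  have hsum := signature_eq_sum h2 hσ hQ hQo hδ' hτ₁
  have hσge : ∀ {x}, W.ge 0 x → W.ge 0 (σ x).unop := fun {x} h =>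
    h.imp (fun h => by rw [h]; simp) fun h => by rwa [hord]
  have hτF : ∀ c, (τ (algebraMap (IsLocalRing.ResidueField O) (ResidueAlg O k A) c)).unop =
      algebraMap (IsLocalRing.ResidueField O) (ResidueAlg O k A) c := fun c => hτ1 _ (by
    exact Subring.mem_center_iff.2 fun x => (Algebra.commutes c x).symm)
  have hterm : ∀ i, signature (τ₁ i) (residue_invo_algebraMap hσ (hQ i) (hτ₁ i)) =
      if o ∣ i then signature τ hτF else 0 := fun i => by
    split_ifs with h
    · have h1 : τ₁ i = τ := RingInvo.ext_unop fun b => by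
        obtain ⟨x, hx, rfl⟩ := W.res_surj b
        rw [hτ₁ i x hx, hτ x hx]
        simp only [Q, if_pos h]
        exact hPt'' _ _ (hσge hx)
      subst h1
      rfl
    -- τ fixes the residual centre while conjugation by Q i moves it, so τ₁ i is not of the first
    -- kind and its signature is zero.
    · obtain ⟨x, hx, hxc, hne⟩ := hnontriv (Q i) (hQ i) i (hQo i) h
      refine signature_eq_zero hxc ?_
      rw [hτ₁ i x hx]
      have h1 := W.exists_residue_conj (inv_ne_zero (hQ i))
      obtain ⟨φ, hφ⟩ := h1
      have h3 : W.res (σ x).unop = W.res x := by rw [← hτ x hx, hτ1 _ hxc]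
      have h4 := hφ _ (hσge hx)
      have h5 := hφ _ hx
      rw [inv_inv] at h4 h5
      rw [← h4, h3, h5]
      exact hne
  have hsum' : signature σ hσ = (∑ j ∈ Finset.range f, ((δ ^ j : ℤˣ) : ℤ)) * signature τ hτF := by
    rw [hsum, hof, Finset.sum_mul]
    simp only [hterm, mul_ite, mul_zero]
    rw [← Finset.sum_filter]
    symm
    refine Finset.sum_bij (fun j _ => o * j) (fun j hj => ?_) (fun a _ b _ h => ?_)
      (fun i hi => ?_) (fun j hj => ?_)
    · rw [Finset.mem_filter, Finset.mem_range]
      exact ⟨(mul_lt_mul_iff_right₀ ho).2 (Finset.mem_range.1 hj), Dvd.intro _ rfl⟩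
    · exact Nat.eq_of_mul_eq_mul_left ho h
    · rw [Finset.mem_filter, Finset.mem_range] at hi
      obtain ⟨hi, j, rfl⟩ := hi
      exact ⟨j, Finset.mem_range.2 (lt_of_mul_lt_mul_left hi (Nat.zero_le _)), rfl⟩
    · simp only [δ', if_pos (Dvd.intro j rfl : o ∣ o * j), Nat.mul_div_cancel_left j ho]
  obtain ⟨d, hd, hdim, habs⟩ := abs_signature h2k hσ1 hσ
  obtain ⟨m, hm, hdimB, habsB⟩ := abs_signature h2 hτ1 hτF
  rw [hcen, one_mul] at hdim
  rw [hcen, Nat.cast_one, one_mul] at habs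
  have hfe := finrank_eq_ramIndex_mul O k A
  -- conjugation by `P ^ f` is residually trivial, which determines the sign of `P ^ f`
  have hδf : δ ^ f = 1 := by
    obtain ⟨ϖ, -, hϖ0, hϖ1⟩ := exists_uniformizer O k
    set π := algebraMap k A (algebraMap O k ϖ) with hπ
    have hπ0 : π ≠ 0 := (map_ne_zero _).2 hϖ0
    have hπo : W.ord π = o * f := by
      rw [hπ, hW, ord_algebraMap hϖ0, hϖ1, mul_one, hof]
      push_cast
      rfl
    have hπc : ∀ x, π * x = x * π := fun x => Algebra.commutes _ x
    have hπic : ∀ x, π⁻¹ * x = x * π⁻¹ := fun x => by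
      rw [hπ, ← map_inv₀]
      exact Algebra.commutes _ x
    set u := π⁻¹ * P ^ f with hu
    have hPf : P ^ f ≠ 0 := pow_ne_zero _ hP
    have hu0 : u ≠ 0 := mul_ne_zero (inv_ne_zero hπ0) hPf
    have huo : W.ord u = 0 := by
      rw [hu, W.ord_mul _ _ (inv_ne_zero hπ0) hPf, W.ord_inv hπ0, W.ord_pow hP, hπo, hPo]
      ring
    have hug : W.ge 0 u := Or.inr huo.ge
    have hur : W.res u ≠ 0 := (ResidueValuation.res_ne_zero_iff hug).2 ⟨hu0, huo⟩
    have huc : W.res u ∈ Subring.center (ResidueAlg O k A) := by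
      rw [Subring.mem_center_iff]
      intro b
      obtain ⟨x, hx, rfl⟩ := W.res_surj b
      have hx' : W.ge 0 x := hx
      have h3 : u * x * u⁻¹ = P ^ f * x * (P ^ f)⁻¹ := by
        rw [hu, mul_inv_rev, inv_inv, hπic, ← hπc]
        simp only [mul_assoc, inv_mul_cancel_left₀ hπ0, hπic]
      have h1 : W.res (u * x * u⁻¹) = W.res x := by rw [h3, hPt' f x hx]
      rw [← h1, ← W.res_mul _ _ (hx'.conj hu0) hug, inv_mul_cancel_right₀ hu0,
        W.res_mul _ _ hug hx, h1]
    have hσu : (σ u).unop = ((δ ^ f : ℤˣ) : ℤ) • u := by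
      rw [hu, RingInvo.unop_mul, RingInvo.unop_inv, hπ, hσ, hδn, ← hπ, smul_mul_assoc, hπic]
    have h1 := hτ1 _ huc
    rw [hτ u hug, hσu, ResidueValuation.res_units_smul hug] at h1
    rcases Int.units_eq_one_or (δ ^ f) with h | h
    · exact h
    · exfalso
      rw [h, Units.val_neg, Units.val_one, neg_one_smul, neg_eq_iff_add_eq_zero, ← two_mul] at h1
      exact (mul_ne_zero h2B hur) h1
  -- Were δ = -1, the number f would be even and the f equal contributions would cancel in pairs,
  -- although the signature is plus or minus the degree d.
  have hδ1 : δ = 1 := by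
    rcases Int.units_eq_one_or δ with h | h
    · exact h
    · exfalso
      rw [h] at hδf hsum'
      have hev : Even f := by
        by_contra hodd
        rw [(Nat.not_even_iff_odd.1 hodd).neg_one_pow] at hδf
        exact absurd hδf (by decide)
      have h0 : (∑ j ∈ Finset.range f, (((-1 : ℤˣ) ^ j : ℤˣ) : ℤ)) = 0 := by
        push_cast
        rw [neg_one_geom_sum, if_pos hev]
      rw [h0, zero_mul] at hsum'
      rw [hsum', abs_zero] at habs
      omega
  rw [hδ1] at hsum'
  simp only [one_pow, Units.val_one, Finset.sum_const, Finset.card_range, nsmul_eq_mul, mul_one]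
    at hsum'
  rw [hsum', abs_mul, habsB, Nat.abs_cast] at habs
  set z := Module.finrank (IsLocalRing.ResidueField O)
      (Subalgebra.center (IsLocalRing.ResidueField O) (ResidueAlg O k A))
  -- The signature gives d = fzm, and the dimension count gives d² = (of)zm²; together they yield fz
  -- = o.
  have h3 : f * (z * m) = d := by exact_mod_cast habs
  rw [hdim, hdimB, hof, ← h3] at hfe
  have hf : 0 < f := Nat.pos_of_ne_zero fun h => by
    rw [h, zero_mul] at h3
    omega
  have hz : 0 < z := Nat.pos_of_ne_zero fun h => by
    rw [h, zero_mul, mul_zero] at h3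
    omega
  have h4 : (f * z * m ^ 2) * (f * z) = (f * z * m ^ 2) * o := by linarith
  exact Nat.eq_of_mul_eq_mul_left (by positivity) h4

end Dichotomy

section Dichotomy

variable {O k : Type*} [CommRing O] [IsDomain O] [IsDiscreteValuationRing O]
  [IsAdicComplete (IsLocalRing.maximalIdeal O) O] [Field k] [Algebra O k] [IsFractionRing O k]
  {A : Type*} [DivisionRing A] [Algebra k A] [FiniteDimensional k A]

theorem exists_algebraMap_of_finrank_center_eq_one
    (h : Module.finrank (IsLocalRing.ResidueField O)
      (Subalgebra.center (IsLocalRing.ResidueField O) (ResidueAlg O k A)) = 1)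
    {b : ResidueAlg O k A} (hb : b ∈ Subring.center (ResidueAlg O k A)) :
    ∃ a : O, b = (residueValuation O k A).res (algebraMap k A (algebraMap O k a)) := by
  obtain ⟨c, hc⟩ := (finrank_eq_one_iff_of_nonzero'
    (1 : Subalgebra.center (IsLocalRing.ResidueField O) (ResidueAlg O k A)) one_ne_zero).1 h ⟨b, hb⟩
  obtain ⟨a, rfl⟩ := IsLocalRing.residue_surjective c
  refine ⟨a, ?_⟩
  rw [← algebraMap_residue, Algebra.algebraMap_eq_smul_one]
  exact (congrArg Subtype.val hc).symm

/-- On the residual centre conjugation by p⁻¹ coincides with an involution, so the period o is 1 or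
2. If o = 1, then ez = 1. If o = 2, then e is even, because the uniformizer of k is central, and
(e/2)z = 2; here z = 1 is impossible since the action on the centre is nontrivial, so e = z = 2. -/
theorem ramIndex_eq_one_or_two_of_residue (h2 : (2 : IsLocalRing.ResidueField O) ≠ 0)
    (hcen : Module.finrank k (Subalgebra.center k A) = 1) {σ : RingInvo A} (hσ1 : IsFirstKind σ)
    (hσ : ∀ c, (σ (algebraMap k A c)).unop = algebraMap k A c) {τ : RingInvo (ResidueAlg O k A)}
    (hτ : ∀ x, (residueValuation O k A).ge 0 x → (τ ((residueValuation O k A).res x)).unop =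
      (residueValuation O k A).res (σ x).unop) (hτ1 : IsFirstKind τ) :
    (ramIndex O k A = 1 ∧ Module.finrank (IsLocalRing.ResidueField O)
      (Subalgebra.center (IsLocalRing.ResidueField O) (ResidueAlg O k A)) = 1) ∨
    (ramIndex O k A = 2 ∧ Module.finrank (IsLocalRing.ResidueField O)
      (Subalgebra.center (IsLocalRing.ResidueField O) (ResidueAlg O k A)) = 2 ∧
      ∀ p : A, p ≠ 0 → (residueValuation O k A).ord p = 1 → ∃ x, (residueValuation O k A).ge 0 x ∧
        (residueValuation O k A).res x ∈ Subring.center (ResidueAlg O k A) ∧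
        (residueValuation O k A).res (p⁻¹ * x * p) ≠ (residueValuation O k A).res x) := by
  set W := residueValuation O k A with hW
  set e := ramIndex O k A
  have he : 0 < e := ramIndex_pos O k A
  have h2B := two_ne_zero_residueAlg k A h2
  have hord : ∀ x, W.ord (σ x).unop = W.ord x := residueValuation_ord_unop hσ
  have hσge : ∀ {x}, W.ge 0 x → W.ge 0 (σ x).unop := fun {x} h =>
    h.imp (fun h => by rw [h]; simp) fun h => by rwa [hord]
  obtain ⟨p, hp, hp1, δ, hδ⟩ := W.exists_unop_eq_smul_of_ord h2B hord 1
  obtain ⟨τ', hτ'⟩ := exists_residue_invo_conj O k hσ hp hδ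
  set q := p⁻¹ with hq
  have hq0 : q ≠ 0 := inv_ne_zero hp
  have hqi : q⁻¹ = p := inv_inv p
  have hqo : W.ord q = -1 := by rw [hq, W.ord_inv hp, hp1]
  obtain ⟨φ, hφ⟩ := W.exists_residue_conj hq0
  have hτφ : ∀ x, W.ge 0 x → W.res x ∈ Subring.center (ResidueAlg O k A) →
      (τ' (W.res x)).unop = W.res (q * x * q⁻¹) := fun x hx hxc => by
    have h3 : W.res (σ x).unop = W.res x := by rw [← hτ x hx, hτ1 _ hxc]
    rw [hτ' x hx, ← hφ x hx, ← h3, hφ _ (hσge hx), hqi]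
  have hcq : ∀ x, W.ge 0 x → W.res x ∈ Subring.center (ResidueAlg O k A) →
      W.res (q * x * q⁻¹) ∈ Subring.center (ResidueAlg O k A) := fun x hx hxc => by
    rw [← hτφ x hx hxc]
    exact RingInvo.unop_mem_center _ hxc
  have hqq : ∀ x, W.ge 0 x → W.res x ∈ Subring.center (ResidueAlg O k A) →
      W.res (q * (q * x * q⁻¹) * q⁻¹) = W.res x := fun x hx hxc => by
    rw [← hτφ _ (hx.conj hq0) (hcq x hx hxc), ← hτφ x hx hxc]
    exact τ'.involution _
  -- conjugation by an element `Q⁻¹` on the centre depends on the parity of the valuation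
  have hconj : ∀ Q : A, Q ≠ 0 → ∀ i : ℕ, W.ord Q = i → ∀ x, W.ge 0 x →
      W.res x ∈ Subring.center (ResidueAlg O k A) → W.res (Q⁻¹ * x * Q) = W.res (q ^ i * x * (q ^ i)⁻¹) := by
    intro Q hQ i hQi x hx hxc
    have hmem : W.res (q ^ i * x * (q ^ i)⁻¹) ∈ Subring.center (ResidueAlg O k A) := by
      rcases Nat.even_or_odd' i with ⟨n, rfl | rfl⟩
      · rwa [ResidueValuation.res_conj_pow_two_mul hq0 hqq n hx hxc]
      · have h1 : q ^ (2 * n + 1) * x * (q ^ (2 * n + 1))⁻¹ =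
            q ^ (2 * n) * (q * x * q⁻¹) * (q ^ (2 * n))⁻¹ := by
          rw [pow_succ, mul_inv_rev]
          simp only [mul_assoc]
        rw [h1, ResidueValuation.res_conj_pow_two_mul hq0 hqq n (hx.conj hq0) (hcq x hx hxc)]
        exact hcq x hx hxc
    have h1 := ResidueValuation.res_conj_eq_of_ord_eq (inv_ne_zero hQ) (pow_ne_zero i hq0)
      (by rw [W.ord_inv hQ, hQi, W.ord_pow hq0, hqo]; ring) hx hmem
    rwa [inv_inv] at h1
  have hodd : ∀ n : ℕ, ∀ x, W.ge 0 x → W.res x ∈ Subring.center (ResidueAlg O k A) →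
      W.res (q ^ (2 * n + 1) * x * (q ^ (2 * n + 1))⁻¹) = W.res (q * x * q⁻¹) := by
    intro n x hx hxc
    have h1 : q ^ (2 * n + 1) * x * (q ^ (2 * n + 1))⁻¹ =
        q ^ (2 * n) * (q * x * q⁻¹) * (q ^ (2 * n))⁻¹ := by
      rw [pow_succ, mul_inv_rev]
      simp only [mul_assoc]
    rw [h1, ResidueValuation.res_conj_pow_two_mul hq0 hqq n (hx.conj hq0) (hcq x hx hxc)]
  obtain ⟨ϖ, -, hϖ0, hϖ1⟩ := exists_uniformizer O k
  set π := algebraMap k A (algebraMap O k ϖ) with hπ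
  have hπ0 : π ≠ 0 := (map_ne_zero _).2 hϖ0
  have hπo : W.ord π = e := by rw [hπ, hW, ord_algebraMap hϖ0, hϖ1, mul_one]
  have hπt : ∀ x, π⁻¹ * x * π = x := fun x => by
    rw [mul_assoc, ← Algebra.commutes, inv_mul_cancel_left₀ hπ0]
  by_cases htriv : ∀ x, W.ge 0 x → W.res x ∈ Subring.center (ResidueAlg O k A) →
      W.res (q * x * q⁻¹) = W.res x
  · left
    have htriv' : ∀ x, W.ge 0 x → W.res x ∈ Subring.center (ResidueAlg O k A) →
        W.res (p * x * p⁻¹) = W.res x := fun x hx hxc => by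
      have h1 := W.res_conj_eq_of_ord_eq (Q := p) (Q' := p) hp hp rfl hx
      obtain ⟨ψ, hψ⟩ := W.exists_residue_conj hp
      have h3 := hψ _ (hx.conj hq0)
      rw [htriv x hx hxc, hψ x hx] at h3
      rw [h3]
      congr 1
      simp only [hq, inv_inv, mul_assoc, mul_inv_cancel₀ hp, mul_one, mul_inv_cancel_left₀ hp]
    have h := finrank_center_mul_ramIndex_div h2 hcen hσ1 hσ hτ hτ1 one_pos (one_mul e).symm hp
      (by exact_mod_cast hp1) htriv' fun Q _ i _ hi => absurd (one_dvd i) hi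
    exact ⟨Nat.eq_one_of_mul_eq_one_right h, Nat.eq_one_of_mul_eq_one_left h⟩
  · right
    push Not at htriv
    obtain ⟨x, hx, hxc, hne⟩ := htriv
    have hnon : ∀ Q : A, Q ≠ 0 → ∀ i : ℕ, W.ord Q = i → ¬ 2 ∣ i →
        ∃ x, W.ge 0 x ∧ W.res x ∈ Subring.center (ResidueAlg O k A) ∧
          W.res (Q⁻¹ * x * Q) ≠ W.res x := by
      intro Q hQ i hi h2i
      obtain ⟨n, rfl⟩ := Nat.odd_iff.2 (Nat.two_dvd_ne_zero.1 h2i)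
      exact ⟨x, hx, hxc, by rwa [hconj Q hQ _ hi x hx hxc, hodd n x hx hxc]⟩
    have he2 : 2 ∣ e := by
      by_contra h
      obtain ⟨y, _, _, hy⟩ := hnon π hπ0 e hπo h
      exact hy (by rw [hπt])
    obtain ⟨f, hf⟩ := he2
    have hpp : ∀ x, W.ge 0 x → W.res x ∈ Subring.center (ResidueAlg O k A) →
        W.res (p ^ 2 * x * (p ^ 2)⁻¹) = W.res x := fun x hx hxc => by
      obtain ⟨ψ, hψ⟩ := W.exists_residue_conj (pow_ne_zero 2 hp)
      have h3 := hψ _ ((hx.conj hq0).conj hq0)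
      rw [hqq x hx hxc, hψ x hx] at h3
      rw [h3]
      congr 1
      simp only [hq, inv_inv, mul_assoc, pow_two, mul_inv_rev, mul_inv_cancel₀ hp, mul_one,
        mul_inv_cancel_left₀ hp]
    have h := finrank_center_mul_ramIndex_div h2 hcen hσ1 hσ hτ hτ1 two_pos hf (pow_ne_zero 2 hp)
      (by rw [W.ord_pow hp, hp1]; rfl) hpp hnon
    set z := Module.finrank (IsLocalRing.ResidueField O)
      (Subalgebra.center (IsLocalRing.ResidueField O) (ResidueAlg O k A)) with hz
    have hz1 : z ≠ 1 := fun hz1 => by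
      obtain ⟨a, ha⟩ := exists_algebraMap_of_finrank_center_eq_one (hz ▸ hz1) hxc
      apply hne
      rw [← hφ x hx, ha, hφ _ (ge_algebraMap_integer a), ← Algebra.commutes,
        mul_inv_cancel_right₀ hq0]
    have hfz : f = 1 ∧ z = 2 := by
      have hzd : z ∣ 2 := Dvd.intro_left _ h
      have hz2 : z = 2 := ((Nat.dvd_prime Nat.prime_two).1 hzd).resolve_left hz1
      rw [hz2] at h
      exact ⟨by omega, hz2⟩
    refine ⟨by omega, hfz.2, fun p' hp'0 hp' => ?_⟩
    exact hnon p' hp'0 1 (by exact_mod_cast hp') (by norm_num)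

/-- A central division algebra with an involution of the first kind over a complete discretely valued
field of residue characteristic not two is either unramified with central residue algebra, or it has
ramification index two and its residue algebra has a quadratic centre, on which uniformizers act
nontrivially. -/
theorem ramIndex_eq_one_or_two [Algebra.IsCentral k A] (h2 : (2 : IsLocalRing.ResidueField O) ≠ 0)
    {σ : RingInvo A} (hσ1 : IsFirstKind σ) :
    (ramIndex O k A = 1 ∧ Module.finrank (IsLocalRing.ResidueField O)
      (Subalgebra.center (IsLocalRing.ResidueField O) (ResidueAlg O k A)) = 1) ∨
    (ramIndex O k A = 2 ∧ Module.finrank (IsLocalRing.ResidueField O)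
      (Subalgebra.center (IsLocalRing.ResidueField O) (ResidueAlg O k A)) = 2 ∧
      ∀ p : A, p ≠ 0 → (residueValuation O k A).ord p = 1 → ∃ x, (residueValuation O k A).ge 0 x ∧
        (residueValuation O k A).res x ∈ Subring.center (ResidueAlg O k A) ∧
        (residueValuation O k A).res (p⁻¹ * x * p) ≠ (residueValuation O k A).res x) := by
  set W := residueValuation O k A with hW
  have h2B := two_ne_zero_residueAlg k A h2
  have h2k := two_ne_zero_of_residueField k k h2
  have hσ : ∀ c, (σ (algebraMap k A c)).unop = algebraMap k A c := fun c => hσ1 _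
    (Subring.mem_center_iff.2 fun x => (Algebra.commutes c x).symm)
  have hcen : Module.finrank k (Subalgebra.center k A) = 1 := by
    rw [Algebra.IsCentral.center_eq_bot]
    exact Subalgebra.finrank_bot
  have hord : ∀ x, W.ord (σ x).unop = W.ord x := residueValuation_ord_unop hσ
  choose Q hQ hQo δ hδ using fun i : ℕ => W.exists_unop_eq_smul_of_ord h2B hord i
  choose τ hτ using fun i => exists_residue_invo_conj O k hσ (hQ i) (hδ i)
  have hsum := signature_eq_sum h2 hσ hQ hQo hδ hτ
  obtain ⟨d, hd, hdim, habs⟩ := abs_signature h2k hσ1 hσ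
  rw [hcen, Nat.cast_one, one_mul] at habs
  have hne0 : signature σ hσ ≠ 0 := fun h => by
    rw [h, abs_zero] at habs
    omega
  rw [hsum] at hne0
  -- The total signature is nonzero, so some graded piece has nonzero signature and its residue
  -- involution is of the first kind. Conjugating σ by the corresponding Q i moves this piece to
  -- degree 0.
  obtain ⟨i, -, hi⟩ := Finset.exists_ne_zero_of_sum_ne_zero hne0
  have hτi : IsFirstKind (τ i) := fun z hz => by
    by_contra hne
    rw [signature_eq_zero hz hne, mul_zero] at hi
    exact hi rfl
  have hδ' : (σ (Q i)⁻¹).unop = (δ i : ℤ) • (Q i)⁻¹ := by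
    rw [RingInvo.unop_inv, hδ]
    rcases Int.units_eq_one_or (δ i) with h | h <;> rw [h]
    · simp
    · simp [inv_neg]
  have happ : ∀ x, (σ.conj (Q i)⁻¹ (inv_ne_zero (hQ i)) (δ i) hδ' x).unop =
      (Q i)⁻¹ * (σ x).unop * Q i := fun x => by rw [RingInvo.conj_apply, inv_inv]
  have hfirst : IsFirstKind (σ.conj (Q i)⁻¹ (inv_ne_zero (hQ i)) (δ i) hδ') := hσ1.conj
  exact ramIndex_eq_one_or_two_of_residue h2 hcen hfirst
    (fun c => hfirst _ (Subring.mem_center_iff.2 fun x => (Algebra.commutes c x).symm))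
    (fun x hx => by rw [happ]; exact hτ i x hx) hτi

end Dichotomy

/-! ### Square-root generators of quadratic field extensions. -/

section SqrtGenerator

variable {F A : Type*} [Field F] [Ring A] [Algebra F A]

theorem mem_adjoin_singleton_iff_of_mul_self {a : A} {c : F} (ha : a * a = algebraMap F A c) {s : A} :
    s ∈ Algebra.adjoin F {a} ↔ ∃ x y : F, s = algebraMap F A x + y • a := by
  constructor
  · intro hs
    induction hs using Algebra.adjoin_induction with
    | mem s hs => exact ⟨0, 1, by rw [map_zero, zero_add, one_smul]; exact hs⟩
    | algebraMap r => exact ⟨r, 0, by rw [zero_smul, add_zero]⟩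
    | add s t _ _ hs ht =>
      obtain ⟨x, y, rfl⟩ := hs
      obtain ⟨x', y', rfl⟩ := ht
      exact ⟨x + x', y + y', by rw [map_add, add_smul]; abel⟩
    | mul s t _ _ hs ht =>
      obtain ⟨x, y, rfl⟩ := hs
      obtain ⟨x', y', rfl⟩ := ht
      refine ⟨x * x' + y * y' * c, x * y' + y * x', ?_⟩
      have h1 : (y • a) * (y' • a) = algebraMap F A (y * y' * c) := by
        rw [smul_mul_smul_comm, ha, map_mul _ (y * y'), Algebra.smul_def]
      have h2 : (y • a) * algebraMap F A x' = (y * x') • a := by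
        rw [← Algebra.commutes, ← Algebra.smul_def, smul_smul, mul_comm]
      rw [mul_add, add_mul, add_mul, h1, h2, ← Algebra.smul_def, ← Algebra.smul_def, smul_smul,
        map_add, Algebra.smul_def x, ← map_mul, add_smul]
      abel
  · rintro ⟨x, y, rfl⟩
    exact add_mem (algebraMap_mem _ _)
      (Subalgebra.smul_mem _ (Algebra.subset_adjoin (Set.mem_singleton a)) _)

theorem IsSqrtGenerator.mem {S : Subalgebra F A} {a : A} (h : IsSqrtGenerator S a) : a ∈ S := by
  obtain ⟨c, -, -, rfl⟩ := h
  exact Algebra.subset_adjoin (Set.mem_singleton a)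

theorem IsSqrtGenerator.mem_iff {S : Subalgebra F A} {a : A} (h : IsSqrtGenerator S a) {s : A} :
    s ∈ S ↔ ∃ x y : F, s = algebraMap F A x + y • a := by
  obtain ⟨c, -, hc, rfl⟩ := h
  exact mem_adjoin_singleton_iff_of_mul_self hc

theorem IsSqrtGenerator.notMem_range [Nontrivial A] {S : Subalgebra F A} {a : A}
    (h : IsSqrtGenerator S a) (x : F) : a ≠ algebraMap F A x := by
  rintro rfl
  obtain ⟨c, hc, h, -⟩ := h
  rw [← map_mul] at h
  exact hc ⟨x, (algebraMap F A).injective h.symm⟩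

theorem eq_zero_of_algebraMap_add_smul [Nontrivial A] {a : A} (ha : ∀ x : F, a ≠ algebraMap F A x)
    {x y : F} (h : algebraMap F A x + y • a = 0) : x = 0 ∧ y = 0 := by
  have hy : y = 0 := by
    by_contra hy
    refine ha (-(y⁻¹ * x)) ?_
    have h1 := congrArg (fun z => y⁻¹ • z) h
    simp only [smul_add, smul_smul, inv_mul_cancel₀ hy, one_smul, smul_zero] at h1
    rw [map_neg, map_mul, ← Algebra.smul_def]
    exact eq_neg_of_add_eq_zero_right h1
  rw [hy, zero_smul, add_zero] at h
  exact ⟨(algebraMap F A).injective (by rw [h, map_zero]), hy⟩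

/-- A quadratic extension in characteristic not two is generated by a square root. -/
theorem exists_isSqrtGenerator {A : Type*} [DivisionRing A] [Algebra F A] (h2 : (2 : F) ≠ 0)
    {S : Subalgebra F A} (hS : Module.finrank F S = 2) : ∃ a, IsSqrtGenerator S a := by
  have hfin : FiniteDimensional F S := FiniteDimensional.of_finrank_eq_succ hS
  obtain ⟨y, hyS, hy⟩ : ∃ y ∈ S, ∀ x : F, y ≠ algebraMap F A x := by
    by_contra! h
    have h1 : S = ⊥ := by
      rw [eq_bot_iff]
      intro y hy
      obtain ⟨x, rfl⟩ := h y hy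
      exact algebraMap_mem _ _
    rw [h1, Subalgebra.finrank_bot] at hS
    omega
  have hli : LinearIndependent F ![(1 : S), ⟨y, hyS⟩] := by
    rw [LinearIndependent.pair_iff]
    intro s t hst
    have h1 := congrArg Subtype.val hst
    refine eq_zero_of_algebraMap_add_smul hy (?_ : algebraMap F A s + t • y = 0)
    rw [Algebra.algebraMap_eq_smul_one]
    exact h1
  let b := basisOfLinearIndependentOfCardEqFinrank hli (by rw [hS]; rfl)
  have hspan : ∀ s ∈ S, ∃ x z : F, s = algebraMap F A x + z • y := fun s hs => by
    have h1 := b.sum_repr ⟨s, hs⟩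
    rw [Fin.sum_univ_two] at h1
    have hb0 : b 0 = 1 := by simp [b]
    have hb1 : b 1 = ⟨y, hyS⟩ := by simp [b]
    rw [hb0, hb1] at h1
    refine ⟨b.repr ⟨s, hs⟩ 0, b.repr ⟨s, hs⟩ 1, ?_⟩
    rw [Algebra.algebraMap_eq_smul_one]
    exact (congrArg Subtype.val h1).symm
  obtain ⟨u, v, huv⟩ := hspan (y * y) (mul_mem hyS hyS)
  have h2' : (2 : F) * (v / 2) = v := by field_simp
  set w := v / 2
  set a := y - algebraMap F A w with ha
  have hya : y = a + algebraMap F A w := by rw [ha, sub_add_cancel]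
  have hane : ∀ x : F, a ≠ algebraMap F A x := fun x hx => hy (x + w) (by
    rw [hya, hx, map_add])
  have haS : a ∈ S := sub_mem hyS (algebraMap_mem _ _)
  have hwa : algebraMap F A w * y = y * algebraMap F A w := Algebra.commutes _ _
  have haa : a * a = algebraMap F A (u + w * w) := by
    rw [ha, sub_mul, mul_sub, mul_sub, huv, ← hwa, map_add, map_mul, Algebra.smul_def, ← h2',
      two_mul, map_add, add_mul]
    abel
  refine ⟨a, u + w * w, ?_, haa, le_antisymm ?_ fun s hs => ?_⟩
  · rintro ⟨r, hr⟩
    rw [hr, map_mul] at haa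
    have h3 : (a - algebraMap F A r) * (a + algebraMap F A r) = 0 := by
      rw [sub_mul, mul_add, mul_add, haa, Algebra.commutes r a]
      abel
    rcases mul_eq_zero.1 h3 with h | h
    · exact hane r (sub_eq_zero.1 h)
    · exact hane (-r) (by rw [map_neg]; exact eq_neg_of_add_eq_zero_left h)
  · exact Algebra.adjoin_le (Set.singleton_subset_iff.2 haS)
  · obtain ⟨x, z, rfl⟩ := hspan s hs
    rw [mem_adjoin_singleton_iff_of_mul_self haa]
    refine ⟨x + z * w, z, ?_⟩
    rw [hya, smul_add, map_add, map_mul, Algebra.smul_def z (algebraMap F A w)]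
    abel

/-- The nontrivial automorphism of a quadratic extension. -/
theorem IsSqrtGenerator.exists_conj {K : Type*} [Field K] [Algebra F K] {a : K}
    (h : IsSqrtGenerator (⊤ : Subalgebra F K) a) : ∃ g : K →ₐ[F] K, g a = -a := by
  have hne := h.notMem_range
  have hex : ∀ s : K, ∃ x y : F, s = algebraMap F K x + y • a := fun s => h.mem_iff.1 Algebra.mem_top
  obtain ⟨c, -, hc, -⟩ := h
  choose x y hxy using hex
  have huniq : ∀ {s : K} {x' y' : F}, s = algebraMap F K x' + y' • a → x s = x' ∧ y s = y' := by
    intro s x' y' hs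
    have h1 : algebraMap F K (x s - x') + (y s - y') • a = 0 := by
      rw [map_sub, sub_smul, sub_add_sub_comm, ← hxy, ← hs, sub_self]
    have h2 := eq_zero_of_algebraMap_add_smul hne h1
    exact ⟨sub_eq_zero.1 h2.1, sub_eq_zero.1 h2.2⟩
  have hval : ∀ x' y' : F, algebraMap F K (x (algebraMap F K x' + y' • a)) -
      y (algebraMap F K x' + y' • a) • a = algebraMap F K x' - y' • a := fun x' y' => by
    obtain ⟨h1, h2⟩ := huniq (rfl : algebraMap F K x' + y' • a = _)
    rw [h1, h2]
  have hof : ∀ r : F, algebraMap F K (x (algebraMap F K r)) - y (algebraMap F K r) • a =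
      algebraMap F K r := fun r => by
    have h1 := hval r 0
    rwa [zero_smul, add_zero, sub_zero] at h1
  refine ⟨AlgHom.mk (RingHom.mk (MonoidHom.mk (OneHom.mk
    (fun s => algebraMap F K (x s) - y s • a) ?_) ?_) ?_ ?_) ?_, ?_⟩
  · have h1 := hof 1
    rwa [map_one] at h1
  · intro s s'
    change algebraMap F K (x (s * s')) - y (s * s') • a =
      (algebraMap F K (x s) - y s • a) * (algebraMap F K (x s') - y s' • a)
    have h1 : s * s' = algebraMap F K (x s * x s' + y s * y s' * c) +
        (x s * y s' + y s * x s') • a := by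
      nth_rewrite 1 [hxy s, hxy s']
      simp only [Algebra.smul_def, map_add, map_mul]
      linear_combination algebraMap F K (y s) * algebraMap F K (y s') * hc
    rw [h1, hval]
    simp only [Algebra.smul_def, map_add, map_mul]
    linear_combination -(algebraMap F K (y s) * algebraMap F K (y s')) * hc
  · have h1 := hof 0
    rwa [map_zero] at h1
  · intro s s'
    change algebraMap F K (x (s + s')) - y (s + s') • a =
      (algebraMap F K (x s) - y s • a) + (algebraMap F K (x s') - y s' • a)
    have h1 : s + s' = algebraMap F K (x s + x s') + (y s + y s') • a := by
      nth_rewrite 1 [hxy s, hxy s']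
      rw [map_add, add_smul]
      ring
    rw [h1, hval, map_add, add_smul]
    ring
  · exact hof
  · change algebraMap F K (x a) - y a • a = -a
    have h1 := hval 0 1
    rwa [map_zero, zero_add, one_smul, zero_sub] at h1

end SqrtGenerator

/-! ### Valuations and residues in quadratic extensions of division algebras. -/

section QuadraticExtension

/-- `A = B ⊕ B t` with `t` commuting with `B`, with square `c ∈ k`, and `ι` is the automorphism of `A`
that fixes `B` and maps `t` to `-t`. -/
structure IsQuadraticExtension {k A B : Type*} [Field k] [Ring A] [Algebra k A] [Ring B] [Algebra k B]
    (i : B →ₐ[k] A) (t : A) (c : k) (ι : A →ₐ[k] A) : Prop where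
  ne_zero : t ≠ 0
  comm : ∀ b, i b * t = t * i b
  mul_self : t * t = algebraMap k A c
  map_left : ∀ b, ι (i b) = i b
  map_gen : ι t = -t
  exists_eq : ∀ x, ∃ a b, x = i a + i b * t

variable {O k : Type*} [CommRing O] [IsDomain O] [IsDiscreteValuationRing O]
  [IsAdicComplete (IsLocalRing.maximalIdeal O) O] [Field k] [Algebra O k] [IsFractionRing O k]
  {A : Type*} [DivisionRing A] [Algebra k A] [FiniteDimensional k A]
  {B : Type*} [DivisionRing B] [Algebra k B] [FiniteDimensional k B]
  {i : B →ₐ[k] A} {t : A} {c : k} {ι : A →ₐ[k] A}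

namespace IsQuadraticExtension

theorem ι_ι (h : IsQuadraticExtension i t c ι) (x : A) : ι (ι x) = x := by
  obtain ⟨a, b, rfl⟩ := h.exists_eq x
  simp [h.map_left, h.map_gen]

theorem ne_zero_base (h : IsQuadraticExtension i t c ι) : c ≠ 0 := fun hc => by
  have h1 := h.mul_self
  rw [hc, map_zero, mul_self_eq_zero] at h1
  exact h.ne_zero h1

theorem commute_gen (h : IsQuadraticExtension i t c ι) (x : A) : x * t = t * x := by
  obtain ⟨a, b, rfl⟩ := h.exists_eq x
  rw [add_mul, mul_add, h.comm, ← mul_assoc, h.comm]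

theorem ord_ι (h : IsQuadraticExtension i t c ι) (x : A) :
    (residueValuation O k A).ord (ι x) = (residueValuation O k A).ord x := by
  by_cases hx : x = 0
  · rw [hx, map_zero]
  obtain ⟨e, he, hord⟩ := exists_ord_map_eq_mul (O := O) ι
  obtain ⟨p, hp, hp1⟩ := (residueValuation O k A).exists_ord_eq_one
  have h1 := hord (ι p) ((map_ne_zero ι).2 hp)
  rw [h.ι_ι, hord p hp, hp1] at h1
  have he1 : e = 1 := by nlinarith
  rw [hord x hx, he1, one_mul]

/-- The components of x are half the sum and half the difference of x and ι(x); ι preserves the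
valuation and 2 is a unit. -/
theorem ge_components (h : IsQuadraticExtension i t c ι) (h2 : (2 : IsLocalRing.ResidueField O) ≠ 0)
    {n : ℤ} {a b : B} (hx : (residueValuation O k A).ge n (i a + i b * t)) :
    (residueValuation O k A).ge n (i a) ∧ (residueValuation O k A).ge n (i b * t) := by
  set W := residueValuation O k A with hW
  have h2A := two_ne_zero_residueAlg k A h2
  have h2' := two_ne_zero_of_residueField k A h2
  have hι : W.ge n (ι (i a + i b * t)) := by
    rcases hx with hx | hx
    · exact Or.inl (by rw [hx, map_zero])
    · exact Or.inr (by rw [hW, h.ord_ι]; exact hx)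
  have h3 : ι (i a + i b * t) = i a - i b * t := by
    rw [map_add, map_mul, h.map_left, h.map_left, h.map_gen, mul_neg, sub_eq_add_neg]
  rw [h3] at hι
  have h4 : i a = (2 : A)⁻¹ * ((i a + i b * t) + (i a - i b * t)) := by
    rw [add_add_sub_cancel, ← two_mul, inv_mul_cancel_left₀ h2']
  have h5 : i b * t = (2 : A)⁻¹ * ((i a + i b * t) - (i a - i b * t)) := by
    rw [add_sub_sub_cancel, ← two_mul, inv_mul_cancel_left₀ h2']
  exact ⟨h4 ▸ (hx.add hι).two_inv h2A, h5 ▸ (hx.sub hι).two_inv h2A⟩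

/-- The values of B and of t generate ℤ: an element of valuation 1 has components of valuation at
least 1, and not both can reach 2. -/
theorem isUnit_of_dvd (h : IsQuadraticExtension i t c ι) (h2 : (2 : IsLocalRing.ResidueField O) ≠ 0)
    {e g : ℤ}
    (he : ∀ b, b ≠ 0 → (residueValuation O k A).ord (i b) = e * (residueValuation O k B).ord b)
    (hge : g ∣ e) (hgt : g ∣ (residueValuation O k A).ord t) : g ∣ 1 := by
  set W := residueValuation O k A with hW
  obtain ⟨x, hx0, hx⟩ := W.exists_ord_eq_one
  obtain ⟨a, b, rfl⟩ := h.exists_eq x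
  obtain ⟨ha, hb⟩ := h.ge_components (O := O) h2 (W.ge_ord _)
  rw [← hW, hx] at ha hb
  have hdiv : ∀ y : A, y ≠ 0 → W.ge 1 y → g ∣ W.ord y → ¬ g ∣ 1 → W.ge 2 y := fun y hy hy1 hg hn => by
    right
    have h1 := hy1.le hy
    rcases eq_or_lt_of_le h1 with h3 | h3
    · exact absurd (h3 ▸ hg) hn
    · omega
  by_contra hn
  have ha2 : W.ge 2 (i a) := by
    by_cases ha0 : a = 0
    · exact Or.inl (by rw [ha0, map_zero])
    · exact hdiv _ ((map_ne_zero i).2 ha0) ha (by rw [he a ha0]; exact hge.mul_right _) hn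
  have hb2 : W.ge 2 (i b * t) := by
    by_cases hb0 : b = 0
    · exact Or.inl (by rw [hb0, map_zero, zero_mul])
    · refine hdiv _ (mul_ne_zero ((map_ne_zero i).2 hb0) h.ne_zero) hb ?_ hn
      rw [W.ord_mul _ _ ((map_ne_zero i).2 hb0) h.ne_zero, he b hb0]
      exact dvd_add (hge.mul_right _) hgt
  have := (ha2.add hb2).le hx0
  omega

/-- The ramification of a quadratic extension in terms of the valuation of the square of the
generator. -/
theorem exists_ord (h : IsQuadraticExtension i t c ι) (h2 : (2 : IsLocalRing.ResidueField O) ≠ 0) :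
    ∃ e : ℤ, 0 < e ∧
      (∀ b, b ≠ 0 → (residueValuation O k A).ord (i b) = e * (residueValuation O k B).ord b) ∧
      2 * (residueValuation O k A).ord t = e * (residueValuation O k B).ord (algebraMap k B c) ∧
      ((residueValuation O k B).ord (algebraMap k B c) = 0 →
        e = 1 ∧ (residueValuation O k A).ord t = 0) ∧
      ((residueValuation O k B).ord (algebraMap k B c) = 1 →
        e = 2 ∧ (residueValuation O k A).ord t = 1) ∧
      ((residueValuation O k B).ord (algebraMap k B c) = 2 →
        e = 1 ∧ (residueValuation O k A).ord t = 1) := by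
  set W := residueValuation O k A with hW
  obtain ⟨e, he, hord⟩ := exists_ord_map_eq_mul (O := O) i
  have hc := h.ne_zero_base
  have key : 2 * W.ord t = e * (residueValuation O k B).ord (algebraMap k B c) := by
    have h1 := W.ord_mul t t h.ne_zero h.ne_zero
    rw [h.mul_self, ← i.commutes, hord _ ((map_ne_zero _).2 hc)] at h1
    rw [h1, two_mul]
  -- Each case below follows from 2·ord(t) = e·ord(c) and the coprimality of e and ord(t).
  have hdvd := fun g => h.isUnit_of_dvd (O := O) h2 (g := g) hord
  refine ⟨e, he, hord, key, fun h0 => ?_, fun h0 => ?_, fun h0 => ?_⟩ <;> rw [h0] at key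
  · have h1 : W.ord t = 0 := by omega
    exact ⟨Int.eq_one_of_dvd_one he.le (hdvd e dvd_rfl (h1 ▸ dvd_zero e)), h1⟩
  · have h3 : 0 ≤ W.ord t := by omega
    have h1 : W.ord t = 1 := Int.eq_one_of_dvd_one h3
      (hdvd (W.ord t) (Dvd.intro_left 2 (by omega)) dvd_rfl)
    exact ⟨by omega, h1⟩
  · have h3 : e * 1 = W.ord t := by omega
    have h1 : e = 1 := Int.eq_one_of_dvd_one he.le (hdvd e dvd_rfl (Dvd.intro 1 h3))
    exact ⟨h1, by omega⟩

section Residue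

variable {φ : ResidueAlg O k B →+* ResidueAlg O k A}

theorem ge_zero_of_map {b : B} (hb : (residueValuation O k A).ge 0 (i b)) :
    (residueValuation O k B).ge 0 b :=
  residueValuation_ge_zero_iff.2 ((isValInteger_map_iff i).1 (residueValuation_ge_zero_iff.1 hb))

theorem ge_zero_map {b : B} (hb : (residueValuation O k B).ge 0 b) :
    (residueValuation O k A).ge 0 (i b) :=
  residueValuation_ge_zero_iff.2 ((isValInteger_map_iff i).2 (residueValuation_ge_zero_iff.1 hb))

theorem ord_inv_mul (h : IsQuadraticExtension i t c ι) {p : B} (hp : p ≠ 0)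
    (hpt : (residueValuation O k A).ord (i p) = (residueValuation O k A).ord t) :
    i p⁻¹ * t ≠ 0 ∧ (residueValuation O k A).ord (i p⁻¹ * t) = 0 := by
  have h1 : i p⁻¹ ≠ 0 := (map_ne_zero i).2 (inv_ne_zero hp)
  refine ⟨mul_ne_zero h1 h.ne_zero, ?_⟩
  rw [(residueValuation O k A).ord_mul _ _ h1 h.ne_zero, map_inv₀,
    (residueValuation O k A).ord_inv ((map_ne_zero i).2 hp), hpt]
  omega

/-- If p in B has the valuation of t, then p⁻¹t is a unit and can replace t as second basis element;
integral elements then have integral coordinates, and the decomposition descends to residues. -/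
theorem exists_components (h : IsQuadraticExtension i t c ι)
    (h2 : (2 : IsLocalRing.ResidueField O) ≠ 0) {p : B} (hp : p ≠ 0)
    (hpt : (residueValuation O k A).ord (i p) = (residueValuation O k A).ord t) {n : ℤ} {x : A}
    (hx : (residueValuation O k A).ge n x) : ∃ a b, x = i a + i b * (i p⁻¹ * t) ∧
      (residueValuation O k A).ge n (i a) ∧ (residueValuation O k A).ge n (i b) := by
  obtain ⟨a, b, rfl⟩ := h.exists_eq x
  obtain ⟨ha, hb⟩ := h.ge_components h2 hx
  have h3 : i b * t = i (b * p) * (i p⁻¹ * t) := by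
    rw [← mul_assoc, ← map_mul, mul_inv_cancel_right₀ hp]
  refine ⟨a, b * p, by rw [← h3], ha, ?_⟩
  rw [h3] at hb
  obtain ⟨h4, h5⟩ := h.ord_inv_mul hp hpt
  have h6 := hb.mul ((residueValuation O k A).ge_ord (i p⁻¹ * t)⁻¹)
  rwa [mul_inv_cancel_right₀ h4, (residueValuation O k A).ord_inv h4, h5, neg_zero, add_zero] at h6

theorem exists_residue_eq (h : IsQuadraticExtension i t c ι)
    (h2 : (2 : IsLocalRing.ResidueField O) ≠ 0)
    (hφ : ∀ x, (residueValuation O k B).ge 0 x →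
      φ ((residueValuation O k B).res x) = (residueValuation O k A).res (i x)) {p : B} (hp : p ≠ 0)
    (hpt : (residueValuation O k A).ord (i p) = (residueValuation O k A).ord t)
    (y : ResidueAlg O k A) :
    ∃ a b, y = φ a + φ b * (residueValuation O k A).res (i p⁻¹ * t) := by
  obtain ⟨x, hx, rfl⟩ := (residueValuation O k A).res_surj y
  obtain ⟨a, b, rfl, ha, hb⟩ := h.exists_components h2 hp hpt hx
  have hw := ResidueValuation.ge_of_ord_eq_zero (h.ord_inv_mul hp hpt).2
  refine ⟨(residueValuation O k B).res a, (residueValuation O k B).res b, ?_⟩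
  rw [hφ _ (ge_zero_of_map ha), hφ _ (ge_zero_of_map hb),
    (residueValuation O k A).res_add _ _ ha (hb.mul_zero_zero hw),
    (residueValuation O k A).res_mul _ _ hb hw]

theorem eq_zero_of_residue_eq_zero (h : IsQuadraticExtension i t c ι)
    (h2 : (2 : IsLocalRing.ResidueField O) ≠ 0)
    (hφ : ∀ x, (residueValuation O k B).ge 0 x →
      φ ((residueValuation O k B).res x) = (residueValuation O k A).res (i x)) {p : B} (hp : p ≠ 0)
    (hpt : (residueValuation O k A).ord (i p) = (residueValuation O k A).ord t)
    {a b : ResidueAlg O k B} (hab : φ a + φ b * (residueValuation O k A).res (i p⁻¹ * t) = 0) :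
    a = 0 ∧ b = 0 := by
  set W := residueValuation O k A with hW
  obtain ⟨x, hx, rfl⟩ := (residueValuation O k B).res_surj a
  obtain ⟨y, hy, rfl⟩ := (residueValuation O k B).res_surj b
  have hw := h.ord_inv_mul hp hpt
  have hw0 := ResidueValuation.ge_of_ord_eq_zero hw.2
  have hx' := ge_zero_map (i := i) hx
  have hy' := ge_zero_map (i := i) hy
  rw [hφ x hx, hφ y hy, ← W.res_mul _ _ hy' hw0, ← W.res_add _ _ hx' (hy'.mul_zero_zero hw0),
    W.res_eq_zero_iff _ (hx'.add (hy'.mul_zero_zero hw0)), ← mul_assoc, ← map_mul] at hab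
  have h3 : W.ge 1 (i x) ∧ W.ge 1 (i (y * p⁻¹) * t) := h.ge_components h2 hab
  have h4 : W.ge 1 (i y) := by
    have h5 := h3.2
    rw [map_mul, mul_assoc] at h5
    have h6 := h5.mul (W.ge_ord (i p⁻¹ * t)⁻¹)
    rwa [mul_inv_cancel_right₀ hw.1, W.ord_inv hw.1, hw.2] at h6
  constructor
  · rw [← map_eq_zero φ, hφ x hx, W.res_eq_zero_iff _ hx']
    exact h3.1
  · rw [← map_eq_zero φ, hφ y hy, W.res_eq_zero_iff _ hy']
    exact h4

/-- Now e = 2 and t has valuation 1, so the component bt has odd valuation; being integral, it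
reduces to 0. -/
theorem residue_surjective (h : IsQuadraticExtension i t c ι)
    (h2 : (2 : IsLocalRing.ResidueField O) ≠ 0)
    (hφ : ∀ x, (residueValuation O k B).ge 0 x →
      φ ((residueValuation O k B).res x) = (residueValuation O k A).res (i x))
    (hc : (residueValuation O k B).ord (algebraMap k B c) = 1) : Function.Surjective φ := fun y => by
  set W := residueValuation O k A with hW
  obtain ⟨e, -, hord, -, -, he, -⟩ := h.exists_ord h2
  obtain ⟨rfl, ht⟩ := he hc
  obtain ⟨x, hx, rfl⟩ := W.res_surj y
  obtain ⟨a, b, rfl⟩ := h.exists_eq x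
  have h3 : W.ge 0 (i a) ∧ W.ge 0 (i b * t) := h.ge_components h2 hx
  have h4 : W.ge 1 (i b * t) := by
    by_cases hb0 : b = 0
    · exact Or.inl (by rw [hb0, map_zero, zero_mul])
    have h5 := h3.2.le (mul_ne_zero ((map_ne_zero i).2 hb0) h.ne_zero)
    right
    rw [W.ord_mul _ _ ((map_ne_zero i).2 hb0) h.ne_zero, hord b hb0, ht] at h5 ⊢
    omega
  refine ⟨(residueValuation O k B).res a, ?_⟩
  rw [hφ a (ge_zero_of_map h3.1), W.res_add _ _ h3.1 h3.2, (W.res_eq_zero_iff _ h3.2).2 h4, add_zero]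

end Residue

end IsQuadraticExtension

end QuadraticExtension

/-! ### Transport of unitary invariants along isomorphisms. -/

section Transport

/-- Transport of an involution along an isomorphism. -/
def RingInvo.comap {A B : Type*} [Ring A] [Ring B] (e : A ≃+* B) (σ : RingInvo B) : RingInvo A :=
  RingInvo.ofFun (fun x => e.symm (σ (e x)).unop)
    (fun x y => by rw [map_add, RingInvo.unop_add, map_add])
    (fun x y => by rw [map_mul, RingInvo.unop_mul, map_mul])
    (fun x => by rw [e.apply_symm_apply, RingInvo.involution, e.symm_apply_apply])

theorem RingInvo.comap_apply {A B : Type*} [Ring A] [Ring B] (e : A ≃+* B) (σ : RingInvo B) (x : A) :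
    (RingInvo.comap e σ x).unop = e.symm (σ (e x)).unop := rfl

theorem RingEquiv.mem_center_iff {A B : Type*} [Ring A] [Ring B] (e : A ≃+* B) {x : A} :
    e x ∈ Subring.center B ↔ x ∈ Subring.center A := by
  rw [Subring.mem_center_iff, Subring.mem_center_iff]
  refine ⟨fun h y => e.injective (by rw [map_mul, map_mul, h]), fun h y => ?_⟩
  rw [← e.apply_symm_apply y, ← map_mul, ← map_mul, h]

theorem IsUnitaryOver.comap {A B : Type*} [Ring A] [Ring B] (e : A ≃+* B) {σ : RingInvo B}
    {F : Subring B} {F' : Subring A} (hF : ∀ x, x ∈ F' ↔ e x ∈ F) (h : IsUnitaryOver F σ) :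
    IsUnitaryOver F' (RingInvo.comap e σ) := by
  constructor
  · intro h1
    refine h.1 fun z hz => ?_
    have h2 := h1 (e.symm z) (e.symm.mem_center_iff.2 hz)
    rw [RingInvo.comap_apply, e.apply_symm_apply] at h2
    exact e.symm.injective h2
  · intro z
    rw [hF, h.2, e.mem_center_iff, RingInvo.comap_apply, RingEquiv.symm_apply_eq]

/-- Only the target is a division ring by hypothesis: the intended source is a tensor product of
residue algebras, which inherits this property from the isomorphism. -/
theorem IsUZero.comap {A B : Type*} [Ring A] [DivisionRing B] (e : A ≃+* B)
    {F : Subring B} {F' : Subring A} (hF : ∀ x, x ∈ F' ↔ e x ∈ F) {n : ℕ∞} (h : IsUZero F n) :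
    IsUZero F' n := by
  obtain ⟨⟨σ, hσ⟩, h⟩ := h
  have : Nontrivial A := e.toEquiv.nontrivial
  letI : DivisionRing A := DivisionRing.ofIsUnitOrEqZero fun a => by
    by_cases ha : a = 0
    · exact Or.inr ha
    · exact Or.inl ((MulEquiv.isUnit_map e).1 (isUnit_iff_ne_zero.2 ((map_ne_zero_iff e e.injective).2 ha)))
  refine ⟨⟨_, hσ.comap e hF⟩, fun τ hτ ε => ?_⟩
  rw [← h _ (hτ.comap e.symm (F' := F) fun x => by rw [hF, e.apply_symm_apply]) ε]
  exact uInv_eq_uInv_of_ringEquiv e (fun x => by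
    rw [RingInvo.comap_apply, e.symm_apply_apply]; rfl) ε

end Transport

/-! ### Recognizing the fixed field of a unitary involution. -/

section Unitary

/-- An involution is unitary over a subring of symmetric central elements if the centre is generated
over it by a skew-symmetric element. -/
theorem isUnitaryOver_of_center {A : Type*} [DivisionRing A] (h2 : (2 : A) ≠ 0) {S : Subring A}
    {τ : RingInvo A} (hS : ∀ x ∈ S, x ∈ Subring.center A ∧ (τ x).unop = x) {δ : A} (hδ0 : δ ≠ 0)
    (hδc : δ ∈ Subring.center A) (hδ : (τ δ).unop = -δ)
    (hgen : ∀ z ∈ Subring.center A, ∃ x ∈ S, ∃ y ∈ S, z = x + y * δ) : IsUnitaryOver S τ := by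
  have hne : ∀ x : A, x = -x → x = 0 := fun x hx => by
    have h3 : 2 * x = 0 := by
      rw [two_mul]
      nth_rewrite 1 [hx]
      exact neg_add_cancel x
    exact (mul_eq_zero.1 h3).resolve_left h2
  refine ⟨fun h => hδ0 (hne δ ((h δ hδc).symm.trans hδ)), fun z => ⟨hS z, fun hz => ?_⟩⟩
  obtain ⟨x, hx, y, hy, rfl⟩ := hgen z hz.1
  have h3 := hz.2
  rw [RingInvo.unop_add, RingInvo.unop_mul, hδ, (hS x hx).2, (hS y hy).2, neg_mul,
    Subring.mem_center_iff.1 (hS y hy).1 δ, add_right_inj] at h3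
  rw [hne _ h3.symm, add_zero]
  exact hx

variable {F A B L : Type*} [Field F] [DivisionRing A] [Algebra F A] [DivisionRing B] [Algebra F B]
  {φ : B →ₐ[F] A} {w : A}

/-- Compare components in the commutators with the elements of B. -/
theorem mem_center_of_add_mul (hcomm : ∀ b, φ b * w = w * φ b)
    (huniq : ∀ {a b}, φ a + φ b * w = 0 → a = 0 ∧ b = 0) {a b : B}
    (h : φ a + φ b * w ∈ Subring.center A) : a ∈ Subring.center B ∧ b ∈ Subring.center B := by
  have key : ∀ c, c * a - a * c = 0 ∧ c * b - b * c = 0 := fun c => huniq (by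
    have h1 := Subring.mem_center_iff.1 h (φ c)
    rw [map_sub, map_sub, map_mul, map_mul, map_mul, map_mul, sub_mul, mul_assoc (φ b), hcomm c,
      sub_add_sub_comm, sub_eq_zero, ← mul_assoc, mul_assoc (φ c), ← mul_add, ← add_mul, h1])
  exact ⟨Subring.mem_center_iff.2 fun c => sub_eq_zero.1 (key c).1,
    Subring.mem_center_iff.2 fun c => sub_eq_zero.1 (key c).2⟩

theorem map_mem_center (hcomm : ∀ b, φ b * w = w * φ b) (hex : ∀ y, ∃ a b, y = φ a + φ b * w) {b : B}
    (hb : b ∈ Subring.center B) : φ b ∈ Subring.center A := Subring.mem_center_iff.2 fun y => by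
  obtain ⟨a, c, rfl⟩ := hex y
  rw [add_mul, mul_add, ← map_mul, ← map_mul, mul_assoc, ← hcomm, ← mul_assoc, ← mul_assoc,
    ← map_mul, ← map_mul, Subring.mem_center_iff.1 hb, Subring.mem_center_iff.1 hb]

theorem gen_mem_center (hcomm : ∀ b, φ b * w = w * φ b) (hex : ∀ y, ∃ a b, y = φ a + φ b * w) :
    w ∈ Subring.center A := Subring.mem_center_iff.2 fun y => by
  obtain ⟨a, c, rfl⟩ := hex y
  rw [add_mul, mul_add, hcomm, ← mul_assoc, hcomm]

theorem algebraMap_mem_center (x : F) : algebraMap F A x ∈ Subring.center A :=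
  Subring.mem_center_iff.2 fun y => (Algebra.commutes x y).symm

theorem isUnitaryOver_range (h2 : (2 : F) ≠ 0) (hcomm : ∀ b, φ b * w = w * φ b)
    (hex : ∀ y, ∃ a b, y = φ a + φ b * w) (huniq : ∀ {a b}, φ a + φ b * w = 0 → a = 0 ∧ b = 0)
    (hcen : ∀ b ∈ Subring.center B, ∃ x, b = algebraMap F B x) {τ : RingInvo A}
    (hτF : ∀ x, (τ (algebraMap F A x)).unop = algebraMap F A x) (hτw : (τ w).unop = -w)
    (hw : w ≠ 0) : IsUnitaryOver (algebraMap F A).range τ := by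
  have h2A : (2 : A) ≠ 0 := by
    rw [← map_ofNat (algebraMap F A)]
    exact (map_ne_zero _).2 h2
  refine isUnitaryOver_of_center h2A ?_ hw (gen_mem_center hcomm hex) hτw fun z hz => ?_
  · rintro _ ⟨x, rfl⟩
    exact ⟨algebraMap_mem_center x, hτF x⟩
  · obtain ⟨a, b, rfl⟩ := hex z
    obtain ⟨ha, hb⟩ := mem_center_of_add_mul hcomm huniq hz
    obtain ⟨x, rfl⟩ := hcen a ha
    obtain ⟨y, rfl⟩ := hcen b hb
    exact ⟨_, ⟨x, rfl⟩, _, ⟨y, rfl⟩, by rw [φ.commutes, φ.commutes]⟩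

/-- The centre is F(α) ⊕ F(α)w, with α symmetric and w skew. -/
theorem isUnitaryOver_adjoin (h2 : (2 : F) ≠ 0) (hcomm : ∀ b, φ b * w = w * φ b)
    (hex : ∀ y, ∃ a b, y = φ a + φ b * w) (huniq : ∀ {a b}, φ a + φ b * w = 0 → a = 0 ∧ b = 0)
    {α : B} {c : F} (hα : α * α = algebraMap F B c) (hαc : α ∈ Subring.center B)
    (hcen : ∀ b ∈ Subring.center B, ∃ x y : F, b = algebraMap F B x + y • α) {τ : RingInvo A}
    (hτF : ∀ x, (τ (algebraMap F A x)).unop = algebraMap F A x) (hτw : (τ w).unop = -w)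
    (hw : w ≠ 0) (hτα : (τ (φ α)).unop = φ α) :
    IsUnitaryOver (Algebra.adjoin F {φ α}).toSubring τ := by
  have h2A : (2 : A) ≠ 0 := by
    rw [← map_ofNat (algebraMap F A)]
    exact (map_ne_zero _).2 h2
  have hmem : ∀ s, s ∈ (Algebra.adjoin F {φ α}).toSubring ↔
      ∃ x y : F, s = algebraMap F A x + y • φ α := fun s => by
    rw [Subalgebra.mem_toSubring]
    exact mem_adjoin_singleton_iff_of_mul_self (c := c) (by rw [← map_mul, hα, φ.commutes])
  refine isUnitaryOver_of_center h2A ?_ hw (gen_mem_center hcomm hex) hτw fun z hz => ?_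
  · intro s hs
    obtain ⟨x, y, rfl⟩ := (hmem s).1 hs
    have h3 := map_mem_center hcomm hex hαc
    refine ⟨add_mem (algebraMap_mem_center x) ?_, ?_⟩
    · rw [Algebra.smul_def]
      exact mul_mem (algebraMap_mem_center y) h3
    · rw [Algebra.smul_def, RingInvo.unop_add, RingInvo.unop_mul, hτF, hτF, hτα, Algebra.commutes]
  · obtain ⟨a, b, rfl⟩ := hex z
    obtain ⟨ha, hb⟩ := mem_center_of_add_mul hcomm huniq hz
    obtain ⟨x, y, rfl⟩ := hcen a ha
    obtain ⟨x', y', rfl⟩ := hcen b hb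
    exact ⟨_, (hmem _).2 ⟨x, y, rfl⟩, _, (hmem _).2 ⟨x', y', rfl⟩, by
      rw [map_add, map_add, φ.commutes, φ.commutes, map_smul, map_smul]⟩

/-- With α and w both skew, γ = αw is symmetric, and since α = l⁻¹γw the centre is F(γ) ⊕ F(γ)w. -/
theorem isUnitaryOver_adjoin_mul (h2 : (2 : F) ≠ 0) (hcomm : ∀ b, φ b * w = w * φ b)
    (hex : ∀ y, ∃ a b, y = φ a + φ b * w) (huniq : ∀ {a b}, φ a + φ b * w = 0 → a = 0 ∧ b = 0)
    {α : B} {c l : F} (hα : α * α = algebraMap F B c) (hαc : α ∈ Subring.center B)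
    (hcen : ∀ b ∈ Subring.center B, ∃ x y : F, b = algebraMap F B x + y • α) {τ : RingInvo A}
    (hτF : ∀ x, (τ (algebraMap F A x)).unop = algebraMap F A x) (hτw : (τ w).unop = -w)
    (hw : w ≠ 0) (hww : w * w = algebraMap F A l) (hτα : (τ (φ α)).unop = -φ α) :
    IsUnitaryOver (Algebra.adjoin F {φ α * w}).toSubring τ := by
  have h2A : (2 : A) ≠ 0 := by
    rw [← map_ofNat (algebraMap F A)]
    exact (map_ne_zero _).2 h2
  have hl : l ≠ 0 := fun h => hw (by
    rw [h, map_zero, mul_self_eq_zero] at hww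
    exact hww)
  have hγ : (φ α * w) * (φ α * w) = algebraMap F A (c * l) := by
    rw [mul_assoc, ← mul_assoc w, ← hcomm, mul_assoc, ← mul_assoc, hww, ← map_mul, hα, φ.commutes,
      map_mul]
  have hmem : ∀ s, s ∈ (Algebra.adjoin F {φ α * w}).toSubring ↔
      ∃ x y : F, s = algebraMap F A x + y • (φ α * w) := fun s => by
    rw [Subalgebra.mem_toSubring]
    exact mem_adjoin_singleton_iff_of_mul_self hγ
  have hwc := gen_mem_center hcomm hex
  refine isUnitaryOver_of_center h2A ?_ hw hwc hτw fun z hz => ?_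
  · intro s hs
    obtain ⟨x, y, rfl⟩ := (hmem s).1 hs
    have h3 := mul_mem (map_mem_center hcomm hex hαc) hwc
    refine ⟨add_mem (algebraMap_mem_center x) ?_, ?_⟩
    · rw [Algebra.smul_def]
      exact mul_mem (algebraMap_mem_center y) h3
    · rw [Algebra.smul_def, RingInvo.unop_add, RingInvo.unop_mul, RingInvo.unop_mul, hτF, hτF, hτα,
        hτw, neg_mul_neg, ← hcomm, Algebra.commutes]
  · obtain ⟨a, b, rfl⟩ := hex z
    obtain ⟨ha, hb⟩ := mem_center_of_add_mul hcomm huniq hz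
    obtain ⟨x, y, rfl⟩ := hcen a ha
    obtain ⟨x', y', rfl⟩ := hcen b hb
    refine ⟨_, (hmem _).2 ⟨x, y', rfl⟩, _, (hmem _).2 ⟨x', y / l, rfl⟩, ?_⟩
    have h3 : (y / l) • (φ α * w) * w = y • φ α := by
      rw [smul_mul_assoc, mul_assoc, hww, ← Algebra.commutes, ← Algebra.smul_def, smul_smul,
        div_mul_cancel₀ y hl]
    rw [map_add, map_add, φ.commutes, φ.commutes, map_smul, map_smul, add_mul, add_mul, h3,
      smul_mul_assoc]
    abel

/-- The compositum of two commuting subalgebras is their tensor product. -/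
theorem exists_tensorProduct_algEquiv [Ring L] [Algebra F L] {ψ : L →ₐ[F] A} {ω : L}
    (hcomm : ∀ b l, Commute (φ b) (ψ l)) (hL : ∀ l, ∃ x y : F, l = algebraMap F L x + y • ω)
    (hex : ∀ y, ∃ a b, y = φ a + φ b * ψ ω)
    (huniq : ∀ {a b}, φ a + φ b * ψ ω = 0 → a = 0 ∧ b = 0) :
    ∃ Ψ : B ⊗[F] L ≃ₐ[F] A, ∀ b l, Ψ (b ⊗ₜ l) = φ b * ψ l := by
  let Ψ := Algebra.TensorProduct.lift φ ψ hcomm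
  have hΨ : ∀ b l, Ψ (b ⊗ₜ l) = φ b * ψ l := fun b l => Algebra.TensorProduct.lift_tmul ..
  have hT : ∀ y : B ⊗[F] L, ∃ a b, y = a ⊗ₜ 1 + b ⊗ₜ ω := fun y => by
    induction y with
    | zero => exact ⟨0, 0, by simp⟩
    | tmul b l =>
      obtain ⟨x, y, rfl⟩ := hL l
      exact ⟨x • b, y • b, by
        rw [TensorProduct.tmul_add, Algebra.algebraMap_eq_smul_one, TensorProduct.tmul_smul,
          TensorProduct.tmul_smul, TensorProduct.smul_tmul', TensorProduct.smul_tmul']⟩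
    | add y z hy hz =>
      obtain ⟨a, b, rfl⟩ := hy
      obtain ⟨a', b', rfl⟩ := hz
      exact ⟨a + a', b + b', by rw [TensorProduct.add_tmul, TensorProduct.add_tmul]; abel⟩
  have hval : ∀ a b, Ψ (a ⊗ₜ 1 + b ⊗ₜ ω) = φ a + φ b * ψ ω := fun a b => by
    rw [map_add, hΨ, hΨ, map_one, mul_one]
  refine ⟨AlgEquiv.ofBijective Ψ ⟨?_, fun y => ?_⟩, hΨ⟩
  · rw [injective_iff_map_eq_zero]
    intro y hy
    obtain ⟨a, b, rfl⟩ := hT y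
    rw [hval] at hy
    obtain ⟨rfl, rfl⟩ := huniq hy
    simp
  · obtain ⟨a, b, rfl⟩ := hex y
    exact ⟨_, hval a b⟩

theorem IsUZero.comap_adjoin {A B : Type*} [Ring B] [Algebra F B] [DivisionRing A] [Algebra F A]
    (Ψ : B ≃ₐ[F] A) {x : B} {n : ℕ∞} (h : IsUZero (Algebra.adjoin F {Ψ x}).toSubring n) :
    IsUZero (Algebra.adjoin F {x}).toSubring n :=
  h.comap Ψ.toRingEquiv fun y => by
    have h1 := AlgHom.map_adjoin_singleton Ψ.toAlgHom x
    have h2 : Algebra.adjoin F {Ψ x} = (Algebra.adjoin F {x}).map Ψ.toAlgHom := h1.symm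
    rw [h2, Subalgebra.mem_toSubring, Subalgebra.mem_toSubring]
    exact (Set.InjOn.mem_image_iff Ψ.injective.injOn (Set.subset_univ _) (Set.mem_univ y)).symm

theorem IsUZero.comap_range {A B : Type*} [Ring B] [Algebra F B] [DivisionRing A] [Algebra F A]
    (Ψ : B ≃ₐ[F] A) {n : ℕ∞} (h : IsUZero (algebraMap F A).range n) :
    IsUZero (algebraMap F B).range n :=
  h.comap Ψ.toRingEquiv fun y => by
    constructor
    · rintro ⟨x, rfl⟩
      exact ⟨x, (Ψ.commutes x).symm⟩
    · rintro ⟨x, hx⟩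
      exact ⟨x, Ψ.injective ((Ψ.commutes x).trans hx)⟩

/-- A ring homomorphism or antihomomorphism maps a central square root to itself or its negative. -/
theorem eq_or_eq_neg_of_mul_self {A : Type*} [DivisionRing A] {a b : A} (ha : a ∈ Subring.center A)
    (h : b * b = a * a) : b = a ∨ b = -a := by
  have h1 : (b - a) * (b + a) = 0 := by
    rw [sub_mul, mul_add, mul_add, h, Subring.mem_center_iff.1 ha b]
    abel
  rcases mul_eq_zero.1 h1 with h2 | h2
  · exact Or.inl (sub_eq_zero.1 h2)
  · exact Or.inr (eq_neg_of_add_eq_zero_left h2)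

end Unitary

section Generators

variable {F A : Type*} [Field F] [Ring A] [Algebra F A]

theorem isSqrtGenerator_of_notMem_range {A : Type*} [DivisionRing A] [Algebra F A] {S : Subalgebra F A}
    {a : A} {c : F} (hac : a * a = algebraMap F A c)
    (ha : ∀ x, a ≠ algebraMap F A x) (hS : Algebra.adjoin F {a} = S) : IsSqrtGenerator S a := by
  refine ⟨c, ?_, hac, hS⟩
  rintro ⟨r, rfl⟩
  rw [map_mul] at hac
  rcases eq_or_eq_neg_of_mul_self (algebraMap_mem_center r) hac with h | h
  · exact ha r h
  · exact ha (-r) (by rw [h, map_neg])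

/-- Writing b = x + ya, the square of b has a-component 2xy, which must vanish. This makes the final
formula independent of the square root chosen in the residue field. -/
theorem IsSqrtGenerator.exists_eq_smul {A : Type*} [DivisionRing A] [Algebra F A] (h2 : (2 : F) ≠ 0)
    {S : Subalgebra F A} {a b : A} (ha : IsSqrtGenerator S a) (hb : IsSqrtGenerator S b) :
    ∃ r : F, r ≠ 0 ∧ b = r • a := by
  obtain ⟨x, y, hxy⟩ := ha.mem_iff.1 hb.mem
  have hy : y ≠ 0 := fun h => hb.notMem_range x (by rw [hxy, h, zero_smul, add_zero])
  refine ⟨y, hy, ?_⟩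
  have hna := ha.notMem_range
  obtain ⟨c, -, hac, -⟩ := ha
  obtain ⟨d, -, hbd, -⟩ := hb
  have h3 : algebraMap F A (x * x + y * y * c - d) + (2 * (x * y)) • a = 0 := by
    rw [map_sub, ← hbd, hxy, mul_add, add_mul, add_mul, smul_mul_smul_comm, hac, map_add, map_mul,
      map_mul _ (y * y), ← Algebra.commutes x (y • a), ← Algebra.smul_def, ← Algebra.smul_def x (y • a),
      smul_smul, two_mul, add_smul, ← Algebra.smul_def]
    abel
  have h4 := (eq_zero_of_algebraMap_add_smul hna h3).2
  have hx : x = 0 := by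
    rcases mul_eq_zero.1 h4 with h | h
    · exact absurd h h2
    · exact (mul_eq_zero.1 h).resolve_right hy
  rw [hxy, hx, map_zero, zero_add]

theorem adjoin_smul_singleton {r : F} (hr : r ≠ 0) (a : A) :
    Algebra.adjoin F {r • a} = Algebra.adjoin F {a} := by
  refine le_antisymm (Algebra.adjoin_le (Set.singleton_subset_iff.2 ?_))
    (Algebra.adjoin_le (Set.singleton_subset_iff.2 ?_))
  · exact Subalgebra.smul_mem _ (Algebra.subset_adjoin (Set.mem_singleton a)) r
  · have h := Subalgebra.smul_mem _ (Algebra.subset_adjoin (R := F) (Set.mem_singleton (r • a))) r⁻¹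
    rwa [inv_smul_smul₀ hr] at h

end Generators

/-! ### Residues of homomorphisms, involutions and unramified quadratic fields. -/

section Residues

variable {O k : Type*} [CommRing O] [IsDomain O] [IsDiscreteValuationRing O]
  [IsAdicComplete (IsLocalRing.maximalIdeal O) O] [Field k] [Algebra O k] [IsFractionRing O k]

theorem exists_residue_algHom_over {A B : Type*} [DivisionRing A] [Algebra k A] [FiniteDimensional k A]
    [DivisionRing B] [Algebra k B] [FiniteDimensional k B] (f : B →ₐ[k] A) :
    ∃ φ : ResidueAlg O k B →ₐ[IsLocalRing.ResidueField O] ResidueAlg O k A,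
      ∀ x, (residueValuation O k B).ge 0 x →
        φ ((residueValuation O k B).res x) = (residueValuation O k A).res (f x) := by
  obtain ⟨φ, hφ⟩ := exists_residue_algHom (O := O) f
  refine ⟨{ φ with commutes' := fun c => ?_ }, hφ⟩
  obtain ⟨a, rfl⟩ := IsLocalRing.residue_surjective c
  change φ _ = _
  rw [algebraMap_residue, hφ _ (ge_algebraMap_integer a), f.commutes, algebraMap_residue]

theorem exists_residue_invo_over {A : Type*} [DivisionRing A] [Algebra k A] [FiniteDimensional k A]
    {σ : RingInvo A} (hσ : ∀ c, (σ (algebraMap k A c)).unop = algebraMap k A c) :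
    ∃ τ : RingInvo (ResidueAlg O k A), (∀ x, (residueValuation O k A).ge 0 x →
      (τ ((residueValuation O k A).res x)).unop = (residueValuation O k A).res (σ x).unop) ∧
      ∀ c, (τ (algebraMap (IsLocalRing.ResidueField O) _ c)).unop = algebraMap _ _ c := by
  obtain ⟨τ, hτ⟩ := exists_residue_invo_conj O k hσ one_ne_zero (δ := 1) (by simp)
  exact ⟨τ, fun x hx => by simpa using hτ x hx, residue_invo_algebraMap hσ one_ne_zero hτ⟩

theorem exists_eq_algebraMap_of_base (y : ResidueAlg O k k) :
    ∃ x, y = algebraMap (IsLocalRing.ResidueField O) (ResidueAlg O k k) x := by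
  obtain ⟨a, ha, rfl⟩ := (residueValuation O k k).res_surj y
  obtain ⟨b, rfl⟩ := ge_zero_base_iff.1 ha
  exact ⟨IsLocalRing.residue O b, by rw [algebraMap_residue, Algebra.algebraMap_self_apply]⟩

theorem ord_algebraMap_self (c : k) :
    (residueValuation O k k).ord (algebraMap k k c) = (residueValuation O k k).ord c := by
  rw [Algebra.algebraMap_self_apply]

theorem exists_eq_algebraMap_of_finrank_center {A : Type*} [DivisionRing A] [Algebra k A]
    [FiniteDimensional k A] (h : Module.finrank (IsLocalRing.ResidueField O)
      (Subalgebra.center (IsLocalRing.ResidueField O) (ResidueAlg O k A)) = 1) {b : ResidueAlg O k A}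
    (hb : b ∈ Subring.center (ResidueAlg O k A)) :
    ∃ x, b = algebraMap (IsLocalRing.ResidueField O) _ x := by
  obtain ⟨a, rfl⟩ := exists_algebraMap_of_finrank_center_eq_one h hb
  exact ⟨IsLocalRing.residue O a, (algebraMap_residue a).symm⟩

/-- The square of the residue of a unit whose square lies in the base field. -/
theorem exists_res_mul_self {A : Type*} [DivisionRing A] [Algebra k A] [FiniteDimensional k A]
    {t : A} {c : k} (ht : t * t = algebraMap k A c)
    (h0 : (residueValuation O k A).ord t = 0) (hc0 : c ≠ 0) (hc : (residueValuation O k k).ord c = 0) :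
    ∃ l, (residueValuation O k A).res t * (residueValuation O k A).res t =
      algebraMap (IsLocalRing.ResidueField O) _ l := by
  obtain ⟨a, rfl⟩ := ge_zero_base_iff.1 (ResidueValuation.ge_of_ord_eq_zero hc)
  have h1 := ResidueValuation.ge_of_ord_eq_zero h0
  exact ⟨IsLocalRing.residue O a, by
    rw [← (residueValuation O k A).res_mul _ _ h1 h1, ht, algebraMap_residue]⟩

/-- The residue field of an unramified quadratic extension. -/
theorem IsQuadraticExtension.isSqrtGenerator_residue {K : Type*} [Field K] [Algebra k K]
    [FiniteDimensional k K] {θ : K} {c : k} {g : K →ₐ[k] K}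
    (h : IsQuadraticExtension (Algebra.ofId k K) θ c g) (h2 : (2 : IsLocalRing.ResidueField O) ≠ 0)
    (hc : (residueValuation O k k).ord c = 0) :
    IsSqrtGenerator (⊤ : Subalgebra (IsLocalRing.ResidueField O) (ResidueAlg O k K))
      ((residueValuation O k K).res θ) := by
  obtain ⟨e, -, -, -, h0, -, -⟩ := h.exists_ord (O := O) h2
  obtain ⟨-, hθ⟩ := h0 (by rw [ord_algebraMap_self, hc])
  obtain ⟨φ, hφ⟩ := exists_residue_algHom_over (O := O) (Algebra.ofId k K)
  obtain ⟨l, hl⟩ := exists_res_mul_self h.mul_self hθ h.ne_zero_base hc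
  have h1 : (residueValuation O k K).ord (Algebra.ofId k K 1) = (residueValuation O k K).ord θ := by
    rw [map_one, (residueValuation O k K).ord_one, hθ]
  have hw : Algebra.ofId k K 1⁻¹ * θ = θ := by rw [inv_one, map_one, one_mul]
  have hex := h.exists_residue_eq h2 hφ one_ne_zero h1
  have hun := fun a b => h.eq_zero_of_residue_eq_zero (a := a) (b := b) h2 hφ one_ne_zero h1
  rw [hw] at hex
  simp only [hw] at hun
  refine isSqrtGenerator_of_notMem_range hl (fun x hx => ?_) ?_
  · have h3 := hun (algebraMap _ _ (-x)) 1 (by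
      rw [map_one, one_mul, hx]
      change φ _ + _ = 0
      rw [φ.commutes, map_neg, neg_add_cancel])
    exact one_ne_zero h3.2
  · rw [eq_top_iff]
    rintro y -
    obtain ⟨a, b, rfl⟩ := hex y
    obtain ⟨x, rfl⟩ := exists_eq_algebraMap_of_base a
    obtain ⟨z, rfl⟩ := exists_eq_algebraMap_of_base b
    rw [mem_adjoin_singleton_iff_of_mul_self hl]
    refine ⟨x, z, ?_⟩
    rw [Algebra.smul_def]
    change φ _ + φ _ * _ = _
    rw [φ.commutes, φ.commutes]

end Residues

/-! ### The two cases where K/k is unramified. -/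

section UnitaryResidues

variable {O k : Type*} [CommRing O] [IsDomain O] [IsDiscreteValuationRing O]
  [IsAdicComplete (IsLocalRing.maximalIdeal O) O] [Field k] [Algebra O k] [IsFractionRing O k]
  {K : Type*} [Field K] [Algebra k K] [FiniteDimensional k K]
  {D : Type*} [DivisionRing D] [Algebra k D] [FiniteDimensional k D]
  {E : Type*} [DivisionRing E] [Algebra k E] [FiniteDimensional k E]
  {i : D →ₐ[k] E} {j : K →ₐ[k] E} {θ : K} {c : k} {g : K →ₐ[k] K} {ι : E →ₐ[k] E}

/-- The residue algebra of an unramified quadratic scalar extension. -/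
theorem exists_residue_of_ord_eq_zero (h2 : (2 : IsLocalRing.ResidueField O) ≠ 0)
    (hij : ∀ d l, i d * j l = j l * i d)
    (hK : IsQuadraticExtension (Algebra.ofId k K) θ c g) (hE : IsQuadraticExtension i (j θ) c ι)
    (hc : (residueValuation O k k).ord c = 0) :
    ∃ (φ : ResidueAlg O k D →ₐ[IsLocalRing.ResidueField O] ResidueAlg O k E)
      (ψ : ResidueAlg O k K →ₐ[IsLocalRing.ResidueField O] ResidueAlg O k E),
      (∀ x, (residueValuation O k D).ge 0 x →
        φ ((residueValuation O k D).res x) = (residueValuation O k E).res (i x)) ∧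
      (∀ x, (residueValuation O k K).ge 0 x →
        ψ ((residueValuation O k K).res x) = (residueValuation O k E).res (j x)) ∧
      (residueValuation O k K).ge 0 θ ∧
      (∀ b l, Commute (φ b) (ψ l)) ∧
      (∀ y, ∃ a b, y = φ a + φ b * ψ ((residueValuation O k K).res θ)) ∧
      ∀ a b, φ a + φ b * ψ ((residueValuation O k K).res θ) = 0 → a = 0 ∧ b = 0 := by
  obtain ⟨φ, hφ⟩ := exists_residue_algHom_over (O := O) i
  obtain ⟨ψ, hψ⟩ := exists_residue_algHom_over (O := O) j
  obtain ⟨_, -, -, -, h0, -, -⟩ := hK.exists_ord (O := O) h2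
  have hθ := ResidueValuation.ge_of_ord_eq_zero (h0 (by rw [ord_algebraMap_self, hc])).2
  obtain ⟨_, -, -, -, h0', -, -⟩ := hE.exists_ord (O := O) h2
  have ht := (h0' (by rw [ord_algebraMap hE.ne_zero_base, hc, mul_zero])).2
  have h1 : (residueValuation O k E).ord (i 1) = (residueValuation O k E).ord (j θ) := by
    rw [map_one, (residueValuation O k E).ord_one, ht]
  have hw : i 1⁻¹ * j θ = j θ := by rw [inv_one, map_one, one_mul]
  have hex := hE.exists_residue_eq h2 hφ one_ne_zero h1
  have hun := fun a b => hE.eq_zero_of_residue_eq_zero (a := a) (b := b) h2 hφ one_ne_zero h1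
  rw [hw, ← hψ θ hθ] at hex
  simp only [hw, ← hψ θ hθ] at hun
  refine ⟨φ, ψ, hφ, hψ, hθ, fun b l => ?_, hex, hun⟩
  obtain ⟨x, hx, rfl⟩ := (residueValuation O k D).res_surj b
  obtain ⟨y, hy, rfl⟩ := (residueValuation O k K).res_surj l
  have hx' := IsQuadraticExtension.ge_zero_map (i := i) hx
  have hy' := IsQuadraticExtension.ge_zero_map (i := j) hy
  rw [Commute, SemiconjBy, hφ x hx, hψ y hy, ← (residueValuation O k E).res_mul _ _ hx' hy', hij,
    (residueValuation O k E).res_mul _ _ hy' hx']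

variable {σ : RingInvo D} {s : RingInvo E}

theorem isUnit_two_of_residueField (h2 : (2 : IsLocalRing.ResidueField O) ≠ 0) : IsUnit (2 : O) := by
  rw [← IsLocalRing.residue_ne_zero_iff_isUnit, map_ofNat]
  exact h2

/-- The `u`-invariant of a division algebra in terms of its residue algebra. -/
theorem uInv_eq_add_residue (h2 : (2 : IsLocalRing.ResidueField O) ≠ 0)
    (hsk : ∀ c, (s (algebraMap k E c)).unop = algebraMap k E c) {q : E} (hq : q ≠ 0)
    (hq1 : (residueValuation O k E).ord q = 1) {δ : ℤˣ} (hδ : (s q).unop = (δ : ℤ) • q)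
    {τ τ' : RingInvo (ResidueAlg O k E)}
    (hτ : ∀ x, (residueValuation O k E).ge 0 x →
      (τ ((residueValuation O k E).res x)).unop = (residueValuation O k E).res (s x).unop)
    (hτ' : ∀ x, (residueValuation O k E).ge 0 x → (τ' ((residueValuation O k E).res x)).unop =
      (residueValuation O k E).res (q⁻¹ * (s x).unop * q)) :
    uInv s 1 = uInv τ 1 + uInv τ' δ := by
  have hδ' : (s q⁻¹).unop = (δ : ℤ) • q⁻¹ := by
    rw [RingInvo.unop_inv, hδ]
    rcases Int.units_eq_one_or δ with rfl | rfl
    · simp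
    · simp [inv_neg]
  have h := ResidueValuation.uInv_eq_add (W := residueValuation O k E) (k := k)
    (two_ne_zero_residueAlg k E h2)
    (fun t ht => exists_mul_self_eq_one_add (isUnit_two_of_residueField h2)
      (residueValuation_ge_one_iff.1 ht)) hsk (residueValuation_ord_unop hsk) hq hq1 δ hδ' hτ
    (τ' := τ') (fun x hx => by rw [hτ' x hx, RingInvo.conj_apply, inv_inv]) 1
  rwa [mul_one] at h

/-- The unramified case. -/
theorem exists_isUZero_of_ramIndex_eq_one (h2 : (2 : IsLocalRing.ResidueField O) ≠ 0)
    (hij : ∀ d l, i d * j l = j l * i d)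
    (hK : IsQuadraticExtension (Algebra.ofId k K) θ c g) (hE : IsQuadraticExtension i (j θ) c ι)
    (hc : (residueValuation O k k).ord c = 0) (hram : ramIndex O k D = 1)
    (hcen : Module.finrank (IsLocalRing.ResidueField O)
      (Subalgebra.center (IsLocalRing.ResidueField O) (ResidueAlg O k D)) = 1)
    (hsk : ∀ c, (s (algebraMap k E c)).unop = algebraMap k E c) (hsθ : (s (j θ)).unop = -j θ) :
    ∃ n, IsUZero (algebraMap (IsLocalRing.ResidueField O)
      (ResidueAlg O k D ⊗[IsLocalRing.ResidueField O] ResidueAlg O k K)).range n ∧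
      uInv s 1 = 2 * n := by
  obtain ⟨φ, ψ, hφ, hψ, hθ, hcomm, hex, hun⟩ := exists_residue_of_ord_eq_zero h2 hij hK hE hc
  obtain ⟨τ, hτ, hτF⟩ := exists_residue_invo_over (O := O) hsk
  have hβ := hK.isSqrtGenerator_residue h2 hc
  obtain ⟨Ψ, hΨ⟩ := exists_tensorProduct_algEquiv hcomm (fun l => hβ.mem_iff.1 Algebra.mem_top) hex
    (hun _ _)
  have hw : ψ ((residueValuation O k K).res θ) ≠ 0 := fun h =>
    one_ne_zero (hun 0 1 (by rw [h, mul_zero, map_zero, add_zero])).2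
  have hjθ := IsQuadraticExtension.ge_zero_map (i := j) hθ
  have hτ' : IsUnitaryOver (algebraMap (IsLocalRing.ResidueField O) (ResidueAlg O k E)).range τ :=
    isUnitaryOver_range h2 (fun b => hcomm b _) hex (hun _ _)
      (fun b hb => exists_eq_algebraMap_of_finrank_center hcen hb) hτF
      (by rw [hψ θ hθ, hτ _ hjθ, hsθ, ResidueValuation.res_neg hjθ]) hw
  refine ⟨uInv τ 1, hτ'.isUZero.comap_range Ψ, ?_⟩
  -- A uniformizer of k is still one in E; being central and symmetric, it gives δ = 1 and two equal
  -- residue involutions.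
  obtain ⟨ϖ, -, hϖ, hϖ1⟩ := exists_uniformizer O k
  obtain ⟨e, -, hord, -, h0, -, -⟩ := hE.exists_ord (O := O) h2
  obtain ⟨rfl, -⟩ := h0 (by rw [ord_algebraMap hE.ne_zero_base, hc, mul_zero])
  have hq : algebraMap k E (algebraMap O k ϖ) ≠ 0 := (map_ne_zero _).2 hϖ
  have hq1 : (residueValuation O k E).ord (algebraMap k E (algebraMap O k ϖ)) = 1 := by
    rw [← i.commutes, hord _ ((map_ne_zero _).2 hϖ), ord_algebraMap hϖ, hram, hϖ1]
    rfl
  rw [two_mul]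
  exact uInv_eq_add_residue (δ := 1) h2 hsk hq hq1 (by rw [hsk, Units.val_one, one_smul]) hτ
    fun x hx => by rw [hτ x hx, mul_assoc, ← Algebra.commutes, inv_mul_cancel_left₀ hq]

/-- Conjugation by a uniformizer acts nontrivially on the generator of a quadratic centre. -/
theorem residue_conj_generator {p : D} (hp : p ≠ 0)
    (hmove : ∃ x, (residueValuation O k D).ge 0 x ∧
      (residueValuation O k D).res x ∈ Subring.center (ResidueAlg O k D) ∧
      (residueValuation O k D).res (p⁻¹ * x * p) ≠ (residueValuation O k D).res x)
    {α : ResidueAlg O k D}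
    (hα : IsSqrtGenerator (Subalgebra.center (IsLocalRing.ResidueField O) (ResidueAlg O k D)) α)
    {κ : ResidueAlg O k D →+* ResidueAlg O k D}
    (hκ : ∀ x, (residueValuation O k D).ge 0 x →
      κ ((residueValuation O k D).res x) = (residueValuation O k D).res (p⁻¹ * x * p)) :
    (∀ x, κ (algebraMap (IsLocalRing.ResidueField O) _ x) = algebraMap _ _ x) ∧ κ α = -α := by
  have hκF : ∀ x, κ (algebraMap (IsLocalRing.ResidueField O) _ x) = algebraMap _ _ x := fun x => by
    obtain ⟨a, rfl⟩ := IsLocalRing.residue_surjective x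
    rw [algebraMap_residue, hκ _ (ge_algebraMap_integer a), mul_assoc, Algebra.commutes,
      inv_mul_cancel_left₀ hp]
  refine ⟨hκF, ?_⟩
  have hαc := hα.mem
  have hgen := fun b => (hα.mem_iff (s := b)).1
  obtain ⟨d, -, hd, -⟩ := hα
  -- If κ fixed α it would fix the whole residual centre, which α generates.
  refine (eq_or_eq_neg_of_mul_self hαc (by rw [← map_mul, hd, hκF])).resolve_left fun h => ?_
  obtain ⟨x, hx, hxc, hne⟩ := hmove
  apply hne
  obtain ⟨y, z, hyz⟩ := hgen _ hxc
  rw [← hκ x hx, hyz, map_add, hκF, Algebra.smul_def, map_mul, hκF, h]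

/-- The case of a ramified algebra that is scalar extended to an unramified field extension. -/
theorem exists_isUZero_of_ramIndex_eq_two (h2 : (2 : IsLocalRing.ResidueField O) ≠ 0)
    (hij : ∀ d l, i d * j l = j l * i d)
    (hK : IsQuadraticExtension (Algebra.ofId k K) θ c g) (hE : IsQuadraticExtension i (j θ) c ι)
    (hc : (residueValuation O k k).ord c = 0)
    (hmove : ∀ p : D, p ≠ 0 → (residueValuation O k D).ord p = 1 →
      ∃ x, (residueValuation O k D).ge 0 x ∧
        (residueValuation O k D).res x ∈ Subring.center (ResidueAlg O k D) ∧
        (residueValuation O k D).res (p⁻¹ * x * p) ≠ (residueValuation O k D).res x)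
    (hσ : ∀ c, (σ (algebraMap k D c)).unop = algebraMap k D c)
    (hsk : ∀ c, (s (algebraMap k E c)).unop = algebraMap k E c)
    (hsi : ∀ d, (s (i d)).unop = i (σ d).unop) (hsθ : (s (j θ)).unop = -j θ)
    {α : ResidueAlg O k D} {β : ResidueAlg O k K}
    (hα : IsSqrtGenerator (Subalgebra.center (IsLocalRing.ResidueField O) (ResidueAlg O k D)) α)
    (hβ : IsSqrtGenerator (⊤ : Subalgebra (IsLocalRing.ResidueField O) (ResidueAlg O k K)) β) :
    ∃ n₁ n₃ : ℕ∞,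
      IsUZero (Algebra.adjoin (IsLocalRing.ResidueField O)
        {α ⊗ₜ[IsLocalRing.ResidueField O] (1 : ResidueAlg O k K)}).toSubring n₁ ∧
      IsUZero (Algebra.adjoin (IsLocalRing.ResidueField O)
        {α ⊗ₜ[IsLocalRing.ResidueField O] β}).toSubring n₃ ∧ uInv s 1 = n₁ + n₃ := by
  set V := residueValuation O k D with hV
  set W := residueValuation O k E with hW
  obtain ⟨φ, ψ, hφ, hψ, hθ, hcomm, hex, hun⟩ := exists_residue_of_ord_eq_zero h2 hij hK hE hc
  have hβ0 := hK.isSqrtGenerator_residue h2 hc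
  obtain ⟨Ψ, hΨ⟩ := exists_tensorProduct_algEquiv hcomm (fun l => hβ0.mem_iff.1 Algebra.mem_top) hex
    (hun _ _)
  -- Any β is a scalar multiple of the residue of θ, and the scalar does not change the field
  -- generated by α ⊗ β.
  obtain ⟨r, hr, rfl⟩ := hβ0.exists_eq_smul h2 hβ
  set w := ψ ((residueValuation O k K).res θ) with hwdef
  have hw : w ≠ 0 := fun h => one_ne_zero (hun 0 1 (by rw [h, mul_zero, map_zero, add_zero])).2
  have hjθ : W.ge 0 (j θ) := IsQuadraticExtension.ge_zero_map (i := j) hθ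
  have hwres : w = W.res (j θ) := hψ θ hθ
  obtain ⟨l, hl⟩ : ∃ l, w * w = algebraMap (IsLocalRing.ResidueField O) _ l := by
    obtain ⟨l, -, hl, -⟩ := hβ0
    exact ⟨l, by rw [hwdef, ← map_mul, hl, ψ.commutes]⟩
  have hαc := hα.mem
  have hgen := fun b => (hα.mem_iff (s := b)).1
  obtain ⟨d, hd⟩ : ∃ d, α * α = algebraMap (IsLocalRing.ResidueField O) _ d := by
    obtain ⟨d, -, hd, -⟩ := hα
    exact ⟨d, hd⟩
  -- the two kinds of involutions on the residue algebra
  have hpos : ∀ ρ : RingInvo (ResidueAlg O k E),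
      (∀ x, (ρ (algebraMap (IsLocalRing.ResidueField O) _ x)).unop = algebraMap _ _ x) →
      (ρ w).unop = -w → (ρ (φ α)).unop = φ α → ∀ ε, IsUZero (Algebra.adjoin (IsLocalRing.ResidueField O)
        {α ⊗ₜ[IsLocalRing.ResidueField O] (1 : ResidueAlg O k K)}).toSubring (uInv ρ ε) := by
    intro ρ hρF hρw hρα ε
    have h := isUnitaryOver_adjoin h2 (fun b => hcomm b _) hex (hun _ _) hd hαc hgen hρF hρw hw hρα
    refine IsUZero.comap_adjoin Ψ ?_
    rw [hΨ, map_one, mul_one, h.isUZero.2 ρ h ε]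
    exact h.isUZero
  have hneg : ∀ ρ : RingInvo (ResidueAlg O k E),
      (∀ x, (ρ (algebraMap (IsLocalRing.ResidueField O) _ x)).unop = algebraMap _ _ x) →
      (ρ w).unop = -w → (ρ (φ α)).unop = -φ α → ∀ ε,
      IsUZero (Algebra.adjoin (IsLocalRing.ResidueField O)
        {α ⊗ₜ[IsLocalRing.ResidueField O] (r • (residueValuation O k K).res θ)}).toSubring
          (uInv ρ ε) := by
    intro ρ hρF hρw hρα ε
    have h := isUnitaryOver_adjoin_mul h2 (fun b => hcomm b _) hex (hun _ _) hd hαc hgen hρF hρw hw hl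
      hρα
    refine IsUZero.comap_adjoin Ψ ?_
    rw [hΨ, map_smul, mul_smul_comm, adjoin_smul_singleton hr, h.isUZero.2 ρ h ε]
    exact h.isUZero
  -- A symmetric or skew uniformizer of D remains a uniformizer in E, since E/D is unramified.
  obtain ⟨p, hp, hp1, δ, hδ⟩ := V.exists_unop_eq_smul_of_ord (two_ne_zero_residueAlg k D h2)
    (residueValuation_ord_unop hσ) 1
  obtain ⟨e, -, hord, -, h0, -, -⟩ := hE.exists_ord (O := O) h2
  obtain ⟨rfl, -⟩ := h0 (by rw [ord_algebraMap hE.ne_zero_base, hc, mul_zero])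
  have hq : i p ≠ 0 := (map_ne_zero i).2 hp
  have hq1 : W.ord (i p) = 1 := by rw [hW, hord p hp, one_mul, ← hV, hp1]
  have hsq : (s (i p)).unop = (δ : ℤ) • i p := by rw [hsi, hδ, map_zsmul]
  obtain ⟨τ, hτ, hτF⟩ := exists_residue_invo_over (O := O) hsk
  obtain ⟨τ', hτ'⟩ := exists_residue_invo_conj O k hsk hq hsq
  have hτF' := residue_invo_algebraMap hsk hq hτ'
  obtain ⟨σ', hσ', hσF⟩ := exists_residue_invo_over (O := O) hσ
  obtain ⟨κ, hκ⟩ := V.exists_residue_conj (inv_ne_zero hp)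
  simp only [inv_inv] at hκ
  obtain ⟨hκF, hκα⟩ := residue_conj_generator hp (hmove p hp hp1) hα hκ
  have hsum := uInv_eq_add_residue h2 hsk hq hq1 hsq hτ hτ'
  have hτw : (τ w).unop = -w := by
    rw [hwres, hτ _ hjθ, hsθ, ResidueValuation.res_neg hjθ]
  have hτw' : (τ' w).unop = -w := by
    rw [hwres, hτ' _ hjθ, hsθ, mul_assoc, neg_mul, ← hE.commute_gen, mul_neg,
      inv_mul_cancel_left₀ hq, ResidueValuation.res_neg hjθ]
  have hge : ∀ {x}, V.ge 0 x → V.ge 0 (σ x).unop := fun {x} hx =>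
    residueValuation_ge_zero_iff.2 ((isValInteger_unop_iff hσ).2 (residueValuation_ge_zero_iff.1 hx))
  have hτφ : ∀ b, (τ (φ b)).unop = φ (σ' b).unop := fun b => by
    obtain ⟨x, hx, rfl⟩ := V.res_surj b
    rw [hφ x hx, hτ _ (IsQuadraticExtension.ge_zero_map hx), hsi, hσ' x hx, hφ _ (hge hx)]
  have hτφ' : ∀ b, (τ' (φ b)).unop = φ (κ (σ' b).unop) := fun b => by
    obtain ⟨x, hx, rfl⟩ := V.res_surj b
    have h1 : V.ge 0 (p⁻¹ * (σ x).unop * p) := by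
      rcases hge hx with h | h
      · exact Or.inl (by rw [h, mul_zero, zero_mul])
      · refine Or.inr ?_
        have h3 := V.ord_conj (inv_ne_zero hp) (σ x).unop
        rw [inv_inv] at h3
        rw [h3]
        exact h
    rw [hφ x hx, hτ' _ (IsQuadraticExtension.ge_zero_map hx), hsi, hσ' x hx, hκ _ (hge hx),
      hφ _ h1, map_mul, map_mul, map_inv₀]
  -- The residue of σ maps α to ±α, and conjugation by p flips the sign. So exactly one of τ and τ'
  -- fixes α, and the other fixes αw; which one it is only affects the order of the summands.
  rcases eq_or_eq_neg_of_mul_self hαc (b := (σ' α).unop) (by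
    rw [← RingInvo.unop_mul, hd, hσF]) with h | h
  · refine ⟨_, _, hpos τ hτF hτw (by rw [hτφ, h]) 1, hneg τ' hτF' hτw' (by
      rw [hτφ', h, hκα, map_neg]) δ, hsum⟩
  · refine ⟨_, _, hpos τ' hτF' hτw' (by rw [hτφ', h, map_neg, hκα, neg_neg]) δ,
      hneg τ hτF hτw (by rw [hτφ, h, map_neg]) 1, by rw [hsum, add_comm]⟩

end UnitaryResidues

/-! ### The case where K/k is ramified. -/

section RamifiedExtension

variable {O k : Type*} [CommRing O] [IsDomain O] [IsDiscreteValuationRing O]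
  [IsAdicComplete (IsLocalRing.maximalIdeal O) O] [Field k] [Algebra O k] [IsFractionRing O k]
  {D : Type*} [DivisionRing D] [Algebra k D] [FiniteDimensional k D]
  {E : Type*} [DivisionRing E] [Algebra k E] [FiniteDimensional k E]
  {i : D →ₐ[k] E} {t : E} {c : k} {ι : E →ₐ[k] E} {σ : RingInvo D} {s : RingInvo E}

/-- D and E have the same residue algebra here, as all the ramification of E/D is absorbed by t. -/
theorem exists_eq_algebraMap_of_ramIndex_eq_one (h2 : (2 : IsLocalRing.ResidueField O) ≠ 0)
    (hE : IsQuadraticExtension i t c ι) (hc : (residueValuation O k k).ord c = 1)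
    (hram : ramIndex O k D = 1) (hcen : Module.finrank (IsLocalRing.ResidueField O)
      (Subalgebra.center (IsLocalRing.ResidueField O) (ResidueAlg O k D)) = 1) {z : ResidueAlg O k E}
    (hz : z ∈ Subring.center (ResidueAlg O k E)) :
    ∃ x, z = algebraMap (IsLocalRing.ResidueField O) _ x := by
  obtain ⟨φ, hφ⟩ := exists_residue_algHom_over (O := O) i
  obtain ⟨b, rfl⟩ := hE.residue_surjective h2 hφ
    (by rw [ord_algebraMap hE.ne_zero_base, hc, hram]; rfl) z
  obtain ⟨x, rfl⟩ := exists_eq_algebraMap_of_finrank_center hcen (b := b)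
    (Subring.mem_center_iff.2 fun y => φ.toRingHom.injective (by
      rw [map_mul, map_mul]
      exact Subring.mem_center_iff.1 hz _))
  exact ⟨x, φ.commutes x⟩

/-- Here E has the value group of D, and its residue algebra is that of D plus its multiples of w,
the residue of p⁻¹t, with w acting as conjugation κ by the uniformizer p. For a central a + bw, a
nonzero b would force κ to be trivial on the residual centre of D; and a is central and κ-invariant.
As κ negates the generator α of that centre, a is a scalar. -/
theorem exists_eq_algebraMap_of_ramIndex_eq_two (h2 : (2 : IsLocalRing.ResidueField O) ≠ 0)
    (hE : IsQuadraticExtension i t c ι) (hc : (residueValuation O k k).ord c = 1)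
    (hram : ramIndex O k D = 2) (hcen : Module.finrank (IsLocalRing.ResidueField O)
      (Subalgebra.center (IsLocalRing.ResidueField O) (ResidueAlg O k D)) = 2)
    (hmove : ∀ p : D, p ≠ 0 → (residueValuation O k D).ord p = 1 →
      ∃ x, (residueValuation O k D).ge 0 x ∧
        (residueValuation O k D).res x ∈ Subring.center (ResidueAlg O k D) ∧
        (residueValuation O k D).res (p⁻¹ * x * p) ≠ (residueValuation O k D).res x)
    {z : ResidueAlg O k E} (hz : z ∈ Subring.center (ResidueAlg O k E)) :
    ∃ x, z = algebraMap (IsLocalRing.ResidueField O) _ x := by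
  set V := residueValuation O k D with hV
  set W := residueValuation O k E with hW
  obtain ⟨φ, hφ⟩ := exists_residue_algHom_over (O := O) i
  obtain ⟨e, -, hord, -, -, -, h0⟩ := hE.exists_ord (O := O) h2
  obtain ⟨rfl, ht⟩ := h0 (by rw [ord_algebraMap hE.ne_zero_base, hc, hram]; rfl)
  obtain ⟨p, hp, hp1⟩ := V.exists_ord_eq_one
  have hpt : W.ord (i p) = W.ord t := by rw [hW, hord p hp, one_mul, ← hV, hp1, ht]
  obtain ⟨κ, hκ⟩ := V.exists_residue_conj (inv_ne_zero hp)
  simp only [inv_inv] at hκ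
  obtain ⟨α, hα⟩ := exists_isSqrtGenerator h2 hcen
  obtain ⟨hκF, hκα⟩ := residue_conj_generator hp (hmove p hp hp1) hα hκ
  obtain ⟨a, b, hab⟩ := hE.exists_residue_eq h2 hφ hp hpt z
  have hun := fun a b => hE.eq_zero_of_residue_eq_zero (a := a) (b := b) h2 hφ hp hpt
  obtain ⟨hw, hw0⟩ := hE.ord_inv_mul hp hpt
  have hwge := ResidueValuation.ge_of_ord_eq_zero hw0
  set w := W.res (i p⁻¹ * t) with hwdef
  change z = φ a + φ b * w at hab
  replace hun : ∀ a b, φ a + φ b * w = 0 → a = 0 ∧ b = 0 := hun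
  have hwφ : ∀ y, w * φ y = φ (κ y) * w := fun y => by
    obtain ⟨x, hx, rfl⟩ := V.res_surj y
    have h1 : V.ge 0 (p⁻¹ * x * p) := by
      rcases hx with h | h
      · exact Or.inl (by rw [h, mul_zero, zero_mul])
      · refine Or.inr ?_
        have h3 := V.ord_conj (inv_ne_zero hp) x
        rw [inv_inv] at h3
        rw [h3]
        exact h
    rw [hκ x hx, hφ x hx, hφ _ h1,
      ← W.res_mul _ _ hwge (IsQuadraticExtension.ge_zero_map hx),
      ← W.res_mul _ _ (IsQuadraticExtension.ge_zero_map h1) hwge, mul_assoc, ← hE.comm, ← mul_assoc,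
      ← map_mul, ← mul_assoc (i _), ← map_mul, mul_inv_cancel_right₀ hp]
  have key : ∀ y, y * a - a * y = 0 ∧ y * b - b * κ y = 0 := fun y => hun _ _ (by
    have h1 := Subring.mem_center_iff.1 hz (φ y)
    rw [hab, mul_add, add_mul, mul_assoc (φ b), hwφ, ← mul_assoc, ← mul_assoc] at h1
    rw [map_sub, map_sub, map_mul, map_mul, map_mul, map_mul, sub_mul, sub_add_sub_comm, h1, sub_self])
  have hb : b = 0 := by
    by_contra hb
    obtain ⟨x, hx, hxc, hne⟩ := hmove p hp hp1
    apply hne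
    have h1 := (key (V.res x)).2
    rw [← Subring.mem_center_iff.1 hxc b, ← mul_sub] at h1
    rw [← hκ x hx]
    exact (sub_eq_zero.1 ((mul_eq_zero.1 h1).resolve_left hb)).symm
  have hac : a ∈ Subring.center (ResidueAlg O k D) :=
    Subring.mem_center_iff.2 fun y => sub_eq_zero.1 (key y).1
  have hκa : κ a = a := by
    have h1 := Subring.mem_center_iff.1 hz w
    rw [hab, hb, map_zero, zero_mul, add_zero, hwφ] at h1
    exact sub_eq_zero.1 (hun 0 (κ a - a) (by rw [map_zero, zero_add, map_sub, sub_mul, h1, sub_self])).2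
  obtain ⟨x, y, hxy⟩ := hα.mem_iff.1 hac
  rw [hxy, map_add, hκF, add_right_inj, Algebra.smul_def, map_mul, hκF, hκα, mul_neg] at hκa
  have h3 : (2 : ResidueAlg O k D) * (algebraMap (IsLocalRing.ResidueField O) _ y * α) = 0 := by
    rw [two_mul]
    nth_rewrite 1 [← hκa]
    exact neg_add_cancel _
  have h4 := (mul_eq_zero.1 h3).resolve_left (two_ne_zero_residueAlg k D h2)
  refine ⟨x, ?_⟩
  rw [hab, hb, map_zero, zero_mul, add_zero, hxy, Algebra.smul_def, h4, add_zero, φ.commutes]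

/-- The case of a ramified quadratic extension. -/
theorem exists_isUPlus_isUMinus_residue (h2 : (2 : IsLocalRing.ResidueField O) ≠ 0)
    (hE : IsQuadraticExtension i t c ι) (ht1 : (residueValuation O k E).ord t = 1)
    (hcen : ∀ z ∈ Subring.center (ResidueAlg O k E), ∃ x, z = algebraMap (IsLocalRing.ResidueField O) _ x)
    (hsk : ∀ c, (s (algebraMap k E c)).unop = algebraMap k E c) (hst : (s t).unop = -t) :
    ∃ τ : RingInvo (ResidueAlg O k E), (∀ x, (residueValuation O k E).ge 0 x →
      (τ ((residueValuation O k E).res x)).unop = (residueValuation O k E).res (s x).unop) ∧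
      IsFirstKind τ ∧ uInv s 1 = uInv τ 1 + uInv τ (-1) := by
  obtain ⟨τ, hτ, hτF⟩ := exists_residue_invo_over (O := O) hsk
  refine ⟨τ, hτ, fun z hz => ?_, ?_⟩
  · obtain ⟨x, rfl⟩ := hcen z hz
    exact hτF x
  -- The uniformizer t is central and skew, so τ serves as both residue involutions, with δ = -1.
  · exact uInv_eq_add_residue h2 hsk hE.ne_zero ht1 (by rw [hst]; simp) hτ fun x hx => by
      rw [hτ x hx, mul_assoc, hE.commute_gen, inv_mul_cancel_left₀ hE.ne_zero]

theorem uInv_residue_eq_uInv_residue (h2 : (2 : IsLocalRing.ResidueField O) ≠ 0)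
    (hE : IsQuadraticExtension i t c ι) (hc : (residueValuation O k k).ord c = 1)
    (hram : ramIndex O k D = 1)
    (hσ : ∀ c, (σ (algebraMap k D c)).unop = algebraMap k D c)
    (hsi : ∀ d, (s (i d)).unop = i (σ d).unop)
    {τ : RingInvo (ResidueAlg O k E)} {ρ : RingInvo (ResidueAlg O k D)}
    (hτ : ∀ x, (residueValuation O k E).ge 0 x →
      (τ ((residueValuation O k E).res x)).unop = (residueValuation O k E).res (s x).unop)
    (hρ : ∀ x, (residueValuation O k D).ge 0 x →
      (ρ ((residueValuation O k D).res x)).unop = (residueValuation O k D).res (σ x).unop)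
    (ε : ℤˣ) : uInv ρ ε = uInv τ ε := by
  obtain ⟨φ, hφ⟩ := exists_residue_algHom_over (O := O) i
  have hsurj := hE.residue_surjective h2 hφ
    (by rw [ord_algebraMap hE.ne_zero_base, hc, hram]; rfl)
  refine uInv_eq_uInv_of_ringEquiv (RingEquiv.ofBijective φ ⟨φ.toRingHom.injective, hsurj⟩)
    (fun b => ?_) ε
  obtain ⟨x, hx, rfl⟩ := (residueValuation O k D).res_surj b
  have hge : (residueValuation O k D).ge 0 (σ x).unop :=
    residueValuation_ge_zero_iff.2 ((isValInteger_unop_iff hσ).2 (residueValuation_ge_zero_iff.1 hx))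
  change (τ (φ _)).unop = φ _
  rw [hφ x hx, hτ _ (IsQuadraticExtension.ge_zero_map hx), hsi, hρ x hx, hφ _ hge]

end RamifiedExtension

/-! ### Ramification, generators and centres of the extensions. -/

section Ramification

variable {O k : Type*} [CommRing O] [IsDomain O] [IsDiscreteValuationRing O]
  [IsAdicComplete (IsLocalRing.maximalIdeal O) O] [Field k] [Algebra O k] [IsFractionRing O k]
  {A : Type*} [DivisionRing A] [Algebra k A] [FiniteDimensional k A]
  {B : Type*} [DivisionRing B] [Algebra k B] [FiniteDimensional k B]

theorem isUnramifiedOver_iff {f : B →ₐ[k] A} : IsUnramifiedOver O k f ↔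
    ∃ b, b ≠ 0 ∧ (residueValuation O k A).ord (f b) = 1 := by
  constructor
  · intro h
    obtain ⟨p, hp, hp1⟩ := (residueValuation O k A).exists_ord_eq_one
    obtain ⟨b, hb⟩ := h p hp
    obtain ⟨hb0, hb1⟩ := isValUnit_iff.1 hb
    have hfb := left_ne_zero_of_mul hb0
    rw [(residueValuation O k A).ord_mul _ _ hfb hp, hp1] at hb1
    refine ⟨b⁻¹, inv_ne_zero ((map_ne_zero f).1 hfb), ?_⟩
    rw [map_inv₀, (residueValuation O k A).ord_inv hfb]
    omega
  · rintro ⟨b, hb, hb1⟩ x hx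
    have hfb : f b ≠ 0 := (map_ne_zero f).2 hb
    have hz := zpow_ne_zero (-(residueValuation O k A).ord x) hfb
    refine ⟨b ^ (-(residueValuation O k A).ord x), isValUnit_iff.2 ⟨?_, ?_⟩⟩ <;> rw [map_zpow₀]
    · exact mul_ne_zero hz hx
    · rw [(residueValuation O k A).ord_mul _ _ hz hx, (residueValuation O k A).ord_zpow hfb, hb1]
      omega

theorem isUnramifiedOver_ofId_iff : IsUnramifiedOver O k (Algebra.ofId k A) ↔ ramIndex O k A = 1 := by
  rw [isUnramifiedOver_iff]
  constructor
  · rintro ⟨b, hb, h⟩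
    have h1 : (residueValuation O k A).ord (algebraMap k A b) = 1 := h
    rw [ord_algebraMap hb] at h1
    exact_mod_cast Int.eq_one_of_dvd_one (by omega) (Dvd.intro _ h1)
  · intro h
    obtain ⟨ϖ, -, hϖ, hϖ1⟩ := exists_uniformizer O k
    exact ⟨_, hϖ, (ord_algebraMap hϖ).trans (by rw [h, hϖ1]; rfl)⟩

end Ramification

section Generator

variable {O k : Type*} [CommRing O] [IsDomain O] [IsDiscreteValuationRing O]
  [IsAdicComplete (IsLocalRing.maximalIdeal O) O] [Field k] [Algebra O k] [IsFractionRing O k]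
  {K : Type*} [Field K] [Algebra k K]

variable (O) in
/-- A quadratic extension is generated by the square root of a unit or of a uniformizer. -/
theorem exists_isQuadraticExtension (h2 : (2 : k) ≠ 0) (hK : Module.finrank k K = 2) :
    ∃ (θ : K) (c : k) (g : K →ₐ[k] K), IsQuadraticExtension (Algebra.ofId k K) θ c g ∧
      ((residueValuation O k k).ord c = 0 ∨ (residueValuation O k k).ord c = 1) := by
  set V := residueValuation O k k
  obtain ⟨a, ha⟩ := exists_isSqrtGenerator h2 (S := (⊤ : Subalgebra k K)) (by rw [← hK]; exact finrank_top k K)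
  obtain ⟨g, hg⟩ := ha.exists_conj
  have hmem : ∀ x : K, ∃ y z : k, x = algebraMap k K y + z • a := fun x => ha.mem_iff.1 Algebra.mem_top
  have ha0 : a ≠ 0 := fun h => ha.notMem_range 0 (by rw [h, map_zero])
  obtain ⟨d, -, hd, -⟩ := ha
  have hd0 : d ≠ 0 := fun h => by
    rw [h, map_zero, mul_self_eq_zero] at hd
    exact ha0 hd
  obtain ⟨ϖ, -, hϖ, hϖ1⟩ := exists_uniformizer O k
  -- Multiplying the square root by u changes ord(d) by an even amount and leaves 0 or 1.
  set u := algebraMap O k ϖ ^ (-(V.ord d / 2)) with hu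
  have hu0 : u ≠ 0 := zpow_ne_zero _ hϖ
  have hordu : V.ord u = -(V.ord d / 2) := by rw [hu, V.ord_zpow hϖ, hϖ1, mul_one]
  refine ⟨u • a, u * u * d, g, ⟨smul_ne_zero hu0 ha0, fun b => mul_comm _ _, ?_, g.commutes, ?_,
    fun x => ?_⟩, ?_⟩
  · rw [smul_mul_smul_comm, hd, map_mul _ (u * u), Algebra.smul_def]
  · rw [map_smul, hg, smul_neg]
  · obtain ⟨y, z, rfl⟩ := hmem x
    refine ⟨y, z * u⁻¹, ?_⟩
    change _ = algebraMap k K y + algebraMap k K (z * u⁻¹) * u • a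
    rw [← Algebra.smul_def, smul_smul, inv_mul_cancel_right₀ hu0]
  · rw [V.ord_mul _ _ (mul_ne_zero hu0 hu0) hd0, V.ord_mul _ _ hu0 hu0, hordu]
    omega

end Generator

section Centre

/-- A quadratic scalar extension of an involution of the first kind is unitary. -/
theorem IsQuadraticExtension.isUnitaryOver {k D E : Type*} [Field k] [DivisionRing D] [Algebra k D]
    [Algebra.IsCentral k D] [DivisionRing E] [Algebra k E] (h2 : (2 : k) ≠ 0) {i : D →ₐ[k] E} {t : E}
    {c : k} {ι : E →ₐ[k] E} (hE : IsQuadraticExtension i t c ι) {s : RingInvo E}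
    (hsk : ∀ c, (s (algebraMap k E c)).unop = algebraMap k E c) (hst : (s t).unop = -t) :
    IsUnitaryOver (algebraMap k E).range s := by
  have h2E : (2 : E) ≠ 0 := by
    rw [← map_ofNat (algebraMap k E)]
    exact (map_ne_zero _).2 h2
  refine isUnitaryOver_range (φ := i) h2 hE.comm hE.exists_eq (fun {a b} h => ?_) (fun b hb => ?_) hsk
    hst hE.ne_zero
  · have h1 := congrArg ι h
    rw [map_add, map_mul, hE.map_left, hE.map_left, hE.map_gen, mul_neg, map_zero, ← sub_eq_add_neg,
      sub_eq_zero] at h1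
    rw [← h1, ← two_mul] at h
    have h3 := (mul_eq_zero.1 h).resolve_left h2E
    rw [h3] at h1
    exact ⟨(map_eq_zero i).1 h3, (map_eq_zero i).1 ((mul_eq_zero.1 h1.symm).resolve_right hE.ne_zero)⟩
  · obtain ⟨x, hx⟩ := (Algebra.IsCentral.mem_center_iff k).1
      (Subalgebra.mem_center_iff.2 (Subring.mem_center_iff.1 hb) : b ∈ Subalgebra.center k D)
    exact ⟨x, hx⟩

theorem finite_over_center {F A : Type*} [Field F] [DivisionRing A] [Algebra F A]
    [FiniteDimensional F A] : Module.Finite (Subring.center A) A := by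
  let Z := Subring.center A
  let _ : Algebra F Z := ((algebraMap F A).codRestrict Z algebraMap_mem_center).toAlgebra
  have : IsScalarTower F Z A := ⟨fun c z x => by
    rw [Subring.smul_def, Subring.smul_def, smul_eq_mul, smul_eq_mul, Algebra.smul_def,
      Algebra.smul_def, ← mul_assoc]
    rfl⟩
  exact Module.Finite.of_restrictScalars_finite F Z A

end Centre

/-! ### Assembly of the three cases. -/

section Assembly

section

variable {O k K D E : Type*} [CommRing O] [IsDomain O] [IsDiscreteValuationRing O]
  [IsAdicComplete (IsLocalRing.maximalIdeal O) O] [Field k] [Algebra O k] [IsFractionRing O k]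
  [Field K] [Algebra k K] [FiniteDimensional k K]
  [DivisionRing D] [Algebra k D] [FiniteDimensional k D] [Algebra.IsCentral k D]
  [DivisionRing E] [Algebra k E] [FiniteDimensional k E]
  {i : D →ₐ[k] E} {j : K →ₐ[k] E} {θ : K} {c : k} {g : K →ₐ[k] K} {ι : E →ₐ[k] E}
  {σ : RingInvo D} {s : RingInvo E}

/-- An abstract division algebra E containing D and K stands for D ⊗ K. The cases are decided by
ord(c) and by the ramification index of D: K/k is unramified exactly when ord(c) = 0, and then E/K
is unramified exactly when D/k is. -/
theorem isUZero_of_isQuadraticExtension (h2 : (2 : IsLocalRing.ResidueField O) ≠ 0)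
    (hij : ∀ d l, i d * j l = j l * i d)
    (hK : IsQuadraticExtension (Algebra.ofId k K) θ c g) (hE : IsQuadraticExtension i (j θ) c ι)
    (hc : (residueValuation O k k).ord c = 0 ∨ (residueValuation O k k).ord c = 1)
    (hσ : IsFirstKind σ) (hsi : ∀ d, (s (i d)).unop = i (σ d).unop) (hsθ : (s (j θ)).unop = -j θ) :
    (IsUnramifiedOver O k (Algebra.ofId k K) → IsUnramifiedOver O k j →
      ∃ n : ℕ∞,
        IsUZero (algebraMap (IsLocalRing.ResidueField O)
          (ResidueAlg O k D ⊗[IsLocalRing.ResidueField O] ResidueAlg O k K)).range n ∧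
        IsUZero (algebraMap k E).range (2 * n)) ∧
    (¬ IsUnramifiedOver O k j →
      (∃ α : ResidueAlg O k D,
        IsSqrtGenerator (Subalgebra.center (IsLocalRing.ResidueField O) (ResidueAlg O k D)) α) ∧
      (∃ β : ResidueAlg O k K,
        IsSqrtGenerator (⊤ : Subalgebra (IsLocalRing.ResidueField O) (ResidueAlg O k K)) β) ∧
      ∀ (α : ResidueAlg O k D) (β : ResidueAlg O k K),
        IsSqrtGenerator (Subalgebra.center (IsLocalRing.ResidueField O) (ResidueAlg O k D)) α →
        IsSqrtGenerator (⊤ : Subalgebra (IsLocalRing.ResidueField O) (ResidueAlg O k K)) β →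
        ∃ n₁ n₃ : ℕ∞,
          IsUZero (Algebra.adjoin (IsLocalRing.ResidueField O)
            {α ⊗ₜ[IsLocalRing.ResidueField O] (1 : ResidueAlg O k K)}).toSubring n₁ ∧
          IsUZero (Algebra.adjoin (IsLocalRing.ResidueField O)
            {α ⊗ₜ[IsLocalRing.ResidueField O] β}).toSubring n₃ ∧
          IsUZero (algebraMap k E).range (n₁ + n₃)) ∧
    (¬ IsUnramifiedOver O k (Algebra.ofId k K) →
      (∃ p m : ℕ∞,
        IsUPlus (ResidueAlg O k E) p ∧ IsUMinus (ResidueAlg O k E) m ∧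
        IsUZero (algebraMap k E).range (p + m)) ∧
      (IsUnramifiedOver O k (Algebra.ofId k D) →
        ∃ p m : ℕ∞,
          IsUPlus (ResidueAlg O k D) p ∧ IsUMinus (ResidueAlg O k D) m ∧
          IsUZero (algebraMap k E).range (p + m))) := by
  have hσk : ∀ c, (σ (algebraMap k D c)).unop = algebraMap k D c := fun c =>
    hσ _ (algebraMap_mem_center c)
  have hsk : ∀ c, (s (algebraMap k E c)).unop = algebraMap k E c := fun c => by
    rw [← i.commutes, hsi, hσk]
  have hdich := ramIndex_eq_one_or_two (O := O) (k := k) h2 hσ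
  have hfin : Module.Finite (Subring.center E) E := finite_over_center (F := k)
  have hu : IsUZero (algebraMap k E).range (uInv s 1) :=
    (hE.isUnitaryOver (two_ne_zero_of_residueField k k h2) hsk hsθ).isUZero
  obtain ⟨eK, -, hordK, -, hK0, hK1, -⟩ := hK.exists_ord (O := O) h2
  rw [ord_algebraMap_self] at hK0 hK1
  obtain ⟨e, -, hord, -, hE0, hE1, hE2⟩ := hE.exists_ord (O := O) h2
  rw [ord_algebraMap hE.ne_zero_base] at hE0 hE1 hE2
  obtain ⟨ϖ, -, hϖ, hϖ1⟩ := exists_uniformizer O k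
  have hunramK : (residueValuation O k k).ord c = 0 → ∀ b, b ≠ 0 →
      (residueValuation O k K).ord (algebraMap k K b) = (residueValuation O k k).ord b := fun h b hb => by
    have h1 := hordK b hb
    rw [(hK0 h).1, one_mul] at h1
    exact h1
  -- ramification of the extension in terms of the square of the generator
  have hram0 : (residueValuation O k k).ord c = 0 →
      IsUnramifiedOver O k (Algebra.ofId k K) ∧ (ramIndex O k D = 1 ↔ IsUnramifiedOver O k j) := by
    intro h
    have hE0' := (hE0 (by rw [h, mul_zero])).1
    have hϖE : (residueValuation O k E).ord (j (algebraMap k K (algebraMap O k ϖ))) =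
        ramIndex O k D := by
      rw [j.commutes, ← i.commutes, hord _ ((map_ne_zero _).2 hϖ), hE0', ord_algebraMap hϖ, hϖ1,
        mul_one, one_mul]
    refine ⟨isUnramifiedOver_iff.2 ⟨_, hϖ, (hunramK h _ hϖ).trans hϖ1⟩, fun h1 => ?_, fun h1 => ?_⟩
    · exact isUnramifiedOver_iff.2 ⟨_, (map_ne_zero _).2 hϖ, by rw [hϖE, h1]; rfl⟩
    · obtain ⟨b, hb, hb1⟩ := isUnramifiedOver_iff.1 h1
      obtain ⟨e', -, hord'⟩ := exists_ord_map_eq_mul (O := O) j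
      rw [hord' _ ((map_ne_zero _).2 hϖ), hunramK h _ hϖ, hϖ1, mul_one] at hϖE
      rw [hord' b hb, hϖE] at hb1
      exact_mod_cast Int.eq_one_of_dvd_one (by omega) (Dvd.intro _ hb1)
  have hram1 : (residueValuation O k k).ord c = 1 → ¬ IsUnramifiedOver O k (Algebra.ofId k K) ∧
      (residueValuation O k E).ord (j θ) = 1 := by
    intro h
    constructor
    · intro h1
      obtain ⟨b, hb, hb1⟩ := isUnramifiedOver_iff.1 h1
      rw [hordK b hb, (hK1 h).1] at hb1
      omega
    · rcases hdich with ⟨hD, -⟩ | ⟨hD, -⟩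
      · exact (hE1 (by rw [h, hD]; rfl)).2
      · exact (hE2 (by rw [h, hD]; rfl)).2
  refine ⟨fun h3 h4 => ?_, fun h3 => ?_, fun h3 => ?_⟩
  · have hc0 := hc.resolve_right fun h => (hram1 h).1 h3
    have hD := (hram0 hc0).2.2 h4
    obtain ⟨n, hn, hn'⟩ := exists_isUZero_of_ramIndex_eq_one h2 hij hK hE hc0 hD
      (by rcases hdich with h | h
          · exact h.2
          · omega) hsk hsθ
    exact ⟨n, hn, hn' ▸ hu⟩
  -- If ord(c) were 1, then θ in K would be a uniformizer of E, and E would be unramified over K.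
  · have hc0 := hc.resolve_right fun h =>
      h3 (isUnramifiedOver_iff.2 ⟨θ, hK.ne_zero, (hram1 h).2⟩)
    obtain ⟨-, hcen, hmove⟩ := hdich.resolve_left fun h => h3 ((hram0 hc0).2.1 h.1)
    refine ⟨exists_isSqrtGenerator h2 hcen, ⟨_, hK.isSqrtGenerator_residue h2 hc0⟩,
      fun α β hα hβ => ?_⟩
    obtain ⟨n₁, n₃, h₁, h₃, h⟩ :=
      exists_isUZero_of_ramIndex_eq_two h2 hij hK hE hc0 hmove hσk hsk hsi hsθ hα hβ
    exact ⟨n₁, n₃, h₁, h₃, h ▸ hu⟩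
  · have hc1 := hc.resolve_left fun h => h3 (hram0 h).1
    have ht1 := (hram1 hc1).2
    obtain ⟨τ, hτ, hτ1, hsum⟩ := exists_isUPlus_isUMinus_residue h2 hE ht1 (fun z hz => by
      rcases hdich with ⟨hD, hcen⟩ | ⟨hD, hcen, hmove⟩
      · exact exists_eq_algebraMap_of_ramIndex_eq_one h2 hE hc1 hD hcen hz
      · exact exists_eq_algebraMap_of_ramIndex_eq_two h2 hE hc1 hD hcen hmove hz) hsk hsθ
    constructor
    · obtain ⟨p, m, hp, hm, h⟩ := hτ1.exists_isUPlus_isUMinus (two_ne_zero_residueAlg k E h2)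
      exact ⟨p, m, hp, hm, by rw [h, ← hsum]; exact hu⟩
    · intro h4
      have hD := isUnramifiedOver_ofId_iff.1 h4
      have hcen : Module.finrank (IsLocalRing.ResidueField O)
          (Subalgebra.center (IsLocalRing.ResidueField O) (ResidueAlg O k D)) = 1 := by
        rcases hdich with h | h
        · exact h.2
        · omega
      obtain ⟨ρ, hρ, hρF⟩ := exists_residue_invo_over (O := O) hσk
      have hρ1 : IsFirstKind ρ := fun z hz => by
        obtain ⟨x, rfl⟩ := exists_eq_algebraMap_of_finrank_center hcen hz
        exact hρF x
      have huInv := uInv_residue_eq_uInv_residue h2 hE hc1 hD hσk hsi hτ hρ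
      obtain ⟨p, m, hp, hm, h⟩ := hρ1.exists_isUPlus_isUMinus (two_ne_zero_residueAlg k D h2)
      exact ⟨p, m, hp, hm, by rw [h, huInv, huInv, ← hsum]; exact hu⟩

end

section TensorProduct

variable {k K D : Type*} [Field k] [Field K] [Algebra k K] [DivisionRing D] [Algebra k D]

/-- The tensor product of an involution and an involutive automorphism of a field. -/
theorem exists_ringInvo_tensorProduct {σ : RingInvo D}
    (hσ : ∀ c, (σ (algebraMap k D c)).unop = algebraMap k D c) {g : K →ₐ[k] K} (hg : ∀ x, g (g x) = x) :
    ∃ s : RingInvo (D ⊗[k] K), ∀ d l, (s (d ⊗ₜ l)).unop = (σ d).unop ⊗ₜ g l := by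
  let σl : D →ₗ[k] D :=
    { toFun := fun d => (σ d).unop
      map_add' := RingInvo.unop_add σ
      map_smul' := fun c d => by
        rw [Algebra.smul_def, RingInvo.unop_mul, hσ, ← Algebra.commutes, ← Algebra.smul_def]
        rfl }
  let f := TensorProduct.map σl g.toLinearMap
  have hf : ∀ d l, f (d ⊗ₜ l) = (σ d).unop ⊗ₜ g l := fun d l => TensorProduct.map_tmul ..
  refine ⟨RingInvo.ofFun f (map_add f) (fun x y => ?_) (fun x => ?_), hf⟩
  · induction x with
    | zero => simp
    | add x x' hx hx' => rw [add_mul, map_add, map_add, hx, hx', mul_add]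
    | tmul d l =>
      induction y with
      | zero => simp
      | add y y' hy hy' => rw [mul_add, map_add, map_add, hy, hy', add_mul]
      | tmul d' l' =>
        rw [Algebra.TensorProduct.tmul_mul_tmul, hf, hf, hf, Algebra.TensorProduct.tmul_mul_tmul,
          RingInvo.unop_mul, map_mul, mul_comm (g l)]
  · induction x with
    | zero => simp
    | add x x' hx hx' => rw [map_add, map_add, hx, hx']
    | tmul d l => rw [hf, hf, RingInvo.involution, hg]

/-- Scalar extension of a quadratic extension. -/
theorem IsQuadraticExtension.tensorProduct {θ : K} {c : k} {g : K →ₐ[k] K}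
    (h : IsQuadraticExtension (Algebra.ofId k K) θ c g) (h0 : (1 : D) ⊗ₜ[k] θ ≠ 0) :
    IsQuadraticExtension (Algebra.TensorProduct.includeLeft : D →ₐ[k] D ⊗[k] K)
      ((Algebra.TensorProduct.includeRight : K →ₐ[k] D ⊗[k] K) θ) c
      (Algebra.TensorProduct.map (AlgHom.id k D) g) where
  ne_zero := h0
  comm d := by simp
  mul_self := by
    rw [← map_mul, h.mul_self, AlgHom.commutes]
  map_left d := by simp
  map_gen := by
    rw [Algebra.TensorProduct.includeRight_apply, Algebra.TensorProduct.map_tmul, h.map_gen,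
      TensorProduct.tmul_neg, map_one]
  exists_eq x := by
    induction x with
    | zero => exact ⟨0, 0, by simp⟩
    | tmul d l =>
      obtain ⟨x, y, rfl⟩ := h.exists_eq l
      refine ⟨x • d, y • d, ?_⟩
      change d ⊗ₜ (algebraMap k K x + algebraMap k K y * θ) = _
      simp [TensorProduct.tmul_add, Algebra.algebraMap_eq_smul_one,
        TensorProduct.smul_tmul']
    | add y z hy hz =>
      obtain ⟨a, b, rfl⟩ := hy
      obtain ⟨a', b', rfl⟩ := hz
      exact ⟨a + a', b + b', by rw [map_add, map_add, add_mul]; abel⟩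

end TensorProduct

end Assembly

end

theorem corollary2p9
    {O k K D : Type*}
    [CommRing O] [IsDomain O] [IsDiscreteValuationRing O]
    [IsAdicComplete (IsLocalRing.maximalIdeal O) O]
    (hchar : (2 : IsLocalRing.ResidueField O) ≠ 0)
    [Field k] [Algebra O k] [IsFractionRing O k]
    [Field K] [Algebra k K] (hK : Module.finrank k K = 2) [FiniteDimensional k K]
    [DivisionRing D] [Algebra k D] [FiniteDimensional k D] [Algebra.IsCentral k D]
    (σ : RingInvo D) (hσ : IsFirstKind σ)
    (hDK : ∀ x : D ⊗[k] K, x ≠ 0 → IsUnit x) :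
    -- first case: `K/k` and `D ⊗ K / K` are unramified
    (IsUnramifiedOver O k (Algebra.ofId k K) →
      IsUnramifiedOver O k (Algebra.TensorProduct.includeRight : K →ₐ[k] D ⊗[k] K) →
      ∃ n : ℕ∞,
        IsUZero (algebraMap (IsLocalRing.ResidueField O)
          (ResidueAlg O k D ⊗[IsLocalRing.ResidueField O] ResidueAlg O k K)).range n ∧
        IsUZero (algebraMap k (D ⊗[k] K)).range (2 * n)) ∧
    -- second case: `D ⊗ K / K` is ramified
    (¬ IsUnramifiedOver O k (Algebra.TensorProduct.includeRight : K →ₐ[k] D ⊗[k] K) →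
      (∃ α : ResidueAlg O k D,
        IsSqrtGenerator (Subalgebra.center (IsLocalRing.ResidueField O) (ResidueAlg O k D)) α) ∧
      (∃ β : ResidueAlg O k K,
        IsSqrtGenerator (⊤ : Subalgebra (IsLocalRing.ResidueField O) (ResidueAlg O k K)) β) ∧
      ∀ (α : ResidueAlg O k D) (β : ResidueAlg O k K),
        IsSqrtGenerator (Subalgebra.center (IsLocalRing.ResidueField O) (ResidueAlg O k D)) α →
        IsSqrtGenerator (⊤ : Subalgebra (IsLocalRing.ResidueField O) (ResidueAlg O k K)) β →
        ∃ n₁ n₃ : ℕ∞,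
          IsUZero (Algebra.adjoin (IsLocalRing.ResidueField O)
            {α ⊗ₜ[IsLocalRing.ResidueField O] (1 : ResidueAlg O k K)}).toSubring n₁ ∧
          IsUZero (Algebra.adjoin (IsLocalRing.ResidueField O)
            {α ⊗ₜ[IsLocalRing.ResidueField O] β}).toSubring n₃ ∧
          IsUZero (algebraMap k (D ⊗[k] K)).range (n₁ + n₃)) ∧
    -- third case: `K/k` is ramified
    (¬ IsUnramifiedOver O k (Algebra.ofId k K) →
      (∃ p m : ℕ∞,
        IsUPlus (ResidueAlg O k (D ⊗[k] K)) p ∧ IsUMinus (ResidueAlg O k (D ⊗[k] K)) m ∧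
        IsUZero (algebraMap k (D ⊗[k] K)).range (p + m)) ∧
      (IsUnramifiedOver O k (Algebra.ofId k D) →
        ∃ p m : ℕ∞,
          IsUPlus (ResidueAlg O k D) p ∧ IsUMinus (ResidueAlg O k D) m ∧
          IsUZero (algebraMap k (D ⊗[k] K)).range (p + m))) := by
  have h2k := two_ne_zero_of_residueField k k hchar
  obtain ⟨θ, c, g, hθ, hc⟩ := exists_isQuadraticExtension O h2k hK
  have hσk : ∀ c, (σ (algebraMap k D c)).unop = algebraMap k D c := fun c =>
    hσ _ (algebraMap_mem_center c)
  -- s = σ ⊗ g extends σ and negates θ, so it is unitary over k.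
  obtain ⟨s, hs⟩ := exists_ringInvo_tensorProduct hσk hθ.ι_ι
  letI : DivisionRing (D ⊗[k] K) := DivisionRing.ofIsUnitOrEqZero fun x =>
    or_iff_not_imp_right.2 (hDK x)
  have h0 : (1 : D) ⊗ₜ[k] θ ≠ 0 := fun h =>
    hθ.ne_zero ((Algebra.TensorProduct.includeRight_injective
      (algebraMap k D).injective : Function.Injective
        (Algebra.TensorProduct.includeRight : K →ₐ[k] D ⊗[k] K)) (by simpa using h))
  refine isUZero_of_isQuadraticExtension hchar (i := Algebra.TensorProduct.includeLeft) (s := s)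
    (fun d l => by simp) hθ (hθ.tensorProduct h0) hc hσ (fun d => ?_) ?_
  · exact (hs d 1).trans (by rw [map_one]; rfl)
  · refine (hs 1 θ).trans ?_
    rw [hθ.map_gen, TensorProduct.tmul_neg]
    simp
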